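/- Let $n\ge 1$, $m\ge 1$, $T>0$, and write $D_t=\frac1i\partial_t$, $D_x=\frac1i\partial_x$. For $k=1,\dots,m$ let $$A_k(t,\xi)=\sum_{|\gamma|\le k}a_{k,\gamma}(t)\,\xi^\gamma ,\qquad A_{(k)}(t,\xi)=\sum_{|\gamma|=k}a_{k,\gamma}(t)\,\xi^\gamma ,\qquad t\in[0,T],\ \xi\in\mathbb R^n,$$ where all the complex-valued coefficients $a_{k,\gamma}$, $|\gamma|\le k$, are continuous on $[0,T]$, and the coefficients of the principal parts, $a_{k,\gamma}$ with $|\gamma|=k$, are analytic on $[0,T]$. Consider the Cauchy problem $$D_t^mu+\sum_{j=0}^{m-1}A_{m-j}(t,D_x)D_t^ju=0\ \text{ on } [0,T]\times\mathbb R^n,\qquad D_t^{l-1}u(0,\cdot)=g_l,\quad l=1,\dots,m. \tag{CP}$$ Assume that the characteristic roots are real, i.e. there are $\lambda_1(t,\xi),\dots,\lambda_m(t,\xi)\in\mathbb R$ with $$\tau^m+\sum_{j=0}^{m-1}A_{(m-j)}(t,\xi)\tau^j=\prod_{l=1}^m(\tau-\lambda_l(t,\xi))\qquad\text{for all } t\in[0,T],\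 \xi\in\mathbb R^n,\ \tau\in\mathbb C,$$ that there is $M>0$ such that $$\lambda_i(t,\xi)^2+\lambda_j(t,\xi)^2\le M(\lambda_i(t,\xi)-\lambda_j(t,\xi))^2\qquad\text{for all } i\ne j,\ t\in[0,T],\ \xi\in\mathbb R^n,$$ and that the lower order terms satisfy the following Levi conditions: there are $C,R>0$ such that $$|(A_{m-j+1}-A_{(m-j+1)})(t,\xi)|\le C\sum_{i=1}^m\Bigl|\sum_{\substack{1\le \ell_1<\dots<\ell_{m-j}\le m\\ \ell_h\ne i\ \forall h}}\lambda_{\ell_1}(t,\xi)\cdots\lambda_{\ell_{m-j}}(t,\xi)\Bigr|$$ for all $t\in[0,T]$, $j=1,\dots,m$ and $|\xi|\ge R$ (the inner sum is $1$ for $j=m$). Then (CP) is well-posed in $C^\infty$ and in the sense of distributions: (i) for all $g_1,\dots,g_m\in C^\infty(\mathbb R^n)$ there is a unique solution $u\in C^m([0,T];C^\infty(\mathbb R^n))$ of (CP); (ii) for all $g_1,\dots,g_m\in\mathcal D'(\mathbb R^n)$ there is a unique solution $u\in C^m([0,T];\mathcal D'(\mathbb R^n))$ of (CP). (iii) Moreover,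 with $\langle\xi\rangle=(1+|\xi|^2)^{1/2}$, there are $\kappa\in\mathbb N$ and $C'>0$ such that for every $\xi\in\mathbb R^n$ every solution $V=(V_1,\dots,V_m):[0,T]\to\mathbb C^m$ of the system $$D_tV_l=\langle\xi\rangle V_{l+1}\ (1\le l<m),\qquad D_tV_m=-\sum_{j=1}^mA_{m-j+1}(t,\xi)\langle\xi\rangle^{j-m}V_j ,$$ to which (CP) reduces after Fourier transform in $x$, satisfies $|V(t)|\le C'\langle\xi\rangle^\kappa|V(0)|$ for all $t\in[0,T]$. -/

import Mathlib

open Set TopologicalSpace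
open scoped Topology ContDiff Distributions LineDeriv

noncomputable section

namespace WeaklyHyperbolic

/-- The space `ℝⁿ` with its Euclidean norm. -/
abbrev Rn (n : ℕ) := EuclideanSpace ℝ (Fin n)

/-! ### Symbols -/

/-- The multi-indices `γ ∈ ℕⁿ` with `|γ| = d`. -/
def multiIndices (n d : ℕ) : Finset (Fin n → ℕ) := Finset.piAntidiag Finset.univ d

/-- The monomial `ξ ^ γ`. -/
def monomial {n : ℕ} (ξ : Rn n) (γ : Fin n → ℕ) : ℂ := ∏ i, ((ξ i : ℝ) : ℂ) ^ γ i

/-- The full symbol `A_k(t, ξ) = ∑_{|γ| ≤ k} a_{k,γ}(t) ξ ^ γ`. -/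
def fullSymbol {n : ℕ} (a : ℕ → (Fin n → ℕ) → ℝ → ℂ) (k : ℕ) (t : ℝ) (ξ : Rn n) : ℂ :=
  ∑ d ∈ Finset.range (k + 1), ∑ γ ∈ multiIndices n d, a k γ t * monomial ξ γ

/-- The principal symbol `A_(k)(t, ξ) = ∑_{|γ| = k} a_{k,γ}(t) ξ ^ γ`. -/
def principalSymbol {n : ℕ} (a : ℕ → (Fin n → ℕ) → ℝ → ℂ) (k : ℕ) (t : ℝ) (ξ : Rn n) : ℂ :=
  ∑ γ ∈ multiIndices n k, a k γ t * monomial ξ γ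

/-- The real numbers `lam l t ξ`, `l = 1, …, m`, are the roots, counted with multiplicity, of the
characteristic polynomial `τ ^ m + ∑_{j < m} A_(m-j)(t, ξ) τ ^ j`. -/
def AreCharacteristicRoots {n : ℕ} (m : ℕ) (T : ℝ) (a : ℕ → (Fin n → ℕ) → ℝ → ℂ)
    (lam : Fin m → ℝ → Rn n → ℝ) : Prop :=
  ∀ t ∈ Icc (0 : ℝ) T, ∀ ξ : Rn n, ∀ τ : ℂ,
    τ ^ m + ∑ j ∈ Finset.range m, principalSymbol a (m - j) t ξ * τ ^ j =
      ∏ l : Fin m, (τ - ((lam l t ξ : ℝ) : ℂ))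

/-- The condition `λ_i² + λ_j² ≤ M (λ_i - λ_j)²` for distinct indices, uniformly in `(t, ξ)`. -/
def RootCondition {n : ℕ} (m : ℕ) (T : ℝ) (lam : Fin m → ℝ → Rn n → ℝ) : Prop :=
  ∃ M : ℝ, 0 < M ∧ ∀ i j : Fin m, i ≠ j → ∀ t ∈ Icc (0 : ℝ) T, ∀ ξ : Rn n,
    lam i t ξ ^ 2 + lam j t ξ ^ 2 ≤ M * (lam i t ξ - lam j t ξ) ^ 2

/-- The Levi conditions on the lower order terms; the inner sum is the elementary symmetric
polynomial of degree `m - j` in the roots other than the `i`-th one (it is `1` for `j = m`). -/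
def LeviCondition {n : ℕ} (m : ℕ) (T : ℝ) (a : ℕ → (Fin n → ℕ) → ℝ → ℂ)
    (lam : Fin m → ℝ → Rn n → ℝ) : Prop :=
  ∃ C : ℝ, 0 < C ∧ ∃ R : ℝ, 0 < R ∧
    ∀ t ∈ Icc (0 : ℝ) T, ∀ j ∈ Finset.Icc 1 m, ∀ ξ : Rn n, R ≤ ‖ξ‖ →
      ‖fullSymbol a (m - j + 1) t ξ - principalSymbol a (m - j + 1) t ξ‖ ≤
        C * ∑ i : Fin m,
          |∑ s ∈ Finset.powersetCard (m - j) (Finset.univ.erase i), ∏ l ∈ s, lam l t ξ|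

/-! ### The Fréchet space of smooth functions -/

/-- The smooth functions as a subspace of all functions. -/
def smoothSubmodule (n : ℕ) : Submodule ℂ (Rn n → ℂ) where
  carrier := {f | ContDiff ℝ ∞ f}
  add_mem' {f g} hf hg := by
    have hf' : ContDiff ℝ ∞ f := hf
    have hg' : ContDiff ℝ ∞ g := hg
    exact hf'.add hg'
  zero_mem' := by
    change ContDiff ℝ ∞ (fun _ : Rn n => (0 : ℂ))
    exact contDiff_const
  smul_mem' c f hf := by
    have hf' : ContDiff ℝ ∞ f := hf
    exact hf'.const_smul c

/-- The space `C^∞(ℝⁿ)` of complex valued smooth functions. This is a type of its own, so that it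
does not inherit the topology of pointwise convergence. -/
def Smooth (n : ℕ) : Type := smoothSubmodule n

namespace Smooth

instance (n : ℕ) : AddCommGroup (Smooth n) := inferInstanceAs (AddCommGroup (smoothSubmodule n))

instance (n : ℕ) : Module ℂ (Smooth n) := inferInstanceAs (Module ℂ (smoothSubmodule n))

instance (n : ℕ) : Module ℝ (Smooth n) := inferInstanceAs (Module ℝ (smoothSubmodule n))

/-- The underlying function. -/
def toFun {n : ℕ} (f : Smooth n) : Rn n → ℂ := f.1

theorem contDiff {n : ℕ} (f : Smooth n) : ContDiff ℝ ∞ f.toFun := f.2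

/-- The `k`-th derivative as a continuous function. -/
def iteratedDerivative {n : ℕ} (k : ℕ) (f : Smooth n) : C(Rn n, (Rn n) [×k]→L[ℝ] ℂ) :=
  ⟨iteratedFDeriv ℝ k f.toFun, f.contDiff.continuous_iteratedFDeriv (by exact_mod_cast le_top)⟩

/-- The usual topology of `C^∞(ℝⁿ)`: locally uniform convergence of all derivatives. -/
instance (n : ℕ) : TopologicalSpace (Smooth n) :=
  ⨅ k : ℕ, TopologicalSpace.induced (iteratedDerivative k) inferInstance

/-- Directional derivatives of smooth functions. -/
instance (n : ℕ) : LineDeriv (Rn n) (Smooth n) (Smooth n) where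
  lineDerivOp v f := ⟨fun x => fderiv ℝ f.toFun x v,
    (f.contDiff.fderiv_right (m := ∞) (by simp)).clm_apply contDiff_const⟩

end Smooth

/-- The space `𝓓'(ℝⁿ)` of complex valued distributions on `ℝⁿ`, with Mathlib's (strong) topology. -/
abbrev Distr (n : ℕ) := 𝓓'((⊤ : Opens (Rn n)), ℂ)

/-! ### The Cauchy problem -/

section CauchyProblem

variable {n : ℕ} {X : Type*} [AddCommGroup X] [Module ℂ X] [LineDeriv (Rn n) X X]

/-- The operator `D_{x_i} = (1/i) ∂_{x_i}`. -/
def Dx (i : Fin n) (f : X) : X :=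
  (-Complex.I) • LineDeriv.lineDerivOp (EuclideanSpace.single i (1 : ℝ) : Rn n) f

/-- The operator `D_x ^ γ = D_{x_1} ^ γ_1 ⋯ D_{x_n} ^ γ_n`. -/
def DxPow (γ : Fin n → ℕ) (f : X) : X :=
  (List.finRange n).foldr (fun i h => (Dx i)^[γ i] h) f

/-- The differential operator `A_k(t, D_x) = ∑_{|γ| ≤ k} a_{k,γ}(t) D_x ^ γ`. -/
def diffOp (a : ℕ → (Fin n → ℕ) → ℝ → ℂ) (k : ℕ) (t : ℝ) (f : X) : X :=
  ∑ d ∈ Finset.range (k + 1), ∑ γ ∈ multiIndices n d, a k γ t • DxPow γ f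

variable [Module ℝ X] [TopologicalSpace X]

/-- `v 0` belongs to `C^m([0,T]; X)` and `v j` is its `j`-th time derivative on `[0,T]` for every
`j ≤ m`: the derivative at `t` is the limit in `X` of the difference quotients
`(s - t)⁻¹ • (v j s - v j t)` as `s → t` in `[0,T]`, `s ≠ t`. -/
def IsCmWithDerivs (m : ℕ) (T : ℝ) (v : ℕ → ℝ → X) : Prop :=
  (∀ j < m, ∀ t ∈ Icc (0 : ℝ) T,
      Filter.Tendsto (slope (v j) t) (𝓝[Icc (0 : ℝ) T \ {t}] t) (𝓝 (v (j + 1) t))) ∧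
    ∀ j ≤ m, ContinuousOn (v j) (Icc 0 T)

/-- `u ∈ C^m([0,T]; X)` solves `D_t^m u + ∑_{j < m} A_{m-j}(t, D_x) D_t^j u = 0` on `[0,T]` with
`D_t^l u(0) = g_l` for `l = 0, …, m - 1`, where `D_t = (1/i) ∂_t`. -/
def IsSolution (m : ℕ) (T : ℝ) (a : ℕ → (Fin n → ℕ) → ℝ → ℂ) (g : Fin m → X) (u : ℝ → X) : Prop :=
  ∃ v : ℕ → ℝ → X, v 0 = u ∧ IsCmWithDerivs m T v ∧
    (∀ t ∈ Icc (0 : ℝ) T,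
      (-Complex.I) ^ m • v m t +
        ∑ j ∈ Finset.range m, diffOp a (m - j) t ((-Complex.I) ^ j • v j t) = 0) ∧
    ∀ l : Fin m, (-Complex.I) ^ (l : ℕ) • v l 0 = g l

variable (X) in
/-- Well-posedness in `X`: for all data in `X` there is exactly one solution in
`C^m([0,T]; X)`. -/
def WellPosed (m : ℕ) (T : ℝ) (a : ℕ → (Fin n → ℕ) → ℝ → ℂ) : Prop :=
  ∀ g : Fin m → X, ∃ u : ℝ → X, IsSolution m T a g u ∧
    ∀ w : ℝ → X, IsSolution m T a g w → EqOn w u (Icc 0 T)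

end CauchyProblem

/-! ### The first order system on the Fourier side -/

/-- The bracket `⟨ξ⟩ = (1 + |ξ|²)^{1/2}`. -/
def bracket {n : ℕ} (ξ : Rn n) : ℝ := Real.sqrt (1 + ‖ξ‖ ^ 2)

/-- The companion matrix of the system for the unknowns `v_l = ⟨ξ⟩^{m-l} D_t^{l-1} û`,
`l = 1, …, m`: it has `⟨ξ⟩` above the diagonal and last row
`b_j = -A_{m-j+1}(t, ξ) ⟨ξ⟩^{j-m}`, `j = 1, …, m`. Rows and columns are numbered from `0` here. -/
def systemMatrix {n : ℕ} (m : ℕ) (a : ℕ → (Fin n → ℕ) → ℝ → ℂ) (t : ℝ) (ξ : Rn n) :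
    Matrix (Fin m) (Fin m) ℂ :=
  Matrix.of fun p q =>
    if (p : ℕ) + 1 < m then
      if (q : ℕ) = p + 1 then ((bracket ξ : ℝ) : ℂ) else 0
    else -fullSymbol a (m - q) t ξ / ((bracket ξ : ℝ) : ℂ) ^ (m - 1 - (q : ℕ))

/-- There are `C > 0` and `κ ∈ ℕ` with `|V(t, ξ)| ≤ C ⟨ξ⟩^κ |V(0, ξ)|` (Euclidean norms) for every
solution of `D_t V = 𝓐(t, ξ) V` on `[0,T]`, where `𝓐` is the companion matrix. -/
def PolynomialFourierBound {n : ℕ} (m : ℕ) (T : ℝ) (a : ℕ → (Fin n → ℕ) → ℝ → ℂ) : Prop :=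
  ∃ κ : ℕ, ∃ C : ℝ, 0 < C ∧ ∀ ξ : Rn n, ∀ V : ℝ → Fin m → ℂ,
    (∀ t ∈ Icc (0 : ℝ) T,
      HasDerivWithinAt V (Complex.I • (systemMatrix m a t ξ).mulVec (V t)) (Icc 0 T) t) →
    ∀ t ∈ Icc (0 : ℝ) T,
      ‖WithLp.toLp 2 (V t)‖ ≤ C * bracket ξ ^ κ * ‖WithLp.toLp 2 (V 0)‖

end WeaklyHyperbolic

end

noncomputable section

namespace WeaklyHyperbolic

/-! ### Zeros in finite-dimensional families of analytic functions -/

/-! After Fourier transform in `x` the equation becomes a companion system for `U_q = D_t^q û`, and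
everything rests on `mode_bound`: a solution at frequency `ξ` satisfies `‖U t‖ ≤ A (1 + ‖ξ‖)^κ ‖U
s‖` for all `s, t`, forward and backward in time.

The energy. The polynomials `P_i = ∏_{l ≠ i} (τ - λ_l)` are left eigenvectors of the principal
companion matrix with real eigenvalues `λ_i`. With frozen coefficients the principal part therefore
conserves `∑_i |⟨U, P_i⟩|²`. The matrix of this form (`symmetriser`) is symmetric in the roots,
hence polynomial in the coefficients of the principal symbol and analytic in `t`, even where the
roots themselves are not smooth. The root condition makes the form nearly diagonal: by Lagrange
interpolation every `|coeff_q P_i| |U_q|` is at most a constant times `∑_j |⟨U, P_j⟩|`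
(`norm_coeff_mul_le`). The Levi conditions bound the lower order terms by exactly these
coefficients, so they cost only a bounded exponential factor.

What remains is the time derivative of the symmetriser. On an interval where the derivatives of all
its entries keep their signs, their contribution integrates to a logarithm of the size of the
entries, that is, to `O(log (1 + ‖ξ‖))` (`energy_growth_of_monotone_weights`). The number of such
intervals is bounded independently of `ξ`, because for each `ξ` the entries lie in one fixed
finite-dimensional space of analytic functions of `t` (`exists_card_zeros_le`). Exponentiating gives
a power of `1 + ‖ξ‖`.

From bounds to solvability. The fundamental matrix `S(t, ξ)` and its inverse `R(t, ξ)` extend to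
entire functions along complex coordinate lines, of exponential type by a crude Gronwall estimate at
complex frequencies, while `mode_bound` gives polynomial growth at real ones. By a Paley–Wiener
argument (`multiplier_eq_zero_of_slab`) a Fourier multiplier with such a symbol enlarges supports by
a bounded distance only. The algebra of these symbols therefore acts on all smooth functions, by
cutting off, and on all distributions, by transposition, compatibly with dominated convergence of
symbols. `SymbolAction` records what both spaces have in common. The curve `∑_l S_{0l}(t, D) g_l`
solves the Cauchy problem, and for an arbitrary solution the vector `R(t, D) V(t)` is constant in
time, which gives uniqueness. -/

theorem exists_finset_of_forall_card_le {α : Type*} {A : Set α} {N : ℕ}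
    (h : ∀ s : Finset α, (s : Set α) ⊆ A → s.card ≤ N) :
    ∃ Z : Finset α, Z.card ≤ N ∧ A ⊆ Z := by
  have hfin : A.Finite := by
    by_contra hinf
    obtain ⟨s, hs, hc⟩ := Set.Infinite.exists_subset_card_eq hinf (N + 1)
    have := h s hs
    omega
  exact ⟨hfin.toFinset, h _ (by simp), by simp⟩

/-- By Rolle's theorem the zeros of `F 1` separate those of `F 0`, so each step down the tower of
derivatives adds at most one zero, starting from none for `F k`. -/
theorem card_zeros_le_of_iterated_derivative_ne_zero (k : ℕ) :
    ∀ (F : ℕ → ℝ → ℝ) (I : Set ℝ), I.OrdConnected →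
      (∀ j, ∀ t ∈ I, HasDerivAt (F j) (F (j + 1) t) t) → (∀ t ∈ I, F k t ≠ 0) →
      ∀ s : Finset ℝ, (s : Set ℝ) ⊆ {t ∈ I | F 0 t = 0} → s.card ≤ k := by
  induction k with
  | zero =>
    intro F I _ _ hne s hs
    rw [Nat.le_zero, Finset.card_eq_zero, Finset.eq_empty_iff_forall_notMem]
    intro t ht
    exact hne t (hs ht).1 (hs ht).2
  | succ k ih =>
    intro F I hI hd hne s hs
    obtain ⟨Z, hZ, hsub⟩ := exists_finset_of_forall_card_le
      (ih (fun j => F (j + 1)) I hI (fun j => hd (j + 1)) hne)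
    refine (Finset.card_le_of_interleaved (t := Z) ?_).trans (by omega)
    intro x hx y hy hxy _
    have hsubI : Icc x y ⊆ I := hI.out (hs hx).1 (hs hy).1
    obtain ⟨c, hc, hc0⟩ := exists_hasDerivAt_eq_zero hxy
      (fun t ht => (hd 0 t (hsubI ht)).continuousAt.continuousWithinAt)
      ((hs hx).2.trans (hs hy).2.symm) (fun t ht => hd 0 t (hsubI (Ioo_subset_Icc_self ht)))
    exact ⟨c, hsub ⟨hsubI (Ioo_subset_Icc_self hc), hc0⟩, hc.1, hc.2⟩

/-- Analyticity on the closed interval is one-sided at the end points. Gluing on the germs there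
gives two-sided neighbourhoods, so that ordinary derivatives can be used up to the boundary. -/
theorem exists_analyticOnNhd_extension {T : ℝ} (hT : 0 < T) {f : ℝ → ℝ}
    (hf : AnalyticOn ℝ f (Icc 0 T)) :
    ∃ g, AnalyticOnNhd ℝ g (Icc 0 T) ∧ EqOn f g (Icc 0 T) := by
  obtain ⟨g₀, -, h₀, ha₀⟩ := (hf 0 ⟨le_rfl, hT.le⟩).exists_analyticAt
  obtain ⟨g₁, -, h₁, ha₁⟩ := (hf T ⟨hT.le, le_rfl⟩).exists_analyticAt
  refine ⟨fun t => if t < 0 then g₀ t else if t ≤ T then f t else g₁ t, ?_, ?_⟩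
  · intro t ht
    rcases ht.1.eq_or_lt with h | h
    · subst h
      refine ha₀.congr ?_
      filter_upwards [gt_mem_nhds hT] with s hs
      split_ifs with h1 h2
      · rfl
      · exact (h₀ (mem_insert_of_mem _ ⟨not_lt.1 h1, h2⟩)).symm
      · exact absurd hs.le h2
    · rcases ht.2.eq_or_lt with h' | h'
      · subst h'
        refine ha₁.congr ?_
        filter_upwards [lt_mem_nhds hT] with s hs
        split_ifs with h1 h2
        · exact absurd h1 (not_lt.2 hs.le)
        · exact (h₁ (mem_insert_of_mem _ ⟨hs.le, h2⟩)).symm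
        · rfl
      · have hn : Icc 0 T ∈ 𝓝 t := Icc_mem_nhds h h'
        obtain ⟨g₂, -, h₂, ha₂⟩ := (hf t ht).exists_analyticAt
        refine ha₂.congr ?_
        filter_upwards [hn] with s hs
        rw [if_neg (not_lt.2 hs.1), if_pos hs.2]
        exact (h₂ (mem_insert_of_mem _ hs)).symm
  · intro t ht
    simp [not_lt.2 ht.1, ht.2]

/-- If all derivatives vanished at one point, the order of vanishing would be infinite and the
identity theorem would make `f` zero on the connected interval. -/
theorem AnalyticOnNhd.exists_iteratedDeriv_ne_zero {a b : ℝ} {f : ℝ → ℝ}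
    (hf : AnalyticOnNhd ℝ f (Icc a b)) {t₀ : ℝ} (ht₀ : t₀ ∈ Icc a b)
    (h : ∃ t ∈ Icc a b, f t ≠ 0) : ∃ k, iteratedDeriv k f t₀ ≠ 0 := by
  by_contra! hall
  have htop : analyticOrderAt f t₀ = ⊤ := by
    refine ENat.eq_top_iff_forall_ge.2 fun n => ?_
    exact (natCast_le_analyticOrderAt_iff_iteratedDeriv_eq_zero (hf t₀ ht₀)).2 fun i _ => hall i
  obtain ⟨t, ht, hne⟩ := h
  exact hne (hf.eqOn_zero_of_preconnected_of_eventuallyEq_zero isPreconnected_Icc ht₀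
    (analyticOrderAt_eq_top.1 htop) ht)

theorem AnalyticOnNhd.iteratedDeriv_real {s : Set ℝ} {f : ℝ → ℝ} (hf : AnalyticOnNhd ℝ f s)
    (k : ℕ) : AnalyticOnNhd ℝ (iteratedDeriv k f) s := by
  induction k with
  | zero => simpa using hf
  | succ k ih => rw [iteratedDeriv_succ]; exact ih.deriv

/-- The number of zeros on a compact interval is bounded uniformly over the nonzero members of a
finite-dimensional space of analytic functions. -/
theorem exists_card_zeros_le {ι : Type*} [Fintype ι] (b : ι → ℝ → ℝ) {u v : ℝ}
    (hb : ∀ i, AnalyticOnNhd ℝ (b i) (Icc u v)) :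
    ∃ N : ℕ, ∀ c : ι → ℝ, (∀ t ∈ Icc u v, ∑ i, c i * b i t = 0) ∨
      ∃ Z : Finset ℝ, Z.card ≤ N ∧ ∀ t ∈ Icc u v, ∑ i, c i * b i t = 0 → t ∈ Z := by
  classical
  let H : ℕ → EuclideanSpace ℝ ι → ℝ → ℝ := fun k c t => ∑ i, c i * iteratedDeriv k (b i) t
  have hHd : ∀ k c, ∀ t ∈ Icc u v, HasDerivAt (H k c) (H (k + 1) c t) t := by
    intro k c t ht
    refine HasDerivAt.fun_sum fun i _ => ?_
    simp only [iteratedDeriv_succ]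
    exact ((AnalyticOnNhd.iteratedDeriv_real (hb i) k t ht).differentiableAt.hasDerivAt).const_mul _
  have hHit : ∀ k c, ∀ t ∈ Icc u v, iteratedDeriv k (H 0 c) t = H k c t := by
    intro k c t ht
    have h1 : H 0 c = fun t => ∑ i, c i * b i t := by simp [H]
    rw [h1, iteratedDeriv_fun_sum]
    · refine Finset.sum_congr rfl fun i _ => ?_
      rw [iteratedDeriv_const_mul_field]
    · intro i _
      exact contDiffAt_const.mul ((hb i t ht).contDiffAt)
  -- `K` consists of the coefficient vectors that give the zero function. Only the component in `Kᗮ`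
  -- matters, and after scaling it lies in the compact set `S`, on which no member of the family
  -- vanishes identically.
  let K : Submodule ℝ (EuclideanSpace ℝ ι) :=
    { carrier := {c | ∀ t ∈ Icc u v, H 0 c t = 0}
      add_mem' := by
        intro c d hc hd t ht
        have : H 0 (c + d) t = H 0 c t + H 0 d t := by
          simp [H, add_mul, Finset.sum_add_distrib]
        rw [this, hc t ht, hd t ht, add_zero]
      zero_mem' := by intro t _; simp [H]
      smul_mem' := by
        intro r c hc t ht
        have : H 0 (r • c) t = r * H 0 c t := by
          simp [H, Finset.mul_sum, mul_assoc]
        rw [this, hc t ht, mul_zero] }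
  let S : Set (EuclideanSpace ℝ ι) := Metric.sphere 0 1 ∩ (Kᗮ : Set (EuclideanSpace ℝ ι))
  have hS : IsCompact S := (isCompact_sphere _ _).inter_right K.isClosed_orthogonal
  have key : ∃ N : ℕ, ∀ c : EuclideanSpace ℝ ι, ∃ Z : Finset ℝ, Z.card ≤ N ∧
      ∀ t, (c, t) ∈ S ×ˢ Icc u v → H 0 c t = 0 → t ∈ Z := by
    -- A uniform bound on the number of zeros is inherited by subsets and finite unions of sets of
    -- pairs `(c, t)`, so by compactness it need only be found locally.
    refine (hS.prod isCompact_Icc).induction_on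
      (p := fun A => ∃ N : ℕ, ∀ c : EuclideanSpace ℝ ι, ∃ Z : Finset ℝ, Z.card ≤ N ∧
        ∀ t, (c, t) ∈ A → H 0 c t = 0 → t ∈ Z) ?_ ?_ ?_ ?_
    · exact ⟨0, fun c => ⟨∅, by simp⟩⟩
    · rintro A B hAB ⟨N, hN⟩
      refine ⟨N, fun c => ?_⟩
      obtain ⟨Z, hZ, h⟩ := hN c
      exact ⟨Z, hZ, fun t ht => h t (hAB ht)⟩
    · rintro A B ⟨N, hN⟩ ⟨N', hN'⟩
      refine ⟨N + N', fun c => ?_⟩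
      obtain ⟨Z, hZ, h⟩ := hN c
      obtain ⟨Z', hZ', h'⟩ := hN' c
      refine ⟨Z ∪ Z', (Finset.card_union_le _ _).trans (by omega), fun t ht h0 => ?_⟩
      rcases ht with ht | ht
      · exact Finset.mem_union_left _ (h t ht h0)
      · exact Finset.mem_union_right _ (h' t ht h0)
    · rintro ⟨c₀, t₀⟩ ⟨hc₀, ht₀⟩
      simp only at hc₀ ht₀
      have hne : ∃ t ∈ Icc u v, H 0 c₀ t ≠ 0 := by
        by_contra! hz
        have h1 : c₀ ∈ K := hz
        have h2 : c₀ = 0 := by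
          have := K.inner_right_of_mem_orthogonal h1 hc₀.2
          exact inner_self_eq_zero.1 this
        have h3 := hc₀.1
        simp [h2] at h3
      have han : AnalyticOnNhd ℝ (H 0 c₀) (Icc u v) := by
        intro t ht
        simp only [H, iteratedDeriv_zero]
        exact Finset.analyticAt_fun_sum _ fun i _ => analyticAt_const.mul (hb i t ht)
      -- Some derivative is nonzero at `(c₀, t₀)`. By continuity it stays nonzero on a product
      -- neighbourhood, where Rolle's theorem allows at most `k` zeros for each `c`.
      obtain ⟨k, hk⟩ := AnalyticOnNhd.exists_iteratedDeriv_ne_zero han ht₀ hne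
      rw [hHit k c₀ t₀ ht₀] at hk
      have hcont : ContinuousOn (fun p : EuclideanSpace ℝ ι × ℝ => H k p.1 p.2)
          (univ ×ˢ Icc u v) := by
        refine continuousOn_finsetSum _ fun i _ => ?_
        refine ContinuousOn.mul (by fun_prop) ?_
        exact (AnalyticOnNhd.iteratedDeriv_real (hb i) k).continuousOn.comp
          continuousOn_snd (fun p hp => hp.2)
      have hev := (hcont (c₀, t₀) ⟨mem_univ _, ht₀⟩).eventually_ne hk
      rw [nhdsWithin_prod_eq, nhdsWithin_univ] at hev
      obtain ⟨p, hp, q, hq, hpq⟩ := Filter.eventually_prod_iff.1 hev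
      obtain ⟨δ, hδ, hball⟩ := Metric.mem_nhdsWithin_iff.1 hq
      refine ⟨{c | p c} ×ˢ (Metric.ball t₀ δ ∩ Icc u v), ?_, k, fun c => ?_⟩
      · rw [nhdsWithin_prod_eq]
        refine Filter.prod_mem_prod (mem_nhdsWithin_of_mem_nhds hp) ?_
        exact Filter.inter_mem (mem_nhdsWithin_of_mem_nhds (Metric.ball_mem_nhds _ hδ))
          self_mem_nhdsWithin
      · by_cases hc : p c
        · have hord : (Metric.ball t₀ δ ∩ Icc u v).OrdConnected := by
            rw [Real.ball_eq_Ioo]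
            exact ordConnected_Ioo.inter ordConnected_Icc
          obtain ⟨Z, hZ, hsub⟩ := exists_finset_of_forall_card_le
            (card_zeros_le_of_iterated_derivative_ne_zero k (fun j => H j c) _ hord
              (fun j t ht => hHd j c t ht.2) (fun t ht => hpq hc (hball ht)))
          exact ⟨Z, hZ, fun t ht h0 => hsub ⟨ht.2, h0⟩⟩
        · exact ⟨∅, by simp, fun t ht => absurd ht.1 hc⟩
  obtain ⟨N, hN⟩ := key
  refine ⟨N, fun c => ?_⟩
  -- Splitting off the component in `K` does not change the function, and scaling the rest to length
  -- one does not change its zeros.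
  set c' : EuclideanSpace ℝ ι := WithLp.toLp 2 c with hc'
  obtain ⟨x, hx, y, hy, hxy⟩ := K.exists_add_mem_mem_orthogonal c'
  have hval : ∀ t ∈ Icc u v, ∑ i, c i * b i t = H 0 y t := by
    intro t ht
    have h1 : ∑ i, c i * b i t = H 0 c' t := by simp [H, hc']
    have h2 : H 0 c' t = H 0 x t + H 0 y t := by
      rw [hxy]; simp [H, add_mul, Finset.sum_add_distrib]
    rw [h1, h2, hx t ht, zero_add]
  by_cases hy0 : y = 0
  · left
    intro t ht
    rw [hval t ht, hy0]
    simp [H]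
  · right
    have hyn : ‖y‖ ≠ 0 := norm_ne_zero_iff.2 hy0
    obtain ⟨Z, hZ, h⟩ := hN (‖y‖⁻¹ • y)
    refine ⟨Z, hZ, fun t ht h0 => h t ⟨⟨?_, ?_⟩, ht⟩ ?_⟩
    · simp [norm_smul, hyn]
    · exact Submodule.smul_mem _ _ hy
    · have : H 0 (‖y‖⁻¹ • y) t = ‖y‖⁻¹ * H 0 y t := by
        simp [H, Finset.mul_sum, mul_assoc]
      rw [this, ← hval t ht, h0, mul_zero]

/-! ### Reduced characteristic polynomials -/

section Reduced

open Polynomial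

/-- The polynomial `∏_{l ≠ i} (τ - λ_l)`. -/
def reducedPoly {m : ℕ} (lam : Fin m → ℝ) (i : Fin m) : ℝ[X] :=
  ∏ l ∈ Finset.univ.erase i, (X - C (lam l))

/-- Vieta's formula. Up to sign these are the sums in the Levi conditions with `j = q + 1`, so those
conditions compare lower order terms with coefficients of the reduced polynomials. -/
theorem reducedPoly_coeff {m : ℕ} (lam : Fin m → ℝ) (i : Fin m) (q : Fin m) :
    (reducedPoly lam i).coeff q = (-1) ^ (m - 1 - (q : ℕ)) *
      ∑ s ∈ Finset.powersetCard (m - 1 - (q : ℕ)) (Finset.univ.erase i), ∏ l ∈ s, lam l := by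
  have hcard : (Finset.univ.erase i).card = m - 1 := by simp
  have h := Multiset.prod_X_sub_C_coeff ((Finset.univ.erase i).val.map lam) (k := q)
    (by simp only [Multiset.card_map]; change _ ≤ (Finset.univ.erase i).card; omega)
  rw [Multiset.map_map] at h
  have hc : Multiset.card (Multiset.map lam (Finset.univ.erase i).val) = m - 1 := by
    rw [Multiset.card_map]; exact hcard
  rw [hc, Finset.esymm_map_val] at h
  exact h

/-- Read coefficient by coefficient, this says that the coefficient vector of `reducedPoly lam i` is
a left eigenvector of the companion matrix of `∏ l, (X - C (lam l))`. -/
theorem X_mul_reducedPoly {m : ℕ} (lam : Fin m → ℝ) (i : Fin m) :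
    X * reducedPoly lam i = ∏ l, (X - C (lam l)) + C (lam i) * reducedPoly lam i := by
  rw [← Finset.mul_prod_erase Finset.univ _ (Finset.mem_univ i), reducedPoly]
  ring

theorem reducedPoly_monic {m : ℕ} (lam : Fin m → ℝ) (i : Fin m) : (reducedPoly lam i).Monic :=
  monic_prod_of_monic _ _ fun _ _ => monic_X_sub_C _

theorem reducedPoly_natDegree {m : ℕ} (lam : Fin m → ℝ) (i : Fin m) :
    (reducedPoly lam i).natDegree = m - 1 := by
  rw [reducedPoly, natDegree_prod_of_monic _ _ fun l _ => monic_X_sub_C _]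
  simp

theorem reducedPoly_degree_lt {m : ℕ} (lam : Fin m → ℝ) (i : Fin m) :
    (reducedPoly lam i).degree < m := by
  have := i.pos
  refine (degree_le_natDegree).trans_lt ?_
  rw [reducedPoly_natDegree]
  exact_mod_cast (by omega : m - 1 < m)

theorem reducedPoly_eval_ne {m : ℕ} (lam : Fin m → ℝ) {i j : Fin m} (h : j ≠ i) :
    (reducedPoly lam i).eval (lam j) = 0 := by
  rw [reducedPoly, eval_prod]
  exact Finset.prod_eq_zero (Finset.mem_erase.2 ⟨h, Finset.mem_univ j⟩) (by simp)

theorem reducedPoly_eval_self {m : ℕ} (lam : Fin m → ℝ) (i : Fin m) :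
    (reducedPoly lam i).eval (lam i) = ∏ l ∈ Finset.univ.erase i, (lam i - lam l) := by
  rw [reducedPoly, eval_prod]
  simp

/-- Lagrange interpolation at the `m` distinct roots: `reducedPoly lam i` vanishes at every node
except the `i`-th, and both sides have degree below `m`. -/
theorem X_pow_eq_sum_reducedPoly {m : ℕ} (lam : Fin m → ℝ) (hinj : Function.Injective lam)
    (q : Fin m) :
    (X ^ (q : ℕ) : ℝ[X]) = ∑ i, C (lam i ^ (q : ℕ) / (reducedPoly lam i).eval (lam i)) *
      reducedPoly lam i := by
  refine eq_of_degrees_lt_of_eval_index_eq (v := lam) Finset.univ hinj.injOn ?_ ?_ ?_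
  · simp only [Finset.card_univ, Fintype.card_fin]
    rw [degree_X_pow]
    exact_mod_cast q.2
  · simp only [Finset.card_univ, Fintype.card_fin]
    refine (degree_sum_le _ _).trans_lt ?_
    rw [Finset.sup_lt_iff (WithBot.bot_lt_coe _)]
    intro i _
    rw [← smul_eq_C_mul]
    exact (degree_smul_le _ _).trans_lt (reducedPoly_degree_lt lam i)
  · intro j _
    rw [eval_finsetSum, Finset.sum_eq_single j]
    · rw [eval_pow, eval_X, eval_mul, eval_C, div_mul_cancel₀]
      rw [reducedPoly_eval_self]
      refine Finset.prod_ne_zero_iff.2 fun l hl => sub_ne_zero.2 fun h => ?_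
      exact (Finset.ne_of_mem_erase hl) (hinj h).symm
    · intro i _ hij
      rw [eval_mul, reducedPoly_eval_ne lam hij.symm, mul_zero]
    · simp

/-- The value on `P` of the functional with `τ ^ q ↦ U q`. -/
def coeffPairing {m : ℕ} (U : Fin m → ℂ) (P : ℝ[X]) : ℂ := ∑ q : Fin m, (P.coeff q : ℂ) * U q

theorem coeffPairing_sum_C_mul {m : ℕ} (U : Fin m → ℂ) (c : Fin m → ℝ) (P : Fin m → ℝ[X]) :
    coeffPairing U (∑ i, C (c i) * P i) = ∑ i, (c i : ℂ) * coeffPairing U (P i) := by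
  simp only [coeffPairing, finsetSum_coeff, coeff_C_mul, Finset.mul_sum]
  rw [Finset.sum_comm]
  refine Finset.sum_congr rfl fun q _ => ?_
  push_cast
  rw [Finset.sum_mul]
  exact Finset.sum_congr rfl fun i _ => by ring

theorem coeffPairing_X_pow {m : ℕ} (U : Fin m → ℂ) (q : Fin m) :
    coeffPairing U (X ^ (q : ℕ)) = U q := by
  rw [coeffPairing, Finset.sum_eq_single q]
  · simp
  · intro r _ hr
    rw [coeff_X_pow, if_neg (fun h => hr (Fin.ext h))]
    simp
  · simp

/-- The left side has `m - 1` factors in all. Those indexed by `l ∈ s`, `l ≠ i`, are matched with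
the same index on the right; the others are powers of `|lam i|` and fill the remaining places. If `i
∈ s`, its factor joins the power. -/
theorem prod_abs_mul_pow_le {m : ℕ} (lam : Fin m → ℝ) (i q : Fin m) (s : Finset (Fin m))
    (hs : s.card = m - 1 - (q : ℕ)) :
    (∏ l ∈ s, |lam l|) * |lam i| ^ (q : ℕ) ≤
      ∏ l ∈ Finset.univ.erase i, max |lam i| |lam l| := by
  have hsub : s.erase i ⊆ Finset.univ.erase i := Finset.erase_subset_erase i (Finset.subset_univ s)
  have hq := q.2
  have hcard : (Finset.univ.erase i \ s.erase i).card = m - 1 - (s.erase i).card := by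
    rw [Finset.card_sdiff_of_subset hsub]; simp
  have key : (∏ l ∈ s.erase i, |lam l|) * |lam i| ^ (m - 1 - (s.erase i).card) ≤
      ∏ l ∈ Finset.univ.erase i, max |lam i| |lam l| := by
    rw [← Finset.prod_sdiff hsub, mul_comm, ← hcard, ← Finset.prod_const]
    refine mul_le_mul ?_ ?_ (Finset.prod_nonneg fun _ _ => abs_nonneg _)
      (Finset.prod_nonneg fun _ _ => le_max_of_le_left (abs_nonneg _))
    · exact Finset.prod_le_prod (fun _ _ => abs_nonneg _) fun _ _ => le_max_left _ _
    · exact Finset.prod_le_prod (fun _ _ => abs_nonneg _) fun _ _ => le_max_right _ _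
  refine le_trans (le_of_eq ?_) key
  by_cases hi : i ∈ s
  · have h0 : 0 < s.card := Finset.card_pos.2 ⟨i, hi⟩
    rw [← Finset.mul_prod_erase s _ hi, Finset.card_erase_of_mem hi, hs,
      show m - 1 - (m - 1 - (q : ℕ) - 1) = q + 1 by omega, pow_succ]
    ring
  · rw [Finset.erase_eq_of_notMem hi, hs, show m - 1 - (m - 1 - (q : ℕ)) = q by omega]

/-- Interpolation writes `U q` as a sum of `lam j ^ q / P_j(lam j)` times the pairing with `P_j`. A
coefficient of `P_i` is a sum of at most `2 ^ m` products of `m - 1 - q` roots. Together with `lam j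
^ q` each product is at most `∏ max |lam j| |lam l|`, and the root condition bounds that by `√M ^ (m
- 1) |P_j(lam j)|`, cancelling the denominator. -/
theorem norm_coeff_mul_le_of_injective {m : ℕ} {M : ℝ} (lam : Fin m → ℝ)
    (hne : ∀ i, lam i ≠ 0)
    (hM : ∀ i j, i ≠ j → lam i ^ 2 + lam j ^ 2 ≤ M * (lam i - lam j) ^ 2)
    (U : Fin m → ℂ) (i q : Fin m) :
    |(reducedPoly lam i).coeff q| * ‖U q‖ ≤
      2 ^ m * Real.sqrt M ^ (m - 1) * ∑ j, ‖coeffPairing U (reducedPoly lam j)‖ := by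
  have hinj : Function.Injective lam := by
    intro a b hab
    by_contra h
    have := hM a b h
    have h2 : 0 < lam a ^ 2 := by have := hne a; positivity
    rw [hab] at this h2
    nlinarith [sq_nonneg (lam b)]
  have hpair : U q = ∑ j, ((lam j ^ (q : ℕ) / (reducedPoly lam j).eval (lam j) : ℝ) : ℂ) *
      coeffPairing U (reducedPoly lam j) := by
    rw [← coeffPairing_sum_C_mul, ← X_pow_eq_sum_reducedPoly lam hinj q, coeffPairing_X_pow]
  have hmax : ∀ j, ∏ l ∈ Finset.univ.erase j, max |lam j| |lam l| ≤
      Real.sqrt M ^ (m - 1) * |(reducedPoly lam j).eval (lam j)| := by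
    intro j
    rw [reducedPoly_eval_self, Finset.abs_prod]
    have : Real.sqrt M ^ (m - 1) = ∏ l ∈ Finset.univ.erase j, Real.sqrt M := by simp
    rw [this, ← Finset.prod_mul_distrib]
    refine Finset.prod_le_prod (fun _ _ => le_max_of_le_left (abs_nonneg _)) fun l hl => ?_
    have h := hM j l (Finset.ne_of_mem_erase hl).symm
    have hd : Real.sqrt M * |lam j - lam l| = Real.sqrt (M * (lam j - lam l) ^ 2) := by
      rw [Real.sqrt_mul' _ (sq_nonneg _), Real.sqrt_sq_eq_abs]
    rw [hd]
    refine max_le ?_ ?_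
    · exact Real.abs_le_sqrt (by nlinarith [sq_nonneg (lam l)])
    · exact Real.abs_le_sqrt (by nlinarith [sq_nonneg (lam j)])
  have hpos : ∀ j, 0 < |(reducedPoly lam j).eval (lam j)| := by
    intro j
    rw [reducedPoly_eval_self, abs_pos]
    refine Finset.prod_ne_zero_iff.2 fun l hl => sub_ne_zero.2 fun h => ?_
    exact (Finset.ne_of_mem_erase hl) (hinj h).symm
  have hcoef : ∀ j, |(reducedPoly lam i).coeff q| * |lam j| ^ (q : ℕ) ≤
      2 ^ m * Real.sqrt M ^ (m - 1) * |(reducedPoly lam j).eval (lam j)| := by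
    intro j
    rw [reducedPoly_coeff, abs_mul, abs_pow, abs_neg, abs_one, one_pow, one_mul]
    calc _ ≤ (∑ s ∈ Finset.powersetCard (m - 1 - (q : ℕ)) (Finset.univ.erase i),
            ∏ l ∈ s, |lam l|) * |lam j| ^ (q : ℕ) := by
          gcongr
          refine (Finset.abs_sum_le_sum_abs _ _).trans (le_of_eq ?_)
          simp_rw [Finset.abs_prod]
      _ = ∑ s ∈ Finset.powersetCard (m - 1 - (q : ℕ)) (Finset.univ.erase i),
            (∏ l ∈ s, |lam l|) * |lam j| ^ (q : ℕ) := Finset.sum_mul _ _ _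
      _ ≤ ∑ s ∈ Finset.powersetCard (m - 1 - (q : ℕ)) (Finset.univ.erase i),
            Real.sqrt M ^ (m - 1) * |(reducedPoly lam j).eval (lam j)| :=
          Finset.sum_le_sum fun s hs => (prod_abs_mul_pow_le lam j q s
            (Finset.mem_powersetCard.1 hs).2).trans (hmax j)
      _ = ((Finset.powersetCard (m - 1 - (q : ℕ)) (Finset.univ.erase i)).card : ℝ) *
            (Real.sqrt M ^ (m - 1) * |(reducedPoly lam j).eval (lam j)|) := by
          rw [Finset.sum_const, nsmul_eq_mul]
      _ ≤ 2 ^ m * (Real.sqrt M ^ (m - 1) * |(reducedPoly lam j).eval (lam j)|) := by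
          gcongr
          have h1 : (Finset.powersetCard (m - 1 - (q : ℕ)) (Finset.univ.erase i)).card ≤ 2 ^ m := by
            calc _ ≤ ((Finset.univ : Finset (Fin m)).powerset).card :=
                  Finset.card_le_card fun s _ => by simp
              _ = 2 ^ m := by simp
          exact_mod_cast h1
      _ = _ := by ring
  calc |(reducedPoly lam i).coeff q| * ‖U q‖
      ≤ |(reducedPoly lam i).coeff q| * ∑ j, |lam j| ^ (q : ℕ) /
          |(reducedPoly lam j).eval (lam j)| * ‖coeffPairing U (reducedPoly lam j)‖ := by
        gcongr
        rw [hpair]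
        refine (norm_sum_le _ _).trans (le_of_eq (Finset.sum_congr rfl fun j _ => ?_))
        rw [norm_mul, Complex.norm_real, Real.norm_eq_abs, abs_div, abs_pow]
    _ = ∑ j, (|(reducedPoly lam i).coeff q| * |lam j| ^ (q : ℕ)) /
          |(reducedPoly lam j).eval (lam j)| * ‖coeffPairing U (reducedPoly lam j)‖ := by
        rw [Finset.mul_sum]
        exact Finset.sum_congr rfl fun j _ => by ring
    _ ≤ ∑ j, 2 ^ m * Real.sqrt M ^ (m - 1) * ‖coeffPairing U (reducedPoly lam j)‖ := by
        refine Finset.sum_le_sum fun j _ => ?_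
        gcongr
        rw [div_le_iff₀ (hpos j)]
        exact hcoef j
    _ = _ := by rw [Finset.mul_sum]

theorem continuous_reducedPoly_coeff {m : ℕ} (i q : Fin m) :
    Continuous fun lam : Fin m → ℝ => (reducedPoly lam i).coeff q := by
  simp_rw [reducedPoly_coeff]
  fun_prop

/-- The root condition lets roots coincide only at zero. The zero roots are moved to the distinct
points `ε (l + 1)`, the injective case is applied with a slightly larger constant, and `ε → 0`, both
sides being continuous in the roots. -/
theorem norm_coeff_mul_le {m : ℕ} {M : ℝ} (hM0 : 0 ≤ M) (lam : Fin m → ℝ)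
    (hM : ∀ i j, i ≠ j → lam i ^ 2 + lam j ^ 2 ≤ M * (lam i - lam j) ^ 2)
    (U : Fin m → ℂ) (i q : Fin m) :
    |(reducedPoly lam i).coeff q| * ‖U q‖ ≤
      2 ^ m * Real.sqrt (M + 2 * m ^ 2 + 5) ^ (m - 1) *
        ∑ j, ‖coeffPairing U (reducedPoly lam j)‖ := by
  let pert : ℝ → Fin m → ℝ := fun ε l => if lam l = 0 then ε * (l + 1) else lam l
  have hpert0 : pert 0 = lam := by
    funext l
    by_cases h : lam l = 0 <;> simp [pert, h]
  have hcont : Continuous pert := by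
    refine continuous_pi fun l => ?_
    by_cases h : lam l = 0
    · simp only [pert, h, if_true]; fun_prop
    · simp only [pert, h, if_false]; fun_prop
  have hlim : Filter.Tendsto pert (𝓝[>] 0) (𝓝 lam) := by
    have := hcont.tendsto 0
    rw [hpert0] at this
    exact this.mono_left nhdsWithin_le_nhds
  have hc1 : Continuous fun mu : Fin m → ℝ => |(reducedPoly mu i).coeff q| * ‖U q‖ :=
    ((continuous_reducedPoly_coeff i q).abs).mul continuous_const
  have hc2 : Continuous fun mu : Fin m → ℝ =>
      2 ^ m * Real.sqrt (M + 2 * m ^ 2 + 5) ^ (m - 1) *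
        ∑ j, ‖coeffPairing U (reducedPoly mu j)‖ := by
    refine continuous_const.mul (continuous_finsetSum _ fun j _ => ?_)
    unfold coeffPairing
    refine (continuous_finsetSum _ fun r _ => ?_).norm
    exact (Complex.continuous_ofReal.comp (continuous_reducedPoly_coeff j r)).mul continuous_const
  refine le_of_tendsto_of_tendsto ((hc1.tendsto lam).comp hlim) ((hc2.tendsto lam).comp hlim) ?_
  have hsmall : ∀ l, ∀ᶠ ε in 𝓝[>] (0 : ℝ), lam l ≠ 0 → ε * m ≤ |lam l| / 2 := by
    intro l
    by_cases h : lam l = 0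
    · simp [h]
    · have h1 : Filter.Tendsto (fun ε : ℝ => ε * m) (𝓝[>] 0) (𝓝 0) := by
        have : Continuous fun ε : ℝ => ε * m := by fun_prop
        have h := this.tendsto 0
        rw [zero_mul] at h
        exact h.mono_left nhdsWithin_le_nhds
      have h2 : 0 < |lam l| / 2 := by have := abs_pos.2 h; positivity
      filter_upwards [h1.eventually_le_const h2] with ε hε _ using hε
  filter_upwards [Filter.eventually_all.2 hsmall, self_mem_nhdsWithin] with ε hε hε0
  have hε0 : 0 < ε := hε0
  -- A moved root `x ≤ |lam a| / 2` stays at distance at least `|lam a| / 2` from `lam a`, while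
  -- `lam a ^ 2 + x ^ 2 ≤ 5 (lam a ^ 2 / 4)`: this is the summand `5`. The summand `2 m ^ 2` serves
  -- pairs of moved roots, whose distance is at least `ε`.
  have hmix : ∀ a b : Fin m, lam a ≠ 0 → lam b = 0 →
      lam a ^ 2 + (ε * ((b : ℕ) + 1)) ^ 2 ≤
        (M + 2 * m ^ 2 + 5) * (lam a - ε * ((b : ℕ) + 1)) ^ 2 := by
    intro a b ha _
    have h1 := hε a ha
    set x := ε * ((b : ℕ) + 1 : ℝ) with hx
    have hb : ((b : ℕ) + 1 : ℝ) ≤ m := by exact_mod_cast b.2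
    have hx0 : 0 ≤ x := by positivity
    have hx1 : x ≤ |lam a| / 2 := (mul_le_mul_of_nonneg_left hb hε0.le).trans h1
    have h3 : x ^ 2 ≤ lam a ^ 2 / 4 := by
      rw [← sq_abs (lam a)]; nlinarith
    have h4 : |lam a| / 2 ≤ |lam a - x| := by
      have := abs_sub_abs_le_abs_sub (lam a) x
      rw [abs_of_nonneg hx0] at this
      linarith
    have h5 : lam a ^ 2 / 4 ≤ (lam a - x) ^ 2 := by
      rw [← sq_abs (lam a), ← sq_abs (lam a - x)]
      nlinarith [abs_nonneg (lam a)]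
    have h6 : 0 ≤ (M + 2 * (m : ℝ) ^ 2) * (lam a - x) ^ 2 := by positivity
    nlinarith
  refine norm_coeff_mul_le_of_injective (pert ε) ?_ ?_ U i q
  · intro l
    by_cases h : lam l = 0
    · simp only [pert, h, if_true]; positivity
    · simp only [pert, if_neg h]; exact h
  · intro a b hab
    by_cases ha : lam a = 0 <;> by_cases hb : lam b = 0 <;> simp only [pert, ha, hb, if_true, if_false]
    · have ha' : ((a : ℕ) + 1 : ℝ) ≤ m := by exact_mod_cast a.2
      have hb' : ((b : ℕ) + 1 : ℝ) ≤ m := by exact_mod_cast b.2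
      have hd : (1 : ℝ) ≤ ((a : ℕ) - (b : ℕ) : ℝ) ^ 2 := by
        have h0 : ((a : ℕ) : ℤ) - (b : ℕ) ≠ 0 := by
          intro h
          exact hab (Fin.ext (by omega))
        have h1 : (1 : ℤ) ≤ (((a : ℕ) : ℤ) - (b : ℕ)) ^ 2 := by
          have : 0 < (((a : ℕ) : ℤ) - (b : ℕ)) ^ 2 := by positivity
          omega
        exact_mod_cast h1
      have e1 : (ε * ((a : ℕ) + 1)) ^ 2 + (ε * ((b : ℕ) + 1)) ^ 2 ≤ ε ^ 2 * (2 * m ^ 2) := by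
        have : ((a : ℕ) + 1 : ℝ) ^ 2 ≤ m ^ 2 := by gcongr
        have : ((b : ℕ) + 1 : ℝ) ^ 2 ≤ m ^ 2 := by gcongr
        nlinarith [sq_nonneg ε]
      refine e1.trans ?_
      have e2 : (ε * ((a : ℕ) + 1) - ε * ((b : ℕ) + 1)) ^ 2 =
          ε ^ 2 * ((a : ℕ) - (b : ℕ) : ℝ) ^ 2 := by ring
      rw [e2]
      have e3 : (2 * (m : ℝ) ^ 2) * 1 ≤ (M + 2 * m ^ 2 + 5) * ((a : ℕ) - (b : ℕ) : ℝ) ^ 2 := by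
        gcongr
        linarith
      nlinarith [sq_nonneg ε]
    · have := hmix b a hb ha
      nlinarith
    · exact hmix a b ha hb
    · refine (hM a b hab).trans ?_
      gcongr
      nlinarith [sq_nonneg (m : ℝ)]

end Reduced

/-! ### Symmetric functions of the characteristic roots -/

/-- `h` is a finite sum of products `c(ξ) b(t)` with `b` analytic on `[0,T]` and `c` of polynomial
growth. -/
def IsSeparatedAnalytic {n : ℕ} (T : ℝ) (h : ℝ → Rn n → ℝ) : Prop :=
  ∃ (ι : Type) (_ : Fintype ι) (b : ι → ℝ → ℝ) (c : ι → Rn n → ℝ),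
    (∀ i, AnalyticOnNhd ℝ (b i) (Icc 0 T)) ∧
    (∀ i, ∃ (C : ℝ) (k : ℕ), 0 ≤ C ∧ ∀ ξ, |c i ξ| ≤ C * (1 + ‖ξ‖) ^ k) ∧
    ∀ t ∈ Icc (0 : ℝ) T, ∀ ξ, h t ξ = ∑ i, c i ξ * b i t

namespace IsSeparatedAnalytic

variable {n : ℕ} {T : ℝ} {h h' : ℝ → Rn n → ℝ}

theorem const (x : ℝ) : IsSeparatedAnalytic T fun (_ : ℝ) (_ : Rn n) => x :=
  ⟨Unit, inferInstance, fun _ _ => 1, fun _ _ => x, fun _ => analyticOnNhd_const,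
    fun _ => ⟨|x|, 0, abs_nonneg x, by simp⟩, by simp⟩

theorem add (H : IsSeparatedAnalytic T h) (H' : IsSeparatedAnalytic T h') :
    IsSeparatedAnalytic T fun t ξ => h t ξ + h' t ξ := by
  obtain ⟨ι, _, b, c, hb, hc, e⟩ := H
  obtain ⟨ι', _, b', c', hb', hc', e'⟩ := H'
  refine ⟨ι ⊕ ι', inferInstance, Sum.elim b b', Sum.elim c c', ?_, ?_, ?_⟩
  · rintro (i | i)
    exacts [hb i, hb' i]
  · rintro (i | i)
    exacts [hc i, hc' i]
  · intro t ht ξ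
    simp [e t ht, e' t ht]

theorem mul (H : IsSeparatedAnalytic T h) (H' : IsSeparatedAnalytic T h') :
    IsSeparatedAnalytic T fun t ξ => h t ξ * h' t ξ := by
  obtain ⟨ι, _, b, c, hb, hc, e⟩ := H
  obtain ⟨ι', _, b', c', hb', hc', e'⟩ := H'
  refine ⟨ι × ι', inferInstance, fun p t => b p.1 t * b' p.2 t, fun p ξ => c p.1 ξ * c' p.2 ξ,
    ?_, ?_, ?_⟩
  · intro p t ht
    exact (hb p.1 t ht).mul (hb' p.2 t ht)
  · intro p
    obtain ⟨C, k, hC, hk⟩ := hc p.1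
    obtain ⟨C', k', hC', hk'⟩ := hc' p.2
    refine ⟨C * C', k + k', by positivity, fun ξ => ?_⟩
    rw [abs_mul, pow_add]
    calc _ ≤ (C * (1 + ‖ξ‖) ^ k) * (C' * (1 + ‖ξ‖) ^ k') := by
          gcongr
          exacts [hk ξ, hk' ξ]
      _ = _ := by ring
  · intro t ht ξ
    simp only [e t ht, e' t ht]
    rw [Finset.sum_mul_sum, Fintype.sum_prod_type]
    exact Finset.sum_congr rfl fun i _ => Finset.sum_congr rfl fun j _ => by ring

theorem sum {α : Type*} (s : Finset α) {f : α → ℝ → Rn n → ℝ}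
    (H : ∀ a ∈ s, IsSeparatedAnalytic T (f a)) :
    IsSeparatedAnalytic T fun t ξ => ∑ a ∈ s, f a t ξ := by
  classical
  induction s using Finset.induction_on with
  | empty => simpa using const (n := n) 0
  | insert a s ha ih =>
    simp only [Finset.sum_insert ha]
    exact (H a (Finset.mem_insert_self _ _)).add
      (ih fun b hb => H b (Finset.mem_insert_of_mem hb))

theorem congr (H : IsSeparatedAnalytic T h) (e : ∀ t ∈ Icc (0 : ℝ) T, ∀ ξ, h' t ξ = h t ξ) :
    IsSeparatedAnalytic T h' := by
  obtain ⟨ι, _, b, c, hb, hc, e₁⟩ := H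
  exact ⟨ι, inferInstance, b, c, hb, hc, fun t ht ξ => (e t ht ξ).trans (e₁ t ht ξ)⟩

/-- The separated functions form an algebra; this carries analyticity from the principal
coefficients to the entries of the symmetriser. -/
theorem aeval {σ : Type*} {f : σ → ℝ → Rn n → ℝ} (H : ∀ i, IsSeparatedAnalytic T (f i))
    (G : MvPolynomial σ ℝ) :
    IsSeparatedAnalytic T fun t ξ => MvPolynomial.aeval (fun i => f i t ξ) G := by
  induction G using MvPolynomial.induction_on with
  | C x => simpa using const (n := n) x
  | add p q hp hq => simpa using hp.add hq
  | mul_X p i hp => simpa using hp.mul (H i)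

theorem bounded (H : IsSeparatedAnalytic T h) :
    ∃ (C : ℝ) (k : ℕ), 0 ≤ C ∧ ∀ t ∈ Icc (0 : ℝ) T, ∀ ξ, |h t ξ| ≤ C * (1 + ‖ξ‖) ^ k := by
  obtain ⟨ι, _, b, c, hb, hc, e⟩ := H
  choose C k hC hk using hc
  have hB : ∀ i, ∃ B : ℝ, ∀ t ∈ Icc (0 : ℝ) T, |b i t| ≤ B := fun i =>
    isCompact_Icc.exists_bound_of_continuousOn (hb i).continuousOn
  choose B hB using hB
  refine ⟨∑ i, C i * |B i|, ∑ i, k i,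
    Finset.sum_nonneg fun i _ => mul_nonneg (hC i) (abs_nonneg _), fun t ht ξ => ?_⟩
  rw [e t ht, Finset.sum_mul]
  refine (Finset.abs_sum_le_sum_abs _ _).trans (Finset.sum_le_sum fun i _ => ?_)
  have h1 : (1 + ‖ξ‖) ^ k i ≤ (1 + ‖ξ‖) ^ ∑ i, k i :=
    pow_le_pow_right₀ (by linarith [norm_nonneg ξ])
      (Finset.single_le_sum (f := k) (fun _ _ => Nat.zero_le _) (Finset.mem_univ i))
  rw [abs_mul]
  calc |c i ξ| * |b i t| ≤ (C i * (1 + ‖ξ‖) ^ k i) * |B i| := by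
        exact mul_le_mul (hk i ξ) ((hB i t ht).trans (le_abs_self _)) (abs_nonneg _)
          ((abs_nonneg _).trans (hk i ξ))
    _ = C i * |B i| * (1 + ‖ξ‖) ^ k i := by ring
    _ ≤ _ := mul_le_mul_of_nonneg_left h1 (mul_nonneg (hC i) (abs_nonneg _))

/-- The time derivative exists and has a uniformly bounded number of zeros unless it vanishes. -/
theorem exists_deriv (H : IsSeparatedAnalytic T h) :
    ∃ (h₁ : ℝ → Rn n → ℝ) (N : ℕ),
      (∀ t ∈ Icc (0 : ℝ) T, ∀ ξ, HasDerivWithinAt (fun s => h s ξ) (h₁ t ξ) (Icc 0 T) t) ∧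
      (∀ ξ, ContinuousOn (fun s => h₁ s ξ) (Icc 0 T)) ∧
      ∀ ξ, (∀ t ∈ Icc (0 : ℝ) T, h₁ t ξ = 0) ∨
        ∃ Z : Finset ℝ, Z.card ≤ N ∧ ∀ t ∈ Icc (0 : ℝ) T, h₁ t ξ = 0 → t ∈ Z := by
  obtain ⟨ι, _, b, c, hb, hc, e⟩ := H
  -- The frequency enters only through the coefficients `c i ξ` in front of the fixed functions
  -- `deriv (b i)`, so `N` is independent of `ξ`.
  obtain ⟨N, hN⟩ := exists_card_zeros_le (fun i => deriv (b i)) fun i => (hb i).deriv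
  refine ⟨fun t ξ => ∑ i, c i ξ * deriv (b i) t, N, fun t ht ξ => ?_, fun ξ => ?_,
    fun ξ => hN fun i => c i ξ⟩
  · have h1 : HasDerivAt (fun s => ∑ i, c i ξ * b i s) (∑ i, c i ξ * deriv (b i) t) t :=
      HasDerivAt.fun_sum fun i _ => ((hb i t ht).differentiableAt.hasDerivAt).const_mul _
    exact h1.hasDerivWithinAt.congr (fun s hs => e s hs ξ) (e t ht ξ)
  · exact continuousOn_finsetSum _ fun i _ => continuousOn_const.mul (hb i).deriv.continuousOn

end IsSeparatedAnalytic

section SymmetricFunctions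

open MvPolynomial

/-- The coefficients of `∏_{l ≠ i} (τ - X_l)` as polynomials in the variables `X_l`. -/
def reducedCoeff {m : ℕ} (i : Fin m) (q : ℕ) : MvPolynomial (Fin m) ℝ :=
  (-1) ^ (m - 1 - q) *
    ∑ s ∈ Finset.powersetCard (m - 1 - q) (Finset.univ.erase i), ∏ l ∈ s, X l

theorem aeval_reducedCoeff {m : ℕ} (lam : Fin m → ℝ) (i q : Fin m) :
    aeval lam (reducedCoeff i q) = (reducedPoly lam i).coeff q := by
  rw [reducedPoly_coeff, reducedCoeff]
  simp [map_sum, map_prod]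

theorem rename_reducedCoeff {m : ℕ} (e : Equiv.Perm (Fin m)) (i : Fin m) (q : ℕ) :
    rename e (reducedCoeff i q) = reducedCoeff (e i) q := by
  have h1 : Finset.univ.erase (e i) = (Finset.univ.erase i).map e.toEmbedding := by
    rw [Finset.map_erase, Finset.map_univ_equiv]
    rfl
  rw [reducedCoeff, reducedCoeff, h1, Finset.powersetCard_map, Finset.sum_map]
  simp [map_sum, map_prod, Finset.mapEmbedding_apply]

/-- The entries of the symmetriser, as polynomials in the roots. -/
def symmetriserPoly {m : ℕ} (j k : Fin m) : MvPolynomial (Fin m) ℝ :=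
  ∑ i, reducedCoeff i j * reducedCoeff i k

/-- A permutation of the roots permutes the reduced polynomials, and the entry sums over all of
them. -/
theorem symmetriserPoly_isSymmetric {m : ℕ} (j k : Fin m) :
    (symmetriserPoly j k).IsSymmetric := by
  intro e
  simp only [symmetriserPoly, map_sum, map_mul, rename_reducedCoeff]
  exact Equiv.sum_comp e fun i => reducedCoeff i (j : ℕ) * reducedCoeff i (k : ℕ)

/-- The entries of the symmetriser. -/
def symmetriser {m : ℕ} (lam : Fin m → ℝ) (j k : Fin m) : ℝ :=
  ∑ i, (reducedPoly lam i).coeff j * (reducedPoly lam i).coeff k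

theorem aeval_symmetriserPoly {m : ℕ} (lam : Fin m → ℝ) (j k : Fin m) :
    aeval lam (symmetriserPoly j k) = symmetriser lam j k := by
  simp only [symmetriserPoly, symmetriser, map_sum, map_mul, aeval_reducedCoeff]

/-- The fundamental theorem on symmetric polynomials trades the roots, which need not be smooth in
time, for the coefficients of the characteristic polynomial, which are analytic. -/
theorem exists_symmetriser_eq_aeval_coeff {m : ℕ} (j k : Fin m) :
    ∃ G : MvPolynomial (Fin m) ℝ, ∀ lam : Fin m → ℝ, symmetriser lam j k =
      aeval (fun l : Fin m => (-1) ^ ((l : ℕ) + 1) *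
        (∏ r, (Polynomial.X - Polynomial.C (lam r))).coeff (m - ((l : ℕ) + 1))) G := by
  obtain ⟨G, hG⟩ := (esymmAlgEquiv (σ := Fin m) ℝ (Fintype.card_fin m)).surjective
    ⟨symmetriserPoly j k, symmetriserPoly_isSymmetric j k⟩
  refine ⟨G, fun lam => ?_⟩
  have h1 : symmetriserPoly j k = aeval (fun i : Fin m => esymm (Fin m) ℝ (i + 1)) G := by
    have := congrArg Subtype.val hG
    refine this.symm.trans ?_
    exact esymmAlgHom_apply G
  rw [← aeval_symmetriserPoly, h1]
  have h2 : ∀ l : Fin m, aeval lam (esymm (Fin m) ℝ ((l : ℕ) + 1)) = (-1) ^ ((l : ℕ) + 1) *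
      (∏ r, (Polynomial.X - Polynomial.C (lam r))).coeff (m - ((l : ℕ) + 1)) := by
    intro l
    have hl := l.2
    have hc : Multiset.card (Multiset.map lam Finset.univ.val) = m := by simp
    have h := Multiset.prod_X_sub_C_coeff (Finset.univ.val.map lam) (k := m - ((l : ℕ) + 1))
      (by rw [hc]; omega)
    rw [Multiset.map_map, hc, show m - (m - ((l : ℕ) + 1)) = l + 1 by omega] at h
    rw [aeval_esymm_eq_multiset_esymm]
    have h' : (∏ r, (Polynomial.X - Polynomial.C (lam r))).coeff (m - ((l : ℕ) + 1)) =
      (-1) ^ ((l : ℕ) + 1) * (Multiset.map lam Finset.univ.val).esymm (l + 1) := h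
    rw [h', ← mul_assoc, ← mul_pow]
    simp
  calc aeval lam (aeval (fun i : Fin m => esymm (Fin m) ℝ (i + 1)) G)
      = aeval (fun i : Fin m => aeval lam (esymm (Fin m) ℝ (i + 1))) G := by
        rw [← AlgHom.comp_apply, comp_aeval]
    _ = _ := by simp_rw [h2]

end SymmetricFunctions

/-! ### Analyticity of the symmetriser through the principal symbol -/

section PrincipalSymbol

open Polynomial

/-- Two polynomials with equal values at all complex `τ` have equal coefficients. In particular the
principal symbol is real. -/
theorem principalSymbol_eq_coeff {n m : ℕ} {T : ℝ} {a : ℕ → (Fin n → ℕ) → ℝ → ℂ}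
    {lam : Fin m → ℝ → Rn n → ℝ} (hroots : AreCharacteristicRoots m T a lam) {t : ℝ}
    (ht : t ∈ Icc (0 : ℝ) T) (ξ : Rn n) {j : ℕ} (hj : j < m) :
    principalSymbol a (m - j) t ξ = ((∏ l, (X - C (lam l t ξ))).coeff j : ℝ) := by
  have h : (X ^ m + ∑ j ∈ Finset.range m, C (principalSymbol a (m - j) t ξ) * X ^ j : ℂ[X]) =
      (∏ l, (X - C (lam l t ξ))).map Complex.ofRealHom := by
    refine Polynomial.funext fun τ => ?_
    have := hroots t ht ξ τ
    simp only [eval_add, eval_pow, eval_X, eval_finsetSum, eval_mul, eval_C, Polynomial.map_prod,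
      Polynomial.map_sub, map_X, map_C, eval_prod, eval_sub]
    exact this
  have h2 := congrArg (fun P => P.coeff j) h
  simp only [coeff_add, coeff_X_pow, finsetSum_coeff, coeff_C_mul, coeff_map] at h2
  rw [if_neg (by omega), zero_add, Finset.sum_eq_single j] at h2
  · simpa using h2
  · intro i _ hij
    rw [if_neg hij.symm, mul_zero]
  · intro h; exact absurd (Finset.mem_range.2 hj) h

theorem abs_coord_le {n : ℕ} (ξ : Rn n) (i : Fin n) : |ξ i| ≤ ‖ξ‖ := by
  have := PiLp.norm_apply_le ξ i
  simpa using this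

theorem abs_prod_pow_le {n : ℕ} (ξ : Rn n) (γ : Fin n → ℕ) :
    |∏ i, ξ i ^ γ i| ≤ (1 + ‖ξ‖) ^ ∑ i, γ i := by
  rw [Finset.abs_prod, ← Finset.prod_pow_eq_pow_sum]
  refine Finset.prod_le_prod (fun _ _ => abs_nonneg _) fun i _ => ?_
  rw [abs_pow]
  gcongr
  linarith [abs_coord_le ξ i]

theorem monomial_eq_ofReal {n : ℕ} (ξ : Rn n) (γ : Fin n → ℕ) :
    monomial ξ γ = ((∏ i, ξ i ^ γ i : ℝ) : ℂ) := by
  simp [monomial]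

theorem mem_multiIndices {n d : ℕ} {γ : Fin n → ℕ} : γ ∈ multiIndices n d ↔ ∑ i, γ i = d := by
  simp [multiIndices, Finset.mem_piAntidiag]

/-- The monomials in `ξ` are the factors of polynomial growth. Passing to the real part loses
nothing when the characteristic roots are real, as the principal symbol is then real. -/
theorem isSeparatedAnalytic_re_principalSymbol {n : ℕ} {T : ℝ} (hT : 0 < T)
    {a : ℕ → (Fin n → ℕ) → ℝ → ℂ} {k : ℕ}
    (ha : ∀ γ : Fin n → ℕ, ∑ i, γ i = k → AnalyticOn ℝ (a k γ) (Icc 0 T)) :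
    IsSeparatedAnalytic T fun t ξ => (principalSymbol a k t ξ).re := by
  have h1 : ∀ t ξ, (principalSymbol a k t ξ).re =
      ∑ γ ∈ multiIndices n k, (∏ i, ξ i ^ γ i) * (a k γ t).re := by
    intro t ξ
    rw [principalSymbol, Complex.re_sum]
    refine Finset.sum_congr rfl fun γ _ => ?_
    rw [monomial_eq_ofReal, Complex.re_mul_ofReal, mul_comm]
  simp only [h1]
  refine IsSeparatedAnalytic.sum _ fun γ hγ => ?_
  have h2 : AnalyticOn ℝ (fun t => (a k γ t).re) (Icc 0 T) :=
    Complex.reCLM.comp_analyticOn (ha γ (mem_multiIndices.1 hγ))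
  obtain ⟨g, hg, he⟩ := exists_analyticOnNhd_extension hT h2
  refine ⟨Unit, inferInstance, fun _ => g, fun _ ξ => ∏ i, ξ i ^ γ i, fun _ => hg,
    fun _ => ⟨1, ∑ i, γ i, zero_le_one, fun ξ => by simpa using abs_prod_pow_le ξ γ⟩, ?_⟩
  intro t ht ξ
  have := he ht
  simp only at this
  simp [this]

theorem isSeparatedAnalytic_symmetriser {n m : ℕ} {T : ℝ} (hT : 0 < T)
    {a : ℕ → (Fin n → ℕ) → ℝ → ℂ}
    (ha : ∀ k ∈ Finset.Icc 1 m, ∀ γ : Fin n → ℕ, ∑ i, γ i = k → AnalyticOn ℝ (a k γ) (Icc 0 T))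
    {lam : Fin m → ℝ → Rn n → ℝ} (hroots : AreCharacteristicRoots m T a lam) (j k : Fin m) :
    IsSeparatedAnalytic T fun t ξ => symmetriser (fun l => lam l t ξ) j k := by
  obtain ⟨G, hG⟩ := exists_symmetriser_eq_aeval_coeff j k
  simp only [hG]
  refine IsSeparatedAnalytic.aeval (fun l => ?_) G
  have hl := l.2
  refine (IsSeparatedAnalytic.const _).mul ?_
  refine (isSeparatedAnalytic_re_principalSymbol hT (k := (l : ℕ) + 1) (a := a)
    (ha _ (by simp))).congr fun t ht ξ => ?_
  have := principalSymbol_eq_coeff hroots ht ξ (j := m - ((l : ℕ) + 1)) (by omega)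
  rw [show m - (m - ((l : ℕ) + 1)) = (l : ℕ) + 1 by omega] at this
  rw [this, Complex.ofReal_re]

end PrincipalSymbol

/-! ### A two-sided Gronwall inequality and the companion system -/

/-- `E exp (-Φ)` decreases and `E exp Φ` increases. The backward bound is needed for the inverse of
the fundamental matrix. -/
theorem le_mul_exp_of_abs_deriv_le {u v : ℝ} (huv : u ≤ v) {E E' Φ Φ' : ℝ → ℝ}
    (hEc : ContinuousOn E (Icc u v)) (hΦc : ContinuousOn Φ (Icc u v))
    (hE : ∀ t ∈ Ioo u v, HasDerivAt E (E' t) t) (hΦ : ∀ t ∈ Ioo u v, HasDerivAt Φ (Φ' t) t)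
    (h : ∀ t ∈ Ioo u v, |E' t| ≤ Φ' t * E t) :
    E v ≤ E u * Real.exp (Φ v - Φ u) ∧ E u ≤ E v * Real.exp (Φ v - Φ u) := by
  constructor
  · have hanti : AntitoneOn (fun t => E t * Real.exp (-Φ t)) (Icc u v) := by
      refine antitoneOn_of_deriv_nonpos (convex_Icc u v) (hEc.mul (hΦc.neg.rexp)) ?_ ?_
      · rw [interior_Icc]
        intro t ht
        exact ((hE t ht).mul ((hΦ t ht).neg.exp)).differentiableAt.differentiableWithinAt
      · rw [interior_Icc]
        intro t ht
        rw [((hE t ht).fun_mul ((hΦ t ht).fun_neg.exp)).deriv]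
        have h1 := (abs_le.1 (h t ht)).2
        have h2 := Real.exp_pos (-Φ t)
        nlinarith
    have := hanti ⟨le_rfl, huv⟩ ⟨huv, le_rfl⟩ huv
    simp only at this
    calc E v = (E v * Real.exp (-Φ v)) * Real.exp (Φ v) := by
          rw [mul_assoc, ← Real.exp_add]; simp
      _ ≤ (E u * Real.exp (-Φ u)) * Real.exp (Φ v) := by gcongr
      _ = E u * Real.exp (Φ v - Φ u) := by
          rw [mul_assoc, ← Real.exp_add]; ring_nf
  · have hmono : MonotoneOn (fun t => E t * Real.exp (Φ t)) (Icc u v) := by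
      refine monotoneOn_of_deriv_nonneg (convex_Icc u v) (hEc.mul (hΦc.rexp)) ?_ ?_
      · rw [interior_Icc]
        intro t ht
        exact ((hE t ht).mul ((hΦ t ht).exp)).differentiableAt.differentiableWithinAt
      · rw [interior_Icc]
        intro t ht
        rw [((hE t ht).fun_mul ((hΦ t ht).exp)).deriv]
        have h1 := (abs_le.1 (h t ht)).1
        have h2 := Real.exp_pos (Φ t)
        nlinarith
    have := hmono ⟨le_rfl, huv⟩ ⟨huv, le_rfl⟩ huv
    simp only at this
    calc E u = (E u * Real.exp (Φ u)) * Real.exp (-Φ u) := by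
          rw [mul_assoc, ← Real.exp_add]; simp
      _ ≤ (E v * Real.exp (Φ v)) * Real.exp (-Φ u) := by gcongr
      _ = E v * Real.exp (Φ v - Φ u) := by
          rw [mul_assoc, ← Real.exp_add, sub_eq_add_neg]

/-- The companion matrix with last row `-c`. -/
def companion {m : ℕ} (c : Fin m → ℂ) : Matrix (Fin m) (Fin m) ℂ :=
  Matrix.of fun p q => if (p : ℕ) + 1 < m then (if (q : ℕ) = p + 1 then 1 else 0) else -c q

theorem companion_mulVec_of_lt {m : ℕ} (c U : Fin m → ℂ) {p : Fin m} (hp : (p : ℕ) + 1 < m) :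
    (companion c).mulVec U p = U ⟨p + 1, hp⟩ := by
  simp only [Matrix.mulVec, dotProduct, companion, Matrix.of_apply, hp, if_true]
  rw [Finset.sum_eq_single ⟨p + 1, hp⟩]
  · simp
  · intro q _ hq
    rw [if_neg fun h => hq (Fin.ext h), zero_mul]
  · simp

theorem companion_mulVec_last {m : ℕ} (c U : Fin m → ℂ) {p : Fin m} (hp : ¬ (p : ℕ) + 1 < m) :
    (companion c).mulVec U p = -∑ q, c q * U q := by
  simp [Matrix.mulVec, dotProduct, companion, Matrix.of_apply, hp, Finset.sum_neg_distrib]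

theorem hasDerivAt_normSq {f : ℝ → ℂ} {f' : ℂ} {t : ℝ} (hf : HasDerivAt f f' t) :
    HasDerivAt (fun s => Complex.normSq (f s)) (2 * (f' * (starRingEnd ℂ) (f t)).re) t := by
  have h1 : HasDerivAt (fun s => (f s).re) f'.re t :=
    (Complex.reCLM.hasFDerivAt.comp_hasDerivAt t hf)
  have h2 : HasDerivAt (fun s => (f s).im) f'.im t :=
    (Complex.imCLM.hasFDerivAt.comp_hasDerivAt t hf)
  have h3 := (h1.fun_mul h1).fun_add (h2.fun_mul h2)
  simp only [Complex.normSq_apply]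
  convert! h3 using 1
  simp
  ring

theorem abs_re_mul_conj_le (z w : ℂ) : |(z * (starRingEnd ℂ) w).re| ≤ ‖z‖ * ‖w‖ := by
  refine (Complex.abs_re_le_norm _).trans (le_of_eq ?_)
  rw [norm_mul, Complex.norm_conj]

/-- An exponential bound for the companion system with coefficients of size `ρ ^ (m - q)`. -/
theorem companion_exp_bound {m : ℕ} {T C ρ : ℝ} (hC : 0 ≤ C) (hρ : 1 ≤ ρ)
    {c : ℝ → Fin m → ℂ} (hc : ∀ t ∈ Icc (0 : ℝ) T, ∀ q : Fin m, ‖c t q‖ ≤ C * ρ ^ (m - (q : ℕ)))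
    {U : ℝ → Fin m → ℂ}
    (hU : ∀ t ∈ Icc (0 : ℝ) T,
      HasDerivWithinAt U (Complex.I • (companion (c t)).mulVec (U t)) (Icc 0 T) t)
    {s t : ℝ} (hs : s ∈ Icc (0 : ℝ) T) (ht : t ∈ Icc (0 : ℝ) T) (q : Fin m) :
    ‖U t q‖ ≤ (m : ℝ) * ρ ^ m * Real.exp (ρ * (1 + C) * m * T) * ‖U s‖ := by
  have hρ0 : 0 < ρ := by linarith
  -- With these weights the shift from `U_q` to `U_{q+1}` costs exactly one factor `ρ`, and so does
  -- the last row, since `ρ ^ (m - q) = ρ * w q`.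
  let w : Fin m → ℝ := fun q => ρ ^ (m - 1 - (q : ℕ))
  have hw0 : ∀ q, 0 < w q := fun q => by positivity
  let V : ℝ → Fin m → ℝ := fun t q => w q * ‖U t q‖
  let E : ℝ → ℝ := fun t => ∑ q, w q ^ 2 * Complex.normSq (U t q)
  have hEV : ∀ t, E t = ∑ q, V t q ^ 2 := by
    intro t
    refine Finset.sum_congr rfl fun q _ => ?_
    simp only [V, mul_pow, Complex.normSq_eq_norm_sq]
  let Y : ℝ → Fin m → ℂ := fun t => (companion (c t)).mulVec (U t)
  let E' : ℝ → ℝ := fun t =>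
    ∑ q, w q ^ 2 * (2 * ((Complex.I * Y t q) * (starRingEnd ℂ) (U t q)).re)
  have hEc : ContinuousOn E (Icc 0 T) := by
    have hUc : ContinuousOn U (Icc 0 T) := fun t ht => (hU t ht).continuousWithinAt
    refine continuousOn_finsetSum _ fun q _ => continuousOn_const.mul ?_
    exact Complex.continuous_normSq.comp_continuousOn
      ((continuous_apply q).comp_continuousOn hUc)
  have hE : ∀ t ∈ Ioo 0 T, HasDerivAt E (E' t) t := by
    intro t ht
    refine HasDerivAt.fun_sum fun q _ => HasDerivAt.const_mul _ (hasDerivAt_normSq ?_)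
    have := (hU t (Ioo_subset_Icc_self ht)).hasDerivAt (Icc_mem_nhds ht.1 ht.2)
    exact (hasDerivAt_pi.1 this) q
  have hY : ∀ t ∈ Icc 0 T, ∀ q, w q * ‖Y t q‖ ≤ ρ * (1 + C) * ∑ r, V t r := by
    intro t ht q
    have hV0 : ∀ r, 0 ≤ V t r := fun r => mul_nonneg (hw0 r).le (norm_nonneg _)
    by_cases hq : (q : ℕ) + 1 < m
    · have h1 : Y t q = U t ⟨q + 1, hq⟩ := companion_mulVec_of_lt _ _ hq
      have h2 : w q = ρ * w ⟨q + 1, hq⟩ := by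
        simp only [w]
        rw [← pow_succ']
        congr 1
        omega
      have h3 : V t ⟨q + 1, hq⟩ ≤ ∑ r, V t r :=
        Finset.single_le_sum (f := V t) (fun r _ => hV0 r) (Finset.mem_univ _)
      rw [h1, h2, mul_assoc]
      calc ρ * (w ⟨q + 1, hq⟩ * ‖U t ⟨q + 1, hq⟩‖) ≤ ρ * ∑ r, V t r := by gcongr
        _ ≤ ρ * (1 + C) * ∑ r, V t r := by
          have := Finset.sum_nonneg (s := Finset.univ) fun r _ => hV0 r
          rw [mul_assoc]
          gcongr
          nlinarith
    · have h1 : Y t q = -∑ r, c t r * U t r := companion_mulVec_last _ _ hq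
      have hwq : w q = 1 := by
        simp only [w]
        rw [show m - 1 - (q : ℕ) = 0 by omega, pow_zero]
      rw [h1, hwq, one_mul, norm_neg]
      refine (norm_sum_le _ _).trans ?_
      rw [Finset.mul_sum]
      refine Finset.sum_le_sum fun r _ => ?_
      rw [norm_mul]
      have hr := r.2
      have h4 : ρ ^ (m - (r : ℕ)) = ρ * w r := by
        simp only [w]
        rw [← pow_succ']
        congr 1
        omega
      calc ‖c t r‖ * ‖U t r‖ ≤ (C * (ρ * w r)) * ‖U t r‖ := by
            rw [← h4]; gcongr; exact hc t ht r
        _ = ρ * C * V t r := by simp only [V]; ring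
        _ ≤ ρ * (1 + C) * V t r := by
            have := hV0 r
            gcongr
            linarith
  have hE'le : ∀ t ∈ Icc 0 T, |E' t| ≤ (2 * (ρ * (1 + C) * m)) * E t := by
    intro t ht
    have hV0 : ∀ r, 0 ≤ V t r := fun r => mul_nonneg (hw0 r).le (norm_nonneg _)
    calc |E' t| ≤ ∑ q, |w q ^ 2 * (2 * ((Complex.I * Y t q) * (starRingEnd ℂ) (U t q)).re)| :=
          Finset.abs_sum_le_sum_abs _ _
      _ ≤ ∑ q, 2 * ((ρ * (1 + C) * ∑ r, V t r) * V t q) := by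
          refine Finset.sum_le_sum fun q _ => ?_
          rw [abs_mul, abs_mul, abs_of_nonneg (sq_nonneg _), abs_two]
          have h1 := abs_re_mul_conj_le (Complex.I * Y t q) (U t q)
          rw [norm_mul, Complex.norm_I, one_mul] at h1
          have h2 := hY t ht q
          calc w q ^ 2 * (2 * |((Complex.I * Y t q) * (starRingEnd ℂ) (U t q)).re|)
              ≤ w q ^ 2 * (2 * (‖Y t q‖ * ‖U t q‖)) := by gcongr
            _ = 2 * ((w q * ‖Y t q‖) * V t q) := by simp only [V]; ring
            _ ≤ _ := by
                have := hV0 q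
                gcongr
      _ = 2 * (ρ * (1 + C)) * (∑ r, V t r) ^ 2 := by
          rw [← Finset.mul_sum, ← Finset.mul_sum]; ring
      _ ≤ 2 * (ρ * (1 + C)) * (m * ∑ r, V t r ^ 2) := by
          have := sq_sum_le_card_mul_sum_sq (s := (Finset.univ : Finset (Fin m))) (f := V t)
          simp only [Finset.card_univ, Fintype.card_fin] at this
          gcongr
      _ = _ := by rw [hEV]; ring
  set B := ρ * (1 + C) * m with hB
  have hB0 : 0 ≤ B := by positivity
  have hEle : E t ≤ E s * Real.exp (2 * B * T) := by
    have hE0 : ∀ r, 0 ≤ E r := fun r => by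
      rw [hEV]; exact Finset.sum_nonneg fun _ _ => sq_nonneg _
    have hexp : ∀ x y : ℝ, x ∈ Icc 0 T → y ∈ Icc 0 T →
        Real.exp (2 * B * y - 2 * B * x) ≤ Real.exp (2 * B * T) := by
      intro x y hx hy
      refine Real.exp_le_exp.2 ?_
      nlinarith [hx.1, hy.2, mul_nonneg hB0 hx.1, mul_le_mul_of_nonneg_left hy.2 hB0]
    have main : ∀ x y : ℝ, x ∈ Icc 0 T → y ∈ Icc 0 T → x ≤ y →
        E y ≤ E x * Real.exp (2 * B * T) ∧ E x ≤ E y * Real.exp (2 * B * T) := by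
      intro x y hx hy hxy
      have hsub : Icc x y ⊆ Icc 0 T := Icc_subset_Icc hx.1 hy.2
      have hsub' : Ioo x y ⊆ Ioo 0 T := Ioo_subset_Ioo hx.1 hy.2
      have := le_mul_exp_of_abs_deriv_le hxy (E := E) (E' := E') (Φ := fun t => 2 * B * t)
        (Φ' := fun _ => 2 * B) (hEc.mono hsub) (by fun_prop) (fun t ht => hE t (hsub' ht))
        (fun t _ => by simpa using (hasDerivAt_id t).const_mul (2 * B))
        (fun t ht => hE'le t (hsub (Ioo_subset_Icc_self ht)))
      exact ⟨this.1.trans (mul_le_mul_of_nonneg_left (hexp x y hx hy) (hE0 _)),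
        this.2.trans (mul_le_mul_of_nonneg_left (hexp x y hx hy) (hE0 _))⟩
    rcases le_total s t with h | h
    · exact (main s t hs ht h).1
    · exact (main t s ht hs h).2
  have hwq1 : 1 ≤ w q := one_le_pow₀ hρ
  have hlow : ‖U t q‖ ^ 2 ≤ E t := by
    rw [hEV]
    refine le_trans ?_ (Finset.single_le_sum (f := fun q => V t q ^ 2) (fun _ _ => sq_nonneg _)
      (Finset.mem_univ q))
    simp only [V, mul_pow]
    have : (1 : ℝ) ≤ w q ^ 2 := one_le_pow₀ hwq1
    nlinarith [sq_nonneg ‖U t q‖]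
  have hup : E s ≤ (m * ρ ^ m * ‖U s‖) ^ 2 := by
    rw [hEV]
    calc ∑ q, V s q ^ 2 ≤ ∑ q : Fin m, (ρ ^ m * ‖U s‖) ^ 2 := by
          refine Finset.sum_le_sum fun r _ => ?_
          have h1 : w r ≤ ρ ^ m := pow_le_pow_right₀ hρ (by omega)
          have h2 := norm_le_pi_norm (U s) r
          have := hw0 r
          simp only [V]
          gcongr
      _ = m * (ρ ^ m * ‖U s‖) ^ 2 := by simp
      _ ≤ m ^ 2 * (ρ ^ m * ‖U s‖) ^ 2 := by
          have hm : (1 : ℝ) ≤ m := by exact_mod_cast q.pos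
          gcongr
          nlinarith
      _ = _ := by ring
  have hfin : ‖U t q‖ ^ 2 ≤ (m * ρ ^ m * Real.exp (B * T) * ‖U s‖) ^ 2 := by
    calc ‖U t q‖ ^ 2 ≤ E s * Real.exp (2 * B * T) := hlow.trans hEle
      _ ≤ (m * ρ ^ m * ‖U s‖) ^ 2 * Real.exp (2 * B * T) := by gcongr
      _ = _ := by
          have : Real.exp (2 * B * T) = Real.exp (B * T) ^ 2 := by
            rw [← Real.exp_nat_mul]; push_cast; ring_nf
          rw [this]; ring
  exact le_of_sq_le_sq hfin (by positivity)

/-! ### The energy of a mode -/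

section Energy

open Polynomial

theorem coeffPairing_smul {m : ℕ} (z : ℂ) (U : Fin m → ℂ) (P : ℝ[X]) :
    coeffPairing (z • U) P = z * coeffPairing U P := by
  simp only [coeffPairing, Finset.mul_sum, Pi.smul_apply, smul_eq_mul]
  exact Finset.sum_congr rfl fun q _ => by ring

/-- The reduced polynomials are left eigenvectors of the companion matrix. -/
theorem coeffPairing_companion {m : ℕ} (lam : Fin m → ℝ) (b U : Fin m → ℂ) (i : Fin m) :
    coeffPairing ((companion fun q : Fin m =>
        (((∏ l, (X - C (lam l))).coeff q : ℝ) : ℂ) + b q).mulVec U) (reducedPoly lam i) =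
      (lam i : ℂ) * coeffPairing U (reducedPoly lam i) - ∑ q, b q * U q := by
  cases m with
  | zero => exact i.elim0
  | succ m =>
    set Q := ∏ l, (X - C (lam l)) with hQ
    set P := reducedPoly lam i with hP
    have hX : X * P = Q + C (lam i) * P := X_mul_reducedPoly lam i
    -- The coefficients of `X P = Q + λ_i P` in degree zero and in positive degrees. The shift in
    -- the companion matrix acts on coefficients as multiplication by `X`, and its last row enters
    -- with weight one because `P` is monic of degree `m`.
    have h0 : (0 : ℝ) = Q.coeff 0 + lam i * P.coeff 0 := by
      have := congrArg (fun R => R.coeff 0) hX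
      simpa using this
    have hs : ∀ q : ℕ, P.coeff q = Q.coeff (q + 1) + lam i * P.coeff (q + 1) := by
      intro q
      have := congrArg (fun R => R.coeff (q + 1)) hX
      simpa [coeff_X_mul] using this
    have hlast : P.coeff m = 1 := by
      have h1 := (reducedPoly_monic lam i).coeff_natDegree
      rw [reducedPoly_natDegree] at h1
      simpa using h1
    set c : Fin (m + 1) → ℂ := fun q => ((Q.coeff q : ℝ) : ℂ) + b q with hc
    have hY : ∀ q : Fin m, (companion c).mulVec U q.castSucc = U q.succ := by
      intro q
      rw [companion_mulVec_of_lt c U (p := q.castSucc) (by simp)]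
      rfl
    have hYl : (companion c).mulVec U (Fin.last m) = -∑ q, c q * U q :=
      companion_mulVec_last c U (by simp)
    have e1 : coeffPairing ((companion c).mulVec U) P =
        ∑ q : Fin m, (P.coeff q : ℂ) * U q.succ - ∑ q, c q * U q := by
      rw [coeffPairing, Fin.sum_univ_castSucc]
      simp only [hY, hYl, Fin.val_castSucc, Fin.val_last, hlast]
      simp [sub_eq_add_neg]
    have e2 : ∑ q : Fin m, (P.coeff q : ℂ) * U q.succ =
        ∑ q : Fin (m + 1), ((Q.coeff q : ℂ) + lam i * P.coeff q) * U q := by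
      rw [Fin.sum_univ_succ]
      have h0' : ((Q.coeff 0 : ℝ) : ℂ) + lam i * P.coeff 0 = 0 := by exact_mod_cast h0.symm
      simp only [Fin.val_zero, h0', zero_mul, zero_add, Fin.val_succ]
      refine Finset.sum_congr rfl fun q _ => ?_
      rw [hs q]
      push_cast
      rfl
    rw [e1, e2, coeffPairing, Finset.mul_sum, ← Finset.sum_sub_distrib, ← Finset.sum_sub_distrib]
    refine Finset.sum_congr rfl fun q _ => ?_
    simp only [hc]
    ring

/-- The pairings depend on single roots, which may fail to be differentiable in time; the quadratic
form involves only entries of the symmetriser, so the energy can be differentiated. -/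
theorem sum_symmetriser_mul_re {m : ℕ} (lam : Fin m → ℝ) (U V : Fin m → ℂ) :
    ∑ j, ∑ k, symmetriser lam j k * (U j * (starRingEnd ℂ) (V k)).re =
      ∑ i, (coeffPairing U (reducedPoly lam i) *
        (starRingEnd ℂ) (coeffPairing V (reducedPoly lam i))).re := by
  have h1 : ∀ i, (coeffPairing U (reducedPoly lam i) *
        (starRingEnd ℂ) (coeffPairing V (reducedPoly lam i))).re =
      ∑ j : Fin m, ∑ k : Fin m, (reducedPoly lam i).coeff j * (reducedPoly lam i).coeff k *
        (U j * (starRingEnd ℂ) (V k)).re := by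
    intro i
    simp only [coeffPairing, map_sum, map_mul, Complex.conj_ofReal]
    rw [Finset.sum_mul_sum, Complex.re_sum]
    refine Finset.sum_congr rfl fun j _ => ?_
    rw [Complex.re_sum]
    refine Finset.sum_congr rfl fun k _ => ?_
    rw [← Complex.re_ofReal_mul]
    push_cast
    ring_nf
  simp only [h1, symmetriser, Finset.sum_mul]
  rw [Finset.sum_comm (s := Finset.univ) (t := Finset.univ) (f := fun i j : Fin m => ∑ k : Fin m,
    (reducedPoly lam i).coeff j * (reducedPoly lam i).coeff k * (U j * (starRingEnd ℂ) (V k)).re)]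
  refine Finset.sum_congr rfl fun j _ => ?_
  rw [Finset.sum_comm]

/-- The logarithm of the geometric mean of `symmetriser j j + 1` and `symmetriser k k + 1`. -/
def logWeight {m : ℕ} (lam : Fin m → ℝ) (j k : Fin m) : ℝ :=
  (Real.log (symmetriser lam j j + 1) + Real.log (symmetriser lam k k + 1)) / 2

theorem symmetriser_self_nonneg {m : ℕ} (lam : Fin m → ℝ) (j : Fin m) :
    0 ≤ symmetriser lam j j :=
  Finset.sum_nonneg fun _ _ => mul_self_nonneg _

theorem exp_logWeight_sq {m : ℕ} (lam : Fin m → ℝ) (j k : Fin m) :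
    Real.exp (logWeight lam j k) ^ 2 = (symmetriser lam j j + 1) * (symmetriser lam k k + 1) := by
  have hj := symmetriser_self_nonneg lam j
  have hk := symmetriser_self_nonneg lam k
  rw [← Real.exp_nat_mul, logWeight]
  push_cast
  rw [mul_div_cancel₀ _ two_ne_zero, Real.exp_add, Real.exp_log (by linarith),
    Real.exp_log (by linarith)]

/-- Cauchy–Schwarz in the index of the reduced polynomials. The summands `+ 1` in the weights keep
the logarithms finite where a diagonal entry vanishes. -/
theorem abs_symmetriser_mul_exp_le {m : ℕ} (lam : Fin m → ℝ) (j k : Fin m) :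
    |symmetriser lam j k| * Real.exp (-logWeight lam j k) ≤ 1 := by
  have h1 : symmetriser lam j k ^ 2 ≤ symmetriser lam j j * symmetriser lam k k := by
    have := Finset.sum_mul_sq_le_sq_mul_sq Finset.univ
      (fun i => (reducedPoly lam i).coeff j) (fun i => (reducedPoly lam i).coeff k)
    simpa only [symmetriser, ← sq] using this
  have hj := symmetriser_self_nonneg lam j
  have hk := symmetriser_self_nonneg lam k
  have h2 : |symmetriser lam j k| ≤ Real.exp (logWeight lam j k) := by
    refine abs_le_of_sq_le_sq ?_ (Real.exp_pos _).le
    rw [exp_logWeight_sq]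
    nlinarith
  rw [Real.exp_neg, ← div_eq_mul_inv, div_le_one (Real.exp_pos _)]
  exact h2

/-- The energy. -/
def modeEnergy {m : ℕ} (lam : Fin m → ℝ) (U : Fin m → ℂ) : ℝ :=
  ∑ i, Complex.normSq (coeffPairing U (reducedPoly lam i)) +
    ∑ j : Fin m, if (j : ℕ) + 1 < m then Complex.normSq (U j) else 0

theorem modeEnergy_eq {m : ℕ} (lam : Fin m → ℝ) (U : Fin m → ℂ) :
    modeEnergy lam U = ∑ j, ∑ k, symmetriser lam j k * (U j * (starRingEnd ℂ) (U k)).re +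
      ∑ j : Fin m, if (j : ℕ) + 1 < m then Complex.normSq (U j) else 0 := by
  rw [sum_symmetriser_mul_re, modeEnergy]
  congr 1
  refine Finset.sum_congr rfl fun i _ => ?_
  rw [Complex.mul_conj, Complex.ofReal_re]

theorem sq_sum_norm_coeffPairing_le {m : ℕ} (lam : Fin m → ℝ) (U : Fin m → ℂ) :
    (∑ i, ‖coeffPairing U (reducedPoly lam i)‖) ^ 2 ≤ m * modeEnergy lam U := by
  have h1 := sq_sum_le_card_mul_sum_sq (s := (Finset.univ : Finset (Fin m)))
    (f := fun i => ‖coeffPairing U (reducedPoly lam i)‖)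
  simp only [Finset.card_univ, Fintype.card_fin] at h1
  refine h1.trans (mul_le_mul_of_nonneg_left ?_ (Nat.cast_nonneg m))
  rw [modeEnergy]
  have h2 : 0 ≤ ∑ j : Fin m, if (j : ℕ) + 1 < m then Complex.normSq (U j) else 0 :=
    Finset.sum_nonneg fun j _ => by split_ifs <;> first | exact Complex.normSq_nonneg _ | exact le_rfl
  simp only [Complex.normSq_eq_norm_sq] at h2 ⊢
  linarith

theorem modeEnergy_nonneg {m : ℕ} (lam : Fin m → ℝ) (U : Fin m → ℂ) : 0 ≤ modeEnergy lam U :=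
  add_nonneg (Finset.sum_nonneg fun _ _ => Complex.normSq_nonneg _)
    (Finset.sum_nonneg fun j _ => by
      split_ifs <;> first | exact Complex.normSq_nonneg _ | exact le_rfl)

/-- The constant of the near diagonality estimate. -/
def diagConst (m : ℕ) (M : ℝ) : ℝ := 2 ^ m * Real.sqrt (M + 2 * m ^ 2 + 5) ^ (m - 1)

theorem diagConst_nonneg (m : ℕ) (M : ℝ) : 0 ≤ diagConst m M := by
  unfold diagConst; positivity

/-- The energy controls the diagonal of the symmetriser. -/
theorem weight_mul_normSq_le {m : ℕ} {M : ℝ} (hM0 : 0 ≤ M) (lam : Fin m → ℝ)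
    (hM : ∀ i j, i ≠ j → lam i ^ 2 + lam j ^ 2 ≤ M * (lam i - lam j) ^ 2)
    (U : Fin m → ℂ) (q : Fin m) :
    (symmetriser lam q q + 1) * ‖U q‖ ^ 2 ≤
      (2 * m ^ 2 * diagConst m M ^ 2 + 1) * modeEnergy lam U := by
  set D := diagConst m M with hD
  set W := ∑ i, ‖coeffPairing U (reducedPoly lam i)‖ with hW
  have hD0 : 0 ≤ D := diagConst_nonneg m M
  have hm : (1 : ℝ) ≤ m := by exact_mod_cast q.pos
  have hE := modeEnergy_nonneg lam U
  have hWE : W ^ 2 ≤ m * modeEnergy lam U := sq_sum_norm_coeffPairing_le lam U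
  have ha : ∀ i, |(reducedPoly lam i).coeff q| * ‖U q‖ ≤ D * W :=
    fun i => norm_coeff_mul_le hM0 lam hM U i q
  have hasq : ∀ i, (reducedPoly lam i).coeff q * (reducedPoly lam i).coeff q * ‖U q‖ ^ 2 ≤
      D ^ 2 * (m * modeEnergy lam U) := by
    intro i
    have h := ha i
    calc (reducedPoly lam i).coeff q * (reducedPoly lam i).coeff q * ‖U q‖ ^ 2
        = (|(reducedPoly lam i).coeff q| * ‖U q‖) ^ 2 := by rw [mul_pow, sq_abs]; ring
      _ ≤ (D * W) ^ 2 := by gcongr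
      _ = D ^ 2 * W ^ 2 := by ring
      _ ≤ _ := by gcongr
  have h1 : symmetriser lam q q * ‖U q‖ ^ 2 ≤ m ^ 2 * D ^ 2 * modeEnergy lam U := by
    rw [symmetriser, Finset.sum_mul]
    refine (Finset.sum_le_sum fun i _ => hasq i).trans (le_of_eq ?_)
    simp
    ring
  have h2 : ‖U q‖ ^ 2 ≤ (m ^ 2 * D ^ 2 + 1) * modeEnergy lam U := by
    -- The components before the last one are part of the energy by its second sum. The last one is
    -- controlled by near diagonality alone, because the reduced polynomials are monic of degree `m
    -- - 1`.
    by_cases hq : (q : ℕ) + 1 < m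
    · have h3 : ‖U q‖ ^ 2 ≤ modeEnergy lam U := by
        rw [modeEnergy]
        have h4 : (if (q : ℕ) + 1 < m then Complex.normSq (U q) else 0) ≤
            ∑ j : Fin m, if (j : ℕ) + 1 < m then Complex.normSq (U j) else 0 :=
          Finset.single_le_sum (f := fun j : Fin m =>
            if (j : ℕ) + 1 < m then Complex.normSq (U j) else 0)
            (fun j _ => by split_ifs <;> first | exact Complex.normSq_nonneg _ | exact le_rfl)
            (Finset.mem_univ q)
        rw [if_pos hq, Complex.normSq_eq_norm_sq] at h4
        have h5 : 0 ≤ ∑ i, Complex.normSq (coeffPairing U (reducedPoly lam i)) :=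
          Finset.sum_nonneg fun _ _ => Complex.normSq_nonneg _
        linarith
      have : 0 ≤ m ^ 2 * D ^ 2 * modeEnergy lam U := by positivity
      linarith
    · have hlast : (reducedPoly lam q).coeff q = 1 := by
        have h3 := (reducedPoly_monic lam q).coeff_natDegree
        rw [reducedPoly_natDegree] at h3
        rwa [show (q : ℕ) = m - 1 by omega]
      have h3 := hasq q
      rw [hlast, one_mul, one_mul] at h3
      have : (m : ℝ) * (D ^ 2 * modeEnergy lam U) ≤ m ^ 2 * (D ^ 2 * modeEnergy lam U) := by
        gcongr
        nlinarith
      linarith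
  linarith

/-- The size of the time derivative of the energy. -/
theorem abs_energy_derivative_le {m : ℕ} {M L : ℝ} (hM0 : 0 ≤ M) (hL : 0 ≤ L) (lam : Fin m → ℝ)
    (hM : ∀ i j, i ≠ j → lam i ^ 2 + lam j ^ 2 ≤ M * (lam i - lam j) ^ 2)
    (b : Fin m → ℂ) (hb : ∀ q : Fin m, ‖b q‖ ≤ L * ∑ i, |(reducedPoly lam i).coeff q|)
    (D : Fin m → Fin m → ℝ) (U Y : Fin m → ℂ)
    (hY : Y = Complex.I • (companion fun q : Fin m =>
        (((∏ l, (X - C (lam l))).coeff q : ℝ) : ℂ) + b q).mulVec U) :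
    |(∑ j, ∑ k, (D j k * (U j * (starRingEnd ℂ) (U k)).re +
        symmetriser lam j k *
          ((Y j * (starRingEnd ℂ) (U k)).re + (Y k * (starRingEnd ℂ) (U j)).re))) +
      ∑ j : Fin m, if (j : ℕ) + 1 < m then 2 * (Y j * (starRingEnd ℂ) (U j)).re else 0| ≤
    (1 + 2 * m) * (2 * m ^ 2 * diagConst m M ^ 2 + 1 + L * m ^ 2 * diagConst m M) *
      (1 + ∑ j, ∑ k, |D j k| * Real.exp (-logWeight lam j k)) * modeEnergy lam U := by
  set K := 2 * m ^ 2 * diagConst m M ^ 2 + 1 with hK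
  set E := modeEnergy lam U with hE
  have hE0 : 0 ≤ E := modeEnergy_nonneg lam U
  have hd0 := diagConst_nonneg m M
  have hK0 : 1 ≤ K := by rw [hK]; nlinarith [sq_nonneg ((m : ℝ) * diagConst m M)]
  have hw : ∀ q, (symmetriser lam q q + 1) * ‖U q‖ ^ 2 ≤ K * E :=
    weight_mul_normSq_le hM0 lam hM U
  have hU : ∀ q, ‖U q‖ ^ 2 ≤ K * E := by
    intro q
    have h1 := hw q
    have h2 := mul_nonneg (symmetriser_self_nonneg lam q) (sq_nonneg ‖U q‖)
    linarith
  have hUU : ∀ j k, ‖U j‖ * ‖U k‖ ≤ K * E := by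
    intro j k
    nlinarith [hU j, hU k, sq_nonneg (‖U j‖ - ‖U k‖)]
  set W : Fin m → ℂ := fun i => coeffPairing U (reducedPoly lam i) with hW
  have hWE : (∑ i, ‖W i‖) ^ 2 ≤ m * E := sq_sum_norm_coeffPairing_le lam U
  have hW0 : 0 ≤ ∑ i, ‖W i‖ := Finset.sum_nonneg fun _ _ => norm_nonneg _
  -- Here the Levi bound `hb` meets near diagonality: each `|coeff_q P_i| |U_q|` is controlled by
  -- the pairings, so the lower order terms have the size of the energy with no loss in the
  -- frequency.
  have hbU : ‖∑ q, b q * U q‖ ≤ L * m ^ 2 * diagConst m M * ∑ i, ‖W i‖ := by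
    calc ‖∑ q, b q * U q‖ ≤ ∑ q, ‖b q‖ * ‖U q‖ := by
          refine (norm_sum_le _ _).trans (le_of_eq ?_)
          simp
      _ ≤ ∑ q : Fin m, L * ∑ i : Fin m, diagConst m M * ∑ i, ‖W i‖ := by
          refine Finset.sum_le_sum fun q _ => ?_
          calc ‖b q‖ * ‖U q‖ ≤ (L * ∑ i, |(reducedPoly lam i).coeff q|) * ‖U q‖ := by
                gcongr; exact hb q
            _ = L * ∑ i, |(reducedPoly lam i).coeff q| * ‖U q‖ := by
                rw [mul_assoc, Finset.sum_mul]
            _ ≤ _ := by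
                refine mul_le_mul_of_nonneg_left (Finset.sum_le_sum fun i _ => ?_) hL
                exact norm_coeff_mul_le hM0 lam hM U i q
      _ = _ := by simp; ring
  have hWY : ∀ i, coeffPairing Y (reducedPoly lam i) =
      Complex.I * ((lam i : ℂ) * W i - ∑ q, b q * U q) := by
    intro i
    rw [hY, coeffPairing_smul, coeffPairing_companion]
  -- The eigenvalue contributes `I * lam i * |W i|²`, which is purely imaginary because the roots
  -- are real; only the lower order terms survive in the real part.
  have hreW : ∀ i, |(coeffPairing Y (reducedPoly lam i) * (starRingEnd ℂ) (W i)).re| ≤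
      ‖∑ q, b q * U q‖ * ‖W i‖ := by
    intro i
    have h1 : (coeffPairing Y (reducedPoly lam i) * (starRingEnd ℂ) (W i)).re =
        ((-Complex.I * ∑ q, b q * U q) * (starRingEnd ℂ) (W i)).re := by
      rw [hWY]
      have h2 : Complex.I * ((lam i : ℂ) * W i - ∑ q, b q * U q) * (starRingEnd ℂ) (W i) =
          Complex.I * ((lam i * Complex.normSq (W i) : ℝ) : ℂ) +
            (-Complex.I * ∑ q, b q * U q) * (starRingEnd ℂ) (W i) := by
        push_cast
        rw [← Complex.mul_conj]
        ring
      rw [h2, Complex.add_re, Complex.I_mul_re, Complex.ofReal_im]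
      simp
    rw [h1]
    refine (abs_re_mul_conj_le _ _).trans (le_of_eq ?_)
    rw [norm_mul, norm_neg, Complex.norm_I, one_mul]
  have e1 : ∑ j, ∑ k, symmetriser lam j k *
      ((Y j * (starRingEnd ℂ) (U k)).re + (Y k * (starRingEnd ℂ) (U j)).re) =
      2 * ∑ i, (coeffPairing Y (reducedPoly lam i) * (starRingEnd ℂ) (W i)).re := by
    have h1 := sum_symmetriser_mul_re lam Y U
    have h2 : ∑ j, ∑ k, symmetriser lam j k * (Y k * (starRingEnd ℂ) (U j)).re =
        ∑ j, ∑ k, symmetriser lam j k * (Y j * (starRingEnd ℂ) (U k)).re := by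
      rw [Finset.sum_comm]
      refine Finset.sum_congr rfl fun j _ => Finset.sum_congr rfl fun k _ => ?_
      congr 1
      simp only [symmetriser]
      exact Finset.sum_congr rfl fun i _ => mul_comm _ _
    simp only [mul_add, Finset.sum_add_distrib]
    rw [h2, h1]
    ring
  have b1 : |∑ j, ∑ k, symmetriser lam j k *
      ((Y j * (starRingEnd ℂ) (U k)).re + (Y k * (starRingEnd ℂ) (U j)).re)| ≤
      2 * m * (L * m ^ 2 * diagConst m M) * E := by
    rw [e1, abs_mul, abs_two]
    calc 2 * |∑ i, (coeffPairing Y (reducedPoly lam i) * (starRingEnd ℂ) (W i)).re|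
        ≤ 2 * ∑ i, ‖∑ q, b q * U q‖ * ‖W i‖ := by
          gcongr
          exact (Finset.abs_sum_le_sum_abs _ _).trans (Finset.sum_le_sum fun i _ => hreW i)
      _ = 2 * (‖∑ q, b q * U q‖ * ∑ i, ‖W i‖) := by rw [← Finset.mul_sum]
      _ ≤ 2 * ((L * m ^ 2 * diagConst m M * ∑ i, ‖W i‖) * ∑ i, ‖W i‖) := by gcongr
      _ = 2 * (L * m ^ 2 * diagConst m M) * (∑ i, ‖W i‖) ^ 2 := by ring
      _ ≤ 2 * (L * m ^ 2 * diagConst m M) * (m * E) := by gcongr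
      _ = _ := by ring
  have b2 : |∑ j, ∑ k, D j k * (U j * (starRingEnd ℂ) (U k)).re| ≤
      K * E * ∑ j, ∑ k, |D j k| * Real.exp (-logWeight lam j k) := by
    rw [Finset.mul_sum]
    refine (Finset.abs_sum_le_sum_abs _ _).trans (Finset.sum_le_sum fun j _ => ?_)
    rw [Finset.mul_sum]
    refine (Finset.abs_sum_le_sum_abs _ _).trans (Finset.sum_le_sum fun k _ => ?_)
    rw [abs_mul]
    -- The energy bounds `(symmetriser j j + 1) |U_j|²`, so a product `|U_j| |U_k|` gains the factor
    -- `exp (-logWeight)`, which turns `D j k` into a logarithmic derivative.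
    have h1 : Real.exp (logWeight lam j k) * (‖U j‖ * ‖U k‖) ≤ K * E := by
      refine abs_le_of_sq_le_sq' ?_ (by positivity) |>.2
      rw [mul_pow, mul_pow, exp_logWeight_sq]
      calc _ = ((symmetriser lam j j + 1) * ‖U j‖ ^ 2) *
            ((symmetriser lam k k + 1) * ‖U k‖ ^ 2) := by ring
        _ ≤ (K * E) * (K * E) := by
            have h2 := mul_nonneg (add_nonneg (symmetriser_self_nonneg lam k) zero_le_one)
              (sq_nonneg ‖U k‖)
            exact mul_le_mul (hw j) (hw k) h2 (by positivity)
        _ = _ := by ring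
    calc |D j k| * |(U j * (starRingEnd ℂ) (U k)).re| ≤ |D j k| * (‖U j‖ * ‖U k‖) := by
          gcongr; exact abs_re_mul_conj_le _ _
      _ = (|D j k| * Real.exp (-logWeight lam j k)) *
          (Real.exp (logWeight lam j k) * (‖U j‖ * ‖U k‖)) := by
          have : Real.exp (-logWeight lam j k) * Real.exp (logWeight lam j k) = 1 := by
            rw [← Real.exp_add]; simp
          linear_combination (-(|D j k| * (‖U j‖ * ‖U k‖))) * this
      _ ≤ (|D j k| * Real.exp (-logWeight lam j k)) * (K * E) := by gcongr
      _ = _ := by ring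
  have b3 : |∑ j : Fin m, if (j : ℕ) + 1 < m then 2 * (Y j * (starRingEnd ℂ) (U j)).re else 0| ≤
      2 * m * (K * E) := by
    refine (Finset.abs_sum_le_sum_abs _ _).trans ?_
    have : ∑ _j : Fin m, 2 * (K * E) = 2 * m * (K * E) := by simp; ring
    rw [← this]
    refine Finset.sum_le_sum fun j _ => ?_
    split_ifs with hj
    · rw [abs_mul, abs_two]
      have h1 : Y j = Complex.I * U ⟨j + 1, hj⟩ := by
        rw [hY, Pi.smul_apply, companion_mulVec_of_lt _ _ hj, smul_eq_mul]
      have h2 := abs_re_mul_conj_le (Y j) (U j)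
      rw [h1, norm_mul, Complex.norm_I, one_mul] at h2
      rw [h1]
      have h3 := hUU ⟨j + 1, hj⟩ j
      linarith
    · simp; positivity
  simp only [Finset.sum_add_distrib] at b1 ⊢
  set S := ∑ j, ∑ k, |D j k| * Real.exp (-logWeight lam j k) with hS
  have hS0 : 0 ≤ S := Finset.sum_nonneg fun j _ => Finset.sum_nonneg fun k _ => by positivity
  set A := ∑ j, ∑ k, D j k * (U j * (starRingEnd ℂ) (U k)).re
  set B := ∑ j, ∑ k, symmetriser lam j k *
      ((Y j * (starRingEnd ℂ) (U k)).re + (Y k * (starRingEnd ℂ) (U j)).re)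
  set F := ∑ j : Fin m, if (j : ℕ) + 1 < m then 2 * (Y j * (starRingEnd ℂ) (U j)).re else 0
  have htri : |A + B + F| ≤ |A| + |B| + |F| :=
    (abs_add_le _ _).trans (by linarith [abs_add_le A B])
  refine htri.trans ?_
  set P := L * m ^ 2 * diagConst m M with hP
  have hP0 : 0 ≤ P := by positivity
  calc |A| + |B| + |F| ≤ K * E * S + 2 * m * P * E + 2 * m * (K * E) := by linarith
    _ ≤ (1 + 2 * m) * (K + P) * (1 + S) * E := by
      have hm0 : (0 : ℝ) ≤ m := Nat.cast_nonneg m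
      have : (1 + 2 * m) * (K + P) * (1 + S) * E - (K * E * S + 2 * m * P * E + 2 * m * (K * E)) =
          (K + P) * E + P * E * S + 2 * m * (K + P) * S * E := by ring
      have h2 : 0 ≤ (K + P) * E + P * E * S + 2 * m * (K + P) * S * E := by positivity
      linarith

end Energy

/-! ### Polynomial bounds for the modes -/

/-- A constant `ε` with `|f| = ε f` allows the absolute value of a derivative to be integrated
explicitly between consecutive zeros. -/
theorem exists_sign_of_forall_ne_zero {u v : ℝ} {f : ℝ → ℝ} (hf : ContinuousOn f (Ioo u v))
    (h : (∀ t ∈ Ioo u v, f t = 0) ∨ ∀ t ∈ Ioo u v, f t ≠ 0) :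
    ∃ ε : ℝ, |ε| ≤ 1 ∧ ∀ t ∈ Ioo u v, ε * f t = |f t| := by
  rcases h with h | h
  · exact ⟨1, by simp, fun t ht => by simp [h t ht]⟩
  · by_cases hpos : ∃ t ∈ Ioo u v, 0 < f t
    · obtain ⟨t₀, ht₀, h0⟩ := hpos
      refine ⟨1, by simp, fun t ht => ?_⟩
      rw [one_mul, abs_of_nonneg]
      by_contra hneg
      push Not at hneg
      obtain ⟨s, hs, hs0⟩ := isPreconnected_Ioo.intermediate_value ht ht₀ hf
        ⟨hneg.le, h0.le⟩
      exact h s hs hs0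
    · push Not at hpos
      exact ⟨-1, by simp, fun t ht => by rw [abs_of_nonpos (hpos t ht)]; ring⟩

/-- If a quantity grows by at most a factor on every interval avoiding a finite set, it grows at
most by a power of that factor. -/
theorem le_pow_mul_of_chain {E : ℝ → ℝ} {κ : ℝ} (hκ : 1 ≤ κ) (hE : ∀ t, 0 ≤ E t) (Z : Finset ℝ)
    {T : ℝ} (h : ∀ u v, 0 ≤ u → u ≤ v → v ≤ T → (∀ z ∈ Z, z ∉ Ioo u v) →
      E v ≤ κ * E u ∧ E u ≤ κ * E v) :
    ∀ (N : ℕ) (u v : ℝ), 0 ≤ u → u ≤ v → v ≤ T → (Z.filter fun z => z ∈ Ioo u v).card ≤ N →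
      E v ≤ κ ^ (N + 1) * E u ∧ E u ≤ κ ^ (N + 1) * E v := by
  intro N
  induction N with
  | zero =>
    intro u v hu huv hv hcard
    rw [Nat.le_zero, Finset.card_eq_zero, Finset.filter_eq_empty_iff] at hcard
    simpa using h u v hu huv hv fun z hz => hcard hz
  | succ N ih =>
    intro u v hu huv hv hcard
    by_cases hne : (Z.filter fun z => z ∈ Ioo u v).Nonempty
    -- The leftmost point of `Z` inside the interval cuts it into a piece that avoids `Z` and a
    -- piece with fewer points of `Z`.
    · set z := (Z.filter fun z => z ∈ Ioo u v).min' hne with hz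
      have hzm := Finset.mem_filter.1 ((Z.filter fun z => z ∈ Ioo u v).min'_mem hne)
      rw [← hz] at hzm
      have h1 := h u z hu hzm.2.1.le (hzm.2.2.le.trans hv) fun y hy hyu => by
        have := Finset.min'_le (Z.filter fun z => z ∈ Ioo u v) y
          (Finset.mem_filter.2 ⟨hy, hyu.1, hyu.2.trans hzm.2.2⟩)
        exact absurd hyu.2 (not_lt.2 this)
      have h2 := ih z v (hu.trans hzm.2.1.le) hzm.2.2.le hv (by
        have hlt : (Z.filter fun y => y ∈ Ioo z v).card < (Z.filter fun z => z ∈ Ioo u v).card := by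
          refine Finset.card_lt_card ?_
          refine Finset.ssubset_iff_of_subset ?_ |>.2 ⟨z, Finset.mem_filter.2 hzm, by simp⟩
          intro y hy
          rw [Finset.mem_filter] at hy ⊢
          exact ⟨hy.1, hzm.2.1.trans hy.2.1, hy.2.2⟩
        omega)
      have hk : 0 ≤ κ ^ (N + 1) := by positivity
      constructor
      · calc E v ≤ κ ^ (N + 1) * E z := h2.1
          _ ≤ κ ^ (N + 1) * (κ * E u) := by gcongr; exact h1.1
          _ = _ := by ring
      · calc E u ≤ κ * E z := h1.2
          _ ≤ κ * (κ ^ (N + 1) * E v) := by gcongr; exact h2.2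
          _ = _ := by ring
    · have h0 : (Z.filter fun z => z ∈ Ioo u v).card ≤ N := by
        rw [Finset.not_nonempty_iff_eq_empty.1 hne]; simp
      obtain ⟨h1, h2⟩ := ih u v hu huv hv h0
      have hle : κ ^ (N + 1) ≤ κ ^ (N + 1 + 1) := pow_le_pow_right₀ hκ (by omega)
      exact ⟨h1.trans (mul_le_mul_of_nonneg_right hle (hE _)),
        h2.trans (mul_le_mul_of_nonneg_right hle (hE _))⟩

/-! ### Growth of the energy where all weights are monotone -/

section IntervalEstimate

/-- The growth of an energy controlled by logarithmic derivatives of monotone weights. -/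
theorem energy_growth_of_monotone_weights {m : ℕ} {u v K H : ℝ} (huv : u ≤ v) (hK : 0 ≤ K)
    {E E' : ℝ → ℝ} {f f' : Fin m → Fin m → ℝ → ℝ}
    (hE0 : ∀ t, 0 ≤ E t)
    (hEc : ContinuousOn E (Icc u v)) (hE : ∀ t ∈ Ioo u v, HasDerivAt E (E' t) t)
    (hfc : ∀ j k, ContinuousOn (f j k) (Icc u v))
    (hf : ∀ j k, ∀ t ∈ Ioo u v, HasDerivAt (f j k) (f' j k t) t)
    (hf0 : ∀ j, ∀ t, 0 ≤ f j j t) (hfH : ∀ j, ∀ t ∈ Icc u v, f j j t + 1 ≤ H)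
    (hf1 : ∀ j k t, |f j k t| *
      Real.exp (-((Real.log (f j j t + 1) + Real.log (f k k t + 1)) / 2)) ≤ 1)
    (hsign : ∀ j k, ∃ ε : ℝ, |ε| ≤ 1 ∧ ∀ t ∈ Ioo u v, ε * f' j k t = |f' j k t|)
    (hbound : ∀ t ∈ Ioo u v, |E' t| ≤ K * (1 + ∑ j, ∑ k, |f' j k t| *
      Real.exp (-((Real.log (f j j t + 1) + Real.log (f k k t + 1)) / 2))) * E t) :
    E v ≤ Real.exp (K * (v - u + m ^ 2 * (2 + Real.log H))) * E u ∧
      E u ≤ Real.exp (K * (v - u + m ^ 2 * (2 + Real.log H))) * E v := by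
  choose ε hε1 hε using hsign
  let g : Fin m → ℝ → ℝ := fun j t => Real.log (f j j t + 1)
  let g' : Fin m → ℝ → ℝ := fun j t => f' j j t / (f j j t + 1)
  have hg : ∀ j, ∀ t ∈ Ioo u v, HasDerivAt (g j) (g' j t) t := fun j t ht =>
    ((hf j j t ht).add_const 1).log (by linarith [hf0 j t] : (0 : ℝ) < f j j t + 1).ne'
  have hgc : ∀ j, ContinuousOn (g j) (Icc u v) := fun j =>
    ((hfc j j).add continuousOn_const).log fun t _ =>
      (by linarith [hf0 j t] : (0 : ℝ) < f j j t + 1).ne'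
  have hg0 : ∀ j t, 0 ≤ g j t := fun j t => Real.log_nonneg (by linarith [hf0 j t])
  have hgH : ∀ j, ∀ t ∈ Icc u v, g j t ≤ Real.log H := fun j t ht =>
    Real.log_le_log (by have := hf0 j t; positivity) (hfH j t ht)
  have hεg : ∀ j, ∀ t ∈ Ioo u v, ε j j * g' j t = |g' j t| := by
    intro j t ht
    have h0 : 0 < f j j t + 1 := by have := hf0 j t; positivity
    simp only [g']
    rw [abs_div, abs_of_pos h0, ← hε j j t ht]
    ring
  let L : Fin m → Fin m → ℝ → ℝ := fun j k t => (g j t + g k t) / 2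
  let L' : Fin m → Fin m → ℝ → ℝ := fun j k t => (g' j t + g' k t) / 2
  have hL : ∀ j k, ∀ t ∈ Ioo u v, HasDerivAt (L j k) (L' j k t) t := fun j k t ht =>
    ((hg j t ht).fun_add (hg k t ht)).div_const 2
  have hLc : ∀ j k, ContinuousOn (L j k) (Icc u v) := fun j k =>
    ((hgc j).add (hgc k)).div_const 2
  -- `ψ j k` is almost a primitive of `|f'| exp (-L) = ε f' exp (-L)`. Integrating by parts leaves
  -- the error `ε f exp (-L) L'`, at most `|L'|` by `hf1`. The second summand of `ψ` is a primitive
  -- of the larger quantity `(|g' j| + |g' k|) / 2`, so `ψ'` dominates.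
  let ψ : Fin m → Fin m → ℝ → ℝ := fun j k t =>
    ε j k * (f j k t * Real.exp (-L j k t)) + (ε j j * g j t + ε k k * g k t) / 2
  let ψ' : Fin m → Fin m → ℝ → ℝ := fun j k t =>
    ε j k * (f' j k t * Real.exp (-L j k t) + f j k t * (Real.exp (-L j k t) * -L' j k t)) +
      (ε j j * g' j t + ε k k * g' k t) / 2
  have hψ : ∀ j k, ∀ t ∈ Ioo u v, HasDerivAt (ψ j k) (ψ' j k t) t := fun j k t ht =>
    (((hf j k t ht).fun_mul ((hL j k t ht).fun_neg.exp)).const_mul _).fun_add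
      ((((hg j t ht).const_mul _).fun_add ((hg k t ht).const_mul _)).div_const 2)
  have hψc : ∀ j k, ContinuousOn (ψ j k) (Icc u v) := fun j k =>
    (continuousOn_const.mul ((hfc j k).mul (hLc j k).neg.rexp)).add
      (((continuousOn_const.mul (hgc j)).add (continuousOn_const.mul (hgc k))).div_const 2)
  have hψ'le : ∀ j k, ∀ t ∈ Ioo u v, |f' j k t| * Real.exp (-L j k t) ≤ ψ' j k t := by
    intro j k t ht
    have h1 : ψ' j k t = |f' j k t| * Real.exp (-L j k t) -
        (ε j k * (f j k t * Real.exp (-L j k t))) * L' j k t + (|g' j t| + |g' k t|) / 2 := by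
      simp only [ψ']
      rw [← hε j k t ht, ← hεg j t ht, ← hεg k t ht]
      ring
    have h2 : |(ε j k * (f j k t * Real.exp (-L j k t))) * L' j k t| ≤
        (|g' j t| + |g' k t|) / 2 := by
      rw [abs_mul, abs_mul, abs_mul, abs_of_pos (Real.exp_pos _)]
      have h3 : |L' j k t| ≤ (|g' j t| + |g' k t|) / 2 := by
        simp only [L']
        rw [abs_div, abs_two]
        gcongr
        exact abs_add_le _ _
      have h4 : |ε j k| * (|f j k t| * Real.exp (-L j k t)) ≤ 1 := by
        have h5 := hf1 j k t
        have h6 : 0 ≤ |f j k t| * Real.exp (-L j k t) := by positivity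
        calc _ ≤ 1 * (|f j k t| * Real.exp (-L j k t)) := by gcongr; exact hε1 j k
          _ ≤ 1 := by rw [one_mul]; exact h5
      calc _ ≤ 1 * ((|g' j t| + |g' k t|) / 2) := by gcongr
        _ = _ := one_mul _
    rw [h1]
    linarith [(abs_le.1 h2).2]
  -- The first summand of `ψ` stays in `[-1, 1]` and the logarithms in `[0, log H]`: the total
  -- increase is logarithmic in the size of the weights.
  have hψd : ∀ j k, ψ j k v - ψ j k u ≤ 2 + Real.log H := by
    intro j k
    have hu : u ∈ Icc u v := ⟨le_rfl, huv⟩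
    have hv : v ∈ Icc u v := ⟨huv, le_rfl⟩
    have h1 : ∀ t, |ε j k * (f j k t * Real.exp (-L j k t))| ≤ 1 := by
      intro t
      rw [abs_mul, abs_mul, abs_of_pos (Real.exp_pos _)]
      have h5 := hf1 j k t
      have h6 : 0 ≤ |f j k t| * Real.exp (-L j k t) := by positivity
      calc _ ≤ 1 * (|f j k t| * Real.exp (-L j k t)) := by gcongr; exact hε1 j k
        _ ≤ 1 := by rw [one_mul]; exact h5
    have h2 : ∀ j, ε j j * g j v - ε j j * g j u ≤ Real.log H := by
      intro j
      rw [← mul_sub]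
      have h3 : |g j v - g j u| ≤ Real.log H := by
        rw [abs_le]
        constructor <;> linarith [hg0 j u, hg0 j v, hgH j u hu, hgH j v hv]
      calc ε j j * (g j v - g j u) ≤ |ε j j * (g j v - g j u)| := le_abs_self _
        _ = |ε j j| * |g j v - g j u| := abs_mul _ _
        _ ≤ 1 * Real.log H := by gcongr; exact hε1 j j
        _ = _ := one_mul _
    simp only [ψ]
    linarith [(abs_le.1 (h1 v)).2, (abs_le.1 (h1 u)).1, h2 j, h2 k]
  let Φ : ℝ → ℝ := fun t => K * (t + ∑ j, ∑ k, ψ j k t)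
  have hmain := le_mul_exp_of_abs_deriv_le huv (E := E) (E' := E') (Φ := Φ)
    (Φ' := fun t => K * (1 + ∑ j, ∑ k, ψ' j k t)) hEc
    (continuousOn_const.mul (continuousOn_id.add
      (continuousOn_finsetSum _ fun j _ => continuousOn_finsetSum _ fun k _ => hψc j k)))
    hE
    (fun t ht => ((hasDerivAt_id t).fun_add
      (HasDerivAt.fun_sum fun j _ => HasDerivAt.fun_sum fun k _ => hψ j k t ht)).const_mul K)
    (fun t ht => (hbound t ht).trans (by
      have := hE0 t
      gcongr with j _ k _
      exact hψ'le j k t ht))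
  have hΦ : Φ v - Φ u ≤ K * (v - u + m ^ 2 * (2 + Real.log H)) := by
    have h1 : ∑ j, ∑ k, (ψ j k v - ψ j k u) ≤ m ^ 2 * (2 + Real.log H) := by
      calc ∑ j, ∑ k, (ψ j k v - ψ j k u) ≤ ∑ _j : Fin m, ∑ _k : Fin m, (2 + Real.log H) :=
            Finset.sum_le_sum fun j _ => Finset.sum_le_sum fun k _ => hψd j k
        _ = _ := by simp; ring
    simp only [Finset.sum_sub_distrib] at h1
    simp only [Φ]
    nlinarith
  have hexp := Real.exp_le_exp.2 hΦ
  constructor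
  · rw [mul_comm]
    exact hmain.1.trans (mul_le_mul_of_nonneg_left hexp (hE0 u))
  · rw [mul_comm]
    exact hmain.2.trans (mul_le_mul_of_nonneg_left hexp (hE0 v))

end IntervalEstimate

/-- The full symbol at complex frequencies. -/
def fullSymbolC {n : ℕ} (a : ℕ → (Fin n → ℕ) → ℝ → ℂ) (k : ℕ) (t : ℝ) (ζ : Fin n → ℂ) : ℂ :=
  ∑ d ∈ Finset.range (k + 1), ∑ γ ∈ multiIndices n d, a k γ t * ∏ i, ζ i ^ γ i

theorem fullSymbol_eq_fullSymbolC {n : ℕ} (a : ℕ → (Fin n → ℕ) → ℝ → ℂ) (k : ℕ) (t : ℝ)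
    (ξ : Rn n) : fullSymbol a k t ξ = fullSymbolC a k t fun i => (ξ i : ℂ) := rfl

/-- Complex frequencies are admitted because the growth off the real space determines the
exponential type of the fundamental matrix. -/
theorem exists_fullSymbolC_bound {n m : ℕ} {T : ℝ} {a : ℕ → (Fin n → ℕ) → ℝ → ℂ}
    (hcont : ∀ k ∈ Finset.Icc 1 m, ∀ γ : Fin n → ℕ, ∑ i, γ i ≤ k →
      ContinuousOn (a k γ) (Icc 0 T)) :
    ∃ C : ℝ, 0 ≤ C ∧ ∀ k ∈ Finset.Icc 1 m, ∀ t ∈ Icc (0 : ℝ) T, ∀ ζ : Fin n → ℂ,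
      ‖fullSymbolC a k t ζ‖ ≤ C * (1 + ‖ζ‖) ^ k := by
  have hB : ∀ k (γ : Fin n → ℕ), ∃ B : ℝ, 0 ≤ B ∧ (k ∈ Finset.Icc 1 m → ∑ i, γ i ≤ k →
      ∀ t ∈ Icc (0 : ℝ) T, ‖a k γ t‖ ≤ B) := by
    intro k γ
    by_cases h : k ∈ Finset.Icc 1 m ∧ ∑ i, γ i ≤ k
    · obtain ⟨B, hB⟩ := isCompact_Icc.exists_bound_of_continuousOn (hcont k h.1 γ h.2)
      exact ⟨|B|, abs_nonneg _, fun _ _ t ht => (hB t ht).trans (le_abs_self _)⟩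
    · exact ⟨0, le_rfl, fun h1 h2 => absurd ⟨h1, h2⟩ h⟩
  choose B hB0 hB using hB
  have hS0 : ∀ k, 0 ≤ ∑ d ∈ Finset.range (k + 1), ∑ γ ∈ multiIndices n d, B k γ := fun k =>
    Finset.sum_nonneg fun d _ => Finset.sum_nonneg fun γ _ => hB0 k γ
  refine ⟨∑ k ∈ Finset.Icc 1 m, ∑ d ∈ Finset.range (k + 1), ∑ γ ∈ multiIndices n d, B k γ,
    Finset.sum_nonneg fun k _ => hS0 k, fun k hk t ht ζ => ?_⟩
  have hζ : 1 ≤ 1 + ‖ζ‖ := by linarith [norm_nonneg ζ]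
  calc ‖fullSymbolC a k t ζ‖
      ≤ ∑ d ∈ Finset.range (k + 1), ∑ γ ∈ multiIndices n d, B k γ * (1 + ‖ζ‖) ^ k := by
        refine (norm_sum_le _ _).trans (Finset.sum_le_sum fun d hd => ?_)
        refine (norm_sum_le _ _).trans (Finset.sum_le_sum fun γ hγ => ?_)
        have hγd := mem_multiIndices.1 hγ
        have hdk : d ≤ k := by have := Finset.mem_range.1 hd; omega
        rw [norm_mul, norm_prod]
        have h1 : ∏ i, ‖ζ i ^ γ i‖ ≤ (1 + ‖ζ‖) ^ k := by
          calc ∏ i, ‖ζ i ^ γ i‖ ≤ ∏ i, (1 + ‖ζ‖) ^ γ i := by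
                refine Finset.prod_le_prod (fun _ _ => norm_nonneg _) fun i _ => ?_
                rw [norm_pow]
                gcongr
                linarith [norm_le_pi_norm ζ i]
            _ = (1 + ‖ζ‖) ^ ∑ i, γ i := Finset.prod_pow_eq_pow_sum _ _ _
            _ ≤ _ := pow_le_pow_right₀ hζ (by omega)
        exact mul_le_mul (hB k γ hk (by omega) t ht) h1
          (Finset.prod_nonneg fun _ _ => norm_nonneg _) (hB0 k γ)
    _ = (∑ d ∈ Finset.range (k + 1), ∑ γ ∈ multiIndices n d, B k γ) * (1 + ‖ζ‖) ^ k := by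
        simp only [Finset.sum_mul]
    _ ≤ _ := by
        gcongr
        exact Finset.single_le_sum (f := fun k =>
          ∑ d ∈ Finset.range (k + 1), ∑ γ ∈ multiIndices n d, B k γ) (fun k _ => hS0 k) hk

theorem norm_ofReal_comp_le {n : ℕ} (ξ : Rn n) : ‖fun i => (ξ i : ℂ)‖ ≤ ‖ξ‖ := by
  refine (pi_norm_le_iff_of_nonneg (norm_nonneg _)).2 fun i => ?_
  rw [Complex.norm_real]
  exact abs_coord_le ξ i

/-- `U` solves the first order system for `U_q = D_t^q û` at the frequency `ξ`. -/
def IsMode {n : ℕ} (m : ℕ) (T : ℝ) (a : ℕ → (Fin n → ℕ) → ℝ → ℂ) (ξ : Rn n)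
    (U : ℝ → Fin m → ℂ) : Prop :=
  ∀ t ∈ Icc (0 : ℝ) T, HasDerivWithinAt U
    (Complex.I • (companion fun q : Fin m => fullSymbol a (m - q) t ξ).mulVec (U t)) (Icc 0 T) t

theorem exists_common_poly_bound {n : ℕ} {ι : Type*} [Fintype ι] {T : ℝ}
    {f : ι → ℝ → Rn n → ℝ} (hf : ∀ i, IsSeparatedAnalytic T (f i)) :
    ∃ (C : ℝ) (k : ℕ), 1 ≤ C ∧ ∀ i, ∀ t ∈ Icc (0 : ℝ) T, ∀ ξ, |f i t ξ| ≤ C * (1 + ‖ξ‖) ^ k := by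
  choose C k hC hk using fun i => (hf i).bounded
  have h0 : 0 ≤ ∑ i, C i := Finset.sum_nonneg fun i _ => hC i
  refine ⟨1 + ∑ i, C i, ∑ i, k i, by linarith, fun i t ht ξ => (hk i t ht ξ).trans ?_⟩
  have hξ : 1 ≤ 1 + ‖ξ‖ := by linarith [norm_nonneg ξ]
  have h1 : C i ≤ 1 + ∑ i, C i := by
    have := Finset.single_le_sum (f := C) (fun i _ => hC i) (Finset.mem_univ i)
    linarith
  have h2 : (1 + ‖ξ‖) ^ k i ≤ (1 + ‖ξ‖) ^ ∑ i, k i := pow_le_pow_right₀ hξ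
    (Finset.single_le_sum (f := k) (fun _ _ => Nat.zero_le _) (Finset.mem_univ i))
  exact mul_le_mul h1 h2 (by positivity) (by linarith)

set_option maxHeartbeats 1000000 in
/-- Modes of high frequency grow polynomially. -/
theorem mode_bound_high {n m : ℕ} {T : ℝ} (hT : 0 < T)
    {a : ℕ → (Fin n → ℕ) → ℝ → ℂ}
    (hanalytic : ∀ k ∈ Finset.Icc 1 m, ∀ γ : Fin n → ℕ, ∑ i, γ i = k →
      AnalyticOn ℝ (a k γ) (Icc 0 T))
    {lam : Fin m → ℝ → Rn n → ℝ} (hroots : AreCharacteristicRoots m T a lam)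
    (hLC : RootCondition m T lam) {C R : ℝ} (hC : 0 < C)
    (hLevi : ∀ t ∈ Icc (0 : ℝ) T, ∀ j ∈ Finset.Icc 1 m, ∀ ξ : Rn n, R ≤ ‖ξ‖ →
      ‖fullSymbol a (m - j + 1) t ξ - principalSymbol a (m - j + 1) t ξ‖ ≤
        C * ∑ i : Fin m,
          |∑ s ∈ Finset.powersetCard (m - j) (Finset.univ.erase i), ∏ l ∈ s, lam l t ξ|) :
    ∃ (κ : ℕ) (A : ℝ), 1 ≤ A ∧ ∀ ξ : Rn n, R ≤ ‖ξ‖ → ∀ U : ℝ → Fin m → ℂ, IsMode m T a ξ U →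
      ∀ s ∈ Icc (0 : ℝ) T, ∀ t ∈ Icc (0 : ℝ) T,
        ‖U t‖ ≤ A * (1 + ‖ξ‖) ^ κ * ‖U s‖ := by
  obtain ⟨M, hM0, hM⟩ := hLC
  have hsep := fun j k => isSeparatedAnalytic_symmetriser hT hanalytic hroots j k
  choose f' N hf' hf'c hN using fun j k => (hsep j k).exists_deriv
  obtain ⟨C₁, k₁, hC₁, hb₁⟩ := exists_common_poly_bound (ι := Fin m × Fin m)
    (f := fun p t ξ => symmetriser (fun l => lam l t ξ) p.1 p.2) (fun p => hsep p.1 p.2)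
  set K := (1 + 2 * m) * (2 * m ^ 2 * diagConst m M ^ 2 + 1 + C * m ^ 2 * diagConst m M) with hK
  have hd0 := diagConst_nonneg m M
  have hK0 : 0 ≤ K := by positivity
  set K₁ := 2 * m ^ 2 * diagConst m M ^ 2 + 1 with hK₁
  have hK₁1 : 1 ≤ K₁ := by rw [hK₁]; nlinarith [sq_nonneg ((m : ℝ) * diagConst m M)]
  -- An integer exponent above `K m ^ 2`: the factor `exp (K m ^ 2 log H)` then becomes at most `H ^
  -- N₀`, polynomial in the frequency.
  set N₀ := ⌈K * m ^ 2⌉₊ with hN₀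
  set Nz := ∑ j, ∑ k, N j k with hNz
  -- `B * ρ ^ (k₁ * N₀)` is the growth factor for one interval of monotonicity; `2 * C₁` comes from
  -- `H = 2 * C₁ * ρ ^ k₁`, a bound for the diagonal entries plus one.
  set B := Real.exp (K * (T + m ^ 2 * 2)) * (2 * C₁) ^ N₀ with hB
  have hB1 : 1 ≤ B := by
    have h1 : 1 ≤ Real.exp (K * (T + m ^ 2 * 2)) := Real.one_le_exp (by positivity)
    have h2 : 1 ≤ (2 * C₁) ^ N₀ := one_le_pow₀ (by linarith)
    nlinarith
  have hA1 : 1 ≤ K₁ * (B ^ (Nz + 1) * ((m ^ 2 * C₁ + m) + 1)) := by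
    have h1 : 1 ≤ B ^ (Nz + 1) := one_le_pow₀ hB1
    have h2 : (1 : ℝ) ≤ (m ^ 2 * C₁ + m) + 1 := by
      have : (0 : ℝ) ≤ m ^ 2 * C₁ + m := by positivity
      linarith
    have h3 : 1 ≤ B ^ (Nz + 1) * ((m ^ 2 * C₁ + m) + 1) := one_le_mul_of_one_le_of_one_le h1 h2
    exact one_le_mul_of_one_le_of_one_le hK₁1 h3
  refine ⟨k₁ * N₀ * (Nz + 1) + k₁, K₁ * (B ^ (Nz + 1) * ((m ^ 2 * C₁ + m) + 1)), hA1,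
    fun ξ hξ U hU s hs t ht => ?_⟩
  set ρ := 1 + ‖ξ‖ with hρ
  have hρ1 : 1 ≤ ρ := by linarith [norm_nonneg ξ]
  let lt : ℝ → Fin m → ℝ := fun t l => lam l t ξ
  let f : Fin m → Fin m → ℝ → ℝ := fun j k t => symmetriser (lt t) j k
  have hfb : ∀ j k, ∀ t ∈ Icc (0 : ℝ) T, |f j k t| ≤ C₁ * ρ ^ k₁ := fun j k t ht =>
    hb₁ (j, k) t ht ξ
  have hfd : ∀ j k, ∀ t ∈ Icc (0 : ℝ) T, HasDerivWithinAt (f j k) (f' j k t ξ) (Icc 0 T) t :=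
    fun j k t ht => hf' j k t ht ξ
  let E : ℝ → ℝ := fun t => modeEnergy (lt t) (U t)
  let b : ℝ → Fin m → ℂ := fun t q => fullSymbol a (m - q) t ξ - principalSymbol a (m - q) t ξ
  let Y : ℝ → Fin m → ℂ := fun t =>
    Complex.I • (companion fun q : Fin m => fullSymbol a (m - q) t ξ).mulVec (U t)
  have hYeq : ∀ t ∈ Icc (0 : ℝ) T, Y t = Complex.I • (companion fun q : Fin m =>
      (((∏ l, (Polynomial.X - Polynomial.C (lt t l))).coeff q : ℝ) : ℂ) + b t q).mulVec (U t) := by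
    intro t ht
    have : (fun q : Fin m => fullSymbol a (m - q) t ξ) = fun q : Fin m =>
        (((∏ l, (Polynomial.X - Polynomial.C (lt t l))).coeff q : ℝ) : ℂ) + b t q := by
      funext q
      have h1 := principalSymbol_eq_coeff hroots ht ξ q.2
      simp only [b, lt]
      rw [← h1]
      ring
    simp only [Y, this]
  have hbL : ∀ t ∈ Icc (0 : ℝ) T, ∀ q : Fin m,
      ‖b t q‖ ≤ C * ∑ i, |(reducedPoly (lt t) i).coeff q| := by
    intro t ht q
    have hq := q.2
    -- The index `j` of the Levi conditions starts at one, that of the coefficients at zero.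
    have h1 := hLevi t ht ((q : ℕ) + 1) (by simp) ξ hξ
    rw [show m - ((q : ℕ) + 1) + 1 = m - q by omega,
      show m - ((q : ℕ) + 1) = m - 1 - q by omega] at h1
    refine h1.trans (le_of_eq ?_)
    congr 1
    refine Finset.sum_congr rfl fun i _ => ?_
    rw [reducedPoly_coeff, abs_mul, abs_pow, abs_neg, abs_one, one_pow, one_mul]
  let E' : ℝ → ℝ := fun t =>
    (∑ j, ∑ k, (f' j k t ξ * (U t j * (starRingEnd ℂ) (U t k)).re +
        symmetriser (lt t) j k *
          ((Y t j * (starRingEnd ℂ) (U t k)).re + (Y t k * (starRingEnd ℂ) (U t j)).re))) +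
      ∑ j : Fin m, if (j : ℕ) + 1 < m then 2 * (Y t j * (starRingEnd ℂ) (U t j)).re else 0
  have hUc : ContinuousOn U (Icc 0 T) := fun t ht => (hU t ht).continuousWithinAt
  have hUqc : ∀ q, ContinuousOn (fun t => U t q) (Icc 0 T) := fun q =>
    (continuous_apply q).comp_continuousOn hUc
  have hfc : ∀ j k, ContinuousOn (f j k) (Icc 0 T) := fun j k t ht =>
    (hfd j k t ht).continuousWithinAt
  have hEeq : E = fun t => (∑ j, ∑ k, f j k t * (U t j * (starRingEnd ℂ) (U t k)).re) +
      ∑ j : Fin m, if (j : ℕ) + 1 < m then Complex.normSq (U t j) else 0 := by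
    funext t
    exact modeEnergy_eq (lt t) (U t)
  have hEc : ContinuousOn E (Icc 0 T) := by
    rw [hEeq]
    refine ContinuousOn.add (continuousOn_finsetSum _ fun j _ => continuousOn_finsetSum _ fun k _ =>
      (hfc j k).mul ?_) (continuousOn_finsetSum _ fun j _ => ?_)
    · exact Complex.continuous_re.comp_continuousOn
        ((hUqc j).mul (Complex.continuous_conj.comp_continuousOn (hUqc k)))
    · split_ifs
      · exact Complex.continuous_normSq.comp_continuousOn (hUqc j)
      · exact continuousOn_const
  have hEd : ∀ t ∈ Ioo (0 : ℝ) T, HasDerivAt E (E' t) t := by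
    intro t ht
    have hn : Icc (0 : ℝ) T ∈ 𝓝 t := Icc_mem_nhds ht.1 ht.2
    have ht' := Ioo_subset_Icc_self ht
    have hUd : ∀ q, HasDerivAt (fun t => U t q) (Y t q) t := fun q =>
      (hasDerivAt_pi.1 ((hU t ht').hasDerivAt hn)) q
    rw [hEeq]
    refine HasDerivAt.fun_add (HasDerivAt.fun_sum fun j _ => HasDerivAt.fun_sum fun k _ => ?_)
      (HasDerivAt.fun_sum fun j _ => ?_)
    · have h1 : HasDerivAt (fun t => (U t j * (starRingEnd ℂ) (U t k)).re)
          ((Y t j * (starRingEnd ℂ) (U t k)).re + (Y t k * (starRingEnd ℂ) (U t j)).re) t := by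
        have h2 : HasDerivAt (fun t => (starRingEnd ℂ) (U t k)) ((starRingEnd ℂ) (Y t k)) t :=
          (hUd k).star
        have h3 := Complex.reCLM.hasFDerivAt.comp_hasDerivAt t ((hUd j).fun_mul h2)
        refine h3.congr_deriv ?_
        simp
        ring
      exact ((hfd j k t ht').hasDerivAt hn).fun_mul h1
    · split_ifs
      · exact hasDerivAt_normSq (hUd j)
      · exact hasDerivAt_const _ _
  have hE0 : ∀ t, 0 ≤ E t := fun t => modeEnergy_nonneg _ _
  have hMt : ∀ t ∈ Icc (0 : ℝ) T, ∀ i j, i ≠ j →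
      lt t i ^ 2 + lt t j ^ 2 ≤ M * (lt t i - lt t j) ^ 2 := fun t ht i j hij => hM i j hij t ht ξ
  have hE'b : ∀ t ∈ Icc (0 : ℝ) T, |E' t| ≤ K * (1 + ∑ j, ∑ k, |f' j k t ξ| *
      Real.exp (-logWeight (lt t) j k)) * E t := fun t ht =>
    abs_energy_derivative_le hM0.le hC.le (lt t) (hMt t ht) (b t) (hbL t ht)
      (fun j k => f' j k t ξ) (U t) (Y t) (hYeq t ht)
  -- An entry that is constant in time needs no cutting points, so its exceptional set is empty.
  have hZ : ∀ j k, ∃ Z : Finset ℝ, Z.card ≤ N j k ∧ ((∀ t ∈ Icc (0 : ℝ) T, f' j k t ξ = 0) ∨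
      ∀ t ∈ Icc (0 : ℝ) T, f' j k t ξ = 0 → t ∈ Z) := by
    intro j k
    rcases hN j k ξ with h | ⟨Z, hZ, h⟩
    · exact ⟨∅, by simp, Or.inl h⟩
    · exact ⟨Z, hZ, Or.inr h⟩
  choose Z hZc hZ using hZ
  let Zall : Finset ℝ := Finset.univ.biUnion fun j => Finset.univ.biUnion fun k => Z j k
  have hZall : Zall.card ≤ Nz := by
    refine Finset.card_biUnion_le.trans (Finset.sum_le_sum fun j _ => ?_)
    exact Finset.card_biUnion_le.trans (Finset.sum_le_sum fun k _ => hZc j k)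
  have hH1 : 1 ≤ C₁ * ρ ^ k₁ := one_le_mul_of_one_le_of_one_le hC₁ (one_le_pow₀ hρ1)
  set H := 2 * C₁ * ρ ^ k₁ with hH
  have hH2 : 1 ≤ H := by rw [hH]; linarith
  -- Between consecutive points of `Zall` each derivative `f' j k` vanishes identically or not at
  -- all, so it has a constant sign.
  have hstep : ∀ u v, 0 ≤ u → u ≤ v → v ≤ T → (∀ z ∈ Zall, z ∉ Ioo u v) →
      E v ≤ (B * ρ ^ (k₁ * N₀)) * E u ∧ E u ≤ (B * ρ ^ (k₁ * N₀)) * E v := by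
    intro u v hu huv hv hno
    have hsub : Icc u v ⊆ Icc 0 T := Icc_subset_Icc hu hv
    have hsub' : Ioo u v ⊆ Ioo 0 T := Ioo_subset_Ioo hu hv
    have hgrow := energy_growth_of_monotone_weights (m := m) (H := H) huv hK0 (E := E) (E' := E')
      (f := f) (f' := fun j k t => f' j k t ξ) hE0 (hEc.mono hsub)
      (fun t ht => hEd t (hsub' ht)) (fun j k => (hfc j k).mono hsub)
      (fun j k t ht => (hfd j k t (hsub (Ioo_subset_Icc_self ht))).hasDerivAt
        (Icc_mem_nhds (hsub' ht).1 (hsub' ht).2))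
      (fun j t => symmetriser_self_nonneg (lt t) j)
      (fun j t ht => by
        have := (le_abs_self _).trans (hfb j j t (hsub ht))
        rw [hH]; linarith)
      (fun j k t => abs_symmetriser_mul_exp_le (lt t) j k)
      (fun j k => exists_sign_of_forall_ne_zero
        (((hf'c j k ξ).mono hsub).mono Ioo_subset_Icc_self) (by
          rcases hZ j k with h | h
          · exact Or.inl fun t ht => h t (hsub (Ioo_subset_Icc_self ht))
          · refine Or.inr fun t ht h0 => hno t ?_ ht
            exact Finset.mem_biUnion.2 ⟨j, Finset.mem_univ _, Finset.mem_biUnion.2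
              ⟨k, Finset.mem_univ _, h t (hsub (Ioo_subset_Icc_self ht)) h0⟩⟩))
      (fun t ht => hE'b t (hsub (Ioo_subset_Icc_self ht)))
    have hexp : Real.exp (K * (v - u + m ^ 2 * (2 + Real.log H))) ≤ B * ρ ^ (k₁ * N₀) := by
      have hlog : 0 ≤ Real.log H := Real.log_nonneg hH2
      have h1 : K * (v - u + m ^ 2 * (2 + Real.log H)) ≤
          K * (T + m ^ 2 * 2) + N₀ * Real.log H := by
        have h2 : K * m ^ 2 ≤ N₀ := Nat.le_ceil _
        have h3 : K * (v - u) ≤ K * T := by gcongr; linarith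
        nlinarith [mul_le_mul_of_nonneg_right h2 hlog]
      refine (Real.exp_le_exp.2 h1).trans (le_of_eq ?_)
      rw [Real.exp_add, Real.exp_nat_mul, Real.exp_log (by linarith), hB, hH, mul_pow _ (ρ ^ k₁),
        pow_mul]
      ring
    exact ⟨hgrow.1.trans (mul_le_mul_of_nonneg_right hexp (hE0 u)),
      hgrow.2.trans (mul_le_mul_of_nonneg_right hexp (hE0 v))⟩
  have hκ1 : 1 ≤ B * ρ ^ (k₁ * N₀) := one_le_mul_of_one_le_of_one_le hB1 (one_le_pow₀ hρ1)
  have hchain := le_pow_mul_of_chain hκ1 hE0 Zall hstep Nz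
  have hEst : E t ≤ (B * ρ ^ (k₁ * N₀)) ^ (Nz + 1) * E s := by
    rcases le_total s t with h | h
    · exact (hchain s t hs.1 h ht.2 ((Finset.card_filter_le _ _).trans hZall)).1
    · exact (hchain t s ht.1 h hs.2 ((Finset.card_filter_le _ _).trans hZall)).2
  have hlow : ∀ q, ‖U t q‖ ^ 2 ≤ K₁ * E t := by
    intro q
    have h1 := weight_mul_normSq_le hM0.le (lt t) (hMt t ht) (U t) q
    have h2 := mul_nonneg (symmetriser_self_nonneg (lt t) q) (sq_nonneg ‖U t q‖)
    linarith
  have hup : E s ≤ ((m ^ 2 * C₁ + m) + 1) * ρ ^ k₁ * ‖U s‖ ^ 2 := by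
    rw [hEeq]
    have h1 : ∀ j k, f j k s * (U s j * (starRingEnd ℂ) (U s k)).re ≤
        C₁ * ρ ^ k₁ * ‖U s‖ ^ 2 := by
      intro j k
      calc _ ≤ |f j k s * (U s j * (starRingEnd ℂ) (U s k)).re| := le_abs_self _
        _ = |f j k s| * |(U s j * (starRingEnd ℂ) (U s k)).re| := abs_mul _ _
        _ ≤ (C₁ * ρ ^ k₁) * (‖U s‖ * ‖U s‖) := by
            refine mul_le_mul (hfb j k s hs) ?_ (abs_nonneg _) (by positivity)
            refine (abs_re_mul_conj_le _ _).trans ?_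
            gcongr
            · exact norm_le_pi_norm (U s) j
            · exact norm_le_pi_norm (U s) k
        _ = _ := by ring
    have h2 : ∀ j : Fin m, (if (j : ℕ) + 1 < m then Complex.normSq (U s j) else 0) ≤
        ρ ^ k₁ * ‖U s‖ ^ 2 := by
      intro j
      have h3 : 1 ≤ ρ ^ k₁ := one_le_pow₀ hρ1
      split_ifs
      · rw [Complex.normSq_eq_norm_sq]
        have h4 : ‖U s j‖ ^ 2 ≤ ‖U s‖ ^ 2 := by gcongr; exact norm_le_pi_norm (U s) j
        nlinarith [sq_nonneg ‖U s‖]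
      · positivity
    calc _ ≤ (∑ _j : Fin m, ∑ _k : Fin m, C₁ * ρ ^ k₁ * ‖U s‖ ^ 2) +
          ∑ _j : Fin m, ρ ^ k₁ * ‖U s‖ ^ 2 :=
          add_le_add (Finset.sum_le_sum fun j _ => Finset.sum_le_sum fun k _ => h1 j k)
            (Finset.sum_le_sum fun j _ => h2 j)
      _ = (m ^ 2 * C₁ + m) * (ρ ^ k₁ * ‖U s‖ ^ 2) := by simp; ring
      _ ≤ ((m ^ 2 * C₁ + m) + 1) * (ρ ^ k₁ * ‖U s‖ ^ 2) :=
          mul_le_mul_of_nonneg_right (by linarith) (by positivity)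
      _ = _ := by ring
  set A := K₁ * (B ^ (Nz + 1) * ((m ^ 2 * C₁ + m) + 1)) with hA
  set κ := k₁ * N₀ * (Nz + 1) + k₁ with hκ
  -- Since this factor is at least one, it may be replaced by its square, and the square root can be
  -- taken at the end without new constants.
  have hAρ : 1 ≤ A * ρ ^ κ := one_le_mul_of_one_le_of_one_le hA1 (one_le_pow₀ hρ1)
  refine (pi_norm_le_iff_of_nonneg (by positivity)).2 fun q => ?_
  have hfin : ‖U t q‖ ^ 2 ≤ (A * ρ ^ κ * ‖U s‖) ^ 2 := by
    calc ‖U t q‖ ^ 2 ≤ K₁ * E t := hlow q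
      _ ≤ K₁ * ((B * ρ ^ (k₁ * N₀)) ^ (Nz + 1) *
          (((m ^ 2 * C₁ + m) + 1) * ρ ^ k₁ * ‖U s‖ ^ 2)) := by
          gcongr
          exact hEst.trans (mul_le_mul_of_nonneg_left hup (by positivity))
      _ = A * ρ ^ κ * ‖U s‖ ^ 2 := by
          rw [hA, hκ, mul_pow, ← pow_mul, pow_add]
          ring
      _ ≤ (A * ρ ^ κ) * (A * ρ ^ κ) * ‖U s‖ ^ 2 := by
          exact mul_le_mul_of_nonneg_right (by nlinarith) (sq_nonneg _)
      _ = _ := by ring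
  exact le_of_sq_le_sq hfin (by positivity)

/-- All modes grow polynomially in the frequency, forward and backward in time. -/
theorem mode_bound {n m : ℕ} {T : ℝ} (hT : 0 < T)
    {a : ℕ → (Fin n → ℕ) → ℝ → ℂ}
    (hcont : ∀ k ∈ Finset.Icc 1 m, ∀ γ : Fin n → ℕ, ∑ i, γ i ≤ k →
      ContinuousOn (a k γ) (Icc 0 T))
    (hanalytic : ∀ k ∈ Finset.Icc 1 m, ∀ γ : Fin n → ℕ, ∑ i, γ i = k →
      AnalyticOn ℝ (a k γ) (Icc 0 T))
    {lam : Fin m → ℝ → Rn n → ℝ} (hroots : AreCharacteristicRoots m T a lam)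
    (hLC : RootCondition m T lam) (hLevi : LeviCondition m T a lam) :
    ∃ (κ : ℕ) (A : ℝ), 1 ≤ A ∧ ∀ ξ : Rn n, ∀ U : ℝ → Fin m → ℂ, IsMode m T a ξ U →
      ∀ s ∈ Icc (0 : ℝ) T, ∀ t ∈ Icc (0 : ℝ) T,
        ‖U t‖ ≤ A * (1 + ‖ξ‖) ^ κ * ‖U s‖ := by
  obtain ⟨C, hC, R, hR, hLevi⟩ := hLevi
  obtain ⟨κ, A, hA, hhigh⟩ := mode_bound_high hT hanalytic hroots hLC hC hLevi
  obtain ⟨C₀, hC₀, hsym⟩ := exists_fullSymbolC_bound hcont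
  -- Frequencies below `R` lie outside the Levi conditions, but they are bounded, so the crude
  -- exponential estimate gives a constant.
  set A' := (m : ℝ) * (1 + R) ^ m * Real.exp ((1 + R) * (1 + C₀) * m * T) with hA'
  have hA'0 : 0 ≤ A' := by positivity
  refine ⟨κ, A + A', by linarith, fun ξ U hU s hs t ht => ?_⟩
  have hρ1 : 1 ≤ 1 + ‖ξ‖ := by linarith [norm_nonneg ξ]
  rcases le_or_gt R ‖ξ‖ with h | h
  · refine (hhigh ξ h U hU s hs t ht).trans ?_
    gcongr
    linarith
  · have h1 : ‖U t‖ ≤ A' * ‖U s‖ := by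
      refine (pi_norm_le_iff_of_nonneg (by positivity)).2 fun q => ?_
      refine (companion_exp_bound hC₀ hρ1 (c := fun t q => fullSymbol a (m - q) t ξ)
        (fun t ht q => ?_) hU hs ht q).trans ?_
      · have hq := q.2
        rw [fullSymbol_eq_fullSymbolC]
        refine (hsym (m - q) (by simp; omega) t ht _).trans ?_
        gcongr
        exact norm_ofReal_comp_le ξ
      · rw [hA']
        gcongr
    refine h1.trans ?_
    have h2 : 1 ≤ (1 + ‖ξ‖) ^ κ := one_le_pow₀ hρ1
    have h3 : A' ≤ (A + A') * (1 + ‖ξ‖) ^ κ := by nlinarith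
    gcongr

/-! ### From the modes to the system with weights `⟨ξ⟩^(m-l)` -/

theorem one_le_bracket {n : ℕ} (ξ : Rn n) : 1 ≤ bracket ξ :=
  Real.one_le_sqrt.2 (by nlinarith [sq_nonneg ‖ξ‖])

theorem one_add_norm_le_bracket {n : ℕ} (ξ : Rn n) : 1 + ‖ξ‖ ≤ 2 * bracket ξ := by
  have h1 := one_le_bracket ξ
  have h2 : ‖ξ‖ ≤ bracket ξ := Real.le_sqrt_of_sq_le (by linarith)
  linarith

/-- The bound for the system with the weights `⟨ξ⟩^(m-l)` follows from the one for modes. -/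
theorem polynomialFourierBound_of_mode_bound {n m : ℕ} {T : ℝ} (hT : 0 < T)
    {a : ℕ → (Fin n → ℕ) → ℝ → ℂ} {κ : ℕ} {A : ℝ} (hA : 1 ≤ A)
    (h : ∀ ξ : Rn n, ∀ U : ℝ → Fin m → ℂ, IsMode m T a ξ U →
      ∀ s ∈ Icc (0 : ℝ) T, ∀ t ∈ Icc (0 : ℝ) T, ‖U t‖ ≤ A * (1 + ‖ξ‖) ^ κ * ‖U s‖) :
    PolynomialFourierBound m T a := by
  refine ⟨κ + m, (m + 1) * (A * 2 ^ κ), by positivity, fun ξ V hV t ht => ?_⟩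
  set w : Fin m → ℝ := fun q => bracket ξ ^ (m - 1 - (q : ℕ)) with hw
  have hβ := one_le_bracket ξ
  have hβ0 : 0 < bracket ξ := by linarith
  have hw1 : ∀ q, 1 ≤ w q := fun q => one_le_pow₀ hβ
  have hw0 : ∀ q, 0 < w q := fun q => by linarith [hw1 q]
  have hwC : ∀ q, ((w q : ℝ) : ℂ) ≠ 0 := fun q => by exact_mod_cast (hw0 q).ne'
  have hβC : ((bracket ξ : ℝ) : ℂ) ≠ 0 := by exact_mod_cast hβ0.ne'
  -- Removing the weight `⟨ξ⟩^(m-1-q)`, with rows counted from zero, turns the given system into the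
  -- plain companion system.
  let U : ℝ → Fin m → ℂ := fun t q => ((w q : ℝ) : ℂ)⁻¹ * V t q
  have hU : IsMode m T a ξ U := by
    intro t ht
    refine hasDerivWithinAt_pi.2 fun q => ?_
    have h1 := ((hasDerivWithinAt_pi.1 (hV t ht)) q).const_mul (((w q : ℝ) : ℂ)⁻¹)
    refine h1.congr_deriv ?_
    simp only [Pi.smul_apply, smul_eq_mul]
    rw [mul_left_comm]
    congr 1
    by_cases hq : (q : ℕ) + 1 < m
    · rw [companion_mulVec_of_lt _ _ hq]
      have h2 : (systemMatrix m a t ξ).mulVec (V t) q = (bracket ξ : ℂ) * V t ⟨q + 1, hq⟩ := by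
        simp only [Matrix.mulVec, dotProduct, systemMatrix, Matrix.of_apply, hq, if_true]
        rw [Finset.sum_eq_single ⟨q + 1, hq⟩]
        · simp
        · intro r _ hr
          rw [if_neg fun h => hr (Fin.ext h), zero_mul]
        · simp
      have h3 : w q = bracket ξ * w ⟨q + 1, hq⟩ := by
        simp only [hw]
        rw [← pow_succ']
        congr 1
        omega
      rw [h2, h3]
      simp only [U]
      have h4 := hwC ⟨q + 1, hq⟩
      push_cast
      field_simp
    · rw [companion_mulVec_last _ _ hq]
      have hwq : w q = 1 := by
        simp only [hw]
        rw [show m - 1 - (q : ℕ) = 0 by omega, pow_zero]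
      rw [hwq]
      simp only [Matrix.mulVec, dotProduct, systemMatrix, Matrix.of_apply, hq, if_false, U, hw]
      push_cast
      rw [inv_one, one_mul, ← Finset.sum_neg_distrib]
      refine Finset.sum_congr rfl fun r _ => ?_
      ring
  have h0 : (0 : ℝ) ∈ Icc (0 : ℝ) T := ⟨le_rfl, hT.le⟩
  have hmain := h ξ U hU 0 h0 t ht
  have hU0 : ‖U 0‖ ≤ ‖WithLp.toLp 2 (V 0)‖ := by
    refine (pi_norm_le_iff_of_nonneg (norm_nonneg _)).2 fun q => ?_
    have h1 := PiLp.norm_apply_le (WithLp.toLp 2 (V 0)) q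
    simp only [U, norm_mul, norm_inv, Complex.norm_real, Real.norm_eq_abs, abs_of_pos (hw0 q)]
    have h2 : (w q)⁻¹ ≤ 1 := inv_le_one_of_one_le₀ (hw1 q)
    calc (w q)⁻¹ * ‖V 0 q‖ ≤ 1 * ‖V 0 q‖ := by gcongr
      _ ≤ _ := by rw [one_mul]; exact h1
  have hVt : ‖WithLp.toLp 2 (V t)‖ ≤ (m + 1) * (bracket ξ ^ m * ‖U t‖) := by
    have h1 : ∀ q, ‖V t q‖ ≤ bracket ξ ^ m * ‖U t‖ := by
      intro q
      have h2 : V t q = (w q : ℂ) * U t q := by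
        simp only [U]
        rw [mul_inv_cancel_left₀ (hwC q)]
      rw [h2, norm_mul, Complex.norm_real, Real.norm_eq_abs, abs_of_pos (hw0 q)]
      have h3 : w q ≤ bracket ξ ^ m := pow_le_pow_right₀ hβ (by omega)
      exact mul_le_mul h3 (norm_le_pi_norm (U t) q) (norm_nonneg _) (by positivity)
    rw [EuclideanSpace.norm_eq]
    refine Real.sqrt_le_iff.2 ⟨by positivity, ?_⟩
    calc ∑ q, ‖(WithLp.toLp 2 (V t)) q‖ ^ 2 ≤ ∑ _q : Fin m, (bracket ξ ^ m * ‖U t‖) ^ 2 := by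
          refine Finset.sum_le_sum fun q _ => ?_
          have := h1 q
          simp only
          gcongr
      _ = m * (bracket ξ ^ m * ‖U t‖) ^ 2 := by simp
      _ ≤ (m + 1) ^ 2 * (bracket ξ ^ m * ‖U t‖) ^ 2 := by
          refine mul_le_mul_of_nonneg_right ?_ (sq_nonneg _)
          have : (0 : ℝ) ≤ m := Nat.cast_nonneg m
          nlinarith
      _ = _ := by ring
  calc ‖WithLp.toLp 2 (V t)‖ ≤ (m + 1) * (bracket ξ ^ m * ‖U t‖) := hVt
    _ ≤ (m + 1) * (bracket ξ ^ m * (A * (2 * bracket ξ) ^ κ * ‖WithLp.toLp 2 (V 0)‖)) := by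
        gcongr
        refine hmain.trans ?_
        gcongr
        exact one_add_norm_le_bracket ξ
    _ = _ := by rw [mul_pow, pow_add]; ring

/-! ### A Paley–Wiener theorem -/

/-- An entire function of exponential type `B` with quadratic decay on the real axis is, after
division by `exp (-i y z)` with `B < y`, quadratically small on the whole upper half plane. -/
theorem norm_mul_exp_mul_sq_le {G : ℂ → ℂ} {A B D y : ℝ} (hG : Differentiable ℂ G)
    (hA : ∀ z, ‖G z‖ ≤ A * Real.exp (B * ‖z‖)) (hB : 0 ≤ B)
    (hD : ∀ x : ℝ, ‖G x‖ * (1 + x ^ 2) ≤ D) (hy : B < y) {z : ℂ} (hz : 0 ≤ z.im) :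
    ‖G z * Complex.exp (Complex.I * y * z)‖ * ‖z + Complex.I‖ ^ 2 ≤ D := by
  have hA0 : 0 ≤ A := by
    have := (norm_nonneg _).trans (hA 0)
    simpa using this
  -- The rotation `z = I w` takes the right half plane to the upper one. The factor `(z + I) ^ 2`
  -- has modulus `1 + x ^ 2` on the real axis, so the decay hypothesis bounds `f` by `D` on the
  -- boundary.
  set f : ℂ → ℂ := fun w =>
    G (Complex.I * w) * Complex.exp (-(y : ℂ) * w) * (Complex.I * w + Complex.I) ^ 2 with hf
  have hfd : Differentiable ℂ f := by
    have h1 : Differentiable ℂ fun w => G (Complex.I * w) := hG.comp (by fun_prop)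
    exact (h1.mul (by fun_prop)).mul (by fun_prop)
  have hfn : ∀ w, ‖f w‖ = ‖G (Complex.I * w)‖ * Real.exp (-y * w.re) * ‖w + 1‖ ^ 2 := by
    intro w
    have : Complex.I * w + Complex.I = Complex.I * (w + 1) := by ring
    simp only [hf, norm_mul, norm_pow, this, Complex.norm_exp, Complex.norm_I, one_mul]
    congr 3
    simp
  have hw1 : ∀ w : ℂ, ‖w + 1‖ ^ 2 ≤ (1 + ‖w‖) ^ 2 := fun w => by
    gcongr
    simpa [add_comm] using norm_add_le w 1
  have hkey : ‖f (-Complex.I * z)‖ ≤ D := by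
    refine PhragmenLindelof.right_half_plane_of_bounded_on_real hfd.diffContOnCl ?_ ?_ ?_ ?_
    -- Growth of order one, below the critical order two for a half plane.
    · refine ⟨1, by norm_num, B + y + 2, ?_⟩
      refine Asymptotics.IsBigO.of_bound A (Filter.Eventually.of_forall fun w => ?_)
      rw [hfn, Real.norm_eq_abs, Real.abs_exp, Real.rpow_one]
      have h1 : ‖G (Complex.I * w)‖ ≤ A * Real.exp (B * ‖w‖) := by simpa using hA (Complex.I * w)
      have h2 : Real.exp (-y * w.re) ≤ Real.exp (y * ‖w‖) := by
        apply Real.exp_le_exp.2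
        nlinarith [Complex.abs_re_le_norm w, neg_abs_le w.re]
      have h3 : ‖w + 1‖ ^ 2 ≤ Real.exp (2 * ‖w‖) := by
        refine (hw1 w).trans ?_
        rw [two_mul, Real.exp_add, ← sq]
        gcongr
        linarith [Real.add_one_le_exp ‖w‖]
      calc _ ≤ A * Real.exp (B * ‖w‖) * Real.exp (y * ‖w‖) * Real.exp (2 * ‖w‖) := by gcongr
        _ = A * Real.exp ((B + y + 2) * ‖w‖) := by
          rw [mul_assoc, mul_assoc, ← Real.exp_add, ← Real.exp_add]; ring_nf
    -- On the positive half-line `exp (-y x)` beats `exp (B x)` by `exp (-δ x)`, which absorbs the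
    -- quadratic factor.
    · set δ := y - B with hδ
      have hδ0 : 0 < δ := by linarith
      refine Filter.isBoundedUnder_of_eventually_le (a := A * (1 + 2 / δ) ^ 2) ?_
      filter_upwards [Filter.eventually_ge_atTop (0 : ℝ)] with x hx
      rw [hfn]
      have h1 : ‖G (Complex.I * x)‖ ≤ A * Real.exp (B * x) := by
        simpa [abs_of_nonneg hx] using hA (Complex.I * x)
      have h3 : ‖(x : ℂ) + 1‖ ^ 2 ≤ (1 + 2 / δ) ^ 2 * Real.exp (δ * x) := by
        refine (hw1 x).trans ?_
        have : Real.exp (δ * x) = Real.exp (δ * x / 2) ^ 2 := by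
          rw [sq, ← Real.exp_add]; ring_nf
        rw [this, ← mul_pow]
        gcongr
        rw [Complex.norm_real, Real.norm_of_nonneg hx]
        have h4 := Real.add_one_le_exp (δ * x / 2)
        have h5 : 1 + x ≤ (1 + 2 / δ) * (δ * x / 2 + 1) := by
          have : (1 + 2 / δ) * (δ * x / 2 + 1) = 1 + x + δ * x / 2 + 2 / δ := by
            field_simp; ring
          rw [this]
          have : 0 ≤ δ * x / 2 := by positivity
          have : 0 ≤ 2 / δ := by positivity
          linarith
        exact h5.trans (by gcongr)
      calc _ ≤ A * Real.exp (B * x) * Real.exp (-y * x) * ((1 + 2 / δ) ^ 2 * Real.exp (δ * x)) := by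
            simp only [Complex.ofReal_re]; gcongr
        _ = A * (1 + 2 / δ) ^ 2 * (Real.exp (B * x) * Real.exp (-y * x) * Real.exp (δ * x)) := by
            ring
        _ = A * (1 + 2 / δ) ^ 2 := by
            have : B * x + -y * x + δ * x = 0 := by rw [hδ]; ring
            rw [← Real.exp_add, ← Real.exp_add, this, Real.exp_zero, mul_one]
    · intro x
      rw [hfn]
      have h1 : Complex.I * (x * Complex.I) = ((-x : ℝ) : ℂ) := by
        push_cast
        linear_combination (x : ℂ) * Complex.I_mul_I
      have h2 : ‖(x : ℂ) * Complex.I + 1‖ ^ 2 = 1 + (-x) ^ 2 := by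
        rw [← Complex.normSq_eq_norm_sq, Complex.normSq_apply]; simp; ring
      rw [h1, h2]
      simpa using hD (-x)
    · simpa using hz
  rw [hfn] at hkey
  have h1 : Complex.I * (-Complex.I * z) = z := by linear_combination -z * Complex.I_mul_I
  have h2 : ‖-Complex.I * z + 1‖ = ‖z + Complex.I‖ := by
    have : -Complex.I * z + 1 = -Complex.I * (z + Complex.I) := by
      linear_combination Complex.I_mul_I
    rw [this]; simp
  rw [h1, h2] at hkey
  have h3 : ‖Complex.exp (Complex.I * y * z)‖ = Real.exp (-y * (-Complex.I * z).re) := by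
    rw [Complex.norm_exp]; congr 1; simp
  rw [norm_mul, h3]
  exact hkey

/-- Cauchy's theorem on the rectangle `[-s, s] × [0, s]`: on the three upper sides the integrand is
at most `D / s ^ 2` while their total length is `4 s`, so the integral over the base tends to zero.
-/
theorem integral_mul_exp_eq_zero_of_lt {G : ℂ → ℂ} {A B D y : ℝ} (hG : Differentiable ℂ G)
    (hA : ∀ z, ‖G z‖ ≤ A * Real.exp (B * ‖z‖)) (hB : 0 ≤ B)
    (hD : ∀ x : ℝ, ‖G x‖ * (1 + x ^ 2) ≤ D) (hy : B < y) :
    ∫ x : ℝ, G x * Complex.exp (Complex.I * y * x) = 0 := by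
  have hD0 : 0 ≤ D := le_trans (by positivity) (hD 0)
  set H : ℂ → ℂ := fun z => G z * Complex.exp (Complex.I * y * z) with hH
  have hHd : Differentiable ℂ H := hG.mul (by fun_prop)
  have hHb : ∀ z : ℂ, 0 ≤ z.im → ∀ s : ℝ, 0 < s → s ≤ ‖z + Complex.I‖ → ‖H z‖ ≤ D / s ^ 2 := by
    intro z hz s hs hsz
    rw [le_div_iff₀ (by positivity)]
    refine le_trans ?_ (norm_mul_exp_mul_sq_le hG hA hB hD hy hz)
    gcongr
  have hint : MeasureTheory.Integrable fun x : ℝ => H x := by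
    refine MeasureTheory.Integrable.mono' (integrable_inv_one_add_sq.const_mul D) ?_ ?_
    · exact (hHd.continuous.comp Complex.continuous_ofReal).aestronglyMeasurable
    · refine Filter.Eventually.of_forall fun x => ?_
      have h0 : 0 < 1 + x ^ 2 := by positivity
      have h1 : ‖Complex.exp (Complex.I * y * x)‖ = 1 := by
        have : Complex.I * y * x = ((y * x : ℝ) : ℂ) * Complex.I := by push_cast; ring
        rw [this, Complex.norm_exp_ofReal_mul_I]
      rw [hH, norm_mul, h1, mul_one, ← div_eq_mul_inv, le_div_iff₀ h0]
      exact hD x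
  have hlim := MeasureTheory.intervalIntegral_tendsto_integral hint Filter.tendsto_neg_atTop_atBot
    Filter.tendsto_id
  refine tendsto_nhds_unique hlim ?_
  have hbound : ∀ s : ℝ, 0 < s → ‖∫ x in (-s)..s, H x‖ ≤ 4 * D * s⁻¹ := by
    intro s hs
    have hrect := Complex.integral_boundary_rect_eq_zero_of_differentiableOn H (-s : ℂ)
      (s + s * Complex.I) hHd.differentiableOn
    simp only [Complex.neg_re, Complex.ofReal_re, Complex.add_re, Complex.mul_re, Complex.I_re,
      mul_zero, Complex.ofReal_im, Complex.I_im, mul_one, sub_self, add_zero, Complex.neg_im,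
      neg_zero, Complex.add_im, Complex.mul_im, zero_add, Complex.ofReal_zero, zero_mul] at hrect
    have htop : ‖∫ x in (-s)..s, H (x + s * Complex.I)‖ ≤ D / s ^ 2 * |s - -s| := by
      refine intervalIntegral.norm_integral_le_of_norm_le_const fun x _ => hHb _ ?_ s hs ?_
      · simpa using hs.le
      · refine le_trans ?_ (Complex.abs_im_le_norm _)
        simp only [Complex.add_im, Complex.ofReal_im, Complex.mul_im, Complex.ofReal_re,
          Complex.I_im, mul_one, Complex.I_re, mul_zero, add_zero, zero_add]
        rw [abs_of_pos (by linarith)]; linarith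
    have hside : ∀ r : ℝ, |r| = s →
        ‖∫ v in (0 : ℝ)..s, H (r + v * Complex.I)‖ ≤ D / s ^ 2 * |s - 0| := by
      intro r hr
      refine intervalIntegral.norm_integral_le_of_norm_le_const fun v hv => hHb _ ?_ s hs ?_
      · rw [uIoc_of_le hs.le] at hv
        simpa using hv.1.le
      · refine le_trans ?_ (Complex.abs_re_le_norm _)
        simp [hr]
    have h1 := hside s (abs_of_pos hs)
    have h2 := hside (-s) (by rw [abs_neg, abs_of_pos hs])
    have e1 : |s - -s| = 2 * s := by rw [abs_of_pos] <;> linarith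
    have e2 : |s - 0| = s := by rw [sub_zero, abs_of_pos hs]
    rw [e1] at htop
    rw [e2] at h1 h2
    have hE : (∫ x in (-s)..s, H x) = (∫ x in (-s)..s, H (x + s * Complex.I))
        - Complex.I * (∫ v in (0 : ℝ)..s, H (s + v * Complex.I))
        + Complex.I * (∫ v in (0 : ℝ)..s, H ((-s : ℝ) + v * Complex.I)) := by
      simp only [smul_eq_mul] at hrect
      push_cast at hrect ⊢
      linear_combination hrect
    rw [hE]
    refine (norm_add_le _ _).trans ((add_le_add_left (norm_sub_le _ _) _).trans ?_)
    simp only [norm_mul, Complex.norm_I, one_mul]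
    have : 4 * D * s⁻¹ = D / s ^ 2 * (2 * s) + D / s ^ 2 * s + D / s ^ 2 * s := by
      field_simp; ring
    linarith
  have h0 : Filter.Tendsto (fun s : ℝ => 4 * D * s⁻¹) Filter.atTop (𝓝 0) := by
    simpa using tendsto_inv_atTop_zero.const_mul (4 * D)
  refine squeeze_zero_norm' ?_ h0
  filter_upwards [Filter.eventually_gt_atTop 0] with s hs
  exact hbound s hs

/-- The Fourier integral of an entire function of exponential type `B` with quadratic decay on the
real axis vanishes outside `[-B, B]`. -/
theorem integral_mul_exp_eq_zero {G : ℂ → ℂ} {A B D y : ℝ} (hG : Differentiable ℂ G)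
    (hA : ∀ z, ‖G z‖ ≤ A * Real.exp (B * ‖z‖)) (hB : 0 ≤ B)
    (hD : ∀ x : ℝ, ‖G x‖ * (1 + x ^ 2) ≤ D) (hy : B < |y|) :
    ∫ x : ℝ, G x * Complex.exp (Complex.I * y * x) = 0 := by
  rcases lt_abs.1 hy with h | h
  · exact integral_mul_exp_eq_zero_of_lt hG hA hB hD h
  · have := integral_mul_exp_eq_zero_of_lt (G := fun z => G (-z)) (hG.comp differentiable_neg)
      (fun z => by simpa using hA (-z)) hB (fun x => by simpa using hD (-x)) h
    rw [← MeasureTheory.integral_neg_eq_self]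
    simpa using this

/-- Fubini's theorem in the direction of a coordinate axis. -/
theorem integral_eq_zero_of_slices {n : ℕ} (i : Fin n) {Φ : Rn n → ℂ}
    (hΦ : MeasureTheory.Integrable Φ)
    (h : ∀ ξ : Rn n, ∫ s : ℝ, Φ (ξ + s • EuclideanSpace.single i (1 : ℝ)) = 0) :
    ∫ ξ, Φ ξ = 0 := by
  obtain ⟨k, rfl⟩ : ∃ k, n = k + 1 := ⟨n - 1, by have := i.isLt; omega⟩
  have mp1 := PiLp.volume_preserving_toLp (Fin (k + 1))
  have mp2 := (MeasureTheory.volume_preserving_piFinSuccAbove (fun _ : Fin (k + 1) => ℝ) i).symm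
  have e1 : MeasurableEmbedding (WithLp.toLp 2 : (Fin (k + 1) → ℝ) → Rn (k + 1)) :=
    (MeasurableEquiv.toLp 2 (Fin (k + 1) → ℝ)).measurableEmbedding
  have mp := mp1.comp mp2
  have e2 := e1.comp (MeasurableEquiv.piFinSuccAbove (fun _ : Fin (k + 1) => ℝ) i).symm.measurableEmbedding
  rw [← mp.integral_comp e2]
  have hint := (mp.integrable_comp_emb e2).2 hΦ
  have hfub := MeasureTheory.integral_prod_symm _ hint
  rw [← MeasureTheory.Measure.volume_eq_prod] at hfub
  refine hfub.trans ?_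
  refine MeasureTheory.integral_eq_zero_of_ae (Filter.Eventually.of_forall fun v => ?_)
  refine Eq.trans ?_ (h (WithLp.toLp 2 (i.insertNth 0 v)))
  refine MeasureTheory.integral_congr_ae (Filter.Eventually.of_forall fun s => ?_)
  simp only [Function.comp]
  congr 1
  ext j
  simp only [MeasurableEquiv.piFinSuccAbove_symm_apply, PiLp.add_apply, PiLp.smul_apply]
  refine Fin.succAboveCases i ?_ (fun j => ?_) j <;> simp

/-- Integrals over compact sets of functions depending holomorphically on a parameter. -/
theorem differentiable_setIntegral {Y E : Type*} [TopologicalSpace Y] [T2Space Y] [MeasurableSpace Y]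
    [OpensMeasurableSpace Y] [SecondCountableTopology Y] [NormedAddCommGroup E] [NormedSpace ℂ E]
    [CompleteSpace E] {μ : MeasureTheory.Measure Y} [MeasureTheory.IsFiniteMeasureOnCompacts μ]
    {K : Set Y} (hK : IsCompact K) (hKm : MeasurableSet K) {F : Y → ℂ → E}
    (hF : Continuous (Function.uncurry F)) (hd : ∀ v, Differentiable ℂ (F v)) :
    Differentiable ℂ fun z => ∫ v in K, F v z ∂μ := by
  intro z₀
  have : MeasureTheory.IsFiniteMeasure (μ.restrict K) :=
    ⟨by rw [MeasureTheory.Measure.restrict_apply_univ]; exact hK.measure_lt_top⟩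
  have hslice : ∀ z, Continuous fun v => F v z := fun z =>
    hF.comp (continuous_id.prodMk continuous_const)
  obtain ⟨M, hM⟩ := (hK.prod (isCompact_closedBall z₀ 2)).exists_bound_of_continuousOn
    hF.continuousOn
  refine (hasDerivAt_integral_of_dominated_loc_of_deriv_le (μ := μ.restrict K)
    (F := fun z v => F v z) (F' := fun z v => deriv (F v) z) (bound := fun _ => M)
    (Metric.ball_mem_nhds z₀ one_pos) ?_ ?_ ?_ ?_ ?_ ?_).2.differentiableAt
  · exact Filter.Eventually.of_forall fun z => (hslice z).aestronglyMeasurable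
  · exact (hslice z₀).continuousOn.integrableOn_compact hK
  · exact ((stronglyMeasurable_deriv_with_param hF).comp_measurable
      (measurable_id.prodMk measurable_const)).aestronglyMeasurable
  -- Cauchy's estimate on unit circles: the bound `M` on the ball of radius two around `z₀` also
  -- bounds the derivative on the unit ball.
  · refine (MeasureTheory.ae_restrict_mem hKm).mono fun v hv z hz => ?_
    have := Complex.norm_deriv_le_of_forall_mem_sphere_norm_le one_pos
      ((hd v).diffContOnCl (s := Metric.ball z 1)) (C := M) (fun w hw => hM (v, w) ⟨hv, ?_⟩)
    · simpa using this
    · rw [Metric.mem_closedBall]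
      rw [Metric.mem_ball] at hz
      rw [Metric.mem_sphere] at hw
      linarith [dist_triangle w z z₀]
  · exact MeasureTheory.integrable_const M
  · exact Filter.Eventually.of_forall fun v z _ => (hd v z).hasDerivAt

/-- The unit vector `e_i`. -/
abbrev unitVec {n : ℕ} (i : Fin n) : Rn n := EuclideanSpace.single i (1 : ℝ)

-- The Fourier integral over a compact set makes sense at complex frequencies. The factor `exp (2π i
-- c s)` recentres the support at `c`, so that the type depends on its half width `r` and not on its
-- position.
open scoped FourierTransform in
theorem exists_fourier_slice {n : ℕ} {φ : Rn n → ℂ} (hφ : Continuous φ) (hc : HasCompactSupport φ)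
    (i : Fin n) {c r : ℝ} (hr : ∀ v, φ v ≠ 0 → |v i - c| ≤ r) (ξ : Rn n) :
    ∃ G : ℂ → ℂ, Differentiable ℂ G ∧
      (∀ s : ℝ, G s = 𝓕 φ (ξ + s • unitVec i) * Complex.exp (2 * Real.pi * c * s * Complex.I)) ∧
      ∃ A, ∀ z, ‖G z‖ ≤ A * Real.exp (2 * Real.pi * r * ‖z‖) := by
  set F : Rn n → ℂ → ℂ := fun v z =>
    Complex.exp ((-2 * Real.pi * inner ℝ v ξ : ℝ) * Complex.I) *
      Complex.exp (-2 * Real.pi * (v i - c : ℝ) * z * Complex.I) * φ v with hF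
  have hFc : Continuous (Function.uncurry F) := by
    simp only [hF, Function.uncurry_def]
    fun_prop
  have hzero : ∀ z, ∀ v ∉ tsupport φ, F v z = 0 := fun z v hv => by
    simp only [hF, image_eq_zero_of_notMem_tsupport hv, mul_zero]
  refine ⟨fun z => ∫ v in tsupport φ, F v z,
    differentiable_setIntegral hc (isClosed_tsupport φ).measurableSet hFc fun v => by
      simp only [hF]; fun_prop, fun s => ?_, ∫ v, ‖φ v‖, fun z => ?_⟩
  · change ∫ v in tsupport φ, F v s = _
    rw [MeasureTheory.setIntegral_eq_integral_of_forall_compl_eq_zero (hzero s), Real.fourier_eq',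
      ← MeasureTheory.integral_mul_const]
    refine MeasureTheory.integral_congr_ae (Filter.Eventually.of_forall fun v => ?_)
    simp only [hF, smul_eq_mul]
    have h2 : ∀ a b : ℂ, Complex.exp a * φ v * Complex.exp b = Complex.exp (a + b) * φ v := by
      intro a b; rw [Complex.exp_add]; ring
    rw [h2, ← Complex.exp_add]
    congr 2
    rw [inner_add_right, inner_smul_right, EuclideanSpace.inner_single_right]
    simp
    ring
  · change ‖∫ v in tsupport φ, F v z‖ ≤ _
    rw [MeasureTheory.setIntegral_eq_integral_of_forall_compl_eq_zero (hzero z),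
      ← MeasureTheory.integral_mul_const]
    refine MeasureTheory.norm_integral_le_of_norm_le
      ((hφ.norm.integrable_of_hasCompactSupport hc.norm).mul_const _)
      (Filter.Eventually.of_forall fun v => ?_)
    by_cases hv : φ v = 0
    · simp [hF, hv]
    · simp only [hF, norm_mul, Complex.norm_exp_ofReal_mul_I, one_mul]
      rw [mul_comm]
      gcongr
      rw [Complex.norm_exp]
      gcongr
      refine (Complex.re_le_norm _).trans ?_
      simp only [norm_mul, norm_neg, Complex.norm_ofNat, Complex.norm_real, Complex.norm_I,
        Real.norm_eq_abs, mul_one, abs_of_pos Real.pi_pos]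
      gcongr
      exact hr v hv

/-! ### Symbols of exponential type -/

/-- The restrictions of `σ` to the lines parallel to the coordinate axes extend to entire functions
of exponential type `B`. -/
def HasSliceType {n : ℕ} (B : ℝ) (σ : Rn n → ℂ) : Prop :=
  ∀ (i : Fin n) (ξ : Rn n), ∃ G : ℂ → ℂ, Differentiable ℂ G ∧ (∀ s : ℝ, G s = σ (ξ + s • unitVec i)) ∧
    ∃ A, ∀ z, ‖G z‖ ≤ A * Real.exp (B * ‖z‖)

theorem HasSliceType.mono {n : ℕ} {B B' : ℝ} {σ : Rn n → ℂ} (h : HasSliceType B σ) (hB : B ≤ B') :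
    HasSliceType B' σ := by
  intro i ξ
  obtain ⟨G, hG, hs, A, hA⟩ := h i ξ
  have hA0 : 0 ≤ A := by simpa using (norm_nonneg _).trans (hA 0)
  exact ⟨G, hG, hs, A, fun z => (hA z).trans (by gcongr)⟩

theorem HasSliceType.add {n : ℕ} {B : ℝ} {σ τ : Rn n → ℂ} (h : HasSliceType B σ)
    (h' : HasSliceType B τ) : HasSliceType B (σ + τ) := by
  intro i ξ
  obtain ⟨G, hG, hs, A, hA⟩ := h i ξ
  obtain ⟨G', hG', hs', A', hA'⟩ := h' i ξ
  refine ⟨G + G', hG.add hG', fun s => by simp [hs, hs'], A + A', fun z => ?_⟩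
  rw [add_mul]
  exact (norm_add_le _ _).trans (add_le_add (hA z) (hA' z))

theorem HasSliceType.mul {n : ℕ} {B B' : ℝ} {σ τ : Rn n → ℂ} (h : HasSliceType B σ)
    (h' : HasSliceType B' τ) : HasSliceType (B + B') (σ * τ) := by
  intro i ξ
  obtain ⟨G, hG, hs, A, hA⟩ := h i ξ
  obtain ⟨G', hG', hs', A', hA'⟩ := h' i ξ
  refine ⟨G * G', hG.mul hG', fun s => by simp [hs, hs'], A * A', fun z => ?_⟩
  rw [Pi.mul_apply, norm_mul, add_mul, Real.exp_add]
  refine (mul_le_mul (hA z) (hA' z) (norm_nonneg _) ((norm_nonneg _).trans (hA z))).trans_eq ?_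
  ring

theorem hasSliceType_const {n : ℕ} (c : ℂ) : HasSliceType 0 fun _ : Rn n => c := fun i ξ =>
  ⟨fun _ => c, differentiable_const c, fun _ => rfl, ‖c‖, fun z => by simp⟩

theorem hasSliceType_coord {n : ℕ} (j : Fin n) : HasSliceType 1 fun ξ : Rn n => ((ξ j : ℝ) : ℂ) := by
  intro i ξ
  refine ⟨fun z => ξ j + z * (unitVec i j : ℝ), by fun_prop, fun s => by
    simp only [PiLp.add_apply, PiLp.smul_apply, smul_eq_mul, Complex.ofReal_add,
      Complex.ofReal_mul], ‖ξ j‖ + 1,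
    fun z => ?_⟩
  have h1 : ‖(unitVec i : Rn n) j‖ ≤ 1 := by
    simpa using PiLp.norm_apply_le (unitVec i : Rn n) j
  have h2 := Real.add_one_le_exp ‖z‖
  rw [one_mul]
  calc _ ≤ ‖ξ j‖ + ‖z‖ * 1 := by
        refine (norm_add_le _ _).trans ?_
        rw [norm_mul, Complex.norm_real, Complex.norm_real]
        gcongr
    _ ≤ ‖ξ j‖ * Real.exp ‖z‖ + 1 * Real.exp ‖z‖ := by
        have : ‖ξ j‖ * 1 ≤ ‖ξ j‖ * Real.exp ‖z‖ := by
          gcongr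
          linarith [norm_nonneg z]
        linarith
    _ = _ := by ring

theorem HasSliceType.comp_neg {n : ℕ} {B : ℝ} {σ : Rn n → ℂ} (h : HasSliceType B σ) :
    HasSliceType B fun ξ => σ (-ξ) := by
  intro i ξ
  obtain ⟨G, hG, hs, A, hA⟩ := h i (-ξ)
  refine ⟨fun z => G (-z), hG.comp differentiable_neg, fun s => ?_, A, fun z => by
    simpa using hA (-z)⟩
  have := hs (-s)
  push_cast at this
  refine this.trans (congrArg σ ?_)
  module

/-- The growth condition `|σ(ξ)| ≤ C (1 + |ξ|)^N`. -/
def HasGrowth {n : ℕ} (N : ℕ) (C : ℝ) (σ : Rn n → ℂ) : Prop := ∀ ξ, ‖σ ξ‖ ≤ C * (1 + ‖ξ‖) ^ N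

theorem HasGrowth.nonneg {n : ℕ} {N : ℕ} {C : ℝ} {σ : Rn n → ℂ} (h : HasGrowth N C σ) : 0 ≤ C := by
  simpa using (norm_nonneg _).trans (h 0)

theorem HasGrowth.mono {n : ℕ} {N N' : ℕ} {C C' : ℝ} {σ : Rn n → ℂ} (h : HasGrowth N C σ)
    (hN : N ≤ N') (hC : C ≤ C') : HasGrowth N' C' σ := fun ξ => by
  have := h.nonneg
  refine (h ξ).trans ?_
  gcongr
  · linarith
  · linarith [norm_nonneg ξ]

theorem HasGrowth.add {n : ℕ} {N : ℕ} {C C' : ℝ} {σ τ : Rn n → ℂ} (h : HasGrowth N C σ)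
    (h' : HasGrowth N C' τ) : HasGrowth N (C + C') (σ + τ) := fun ξ => by
  rw [add_mul]
  exact (norm_add_le _ _).trans (add_le_add (h ξ) (h' ξ))

theorem HasGrowth.mul {n : ℕ} {N N' : ℕ} {C C' : ℝ} {σ τ : Rn n → ℂ} (h : HasGrowth N C σ)
    (h' : HasGrowth N' C' τ) : HasGrowth (N + N') (C * C') (σ * τ) := fun ξ => by
  rw [Pi.mul_apply, norm_mul, pow_add]
  refine (mul_le_mul (h ξ) (h' ξ) (norm_nonneg _) ((norm_nonneg _).trans (h ξ))).trans_eq ?_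
  ring

theorem hasGrowth_const {n : ℕ} (c : ℂ) : HasGrowth 0 ‖c‖ fun _ : Rn n => c := fun ξ => by simp

theorem hasGrowth_coord {n : ℕ} (j : Fin n) : HasGrowth 1 1 fun ξ : Rn n => ((ξ j : ℝ) : ℂ) :=
  fun ξ => by
    have := PiLp.norm_apply_le ξ j
    rw [Complex.norm_real]
    linarith

/-- The algebra of continuous symbols of polynomial growth and exponential type. -/
def symbolAlgebra (n : ℕ) : Subalgebra ℂ (Rn n → ℂ) where
  carrier := {σ | Continuous σ ∧ (∃ N C, HasGrowth N C σ) ∧ ∃ B, HasSliceType B σ}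
  add_mem' := by
    rintro σ τ ⟨h1, ⟨N, C, h2⟩, B, h3⟩ ⟨h1', ⟨N', C', h2'⟩, B', h3'⟩
    exact ⟨h1.add h1', ⟨max N N', C + C', (h2.mono (le_max_left _ _) le_rfl).add
      (h2'.mono (le_max_right _ _) le_rfl)⟩, max B B',
      (h3.mono (le_max_left _ _)).add (h3'.mono (le_max_right _ _))⟩
  mul_mem' := by
    rintro σ τ ⟨h1, ⟨N, C, h2⟩, B, h3⟩ ⟨h1', ⟨N', C', h2'⟩, B', h3'⟩
    exact ⟨h1.mul h1', ⟨_, _, h2.mul h2'⟩, _, h3.mul h3'⟩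
  algebraMap_mem' c := ⟨continuous_const, ⟨_, _, hasGrowth_const c⟩, _, hasSliceType_const c⟩

theorem coord_mem_symbolAlgebra {n : ℕ} (j : Fin n) :
    (fun ξ : Rn n => ((ξ j : ℝ) : ℂ)) ∈ symbolAlgebra n :=
  ⟨by fun_prop, ⟨_, _, hasGrowth_coord j⟩, _, hasSliceType_coord j⟩

/-- The symbol `ξ_j`. -/
def coordSymbol {n : ℕ} (j : Fin n) : symbolAlgebra n := ⟨_, coord_mem_symbolAlgebra j⟩

/-- The reflected symbol `σ(-ξ)`. -/
def reflect {n : ℕ} : symbolAlgebra n →ₐ[ℂ] symbolAlgebra n where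
  toFun σ := ⟨fun ξ => σ.1 (-ξ), by
    obtain ⟨h1, ⟨N, C, h2⟩, B, h3⟩ := σ.2
    exact ⟨h1.comp continuous_neg, ⟨N, C, fun ξ => by simpa using h2 (-ξ)⟩, B, h3.comp_neg⟩⟩
  map_one' := rfl
  map_mul' _ _ := rfl
  map_zero' := rfl
  map_add' _ _ := rfl
  commutes' _ := rfl

open scoped FourierTransform

/-! ### Fourier multipliers on test functions -/

/-- Smooth functions supported in `K`. -/
structure IsTestOn {n : ℕ} (K : Set (Rn n)) (φ : Rn n → ℂ) : Prop where
  contDiff : ContDiff ℝ ∞ φ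
  zero_of_notMem : ∀ x ∉ K, φ x = 0

theorem IsTestOn.tsupport_subset {n : ℕ} {K : Set (Rn n)} {φ : Rn n → ℂ} (h : IsTestOn K φ)
    (hK : IsCompact K) : tsupport φ ⊆ K :=
  closure_minimal (fun x hx => by_contra fun hxK => hx (h.zero_of_notMem x hxK)) hK.isClosed

theorem IsTestOn.hasCompactSupport {n : ℕ} {K : Set (Rn n)} {φ : Rn n → ℂ} (h : IsTestOn K φ)
    (hK : IsCompact K) : HasCompactSupport φ :=
  HasCompactSupport.intro hK h.zero_of_notMem

theorem IsTestOn.continuous_iteratedFDeriv {n : ℕ} {K : Set (Rn n)} {φ : Rn n → ℂ}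
    (h : IsTestOn K φ) (j : ℕ) : Continuous (iteratedFDeriv ℝ j φ) :=
  h.contDiff.continuous_iteratedFDeriv (by exact_mod_cast le_top)

theorem IsTestOn.hasCompactSupport_iteratedFDeriv {n : ℕ} {K : Set (Rn n)} {φ : Rn n → ℂ}
    (h : IsTestOn K φ) (hK : IsCompact K) (j : ℕ) : HasCompactSupport (iteratedFDeriv ℝ j φ) :=
  (h.hasCompactSupport hK).iteratedFDeriv j

theorem IsTestOn.exists_bound {n : ℕ} {K : Set (Rn n)} {φ : Rn n → ℂ} (h : IsTestOn K φ)
    (hK : IsCompact K) (k : ℕ) : ∃ M, ∀ j ≤ k, ∀ x, ‖iteratedFDeriv ℝ j φ x‖ ≤ M := by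
  have h1 : ∀ j, ∃ M, ∀ x, ‖iteratedFDeriv ℝ j φ x‖ ≤ M := fun j =>
    (h.continuous_iteratedFDeriv j).bounded_above_of_compact_support
      (h.hasCompactSupport_iteratedFDeriv hK j)
  choose M hM using h1
  refine ⟨∑ j ∈ Finset.range (k + 1), |M j|, fun j hj x => ?_⟩
  refine ((hM j x).trans (le_abs_self _)).trans ?_
  exact Finset.single_le_sum (f := fun j => |M j|) (fun _ _ => abs_nonneg _)
    (Finset.mem_range.2 (by omega))

/-- Decay of the Fourier transform, uniformly for test functions supported in a compact set. -/
theorem exists_fourier_decay {n : ℕ} {K : Set (Rn n)} (hK : IsCompact K) (k : ℕ) :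
    ∃ C, 0 ≤ C ∧ ∀ φ : Rn n → ℂ, IsTestOn K φ → ∀ M, (∀ j ≤ k, ∀ x, ‖iteratedFDeriv ℝ j φ x‖ ≤ M) →
      ∀ ξ, ‖𝓕 φ ξ‖ * (1 + ‖ξ‖) ^ k ≤ C * M := by
  set V := MeasureTheory.volume.real K with hV
  refine ⟨2 ^ k * (V + 2 ^ k * ((k + 1) * V)), by positivity, fun φ hφ M hM ξ => ?_⟩
  have hM0 : 0 ≤ M := (norm_nonneg _).trans (hM 0 (Nat.zero_le _) 0)
  have hint : ∀ j, MeasureTheory.Integrable fun v => ‖iteratedFDeriv ℝ j φ v‖ := fun j =>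
    (hφ.continuous_iteratedFDeriv j).norm.integrable_of_hasCompactSupport
      (hφ.hasCompactSupport_iteratedFDeriv hK j).norm
  have hI : ∀ j ≤ k, ∫ v, ‖iteratedFDeriv ℝ j φ v‖ ≤ V * M := by
    intro j hj
    rw [← MeasureTheory.setIntegral_eq_integral_of_forall_compl_eq_zero (s := K)]
    · refine (MeasureTheory.setIntegral_mono (hint j).integrableOn
        (MeasureTheory.integrableOn_const hK.measure_lt_top.ne) (hM j hj)).trans_eq ?_
      simp [hV]
    · intro v hv
      have : v ∉ tsupport φ := fun h => hv (hφ.tsupport_subset hK h)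
      rw [norm_eq_zero]
      exact image_eq_zero_of_notMem_tsupport fun h => this (tsupport_iteratedFDeriv_subset j h)
  have h0 : ‖𝓕 φ ξ‖ ≤ V * M := by
    refine (VectorFourier.norm_fourierIntegral_le_integral_norm _ _ _ _ _).trans ?_
    simpa using hI 0 (Nat.zero_le _)
  have hk : ‖ξ‖ ^ k * ‖𝓕 φ ξ‖ ≤ 2 ^ k * ((k + 1) * V) * M := by
    have := Real.pow_mul_norm_iteratedFDeriv_fourier_le (f := φ) (K := 0) (N := ⊤) (k := 0) (n := k)
      (hφ.contDiff) (fun p q hp _ => ?_) le_rfl le_top ξ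
    · rw [norm_iteratedFDeriv_zero] at this
      refine this.trans ?_
      rw [Finset.sum_product]
      simp only [zero_add, Finset.range_one, Finset.sum_singleton, pow_zero, one_mul, Nat.cast_zero,
        mul_zero]
      rw [mul_assoc]
      gcongr
      refine (Finset.sum_le_sum fun j hj => hI j (by have := Finset.mem_range.1 hj; omega)).trans_eq
        ?_
      simp
      ring
    · have hp0 : p = 0 := by simpa using hp
      simpa [hp0] using hint q
  have hpow : (1 + ‖ξ‖) ^ k ≤ 2 ^ k * (1 + ‖ξ‖ ^ k) := by
    rcases le_total ‖ξ‖ 1 with h | h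
    · calc (1 + ‖ξ‖) ^ k ≤ 2 ^ k := by gcongr; linarith
        _ ≤ 2 ^ k * (1 + ‖ξ‖ ^ k) := by
          have : (0 : ℝ) ≤ 2 ^ k * ‖ξ‖ ^ k := by positivity
          linarith
    · calc (1 + ‖ξ‖) ^ k ≤ (2 * ‖ξ‖) ^ k := by gcongr; linarith
        _ = 2 ^ k * ‖ξ‖ ^ k := mul_pow _ _ _
        _ ≤ 2 ^ k * (1 + ‖ξ‖ ^ k) := by gcongr; linarith
  calc ‖𝓕 φ ξ‖ * (1 + ‖ξ‖) ^ k ≤ ‖𝓕 φ ξ‖ * (2 ^ k * (1 + ‖ξ‖ ^ k)) := by gcongr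
    _ = 2 ^ k * (‖𝓕 φ ξ‖ + ‖ξ‖ ^ k * ‖𝓕 φ ξ‖) := by ring
    _ ≤ 2 ^ k * (V * M + 2 ^ k * ((k + 1) * V) * M) := by gcongr
    _ = _ := by ring

/-- The Fourier multiplier with symbol `σ`; the symbol is normalised so that `ξ_j` belongs
to `D_{x_j}`. -/
def multiplier {n : ℕ} (σ φ : Rn n → ℂ) : Rn n → ℂ :=
  𝓕⁻ fun ξ => σ ((2 * Real.pi) • ξ) * 𝓕 φ ξ

theorem HasGrowth.norm_dilate_le {n N : ℕ} {C : ℝ} {σ : Rn n → ℂ} (h : HasGrowth N C σ) (ξ : Rn n) :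
    ‖σ ((2 * Real.pi) • ξ)‖ ≤ C * (2 * Real.pi) ^ N * (1 + ‖ξ‖) ^ N := by
  have hC := h.nonneg
  have hpi : (1 : ℝ) ≤ 2 * Real.pi := by linarith [Real.pi_gt_three]
  refine (h _).trans ?_
  rw [mul_assoc, ← mul_pow, norm_smul, Real.norm_of_nonneg (by positivity)]
  gcongr
  nlinarith [norm_nonneg ξ]

theorem integrable_decay (n : ℕ) :
    MeasureTheory.Integrable fun ξ : Rn n => ((1 + ‖ξ‖) ^ (n + 1))⁻¹ := by
  have := integrable_one_add_norm (E := Rn n) (μ := MeasureTheory.volume) (r := (n + 1 : ℕ))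
    (by simp)
  refine this.congr (Filter.Eventually.of_forall fun ξ => ?_)
  simp only
  rw [Real.rpow_neg (by positivity), Real.rpow_natCast]

/-- The pointwise bound behind all estimates of Fourier multipliers. -/
theorem exists_integrand_bound {n : ℕ} {K : Set (Rn n)} (hK : IsCompact K) (N k : ℕ) :
    ∃ C', 0 ≤ C' ∧ ∀ (C : ℝ) (σ φ : Rn n → ℂ), HasGrowth N C σ → IsTestOn K φ → ∀ M,
      (∀ j ≤ N + k + (n + 1), ∀ x, ‖iteratedFDeriv ℝ j φ x‖ ≤ M) → ∀ p ≤ k, ∀ ξ,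
      ‖ξ‖ ^ p * ‖σ ((2 * Real.pi) • ξ) * 𝓕 φ ξ‖ ≤ C' * C * M * ((1 + ‖ξ‖) ^ (n + 1))⁻¹ := by
  obtain ⟨D, hD0, hD⟩ := exists_fourier_decay hK (N + k + (n + 1))
  refine ⟨(2 * Real.pi) ^ N * D, by positivity, fun C σ φ hσ hφ M hM p hp ξ => ?_⟩
  have h1 := hD φ hφ M hM ξ
  have hC := hσ.nonneg
  rw [← div_eq_mul_inv, le_div_iff₀ (by positivity)]
  have h2 : ‖ξ‖ ^ p ≤ (1 + ‖ξ‖) ^ k :=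
    (pow_le_pow_left₀ (norm_nonneg _) (by linarith) p).trans
      (pow_le_pow_right₀ (by linarith [norm_nonneg ξ]) hp)
  rw [norm_mul]
  calc _ ≤ (1 + ‖ξ‖) ^ k * (C * (2 * Real.pi) ^ N * (1 + ‖ξ‖) ^ N * ‖𝓕 φ ξ‖) *
        (1 + ‖ξ‖) ^ (n + 1) := by
        gcongr
        exact hσ.norm_dilate_le ξ
    _ = C * (2 * Real.pi) ^ N * (‖𝓕 φ ξ‖ * (1 + ‖ξ‖) ^ (N + k + (n + 1))) := by ring
    _ ≤ C * (2 * Real.pi) ^ N * (D * M) := by gcongr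
    _ = _ := by ring

theorem continuous_integrand {n : ℕ} {K : Set (Rn n)} (hK : IsCompact K) {σ φ : Rn n → ℂ}
    (hσ : Continuous σ) (hφ : IsTestOn K φ) :
    Continuous fun ξ => σ ((2 * Real.pi) • ξ) * 𝓕 φ ξ := by
  refine (hσ.comp (continuous_const_smul _)).mul ?_
  refine (Real.contDiff_fourier (N := 0) fun p hp => ?_).continuous
  have hp0 : p = 0 := by simpa using hp
  simpa [hp0] using (hφ.contDiff.continuous.integrable_of_hasCompactSupport
    (hφ.hasCompactSupport hK)).norm

theorem integrable_integrand {n : ℕ} {K : Set (Rn n)} (hK : IsCompact K) {N : ℕ} {C : ℝ}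
    {σ φ : Rn n → ℂ} (hσ : Continuous σ) (hσ' : HasGrowth N C σ) (hφ : IsTestOn K φ) (p : ℕ) :
    MeasureTheory.Integrable fun ξ => ‖ξ‖ ^ p * ‖σ ((2 * Real.pi) • ξ) * 𝓕 φ ξ‖ := by
  obtain ⟨C', -, hC'⟩ := exists_integrand_bound hK N p
  obtain ⟨M, hM⟩ := hφ.exists_bound hK (N + p + (n + 1))
  refine ((integrable_decay n).const_mul (C' * C * M)).mono' ?_
    (Filter.Eventually.of_forall fun ξ => ?_)
  · exact ((continuous_norm.pow p).mul (continuous_integrand hK hσ hφ).norm).aestronglyMeasurable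
  · rw [Real.norm_of_nonneg (by positivity)]
    exact hC' C σ φ hσ' hφ M hM p le_rfl ξ

theorem integrable_integrand' {n : ℕ} {K : Set (Rn n)} (hK : IsCompact K) {N : ℕ} {C : ℝ}
    {σ φ : Rn n → ℂ} (hσ : Continuous σ) (hσ' : HasGrowth N C σ) (hφ : IsTestOn K φ) :
    MeasureTheory.Integrable fun ξ => σ ((2 * Real.pi) • ξ) * 𝓕 φ ξ := by
  have := integrable_integrand hK hσ hσ' hφ 0
  simp only [pow_zero, one_mul] at this
  exact (MeasureTheory.integrable_norm_iff
    (continuous_integrand hK hσ hφ).aestronglyMeasurable).1 this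

theorem contDiff_multiplier {n : ℕ} {K : Set (Rn n)} (hK : IsCompact K) {N : ℕ} {C : ℝ}
    {σ φ : Rn n → ℂ} (hσ : Continuous σ) (hσ' : HasGrowth N C σ) (hφ : IsTestOn K φ) :
    ContDiff ℝ ∞ (multiplier σ φ) := by
  have h1 : ContDiff ℝ ∞ (𝓕 fun ξ => σ ((2 * Real.pi) • ξ) * 𝓕 φ ξ) :=
    Real.contDiff_fourier (N := ⊤) fun p _ => integrable_integrand hK hσ hσ' hφ p
  have h2 : multiplier σ φ = fun x => (𝓕 fun ξ => σ ((2 * Real.pi) • ξ) * 𝓕 φ ξ) (-x) := by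
    ext x
    exact Real.fourierInv_eq_fourier_neg _ _
  rw [h2]
  exact h1.comp contDiff_neg

theorem norm_iteratedFDeriv_multiplier_le {n : ℕ} {K : Set (Rn n)} (hK : IsCompact K) {N : ℕ}
    {C : ℝ} {σ φ : Rn n → ℂ} (hσ : Continuous σ) (hσ' : HasGrowth N C σ) (hφ : IsTestOn K φ) (k : ℕ)
    (x : Rn n) :
    ‖iteratedFDeriv ℝ k (multiplier σ φ) x‖ ≤ (2 * Real.pi) ^ k * ∑ p ∈ Finset.range (k + 1),
      ∫ ξ, ‖ξ‖ ^ p * ‖σ ((2 * Real.pi) • ξ) * 𝓕 φ ξ‖ := by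
  set F : Rn n → ℂ := fun ξ => σ ((2 * Real.pi) • ξ) * 𝓕 φ ξ with hF
  have hFc : Continuous F := continuous_integrand hK hσ hφ
  have h := Real.pow_mul_norm_iteratedFDeriv_fourier_le (f := F) (K := ⊤) (N := 0) (k := k) (n := 0)
    (by exact_mod_cast contDiff_zero.2 hFc) (fun p q _ hq => ?_) le_top le_rfl (-x)
  · rw [Finset.sum_product] at h
    simp only [pow_zero, one_mul, mul_one, zero_add, Finset.range_one, Finset.sum_singleton,
      norm_iteratedFDeriv_zero] at h
    refine le_trans (le_of_eq ?_) h
    have h2 : multiplier σ φ = fun x => (𝓕 F) (-x) := by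
      ext x
      exact Real.fourierInv_eq_fourier_neg _ _
    rw [h2]
    have := (LinearIsometryEquiv.neg ℝ (E := Rn n)).norm_iteratedFDeriv_comp_right (𝕜 := ℝ) (𝓕 F) x k
    simpa [Function.comp_def] using this
  · have hq0 : q = 0 := by simpa using hq
    subst hq0
    simp only [norm_iteratedFDeriv_zero]
    exact integrable_integrand hK hσ hσ' hφ p

/-- Continuity of Fourier multipliers, uniformly in the symbol. -/
theorem exists_multiplier_bound {n : ℕ} {K : Set (Rn n)} (hK : IsCompact K) (N k : ℕ) :
    ∃ C', 0 ≤ C' ∧ ∀ (C : ℝ) (σ φ : Rn n → ℂ), Continuous σ → HasGrowth N C σ → IsTestOn K φ → ∀ M,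
      (∀ j ≤ N + k + (n + 1), ∀ x, ‖iteratedFDeriv ℝ j φ x‖ ≤ M) → ∀ x,
      ‖iteratedFDeriv ℝ k (multiplier σ φ) x‖ ≤ C' * C * M := by
  obtain ⟨C', hC0, hC'⟩ := exists_integrand_bound hK N k
  set J := ∫ ξ : Rn n, ((1 + ‖ξ‖) ^ (n + 1))⁻¹ with hJ
  have hJ0 : 0 ≤ J := MeasureTheory.integral_nonneg fun ξ => by positivity
  refine ⟨(2 * Real.pi) ^ k * ((k + 1) * (C' * J)), by positivity,
    fun C σ φ hσ hσ' hφ M hM x => ?_⟩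
  refine (norm_iteratedFDeriv_multiplier_le hK hσ hσ' hφ k x).trans ?_
  have : ∀ p ∈ Finset.range (k + 1), ∫ ξ, ‖ξ‖ ^ p * ‖σ ((2 * Real.pi) • ξ) * 𝓕 φ ξ‖ ≤
      C' * C * M * J := by
    intro p hp
    rw [hJ, ← MeasureTheory.integral_const_mul]
    exact MeasureTheory.integral_mono (integrable_integrand hK hσ hσ' hφ p)
      ((integrable_decay n).const_mul _)
      fun ξ => hC' C σ φ hσ' hφ M hM p (by have := Finset.mem_range.1 hp; omega) ξ
  calc _ ≤ (2 * Real.pi) ^ k * ∑ p ∈ Finset.range (k + 1), C' * C * M * J := by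
        gcongr with p hp
        exact this p hp
    _ = _ := by simp; ring

open scoped FourierTransform

/-- A multiplier of exponential type `B` enlarges the support, in the direction of each coordinate
axis, by at most `B`. -/
theorem multiplier_eq_zero_of_slab {n : ℕ} {K : Set (Rn n)} (hK : IsCompact K) {N : ℕ} {B C : ℝ}
    {σ φ : Rn n → ℂ} (hσ : Continuous σ) (hσ' : HasGrowth N C σ) (hB : 0 ≤ B)
    (hσB : HasSliceType B σ) (hφ : IsTestOn K φ) (i : Fin n) {x : Rn n} {c r : ℝ} (hr0 : 0 ≤ r)
    (hr : ∀ v, φ v ≠ 0 → |v i - c| ≤ r) (hx : B + r < |x i - c|) : multiplier σ φ x = 0 := by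
  rw [multiplier, Real.fourierInv_eq']
  set F : Rn n → ℂ := fun ξ => σ ((2 * Real.pi) • ξ) * 𝓕 φ ξ with hF
  have hFi : MeasureTheory.Integrable F := integrable_integrand' hK hσ hσ' hφ
  -- By Fubini's theorem the inversion integral vanishes once it vanishes on every line parallel to
  -- the `i`-th axis, where the one-dimensional Paley–Wiener argument applies.
  refine integral_eq_zero_of_slices i ?_ fun ξ => ?_
  · refine hFi.norm.mono' ?_ (Filter.Eventually.of_forall fun ξ => ?_)
    · have : Continuous fun v : Rn n =>
          Complex.exp ((2 * Real.pi * inner ℝ v x : ℝ) * Complex.I) := by fun_prop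
      exact (this.smul (continuous_integrand hK hσ hφ)).aestronglyMeasurable
    · rw [norm_smul, Complex.norm_exp_ofReal_mul_I, one_mul]
  · obtain ⟨G₁, hG₁, hs₁, A₁, hA₁⟩ := hσB i ((2 * Real.pi) • ξ)
    obtain ⟨G₂, hG₂, hs₂, A₂, hA₂⟩ := exists_fourier_slice hφ.contDiff.continuous
      (hφ.hasCompactSupport hK) i hr ξ
    have hA₁0 : 0 ≤ A₁ := by simpa using (norm_nonneg _).trans (hA₁ 0)
    -- The dilation in `multiplier` gives the symbol the type `2π B`, and the transform of `φ`
    -- contributes `2π r`; the threshold `2π (B + r)` matches the frequency `2π (x i - c)`.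
    set G : ℂ → ℂ := fun z => G₁ (2 * Real.pi * z) * G₂ z with hG
    have hGs : ∀ s : ℝ, G s = F (ξ + s • unitVec i) *
        Complex.exp (2 * Real.pi * c * s * Complex.I) := by
      intro s
      have h := hs₁ (2 * Real.pi * s)
      push_cast at h
      simp only [hG, hF]
      rw [h, hs₂, ← mul_assoc, smul_add, smul_smul]
    have hGn : ∀ s : ℝ, ‖G s‖ = ‖F (ξ + s • unitVec i)‖ := by
      intro s
      have : (2 * Real.pi * c * s * Complex.I : ℂ) = ((2 * Real.pi * c * s : ℝ) : ℂ) * Complex.I := by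
        push_cast; ring
      rw [hGs, norm_mul, this, Complex.norm_exp_ofReal_mul_I, mul_one]
    -- Two powers of `‖ξ‖` beyond the growth of the symbol provide the quadratic decay along the
    -- line.
    obtain ⟨C', hC'0, hC'⟩ := exists_integrand_bound hK N 2
    obtain ⟨M, hM⟩ := hφ.exists_bound hK (N + 2 + (n + 1))
    have hM0 : 0 ≤ M := (norm_nonneg _).trans (hM 0 (Nat.zero_le _) 0)
    have hC0 := hσ'.nonneg
    have hle : ∀ p ≤ 2, ∀ η, ‖η‖ ^ p * ‖F η‖ ≤ C' * C * M := by
      intro p hp η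
      refine (hC' C σ φ hσ' hφ M hM p hp η).trans (mul_le_of_le_one_right (by positivity) ?_)
      exact inv_le_one_of_one_le₀ (one_le_pow₀ (by linarith [norm_nonneg η]))
    have hD : ∀ s : ℝ, ‖G s‖ * (1 + s ^ 2) ≤ 2 * (1 + ‖ξ‖ ^ 2) * (2 * (C' * C * M)) := by
      intro s
      set η := ξ + s • unitVec i with hη
      have h1 : |s| ≤ ‖η‖ + ‖ξ‖ := by
        have : s • unitVec i = η - ξ := by rw [hη]; abel
        have h2 : ‖s • (unitVec i : Rn n)‖ = |s| := by rw [norm_smul]; simp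
        rw [← h2, this]
        exact norm_sub_le _ _
      have h3 : s ^ 2 ≤ 2 * ‖η‖ ^ 2 + 2 * ‖ξ‖ ^ 2 := by
        rw [← sq_abs]
        nlinarith [sq_nonneg (‖η‖ - ‖ξ‖), abs_nonneg s]
      have h4 : 1 + s ^ 2 ≤ 2 * (1 + ‖ξ‖ ^ 2) * (1 + ‖η‖ ^ 2) := by
        nlinarith [mul_nonneg (sq_nonneg ‖ξ‖) (sq_nonneg ‖η‖)]
      have h5 := hle 0 (by norm_num) η
      have h6 := hle 2 le_rfl η
      rw [pow_zero, one_mul] at h5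
      rw [hGn]
      calc ‖F η‖ * (1 + s ^ 2) ≤ ‖F η‖ * (2 * (1 + ‖ξ‖ ^ 2) * (1 + ‖η‖ ^ 2)) := by gcongr
        _ = 2 * (1 + ‖ξ‖ ^ 2) * (‖F η‖ + ‖η‖ ^ 2 * ‖F η‖) := by ring
        _ ≤ _ := by gcongr; linarith
    have key := integral_mul_exp_eq_zero (G := G) (A := A₁ * A₂) (B := 2 * Real.pi * (B + r))
      (y := 2 * Real.pi * (x i - c)) ((hG₁.comp (by fun_prop)).mul hG₂) (fun z => ?_)
      (by positivity) hD ?_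
    · rw [← mul_zero (Complex.exp ((2 * Real.pi * inner ℝ ξ x : ℝ) * Complex.I)), ← key,
        ← MeasureTheory.integral_const_mul]
      refine MeasureTheory.integral_congr_ae (Filter.Eventually.of_forall fun s => ?_)
      simp only [smul_eq_mul]
      rw [hGs]
      have h2 : ∀ a b c d : ℂ, Complex.exp a * (c * Complex.exp b * Complex.exp d) =
          Complex.exp (a + b + d) * c := by
        intro a b c d; rw [Complex.exp_add, Complex.exp_add]; ring
      rw [h2]
      congr 2
      rw [inner_add_left, inner_smul_left, EuclideanSpace.inner_single_left]
      simp
      ring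
    · simp only [hG, norm_mul]
      refine (mul_le_mul (hA₁ _) (hA₂ _) (norm_nonneg _) (by positivity)).trans_eq ?_
      rw [mul_add, add_mul, Real.exp_add]
      simp only [norm_mul, Complex.norm_real, Complex.norm_ofNat, Real.norm_eq_abs,
        abs_of_pos Real.pi_pos]
      ring_nf
    · rw [abs_mul, abs_of_pos (by positivity)]
      gcongr

/-! ### Linearity, composition and derivatives of multipliers -/

theorem multiplier_zero {n : ℕ} (σ : Rn n → ℂ) : multiplier σ (0 : Rn n → ℂ) = 0 := by
  ext x
  have : (𝓕 (0 : Rn n → ℂ) : Rn n → ℂ) = 0 := by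
    ext w
    rw [Real.fourier_eq]
    simp
  rw [multiplier, this, Real.fourierInv_eq]
  simp

theorem IsTestOn.integrable {n : ℕ} {K : Set (Rn n)} {φ : Rn n → ℂ} (h : IsTestOn K φ)
    (hK : IsCompact K) : MeasureTheory.Integrable φ :=
  h.contDiff.continuous.integrable_of_hasCompactSupport (h.hasCompactSupport hK)

theorem IsTestOn.add {n : ℕ} {K : Set (Rn n)} {φ ψ : Rn n → ℂ} (h : IsTestOn K φ)
    (h' : IsTestOn K ψ) : IsTestOn K (φ + ψ) :=
  ⟨h.contDiff.add h'.contDiff, fun x hx => by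
    simp [h.zero_of_notMem x hx, h'.zero_of_notMem x hx]⟩

theorem IsTestOn.const_smul {n : ℕ} {K : Set (Rn n)} {φ : Rn n → ℂ} (h : IsTestOn K φ) (c : ℂ) :
    IsTestOn K (c • φ) :=
  ⟨h.contDiff.const_smul c, fun x hx => by simp [h.zero_of_notMem x hx]⟩

theorem IsTestOn.mul_left {n : ℕ} {K : Set (Rn n)} {φ f : Rn n → ℂ} (h : IsTestOn K φ)
    (hf : ContDiff ℝ ∞ f) : IsTestOn K (f * φ) :=
  ⟨hf.mul h.contDiff, fun x hx => by simp [h.zero_of_notMem x hx]⟩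

theorem IsTestOn.mono {n : ℕ} {K K' : Set (Rn n)} {φ : Rn n → ℂ} (h : IsTestOn K φ)
    (hK : K ⊆ K') : IsTestOn K' φ :=
  ⟨h.contDiff, fun x hx => h.zero_of_notMem x fun h' => hx (hK h')⟩

theorem fourier_add_apply {n : ℕ} {φ ψ : Rn n → ℂ} (hφ : MeasureTheory.Integrable φ)
    (hψ : MeasureTheory.Integrable ψ) (ξ : Rn n) : 𝓕 (φ + ψ) ξ = 𝓕 φ ξ + 𝓕 ψ ξ := by
  have hi : ∀ {f : Rn n → ℂ}, MeasureTheory.Integrable f → MeasureTheory.Integrable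
      fun v => Real.fourierChar (-inner ℝ v ξ) • f v := fun {f} hf =>
    (VectorFourier.fourierIntegral_convergent_iff Real.continuous_fourierChar
      (L := innerₗ (Rn n)) (by exact continuous_inner) ξ).2 hf
  simp only [Real.fourier_eq, Pi.add_apply, smul_add]
  exact MeasureTheory.integral_add (hi hφ) (hi hψ)

theorem fourier_const_smul_apply {n : ℕ} (c : ℂ) (φ : Rn n → ℂ) (ξ : Rn n) :
    𝓕 (c • φ) ξ = c * 𝓕 φ ξ := by
  simp only [Real.fourier_eq, Pi.smul_apply, smul_comm _ c]
  rw [MeasureTheory.integral_smul, smul_eq_mul]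

theorem fourierInv_add_apply {n : ℕ} {φ ψ : Rn n → ℂ} (hφ : MeasureTheory.Integrable φ)
    (hψ : MeasureTheory.Integrable ψ) (ξ : Rn n) : 𝓕⁻ (φ + ψ) ξ = 𝓕⁻ φ ξ + 𝓕⁻ ψ ξ := by
  simp only [Real.fourierInv_eq_fourier_neg]
  exact fourier_add_apply hφ hψ _

theorem fourierInv_const_smul_apply {n : ℕ} (c : ℂ) (φ : Rn n → ℂ) (ξ : Rn n) :
    𝓕⁻ (c • φ) ξ = c * 𝓕⁻ φ ξ := by
  simp only [Real.fourierInv_eq_fourier_neg]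
  exact fourier_const_smul_apply c φ _

theorem multiplier_add_right {n : ℕ} {K : Set (Rn n)} (hK : IsCompact K) {N : ℕ} {C : ℝ}
    {σ φ ψ : Rn n → ℂ} (hσ : Continuous σ) (hσ' : HasGrowth N C σ) (hφ : IsTestOn K φ)
    (hψ : IsTestOn K ψ) : multiplier σ (φ + ψ) = multiplier σ φ + multiplier σ ψ := by
  ext x
  rw [Pi.add_apply, multiplier, multiplier, multiplier, ← fourierInv_add_apply
    (integrable_integrand' hK hσ hσ' hφ) (integrable_integrand' hK hσ hσ' hψ)]
  refine congrFun (congrArg _ (funext fun ξ => ?_)) x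
  rw [fourier_add_apply (hφ.integrable hK) (hψ.integrable hK), Pi.add_apply, mul_add]

theorem multiplier_smul_right {n : ℕ} (σ φ : Rn n → ℂ) (c : ℂ) :
    multiplier σ (c • φ) = c • multiplier σ φ := by
  ext x
  rw [Pi.smul_apply, smul_eq_mul, multiplier, multiplier, ← fourierInv_const_smul_apply]
  refine congrFun (congrArg _ (funext fun ξ => ?_)) x
  rw [fourier_const_smul_apply, Pi.smul_apply, smul_eq_mul]
  ring

theorem multiplier_add_left {n : ℕ} {K : Set (Rn n)} (hK : IsCompact K) {N N' : ℕ} {C C' : ℝ}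
    {σ τ φ : Rn n → ℂ} (hσ : Continuous σ) (hσ' : HasGrowth N C σ) (hτ : Continuous τ)
    (hτ' : HasGrowth N' C' τ) (hφ : IsTestOn K φ) :
    multiplier (σ + τ) φ = multiplier σ φ + multiplier τ φ := by
  ext x
  rw [Pi.add_apply, multiplier, multiplier, multiplier, ← fourierInv_add_apply
    (integrable_integrand' hK hσ hσ' hφ) (integrable_integrand' hK hτ hτ' hφ)]
  refine congrFun (congrArg _ (funext fun ξ => ?_)) x
  rw [Pi.add_apply, Pi.add_apply, add_mul]

theorem multiplier_smul_left {n : ℕ} (σ φ : Rn n → ℂ) (c : ℂ) :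
    multiplier (c • σ) φ = c • multiplier σ φ := by
  ext x
  rw [Pi.smul_apply, smul_eq_mul, multiplier, multiplier, ← fourierInv_const_smul_apply]
  refine congrFun (congrArg _ (funext fun ξ => ?_)) x
  rw [Pi.smul_apply, Pi.smul_apply, smul_eq_mul, smul_eq_mul, mul_assoc]

theorem hasGrowth_one {n : ℕ} : HasGrowth 0 1 (1 : Rn n → ℂ) := fun ξ => by simp

theorem multiplier_one {n : ℕ} {K : Set (Rn n)} (hK : IsCompact K) {φ : Rn n → ℂ}
    (hφ : IsTestOn K φ) : multiplier 1 φ = φ := by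
  have h := integrable_integrand' hK continuous_one hasGrowth_one hφ
  simp only [Pi.one_apply, one_mul] at h
  simp only [multiplier, Pi.one_apply, one_mul]
  exact Continuous.fourierInv_fourier_eq hφ.contDiff.continuous (hφ.integrable hK) h

/-- Inversion in this direction requires `multiplier σ φ` to be integrable, which its compact
support supplies. Composition of multipliers thus rests on the bounded propagation of supports. -/
theorem fourier_multiplier {n : ℕ} {K K' : Set (Rn n)} (hK : IsCompact K) (hK' : IsCompact K')
    {N : ℕ} {C : ℝ} {σ φ : Rn n → ℂ} (hσ : Continuous σ) (hσ' : HasGrowth N C σ)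
    (hφ : IsTestOn K φ) (hψ : IsTestOn K' (multiplier σ φ)) :
    𝓕 (multiplier σ φ) = fun ξ => σ ((2 * Real.pi) • ξ) * 𝓕 φ ξ := by
  refine Continuous.fourier_fourierInv_eq (continuous_integrand hK hσ hφ)
    (integrable_integrand' hK hσ hσ' hφ) ?_
  have h := (hψ.integrable hK').comp_neg
  refine h.congr (Filter.Eventually.of_forall fun x => ?_)
  simp only [multiplier, Real.fourierInv_eq_fourier_neg, neg_neg]

theorem multiplier_mul {n : ℕ} {K K' : Set (Rn n)} (hK : IsCompact K) (hK' : IsCompact K')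
    {N : ℕ} {C : ℝ} {σ τ φ : Rn n → ℂ} (hτ : Continuous τ) (hτ' : HasGrowth N C τ)
    (hφ : IsTestOn K φ) (hψ : IsTestOn K' (multiplier τ φ)) :
    multiplier (σ * τ) φ = multiplier σ (multiplier τ φ) := by
  rw [multiplier, multiplier, fourier_multiplier hK hK' hτ hτ' hφ hψ]
  simp only [Pi.mul_apply, mul_assoc]

/-- With the kernel `exp (-2π i ⟨x, ξ⟩)` a derivative becomes multiplication by `2π i ξ_j`, and the
dilation by `2π` in `multiplier` leaves exactly the symbol `ξ_j` of `D_{x_j}`. -/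
theorem multiplier_coord {n : ℕ} {K : Set (Rn n)} (hK : IsCompact K) {φ : Rn n → ℂ}
    (hφ : IsTestOn K φ) (j : Fin n) :
    multiplier (fun ξ => ((ξ j : ℝ) : ℂ)) φ =
      fun x => -Complex.I * fderiv ℝ φ x (unitVec j) := by
  have hd : Differentiable ℝ φ := hφ.contDiff.differentiable (by simp)
  have hc : Continuous (fderiv ℝ φ) := hφ.contDiff.continuous_fderiv (by simp)
  have hi : MeasureTheory.Integrable (fderiv ℝ φ) :=
    hc.integrable_of_hasCompactSupport ((hφ.hasCompactSupport hK).fderiv ℝ)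
  set ψ : Rn n → ℂ := fun x => -Complex.I * fderiv ℝ φ x (unitVec j) with hψ
  have hψt : IsTestOn K ψ := by
    refine ⟨contDiff_const.mul ((hφ.contDiff.fderiv_right (m := ∞) (by simp)).clm_apply
      contDiff_const), fun x hx => ?_⟩
    have : fderiv ℝ φ x = 0 := image_eq_zero_of_notMem_tsupport fun h =>
      hx (hφ.tsupport_subset hK (tsupport_fderiv_subset ℝ h))
    simp [hψ, this]
  have hF : ∀ ξ, 𝓕 ψ ξ = (((2 * Real.pi) • ξ) j : ℝ) * 𝓕 φ ξ := by
    intro ξ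
    have h1 := congrFun (Real.fourier_fderiv (hφ.integrable hK) hd hi) ξ
    have h2 : 𝓕 (fderiv ℝ φ) ξ (unitVec j) = 𝓕 (fun x => fderiv ℝ φ x (unitVec j)) ξ := by
      rw [Real.fourier_eq, Real.fourier_eq, ContinuousLinearMap.integral_apply]
      · rfl
      · exact (VectorFourier.fourierIntegral_convergent_iff Real.continuous_fourierChar
          (L := innerₗ (Rn n)) (by exact continuous_inner) ξ).2 hi
    have h3 : ψ = (-Complex.I) • fun x => fderiv ℝ φ x (unitVec j) := by
      ext x; simp [hψ]
    rw [h3, fourier_const_smul_apply, ← h2, h1]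
    have h4 : (innerSL ℝ ξ) (unitVec j) = ξ j := by
      simp [innerSL_apply_apply, EuclideanSpace.inner_single_right]
    simp [VectorFourier.fourierSMulRight_apply, h4]
    ring_nf
    simp
  rw [← multiplier_one hK hψt]
  simp only [multiplier, Pi.one_apply, one_mul, hF]

open scoped FourierTransform

/-! ### Finite speed of propagation for multipliers of exponential type -/

/-- Compactness cuts the half space down to a slab of half width `r`. The point `x` is at distance
`r + b > r + B` from its central plane. -/
theorem multiplier_eq_zero_of_halfSpace {n : ℕ} {K : Set (Rn n)} (hK : IsCompact K) {N : ℕ}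
    {B C : ℝ} {σ φ : Rn n → ℂ} (hσ : Continuous σ) (hσ' : HasGrowth N C σ) (hB : 0 ≤ B)
    (hσB : HasSliceType B σ) (hφ : IsTestOn K φ) (i : Fin n) {x : Rn n} {b : ℝ} (hb : B < b)
    {ε : ℝ} (hε : |ε| = 1) (h : ∀ v, φ v ≠ 0 → b ≤ ε * (v i - x i)) : multiplier σ φ x = 0 := by
  have hcont : Continuous fun v : Rn n => v i - x i := by fun_prop
  obtain ⟨R, hR⟩ := hK.exists_bound_of_continuousOn hcont.continuousOn
  have hε2 : ε * ε = 1 := by rw [← abs_mul_abs_self, hε, one_mul]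
  refine multiplier_eq_zero_of_slab hK hσ hσ' hB hσB hφ i (c := x i + ε * ((b + max R b) / 2))
    (r := (max R b - b) / 2) (by linarith [le_max_right R b]) (fun v hv => ?_) ?_
  · have hvK : v ∈ K := by_contra fun hvK => hv (hφ.zero_of_notMem v hvK)
    have h1 := h v hv
    have h2 : ε * (v i - x i) ≤ max R b := by
      refine (le_abs_self _).trans ?_
      rw [abs_mul, hε, one_mul]
      exact (hR v hvK).trans (le_max_left _ _)
    have h3 : v i - (x i + ε * ((b + max R b) / 2)) =
        ε * (ε * (v i - x i) - (b + max R b) / 2) := by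
      linear_combination (x i - v i) * hε2
    rw [h3, abs_mul, hε, one_mul, abs_le]
    constructor <;> linarith
  · have h3 : x i - (x i + ε * ((b + max R b) / 2)) = -(ε * ((b + max R b) / 2)) := by ring
    have h4 := le_max_right R b
    rw [h3, abs_neg, abs_mul, hε, one_mul, abs_of_nonneg (by linarith)]
    linarith

/-- One coordinate at a time, smooth functions `p 1` and `p (-1)` cut `φ` into two parts beyond
distance `B + 1` from `x`, which the half space case annihilates, and a part within distance `B +
2`. The layer between the two distances is where the cut-offs change. -/
theorem multiplier_eq_zero_of_box {n : ℕ} {K : Set (Rn n)} (hK : IsCompact K) {N : ℕ} {B C : ℝ}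
    {σ φ : Rn n → ℂ} (hσ : Continuous σ) (hσ' : HasGrowth N C σ) (hB : 0 ≤ B)
    (hσB : HasSliceType B σ) (hφ : IsTestOn K φ) {x : Rn n}
    (h : ∀ v : Rn n, (∀ i, |v i - x i| < B + 2) → φ v = 0) : multiplier σ φ x = 0 := by
  suffices H : ∀ (S : Finset (Fin n)) (φ : Rn n → ℂ), IsTestOn K φ →
      (∀ v : Rn n, (∀ i ∈ S, |v i - x i| < B + 2) → φ v = 0) → multiplier σ φ x = 0 from
    H Finset.univ φ hφ fun v hv => h v fun i => hv i (Finset.mem_univ i)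
  intro S
  induction S using Finset.induction_on with
  | empty =>
    intro φ hφ h
    have : φ = 0 := funext fun v => h v (by simp)
    rw [this, multiplier_zero]
    rfl
  | insert i S hi ih =>
    intro φ hφ h
    set p : ℝ → Rn n → ℂ := fun ε v =>
      ((Real.smoothTransition (ε * (v i - x i) - (B + 1)) : ℝ) : ℂ) with hp
    have hps : ∀ ε, ContDiff ℝ ∞ (p ε) := by
      intro ε
      have h1 : ContDiff ℝ ∞ fun v : Rn n => v i := contDiff_euclidean.1 contDiff_id i
      have h2 : ContDiff ℝ ∞ fun v : Rn n => ε * (v i - x i) - (B + 1) :=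
        (contDiff_const.mul (h1.sub contDiff_const)).sub contDiff_const
      exact Complex.ofRealCLM.contDiff.comp (Real.smoothTransition.contDiff.comp h2)
    have hhalf : ∀ ε : ℝ, |ε| = 1 → multiplier σ (p ε * φ) x = 0 := by
      intro ε hε
      refine multiplier_eq_zero_of_halfSpace hK hσ hσ' hB hσB (hφ.mul_left (hps ε)) i
        (b := B + 1) (by linarith) hε fun v hv => ?_
      by_contra hlt
      rw [not_le] at hlt
      apply hv
      simp only [hp, Pi.mul_apply]
      rw [Real.smoothTransition.zero_of_nonpos (by linarith)]
      simp
    have hq := ih ((1 - p 1 - p (-1)) * φ)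
      (hφ.mul_left ((contDiff_const.sub (hps 1)).sub (hps (-1)))) fun v hv => ?_
    · have h1 := hφ.mul_left (hps 1)
      have h2 := hφ.mul_left (hps (-1))
      have h3 : IsTestOn K ((1 - p 1 - p (-1)) * φ) :=
        hφ.mul_left ((contDiff_const.sub (hps 1)).sub (hps (-1)))
      have hsum : φ = p 1 * φ + p (-1) * φ + (1 - p 1 - p (-1)) * φ := by ring
      rw [hsum, multiplier_add_right hK hσ hσ' (h1.add h2) h3,
        multiplier_add_right hK hσ hσ' h1 h2]
      simp [hhalf 1 (by simp), hhalf (-1) (by simp), hq]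
    · rcases lt_or_ge |v i - x i| (B + 2) with hlt | hge
      · have : φ v = 0 := h v fun j hj => by
          rcases Finset.mem_insert.1 hj with rfl | hj
          · exact hlt
          · exact hv j hj
        simp [this]
      · have : (1 : ℂ) - p 1 v - p (-1) v = 0 := by
          simp only [hp]
          rcases le_abs.1 hge with h' | h'
          · rw [Real.smoothTransition.one_of_one_le (by linarith),
              Real.smoothTransition.zero_of_nonpos (by linarith)]
            simp
          · rw [Real.smoothTransition.one_of_one_le (x := -1 * (v i - x i) - (B + 1)) (by linarith),
              Real.smoothTransition.zero_of_nonpos (by linarith)]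
            simp
        simp [this]

theorem norm_le_of_abs_coord_le {n : ℕ} {w : Rn n} {b : ℝ} (hb : 0 ≤ b) (h : ∀ i, |w i| ≤ b) :
    ‖w‖ ≤ n * b := by
  refine abs_le_of_sq_le_sq' ?_ (by positivity) |>.2
  rw [EuclideanSpace.norm_sq_eq]
  calc ∑ i, ‖w i‖ ^ 2 ≤ ∑ _i : Fin n, b ^ 2 := by
        gcongr with i
        exact h i
    _ = n * b ^ 2 := by simp
    _ ≤ (n * b) ^ 2 := by
        rw [mul_pow]
        gcongr
        rcases Nat.eq_zero_or_pos n with rfl | hn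
        · simp
        · exact le_self_pow₀ (by exact_mod_cast hn) (by norm_num)

/-- The distance over which a multiplier of exponential type `B` may propagate supports. -/
def reach (n : ℕ) (B : ℝ) : ℝ := n * (B + 2)

theorem reach_nonneg (n : ℕ) {B : ℝ} (hB : 0 ≤ B) : 0 ≤ reach n B := by
  unfold reach; positivity

theorem reach_mono (n : ℕ) {B B' : ℝ} (h : B ≤ B') : reach n B ≤ reach n B' := by
  unfold reach; gcongr

theorem multiplier_eq_zero_of_ball {n : ℕ} {K : Set (Rn n)} (hK : IsCompact K) {N : ℕ} {B C : ℝ}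
    {σ φ : Rn n → ℂ} (hσ : Continuous σ) (hσ' : HasGrowth N C σ) (hB : 0 ≤ B)
    (hσB : HasSliceType B σ) (hφ : IsTestOn K φ) {x : Rn n}
    (h : ∀ v ∈ Metric.closedBall x (reach n B), φ v = 0) : multiplier σ φ x = 0 :=
  multiplier_eq_zero_of_box hK hσ hσ' hB hσB hφ fun v hv => h v <| by
    rw [Metric.mem_closedBall, dist_eq_norm]
    exact norm_le_of_abs_coord_le (by linarith) fun i => by simpa using (hv i).le

theorem multiplier_congr_of_ball {n : ℕ} {K : Set (Rn n)} (hK : IsCompact K) {N : ℕ} {B C : ℝ}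
    {σ φ ψ : Rn n → ℂ} (hσ : Continuous σ) (hσ' : HasGrowth N C σ) (hB : 0 ≤ B)
    (hσB : HasSliceType B σ) (hφ : IsTestOn K φ) (hψ : IsTestOn K ψ) {x : Rn n}
    (h : ∀ v ∈ Metric.closedBall x (reach n B), φ v = ψ v) :
    multiplier σ φ x = multiplier σ ψ x := by
  have h1 := multiplier_eq_zero_of_ball hK hσ hσ' hB hσB (hφ.add (hψ.const_smul (-1)))
    (x := x) fun v hv => by simp [h v hv]
  rw [multiplier_add_right hK hσ hσ' hφ (hψ.const_smul (-1)), multiplier_smul_right] at h1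
  simp only [Pi.add_apply, Pi.smul_apply, smul_eq_mul] at h1
  linear_combination h1

theorem isTestOn_multiplier {n : ℕ} {r : ℝ} {N : ℕ} {B C : ℝ} {σ φ : Rn n → ℂ} (hσ : Continuous σ)
    (hσ' : HasGrowth N C σ) (hB : 0 ≤ B) (hσB : HasSliceType B σ)
    (hφ : IsTestOn (Metric.closedBall 0 r) φ) :
    IsTestOn (Metric.closedBall 0 (r + reach n B)) (multiplier σ φ) := by
  have hK := isCompact_closedBall (0 : Rn n) r
  refine ⟨contDiff_multiplier hK hσ hσ' hφ, fun x hx => ?_⟩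
  refine multiplier_eq_zero_of_ball hK hσ hσ' hB hσB hφ fun v hv => hφ.zero_of_notMem v fun hv' => ?_
  apply hx
  rw [mem_closedBall_zero_iff] at hv' ⊢
  rw [Metric.mem_closedBall, dist_eq_norm] at hv
  have := norm_sub_le v (v - x)
  rw [sub_sub_cancel] at this
  linarith

/-! ### Dominated convergence -/

/-- Bounds on a symbol: polynomial growth and exponential type. -/
structure SymbolBound {n : ℕ} (B : ℝ) (N : ℕ) (C : ℝ) (σ : symbolAlgebra n) : Prop where
  growth : HasGrowth N C σ.1
  sliceType : HasSliceType B σ.1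

theorem SymbolBound.mono {n : ℕ} {B B' : ℝ} {N N' : ℕ} {C C' : ℝ} {σ : symbolAlgebra n}
    (h : SymbolBound B N C σ) (hB : B ≤ B') (hN : N ≤ N') (hC : C ≤ C') : SymbolBound B' N' C' σ :=
  ⟨h.growth.mono hN hC, h.sliceType.mono hB⟩

theorem exists_symbolBound {n : ℕ} (σ : symbolAlgebra n) :
    ∃ B N C, 0 ≤ B ∧ SymbolBound B N C σ := by
  obtain ⟨-, ⟨N, C, h1⟩, B, h2⟩ := σ.2
  exact ⟨max B 0, N, C, le_max_right _ _, h1, h2.mono (le_max_left _ _)⟩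

/-- Pointwise convergence of symbols with uniform bounds. -/
def DomTendsto {n : ℕ} {ι : Type*} (σs : ι → symbolAlgebra n) (l : Filter ι)
    (σ : symbolAlgebra n) : Prop :=
  (∃ B N C, 0 ≤ B ∧ SymbolBound B N C σ ∧ ∀ᶠ s in l, SymbolBound B N C (σs s)) ∧
    ∀ ξ, Filter.Tendsto (fun s => (σs s).1 ξ) l (𝓝 (σ.1 ξ))

theorem domTendsto_of_bound {n : ℕ} {ι : Type*} {σs : ι → symbolAlgebra n} {l : Filter ι}
    {σ : symbolAlgebra n} {B : ℝ} {N : ℕ} {C : ℝ} (h : ∀ᶠ s in l, SymbolBound B N C (σs s))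
    (ht : ∀ ξ, Filter.Tendsto (fun s => (σs s).1 ξ) l (𝓝 (σ.1 ξ))) : DomTendsto σs l σ := by
  obtain ⟨B', N', C', hB', h'⟩ := exists_symbolBound σ
  refine ⟨⟨max B B', max N N', max C C', hB'.trans (le_max_right _ _),
    h'.mono (le_max_right _ _) (le_max_right _ _) (le_max_right _ _), ?_⟩, ht⟩
  exact h.mono fun s hs => hs.mono (le_max_left _ _) (le_max_left _ _) (le_max_left _ _)

theorem DomTendsto.comp {n : ℕ} {ι κ : Type*} {σs : ι → symbolAlgebra n} {l : Filter ι}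
    {l' : Filter κ} {σ : symbolAlgebra n} (h : DomTendsto σs l σ) {u : κ → ι}
    (hu : Filter.Tendsto u l' l) : DomTendsto (fun k => σs (u k)) l' σ := by
  obtain ⟨⟨B, N, C, hB, h1, h2⟩, h3⟩ := h
  exact ⟨⟨B, N, C, hB, h1, hu.eventually h2⟩, fun ξ => (h3 ξ).comp hu⟩

theorem DomTendsto.reflect {n : ℕ} {ι : Type*} {σs : ι → symbolAlgebra n} {l : Filter ι}
    {σ : symbolAlgebra n} (h : DomTendsto σs l σ) :
    DomTendsto (fun s => reflect (σs s)) l (WeaklyHyperbolic.reflect σ) := by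
  obtain ⟨⟨B, N, C, hB, h1, h2⟩, h3⟩ := h
  have aux : ∀ τ : symbolAlgebra n, SymbolBound B N C τ →
      SymbolBound B N C (WeaklyHyperbolic.reflect τ) := fun τ hτ =>
    ⟨fun ξ => by
      have := hτ.growth (-ξ)
      rw [norm_neg] at this
      exact this, hτ.sliceType.comp_neg⟩
  exact ⟨⟨B, N, C, hB, aux _ h1, h2.mono fun s hs => aux _ hs⟩, fun ξ => h3 (-ξ)⟩

/-- Dominated convergence: all derivatives of `σ_s(D)φ` converge uniformly. -/
theorem DomTendsto.exists_multiplier_rate {n : ℕ} {ι : Type*} {l : Filter ι}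
    [l.IsCountablyGenerated] {σs : ι → symbolAlgebra n} {σ : symbolAlgebra n}
    (h : DomTendsto σs l σ) {K : Set (Rn n)} (hK : IsCompact K) {φ : Rn n → ℂ} (hφ : IsTestOn K φ)
    (k : ℕ) : ∃ e : ι → ℝ, Filter.Tendsto e l (𝓝 0) ∧ ∀ s x,
      ‖iteratedFDeriv ℝ k (multiplier (σs s).1 φ) x - iteratedFDeriv ℝ k (multiplier σ.1 φ) x‖ ≤
        e s := by
  obtain ⟨⟨B, N, C, hB, h1, h2⟩, h3⟩ := h
  refine ⟨fun s => (2 * Real.pi) ^ k * ∑ p ∈ Finset.range (k + 1),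
      ∫ ξ, ‖ξ‖ ^ p * ‖((σs s).1 - σ.1) ((2 * Real.pi) • ξ) * 𝓕 φ ξ‖, ?_, fun s x => ?_⟩
  · rw [show (0 : ℝ) = (2 * Real.pi) ^ k * ∑ p ∈ Finset.range (k + 1), 0 by simp]
    refine Filter.Tendsto.const_mul _ (tendsto_finsetSum _ fun p hp => ?_)
    obtain ⟨C', hC'0, hC'⟩ := exists_integrand_bound hK N p
    obtain ⟨M, hM⟩ := hφ.exists_bound hK (N + p + (n + 1))
    have h0 : (0 : ℝ) = ∫ _ξ : Rn n, (0 : ℝ) := by simp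
    rw [h0]
    refine MeasureTheory.tendsto_integral_filter_of_dominated_convergence
      (fun ξ => C' * (C + C) * M * ((1 + ‖ξ‖) ^ (n + 1))⁻¹) ?_ ?_
      ((integrable_decay n).const_mul _) ?_
    · refine Filter.Eventually.of_forall fun s => ?_
      exact ((continuous_norm.pow p).mul (continuous_integrand hK ((σs s).2.1.sub σ.2.1)
        hφ).norm).aestronglyMeasurable
    · filter_upwards [h2] with s hs
      refine Filter.Eventually.of_forall fun ξ => ?_
      rw [Real.norm_of_nonneg (by positivity)]
      have hg : HasGrowth N (C + C) ((σs s).1 - σ.1) := fun ξ => by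
        rw [add_mul]
        exact (norm_sub_le _ _).trans (add_le_add (hs.growth ξ) (h1.growth ξ))
      exact hC' (C + C) _ φ hg hφ M hM p le_rfl ξ
    · refine Filter.Eventually.of_forall fun ξ => ?_
      have := ((h3 ((2 * Real.pi) • ξ)).sub_const (σ.1 ((2 * Real.pi) • ξ))).mul_const (𝓕 φ ξ)
      rw [sub_self, zero_mul] at this
      have := this.norm.const_mul (‖ξ‖ ^ p)
      rw [norm_zero, mul_zero] at this
      exact this
  · obtain ⟨B', N', C', hB', h'⟩ := exists_symbolBound (σs s)
    obtain ⟨B'', N'', C'', hB'', h''⟩ := exists_symbolBound (σs s - σ)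
    have e1 : multiplier (σs s).1 φ = multiplier σ.1 φ + multiplier ((σs s).1 - σ.1) φ := by
      refine Eq.trans ?_ (multiplier_add_left hK σ.2.1 h1.growth (σs s - σ).2.1 h''.growth hφ)
      congr 1
      exact (add_sub_cancel σ.1 (σs s).1).symm
    have c1 := contDiff_multiplier hK σ.2.1 h1.growth hφ
    have c2 := contDiff_multiplier hK (σs s - σ).2.1 h''.growth hφ
    have e2 : iteratedFDeriv ℝ k (multiplier (σs s).1 φ) x - iteratedFDeriv ℝ k (multiplier σ.1 φ) x
        = iteratedFDeriv ℝ k (multiplier ((σs s).1 - σ.1) φ) x := by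
      rw [e1, sub_eq_iff_eq_add']
      exact iteratedFDeriv_add_apply (c1.contDiffAt.of_le (by exact_mod_cast le_top))
        (ContDiffAt.of_le c2.contDiffAt (by exact_mod_cast le_top))
    rw [e2]
    exact norm_iteratedFDeriv_multiplier_le hK (σs s - σ).2.1 h''.growth hφ k x

/-! ### The action of symbols on smooth functions -/

/-- A smooth cut-off function which is `1` on the ball of radius `r` and vanishes outside the ball of
radius `r + 1`. -/
def cutoff {n : ℕ} (r : ℝ) (x : Rn n) : ℂ := (Real.smoothTransition (r ^ 2 + 1 - ‖x‖ ^ 2) : ℝ)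

theorem contDiff_cutoff {n : ℕ} (r : ℝ) : ContDiff ℝ ∞ (cutoff r : Rn n → ℂ) :=
  Complex.ofRealCLM.contDiff.comp (Real.smoothTransition.contDiff.comp
    (contDiff_const.sub (contDiff_norm_sq ℝ)))

theorem cutoff_eq_one {n : ℕ} {r : ℝ} {x : Rn n} (h : ‖x‖ ≤ r) : cutoff r x = 1 := by
  have : ‖x‖ ^ 2 ≤ r ^ 2 := by gcongr
  rw [cutoff, Real.smoothTransition.one_of_one_le (by linarith), Complex.ofReal_one]

theorem cutoff_eq_zero {n : ℕ} {r : ℝ} (hr : 0 ≤ r) {x : Rn n} (h : r + 1 < ‖x‖) :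
    cutoff r x = 0 := by
  have : (r + 1) ^ 2 ≤ ‖x‖ ^ 2 := by gcongr
  rw [cutoff, Real.smoothTransition.zero_of_nonpos (by nlinarith), Complex.ofReal_zero]

theorem isTestOn_cutoff_mul {n : ℕ} {r R : ℝ} (hr : 0 ≤ r) (hR : r + 1 ≤ R) {f : Rn n → ℂ}
    (hf : ContDiff ℝ ∞ f) : IsTestOn (Metric.closedBall 0 R) (cutoff r * f) := by
  refine ⟨(contDiff_cutoff r).mul hf, fun x hx => ?_⟩
  rw [mem_closedBall_zero_iff, not_le] at hx
  rw [Pi.mul_apply, cutoff_eq_zero hr (by linarith), zero_mul]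

theorem norm_le_of_mem_closedBall {n : ℕ} {x v : Rn n} {ρ r : ℝ} (hv : v ∈ Metric.closedBall x ρ)
    (h : ‖x‖ + ρ ≤ r) : ‖v‖ ≤ r := by
  rw [Metric.mem_closedBall, dist_eq_norm] at hv
  have := norm_add_le (v - x) x
  rw [sub_add_cancel] at this
  linarith

/-- The exponential type of a symbol. -/
def typeOf {n : ℕ} (σ : symbolAlgebra n) : ℝ := (exists_symbolBound σ).choose

theorem typeOf_spec {n : ℕ} (σ : symbolAlgebra n) :
    ∃ N C, 0 ≤ typeOf σ ∧ SymbolBound (typeOf σ) N C σ := (exists_symbolBound σ).choose_spec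

/-- The action of a symbol on a smooth function. -/
def smoothMultiplier {n : ℕ} (σ : symbolAlgebra n) (f : Rn n → ℂ) (x : Rn n) : ℂ :=
  multiplier σ.1 (cutoff (‖x‖ + reach n (typeOf σ)) * f) x

/-- The value at `x` depends only on `f` within the reach of the symbol, so every larger cut-off
radius and every admissible bound give the same result. This freedom makes all later identities
reduce to test functions. -/
theorem smoothMultiplier_eq {n : ℕ} {σ : symbolAlgebra n} {B : ℝ} {N : ℕ} {C : ℝ}
    (hσ : SymbolBound B N C σ) (hB : 0 ≤ B) {f : Rn n → ℂ} (hf : ContDiff ℝ ∞ f) {x : Rn n} {r : ℝ}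
    (hr : ‖x‖ + reach n B ≤ r) : smoothMultiplier σ f x = multiplier σ.1 (cutoff r * f) x := by
  obtain ⟨N', C', h0, h1⟩ := typeOf_spec σ
  have hr0 : 0 ≤ r := (add_nonneg (norm_nonneg x) (reach_nonneg n hB)).trans hr
  have hr0' : 0 ≤ ‖x‖ + reach n (typeOf σ) := add_nonneg (norm_nonneg x) (reach_nonneg n h0)
  -- With the smaller of the two types, both cut-offs equal one on the ball that the multiplier can
  -- see.
  obtain ⟨b, hb0, hb, hb1, hb2⟩ : ∃ b, 0 ≤ b ∧ HasSliceType b σ.1 ∧ b ≤ B ∧ b ≤ typeOf σ := by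
    rcases le_total B (typeOf σ) with h | h
    · exact ⟨B, hB, hσ.sliceType, le_rfl, h⟩
    · exact ⟨_, h0, h1.sliceType, h, le_rfl⟩
  refine multiplier_congr_of_ball
    (isCompact_closedBall 0 (max r (‖x‖ + reach n (typeOf σ)) + 1)) σ.2.1 hσ.growth hb0 hb
    (isTestOn_cutoff_mul hr0' (by gcongr; exact le_max_right _ _) hf)
    (isTestOn_cutoff_mul hr0 (by gcongr; exact le_max_left _ _) hf) fun v hv => ?_
  have m1 := reach_mono n hb1
  have m2 := reach_mono n hb2
  rw [Pi.mul_apply, Pi.mul_apply, cutoff_eq_one (norm_le_of_mem_closedBall hv (by linarith)),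
    cutoff_eq_one (norm_le_of_mem_closedBall hv (by linarith))]

theorem smoothMultiplier_eventuallyEq {n : ℕ} {σ : symbolAlgebra n} {B : ℝ} {N : ℕ} {C : ℝ}
    (hσ : SymbolBound B N C σ) (hB : 0 ≤ B) {f : Rn n → ℂ} (hf : ContDiff ℝ ∞ f) {x : Rn n} {r : ℝ}
    (hr : ‖x‖ + reach n B < r) :
    smoothMultiplier σ f =ᶠ[𝓝 x] multiplier σ.1 (cutoff r * f) := by
  have : ∀ᶠ y in 𝓝 x, ‖y‖ < r - reach n B :=
    continuous_norm.continuousAt.eventually_lt continuousAt_const (by linarith)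
  filter_upwards [this] with y hy
  exact smoothMultiplier_eq hσ hB hf (by linarith)

theorem contDiff_smoothMultiplier {n : ℕ} (σ : symbolAlgebra n) {f : Rn n → ℂ}
    (hf : ContDiff ℝ ∞ f) : ContDiff ℝ ∞ (smoothMultiplier σ f) := by
  obtain ⟨N, C, hB, hσ⟩ := typeOf_spec σ
  rw [contDiff_iff_contDiffAt]
  intro x
  have h0 : 0 ≤ ‖x‖ + reach n (typeOf σ) + 1 := by
    have := reach_nonneg n hB
    positivity
  refine ContDiffAt.congr_of_eventuallyEq ?_
    (smoothMultiplier_eventuallyEq hσ hB hf (x := x) (lt_add_one _))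
  exact (contDiff_multiplier (isCompact_closedBall 0 _) σ.2.1 hσ.growth
    (isTestOn_cutoff_mul h0 le_rfl hf)).contDiffAt

theorem smoothMultiplier_add_right {n : ℕ} (σ : symbolAlgebra n) {f g : Rn n → ℂ}
    (hf : ContDiff ℝ ∞ f) (hg : ContDiff ℝ ∞ g) :
    smoothMultiplier σ (f + g) = smoothMultiplier σ f + smoothMultiplier σ g := by
  obtain ⟨N, C, hB, hσ⟩ := typeOf_spec σ
  ext x
  have h0 : 0 ≤ ‖x‖ + reach n (typeOf σ) := add_nonneg (norm_nonneg x) (reach_nonneg n hB)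
  simp only [smoothMultiplier, Pi.add_apply, mul_add]
  rw [multiplier_add_right (isCompact_closedBall 0 _) σ.2.1 hσ.growth
    (isTestOn_cutoff_mul h0 le_rfl hf) (isTestOn_cutoff_mul h0 le_rfl hg), Pi.add_apply]

theorem smoothMultiplier_smul_right {n : ℕ} (σ : symbolAlgebra n) (f : Rn n → ℂ) (c : ℂ) :
    smoothMultiplier σ (c • f) = c • smoothMultiplier σ f := by
  ext x
  simp only [smoothMultiplier, Pi.smul_apply, mul_smul_comm]
  rw [multiplier_smul_right, Pi.smul_apply]

theorem smoothMultiplier_add_left {n : ℕ} (σ τ : symbolAlgebra n) {f : Rn n → ℂ}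
    (hf : ContDiff ℝ ∞ f) :
    smoothMultiplier (σ + τ) f = smoothMultiplier σ f + smoothMultiplier τ f := by
  obtain ⟨B, N, C, hB, hσ⟩ := exists_symbolBound σ
  obtain ⟨B', N', C', hB', hτ⟩ := exists_symbolBound τ
  obtain ⟨B'', N'', C'', hB'', hστ⟩ := exists_symbolBound (σ + τ)
  have r1 := reach_nonneg n hB
  have r2 := reach_nonneg n hB'
  have r3 := reach_nonneg n hB''
  ext x
  have hx := norm_nonneg x
  set r := ‖x‖ + reach n B + reach n B' + reach n B'' with hr
  rw [Pi.add_apply, smoothMultiplier_eq hσ hB hf (r := r) (by linarith),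
    smoothMultiplier_eq hτ hB' hf (r := r) (by linarith),
    smoothMultiplier_eq hστ hB'' hf (r := r) (by linarith)]
  exact congrFun (multiplier_add_left (isCompact_closedBall 0 (r + 1)) σ.2.1 hσ.growth τ.2.1
    hτ.growth (isTestOn_cutoff_mul (by linarith) le_rfl hf)) x

theorem smoothMultiplier_smul_left {n : ℕ} (c : ℂ) (σ : symbolAlgebra n) {f : Rn n → ℂ}
    (hf : ContDiff ℝ ∞ f) : smoothMultiplier (c • σ) f = c • smoothMultiplier σ f := by
  obtain ⟨B, N, C, hB, hσ⟩ := exists_symbolBound σ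
  obtain ⟨B', N', C', hB', hτ⟩ := exists_symbolBound (c • σ)
  have r1 := reach_nonneg n hB
  have r2 := reach_nonneg n hB'
  ext x
  set r := ‖x‖ + reach n B + reach n B' with hr
  rw [Pi.smul_apply, smoothMultiplier_eq hσ hB hf (r := r) (by linarith),
    smoothMultiplier_eq hτ hB' hf (r := r) (by linarith)]
  exact congrFun (multiplier_smul_left σ.1 _ c) x

theorem smoothMultiplier_one {n : ℕ} {f : Rn n → ℂ} (hf : ContDiff ℝ ∞ f) :
    smoothMultiplier (1 : symbolAlgebra n) f = f := by
  obtain ⟨N, C, hB, -⟩ := typeOf_spec (1 : symbolAlgebra n)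
  ext x
  have h0 := reach_nonneg n hB
  have h1 : 0 ≤ ‖x‖ + reach n (typeOf (1 : symbolAlgebra n)) := add_nonneg (norm_nonneg x) h0
  have := congrFun (multiplier_one (isCompact_closedBall 0 _)
    (isTestOn_cutoff_mul h1 le_rfl hf)) x
  refine this.trans ?_
  rw [Pi.mul_apply, cutoff_eq_one (by linarith), one_mul]

/-- On a ball large enough for all three symbols the composition formula for test functions applies.
The inner function may be replaced by its cut-off version because the outer multiplier sees only a
ball on which the two agree. -/
theorem smoothMultiplier_mul {n : ℕ} (σ τ : symbolAlgebra n) {f : Rn n → ℂ}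
    (hf : ContDiff ℝ ∞ f) :
    smoothMultiplier (σ * τ) f = smoothMultiplier σ (smoothMultiplier τ f) := by
  obtain ⟨B, N, C, hB, hσ⟩ := exists_symbolBound σ
  obtain ⟨B', N', C', hB', hτ⟩ := exists_symbolBound τ
  obtain ⟨B'', N'', C'', hB'', hστ⟩ := exists_symbolBound (σ * τ)
  have r1 := reach_nonneg n hB
  have r2 := reach_nonneg n hB'
  have r3 := reach_nonneg n hB''
  ext x
  have hx := norm_nonneg x
  set r := ‖x‖ + reach n B + reach n B' + reach n B'' with hr
  have ht : IsTestOn (Metric.closedBall 0 (r + 1)) (cutoff r * f) :=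
    isTestOn_cutoff_mul (by linarith) le_rfl hf
  have ht' : IsTestOn (Metric.closedBall 0 (r + 1 + reach n B')) (multiplier τ.1 (cutoff r * f)) :=
    isTestOn_multiplier τ.2.1 hτ.growth hB' hτ.sliceType ht
  rw [smoothMultiplier_eq hστ hB'' hf (r := r) (by linarith),
    smoothMultiplier_eq hσ hB (contDiff_smoothMultiplier τ hf) (r := ‖x‖ + reach n B) le_rfl]
  have h1 : multiplier (σ * τ).1 (cutoff r * f) =
      multiplier σ.1 (multiplier τ.1 (cutoff r * f)) :=
    multiplier_mul (isCompact_closedBall 0 _) (isCompact_closedBall 0 _) τ.2.1 hτ.growth ht ht'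
  rw [h1]
  refine multiplier_congr_of_ball (isCompact_closedBall 0 (r + 1 + reach n B')) σ.2.1 hσ.growth hB
    hσ.sliceType ht' (isTestOn_cutoff_mul (by linarith) (by linarith)
      (contDiff_smoothMultiplier τ hf)) fun v hv => ?_
  have hv' := norm_le_of_mem_closedBall hv le_rfl
  rw [Pi.mul_apply, cutoff_eq_one hv', one_mul,
    smoothMultiplier_eq hτ hB' hf (r := r) (by linarith)]

namespace Smooth

theorem ext {n : ℕ} {f g : Smooth n} (h : f.toFun = g.toFun) : f = g := Subtype.ext h

/-- Symbols act on smooth functions. -/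
def act (n : ℕ) : symbolAlgebra n →ₐ[ℂ] Module.End ℂ (Smooth n) :=
  AlgHom.ofLinearMap
    { toFun σ :=
        { toFun f := ⟨smoothMultiplier σ f.toFun, contDiff_smoothMultiplier σ f.contDiff⟩
          map_add' f g := Smooth.ext (smoothMultiplier_add_right σ f.contDiff g.contDiff)
          map_smul' c f := Smooth.ext (smoothMultiplier_smul_right σ f.toFun c) }
      map_add' σ τ := LinearMap.ext fun f => Smooth.ext (smoothMultiplier_add_left σ τ f.contDiff)
      map_smul' c σ := LinearMap.ext fun f => Smooth.ext (smoothMultiplier_smul_left c σ f.contDiff) }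
    (LinearMap.ext fun f => Smooth.ext (smoothMultiplier_one f.contDiff))
    fun σ τ => LinearMap.ext fun f => Smooth.ext (smoothMultiplier_mul σ τ f.contDiff)

theorem act_toFun {n : ℕ} (σ : symbolAlgebra n) (f : Smooth n) :
    (act n σ f).toFun = smoothMultiplier σ f.toFun := rfl

theorem act_coordSymbol {n : ℕ} (j : Fin n) (f : Smooth n) : act n (coordSymbol j) f = Dx j f := by
  obtain ⟨N, C, hB, hσ⟩ := typeOf_spec (coordSymbol j)
  refine Smooth.ext (funext fun x => ?_)
  have h0 := reach_nonneg n hB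
  set r := ‖x‖ + reach n (typeOf (coordSymbol j)) + 1 with hr
  have h1 : 0 ≤ r := by have := norm_nonneg x; linarith
  rw [act_toFun, smoothMultiplier_eq hσ hB f.contDiff (r := r) (by linarith)]
  refine (congrFun (multiplier_coord (isCompact_closedBall 0 _)
    (isTestOn_cutoff_mul h1 le_rfl f.contDiff) j) x).trans ?_
  have h2 : cutoff r * f.toFun =ᶠ[𝓝 x] f.toFun := by
    have : ∀ᶠ y in 𝓝 x, ‖y‖ < r :=
      continuous_norm.continuousAt.eventually_lt continuousAt_const (by linarith)
    filter_upwards [this] with y hy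
    rw [Pi.mul_apply, cutoff_eq_one hy.le, one_mul]
  rw [h2.fderiv_eq]
  rfl

theorem tendsto_iff {n : ℕ} {ι : Type*} {l : Filter ι} {fs : ι → Smooth n} {f : Smooth n} :
    Filter.Tendsto fs l (𝓝 f) ↔ ∀ (k : ℕ) (r : ℝ), TendstoUniformlyOn
      (fun s => iteratedFDeriv ℝ k (fs s).toFun) (iteratedFDeriv ℝ k f.toFun) l
      (Metric.closedBall 0 r) := by
  have h1 : 𝓝 f = ⨅ k : ℕ, Filter.comap (iteratedDerivative k) (𝓝 (iteratedDerivative k f)) := by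
    refine nhds_iInf.trans ?_
    simp only [nhds_induced]
  rw [h1]
  simp only [Filter.tendsto_iInf, Filter.tendsto_comap_iff]
  refine forall_congr' fun k => ?_
  rw [ContinuousMap.tendsto_iff_forall_isCompact_tendstoUniformlyOn]
  constructor
  · intro h r
    exact h _ (isCompact_closedBall 0 r)
  · intro h K hK
    obtain ⟨r, hr⟩ := hK.isBounded.subset_closedBall 0
    exact (h r).mono hr

end Smooth

theorem exists_cutoff_mul_bound {n : ℕ} {R : ℝ} (hR : 0 ≤ R) (J : ℕ) :
    ∃ D, 0 ≤ D ∧ ∀ (g : Rn n → ℂ), ContDiff ℝ ∞ g → ∀ δ, 0 ≤ δ →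
      (∀ j ≤ J, ∀ x ∈ Metric.closedBall (0 : Rn n) (R + 1), ‖iteratedFDeriv ℝ j g x‖ ≤ δ) →
      ∀ j ≤ J, ∀ x, ‖iteratedFDeriv ℝ j (cutoff R * g) x‖ ≤ D * δ := by
  have h1 : ∀ j : ℕ, ∃ M, ∀ x ∈ Metric.closedBall (0 : Rn n) (R + 1),
      ‖iteratedFDeriv ℝ j (cutoff R : Rn n → ℂ) x‖ ≤ M := fun j =>
    (isCompact_closedBall 0 _).exists_bound_of_continuousOn
      ((contDiff_cutoff R).continuous_iteratedFDeriv (by exact_mod_cast le_top)).continuousOn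
  choose M hM using h1
  set M' := ∑ j ∈ Finset.range (J + 1), |M j| with hM'
  have hM'0 : 0 ≤ M' := Finset.sum_nonneg fun _ _ => abs_nonneg _
  have hMle : ∀ j ≤ J, M j ≤ M' := fun j hj => (le_abs_self _).trans
    (Finset.single_le_sum (f := fun j => |M j|) (fun _ _ => abs_nonneg _)
      (Finset.mem_range.2 (by omega)))
  refine ⟨2 ^ J * M', by positivity, fun g hg δ hδ h j hj x => ?_⟩
  by_cases hx : x ∈ Metric.closedBall (0 : Rn n) (R + 1)
  · refine (norm_iteratedFDeriv_mul_le (N := ∞) (contDiff_cutoff R) hg x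
      (by exact_mod_cast le_top)).trans ?_
    calc _ ≤ ∑ i ∈ Finset.range (j + 1), (j.choose i : ℝ) * M' * δ := by
          refine Finset.sum_le_sum fun i hi => ?_
          have hi' : i ≤ j := by have := Finset.mem_range.1 hi; omega
          have := (hM i x hx).trans (hMle i (hi'.trans hj))
          gcongr
          exact h (j - i) (by omega) x hx
      _ = 2 ^ j * M' * δ := by
          rw [← Finset.sum_mul, ← Finset.sum_mul]
          congr 2
          exact_mod_cast Nat.sum_range_choose j
      _ ≤ 2 ^ J * M' * δ := by
          gcongr
          norm_num
  · have ht := isTestOn_cutoff_mul hR le_rfl hg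
    have : iteratedFDeriv ℝ j (cutoff R * g) x = 0 := image_eq_zero_of_notMem_tsupport fun h' =>
      hx (ht.tsupport_subset (isCompact_closedBall 0 _) (tsupport_iteratedFDeriv_subset j h'))
    rw [this, norm_zero]
    positivity

/-! ### Continuity of the action on smooth functions -/

namespace Smooth

/-- The difference splits into `σ_s (u_s - u)`, controlled by multiplier bounds uniform in `s`, and
`(σ_s - σ) u`, controlled by dominated convergence. The common exponential type allows one cut-off
to serve all `s` on a given ball. -/
theorem tendsto_act {n : ℕ} {ι : Type*} {l : Filter ι} [l.IsCountablyGenerated]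
    {σs : ι → symbolAlgebra n} {σ : symbolAlgebra n} (h : DomTendsto σs l σ) {us : ι → Smooth n}
    {u : Smooth n} (hu : Filter.Tendsto us l (𝓝 u)) :
    Filter.Tendsto (fun s => act n (σs s) (us s)) l (𝓝 (act n σ u)) := by
  rw [tendsto_iff] at hu ⊢
  intro k r₀
  obtain ⟨⟨B, N, C, hB, hσ, hσs⟩, -⟩ := id h
  set r := max r₀ 0 with hr
  have hreach := reach_nonneg n hB
  have hr0 : 0 ≤ r := le_max_right _ _
  set R := r + reach n B + 1 with hR
  have hR0 : 0 ≤ R := by linarith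
  have hK := isCompact_closedBall (0 : Rn n) (R + 1)
  have hloc : ∀ τ : symbolAlgebra n, SymbolBound B N C τ → ∀ g : Smooth n,
      ∀ x ∈ Metric.closedBall (0 : Rn n) r₀, iteratedFDeriv ℝ k (act n τ g).toFun x =
        iteratedFDeriv ℝ k (multiplier τ.1 (cutoff R * g.toFun)) x := by
    intro τ hτ g x hx
    rw [act_toFun]
    refine (Filter.EventuallyEq.iteratedFDeriv ℝ
      (smoothMultiplier_eventuallyEq hτ hB g.contDiff ?_) k).eq_of_nhds
    rw [mem_closedBall_zero_iff] at hx
    have := le_max_left r₀ 0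
    linarith
  obtain ⟨e, he, hes⟩ := h.exists_multiplier_rate hK (isTestOn_cutoff_mul hR0 le_rfl u.contDiff) k
  obtain ⟨C', hC'0, hC'⟩ := exists_multiplier_bound hK N k
  set J := N + k + (n + 1) with hJ
  obtain ⟨D, hD0, hD⟩ := exists_cutoff_mul_bound (n := n) hR0 J
  have hC0 := hσ.growth.nonneg
  rw [Metric.tendstoUniformlyOn_iff]
  intro ε hε
  set δ := ε / (2 * (C' * C * D + 1)) with hδ
  have hden : 0 < C' * C * D + 1 := by positivity
  have hδ0 : 0 < δ := by positivity
  have hδε : C' * C * (D * δ) < ε / 2 := by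
    have : (C' * C * D + 1) * δ = ε / 2 := by rw [hδ]; field_simp
    nlinarith
  have hus : ∀ᶠ s in l, ∀ j ≤ J, ∀ x ∈ Metric.closedBall (0 : Rn n) (R + 1),
      ‖iteratedFDeriv ℝ j ((us s).toFun + (-1 : ℂ) • u.toFun) x‖ ≤ δ := by
    have : ∀ j ∈ Finset.range (J + 1), ∀ᶠ s in l, ∀ x ∈ Metric.closedBall (0 : Rn n) (R + 1),
        dist (iteratedFDeriv ℝ j u.toFun x) (iteratedFDeriv ℝ j (us s).toFun x) < δ := fun j _ =>
      Metric.tendstoUniformlyOn_iff.1 (hu j (R + 1)) δ hδ0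
    filter_upwards [(Filter.eventually_all_finset _).2 this] with s hs j hj x hx
    have h1 := hs j (Finset.mem_range.2 (by omega)) x hx
    have h2 : ContDiffAt ℝ j ((-1 : ℂ) • u.toFun) x :=
      (u.contDiff.const_smul (-1 : ℂ)).contDiffAt.of_le (by exact_mod_cast le_top)
    rw [iteratedFDeriv_add_apply ((us s).contDiff.contDiffAt.of_le (by exact_mod_cast le_top)) h2,
      iteratedFDeriv_const_smul_apply (u.contDiff.contDiffAt.of_le (by exact_mod_cast le_top)),
      neg_one_smul, ← sub_eq_add_neg, ← dist_eq_norm, dist_comm]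
    exact h1.le
  filter_upwards [hσs, hus, he.eventually_lt_const (half_pos hε)] with s hs hus' hes' x hx
  rw [hloc σ hσ u x hx, hloc (σs s) hs (us s) x hx]
  set w : Rn n → ℂ := (us s).toFun + (-1 : ℂ) • u.toFun with hw
  have hwc : ContDiff ℝ ∞ w := (us s).contDiff.add (u.contDiff.const_smul (-1 : ℂ))
  have e1 : multiplier (σs s).1 (cutoff R * (us s).toFun) =
      multiplier (σs s).1 (cutoff R * u.toFun) + multiplier (σs s).1 (cutoff R * w) := by
    rw [← multiplier_add_right hK (σs s).2.1 hs.growth (isTestOn_cutoff_mul hR0 le_rfl u.contDiff)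
      (isTestOn_cutoff_mul hR0 le_rfl hwc)]
    congr 1
    rw [hw, ← mul_add]
    congr 1
    ext y
    simp
  have c1 := contDiff_multiplier hK (σs s).2.1 hs.growth
    (isTestOn_cutoff_mul hR0 le_rfl u.contDiff)
  have c2 := contDiff_multiplier hK (σs s).2.1 hs.growth (isTestOn_cutoff_mul hR0 le_rfl hwc)
  rw [e1, iteratedFDeriv_add_apply (c1.contDiffAt.of_le (by exact_mod_cast le_top))
    (c2.contDiffAt.of_le (by exact_mod_cast le_top)), dist_comm, dist_eq_norm]
  have b1 := hC' C (σs s).1 _ (σs s).2.1 hs.growth (isTestOn_cutoff_mul hR0 le_rfl hwc) (D * δ)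
    (hD w hwc δ hδ0.le hus') x
  have b2 := hes s x
  calc _ = ‖(iteratedFDeriv ℝ k (multiplier (σs s).1 (cutoff R * u.toFun)) x -
        iteratedFDeriv ℝ k (multiplier σ.1 (cutoff R * u.toFun)) x) +
        iteratedFDeriv ℝ k (multiplier (σs s).1 (cutoff R * w)) x‖ := by congr 1; abel
    _ ≤ e s + C' * C * (D * δ) := (norm_add_le _ _).trans (add_le_add b2 b1)
    _ < ε := by linarith

theorem tendsto_add {n : ℕ} {ι : Type*} {l : Filter ι} {us vs : ι → Smooth n}
    {u v : Smooth n} (hu : Filter.Tendsto us l (𝓝 u)) (hv : Filter.Tendsto vs l (𝓝 v)) :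
    Filter.Tendsto (fun s => us s + vs s) l (𝓝 (u + v)) := by
  rw [tendsto_iff] at hu hv ⊢
  intro k r
  refine TendstoUniformlyOn.congr_right (TendstoUniformlyOn.congr ((hu k r).add (hv k r)) ?_) ?_
  · refine Filter.Eventually.of_forall fun s x _ => ?_
    exact (iteratedFDeriv_add_apply ((us s).contDiff.contDiffAt.of_le (by exact_mod_cast le_top))
      ((vs s).contDiff.contDiffAt.of_le (by exact_mod_cast le_top))).symm
  · intro x _
    exact (iteratedFDeriv_add_apply (u.contDiff.contDiffAt.of_le (by exact_mod_cast le_top))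
      (v.contDiff.contDiffAt.of_le (by exact_mod_cast le_top))).symm

instance (n : ℕ) : ContinuousAdd (Smooth n) :=
  ⟨continuous_iff_continuousAt.2 fun p => tendsto_add
    (continuous_fst.tendsto p) (continuous_snd.tendsto p)⟩

theorem tendsto_eval {n : ℕ} {ι : Type*} {l : Filter ι} {us : ι → Smooth n}
    {u : Smooth n} (hu : Filter.Tendsto us l (𝓝 u)) (x : Rn n) :
    Filter.Tendsto (fun s => (us s).toFun x) l (𝓝 (u.toFun x)) := by
  have h := ((tendsto_iff.1 hu) 0 ‖x‖).tendsto_at (x := x) (by simp)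
  have := ((continuousMultilinearCurryFin0 ℝ (Rn n) ℂ).continuous.tendsto _).comp h
  simpa [Function.comp_def] using this

end Smooth

/-- An action of the symbol algebra on a space of functions or distributions which is compatible
with the derivatives and with dominated convergence, and a separating family of functionals. -/
structure SymbolAction (n : ℕ) (X : Type*) [AddCommGroup X] [Module ℂ X] [Module ℝ X]
    [LineDeriv (Rn n) X X] [TopologicalSpace X] where
  /-- The action. -/
  act : symbolAlgebra n →ₐ[ℂ] Module.End ℂ X
  /-- The index set of the functionals. -/
  Index : Type
  /-- The functionals. -/
  functional : Index → X →ₗ[ℂ] ℂ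
  real_smul : ∀ (r : ℝ) (f : X), r • f = (r : ℂ) • f
  act_coord : ∀ i f, act (coordSymbol i) f = Dx i f
  tendsto_act : ∀ {l : Filter ℝ} [l.IsCountablyGenerated] {σs : ℝ → symbolAlgebra n}
    {σ : symbolAlgebra n} (f : X), DomTendsto σs l σ →
    Filter.Tendsto (fun s => act (σs s) f) l (𝓝 (act σ f))
  eq_zero : ∀ f, (∀ i, functional i f = 0) → f = 0
  -- Joint convergence is asked for only after pairing with a functional. This is all that the
  -- product rule in the uniqueness argument uses.
  tendsto_functional : ∀ {l : Filter ℝ} [l.IsCountablyGenerated] {σs : ℝ → symbolAlgebra n}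
    {σ : symbolAlgebra n} {us : ℝ → X} {u : X} (i : Index), DomTendsto σs l σ →
    Filter.Tendsto us l (𝓝 u) →
    Filter.Tendsto (fun s => functional i (act (σs s) (us s))) l (𝓝 (functional i (act σ u)))

/-- The action of symbols on smooth functions. -/
def smoothAction (n : ℕ) : SymbolAction n (Smooth n) where
  act := Smooth.act n
  Index := Rn n
  functional x :=
    { toFun f := f.toFun x
      map_add' _ _ := rfl
      map_smul' _ _ := rfl }
  real_smul _ _ := Smooth.ext (funext fun _ => Complex.real_smul)
  act_coord := Smooth.act_coordSymbol
  tendsto_act _ h := Smooth.tendsto_act h tendsto_const_nhds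
  eq_zero _ h := Smooth.ext (funext h)
  tendsto_functional x h hu := Smooth.tendsto_eval (Smooth.tendsto_act h hu) x

/-! ### Fourier multipliers as continuous operators on test functions -/

/-- Closed balls as compact sets. -/
def ballCompacts (n : ℕ) (r : ℝ) : Compacts (Rn n) :=
  ⟨Metric.closedBall 0 r, isCompact_closedBall 0 r⟩

theorem exists_isTestOn {n : ℕ} (φ : 𝓓((⊤ : Opens (Rn n)), ℂ)) :
    ∃ r, IsTestOn (Metric.closedBall 0 r) φ := by
  obtain ⟨r, hr⟩ := φ.hasCompactSupport.isCompact.isBounded.subset_closedBall 0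
  exact ⟨r, φ.contDiff, fun x hx => image_eq_zero_of_notMem_tsupport fun h => hx (hr h)⟩

theorem isTestOn_of_supportedIn {n : ℕ} {K : Compacts (Rn n)} (f : 𝓓_{K}(Rn n, ℂ)) :
    IsTestOn (K : Set (Rn n)) f := ⟨f.contDiff, fun _ hx => f.zero_on_compl hx⟩

theorem norm_iteratedFDeriv_le_sup {n : ℕ} {K : Compacts (Rn n)} {F : Type*}
    [NormedAddCommGroup F] [NormedSpace ℝ F] (𝕜 : Type*) [NontriviallyNormedField 𝕜]
    [NormedSpace 𝕜 F] [SMulCommClass ℝ 𝕜 F] (f : 𝓓_{K}(Rn n, F)) {J j : ℕ} (hj : j ≤ J)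
    (x : Rn n) :
    ‖iteratedFDeriv ℝ j f x‖ ≤ ((Finset.range (J + 1)).sup fun j => N[𝕜; F]_{K, j}) f :=
  (ContDiffMapSupportedIn.norm_iteratedFDeriv_apply_le_seminorm_top 𝕜).trans
    (Seminorm.le_finset_sup_apply (p := fun j => N[𝕜; F]_{K, j})
      (Finset.mem_range.2 (Nat.lt_succ_of_le hj)))

theorem exists_supported_multiplier_bound {n : ℕ} (K : Compacts (Rn n)) (N i : ℕ) :
    ∃ C', 0 ≤ C' ∧ ∀ (C : ℝ) (σ : Rn n → ℂ), Continuous σ → HasGrowth N C σ →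
      ∀ (f : 𝓓_{K}(Rn n, ℂ)) (x : Rn n), ‖iteratedFDeriv ℝ i (multiplier σ f) x‖ ≤
        C' * C * ((Finset.range (N + i + (n + 1) + 1)).sup fun j => N[ℂ; ℂ]_{K, j}) f := by
  obtain ⟨C', h0, h⟩ := exists_multiplier_bound K.isCompact N i
  exact ⟨C', h0, fun C σ hσ hσ' f x => h C σ f hσ hσ' (isTestOn_of_supportedIn f) _
    (fun j hj y => norm_iteratedFDeriv_le_sup ℂ f hj y) x⟩

/-- A Fourier multiplier as an operator on the test functions supported in a compact set. -/
def supportedMultiplier {n : ℕ} (σ : symbolAlgebra n) {K : Compacts (Rn n)} {r : ℝ}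
    (hr : (K : Set (Rn n)) ⊆ Metric.closedBall 0 r) :
    𝓓_{K}(Rn n, ℂ) →L[ℂ] 𝓓_{ballCompacts n (r + reach n (typeOf σ))}(Rn n, ℂ) :=
  ContDiffMapSupportedIn.mkCLM ℂ (fun f => multiplier σ.1 f)
    (fun f g x => by
      obtain ⟨N, C, hB, hσ⟩ := typeOf_spec σ
      exact congrFun (multiplier_add_right K.isCompact σ.2.1 hσ.growth (isTestOn_of_supportedIn f)
        (isTestOn_of_supportedIn g)) x)
    (fun c f x => congrFun (multiplier_smul_right σ.1 f c) x)
    (fun f => by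
      obtain ⟨N, C, hB, hσ⟩ := typeOf_spec σ
      exact contDiff_multiplier K.isCompact σ.2.1 hσ.growth (isTestOn_of_supportedIn f))
    (fun f x hx => by
      obtain ⟨N, C, hB, hσ⟩ := typeOf_spec σ
      exact (isTestOn_multiplier σ.2.1 hσ.growth hB hσ.sliceType
        ((isTestOn_of_supportedIn f).mono hr)).zero_of_notMem x hx)
    (fun i _ => by
      obtain ⟨N, C, hB, hσ⟩ := typeOf_spec σ
      obtain ⟨C', h0, h⟩ := exists_supported_multiplier_bound K N i
      exact ⟨_, C' * C, mul_nonneg h0 hσ.growth.nonneg,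
        fun f x _ => h C σ.1 σ.2.1 hσ.growth f x⟩)

theorem compacts_subset_closedBall {n : ℕ} (K : Compacts (Rn n)) :
    ∃ r, (K : Set (Rn n)) ⊆ Metric.closedBall 0 r :=
  K.isCompact.isBounded.subset_closedBall 0

/-- A Fourier multiplier as an operator on test functions. -/
def testMultiplier {n : ℕ} (σ : symbolAlgebra n) :
    𝓓((⊤ : Opens (Rn n)), ℂ) →L[ℂ] 𝓓((⊤ : Opens (Rn n)), ℂ) :=
  TestFunction.limitCLM ℂ
    (fun φ => ⟨multiplier σ.1 φ, by
        obtain ⟨r, hr⟩ := exists_isTestOn φ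
        obtain ⟨N, C, hB, hσ⟩ := typeOf_spec σ
        exact contDiff_multiplier (isCompact_closedBall 0 r) σ.2.1 hσ.growth hr, by
        obtain ⟨r, hr⟩ := exists_isTestOn φ
        obtain ⟨N, C, hB, hσ⟩ := typeOf_spec σ
        exact (isTestOn_multiplier σ.2.1 hσ.growth hB hσ.sliceType hr).hasCompactSupport
          (isCompact_closedBall 0 _), subset_univ _⟩)
    (fun K _ => (TestFunction.ofSupportedInCLM ℂ (subset_univ _)).comp
      (supportedMultiplier σ (compacts_subset_closedBall K).choose_spec))
    fun _ _ _ => rfl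

theorem testMultiplier_add {n : ℕ} (σ τ : symbolAlgebra n) (φ : 𝓓((⊤ : Opens (Rn n)), ℂ)) :
    testMultiplier (σ + τ) φ = testMultiplier σ φ + testMultiplier τ φ := by
  obtain ⟨r, hr⟩ := exists_isTestOn φ
  obtain ⟨N, C, hB, hσ⟩ := typeOf_spec σ
  obtain ⟨N', C', hB', hτ⟩ := typeOf_spec τ
  exact TestFunction.ext fun x => congrFun (multiplier_add_left (isCompact_closedBall 0 r) σ.2.1
    hσ.growth τ.2.1 hτ.growth hr) x

theorem testMultiplier_smul {n : ℕ} (c : ℂ) (σ : symbolAlgebra n)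
    (φ : 𝓓((⊤ : Opens (Rn n)), ℂ)) : testMultiplier (c • σ) φ = c • testMultiplier σ φ :=
  TestFunction.ext fun x => congrFun (multiplier_smul_left σ.1 φ c) x

theorem testMultiplier_one {n : ℕ} (φ : 𝓓((⊤ : Opens (Rn n)), ℂ)) : testMultiplier 1 φ = φ := by
  obtain ⟨r, hr⟩ := exists_isTestOn φ
  exact TestFunction.ext fun x => congrFun (multiplier_one (isCompact_closedBall 0 r) hr) x

theorem testMultiplier_mul {n : ℕ} (σ τ : symbolAlgebra n) (φ : 𝓓((⊤ : Opens (Rn n)), ℂ)) :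
    testMultiplier (σ * τ) φ = testMultiplier σ (testMultiplier τ φ) := by
  obtain ⟨r, hr⟩ := exists_isTestOn φ
  obtain ⟨N', C', hB', hτ⟩ := typeOf_spec τ
  exact TestFunction.ext fun x => congrFun (multiplier_mul (isCompact_closedBall 0 r)
    (isCompact_closedBall 0 _) τ.2.1 hτ.growth hr
    (isTestOn_multiplier τ.2.1 hτ.growth hB' hτ.sliceType hr)) x

-- The uniform exponential type puts the multipliers of `φ` for all admissible symbols into a single
-- space of test functions with support in a fixed ball, where convergence means uniform convergence
-- of each derivative. Symbols without the bound are sent to zero, which is eventually irrelevant.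
open Classical in
theorem tendsto_testMultiplier {n : ℕ} {ι : Type*} {l : Filter ι} [l.IsCountablyGenerated]
    {σs : ι → symbolAlgebra n} {σ : symbolAlgebra n} (h : DomTendsto σs l σ)
    (φ : 𝓓((⊤ : Opens (Rn n)), ℂ)) :
    Filter.Tendsto (fun s => testMultiplier (σs s) φ) l (𝓝 (testMultiplier σ φ)) := by
  obtain ⟨⟨B, N, C, hB, hσ, hσs⟩, -⟩ := id h
  obtain ⟨r, hr⟩ := exists_isTestOn φ
  set K := ballCompacts n (r + reach n B) with hK
  have ht : ∀ τ : symbolAlgebra n, SymbolBound B N C τ → IsTestOn (K : Set (Rn n))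
      (multiplier τ.1 φ) := fun τ hτ => isTestOn_multiplier τ.2.1 hτ.growth hB hτ.sliceType hr
  set g : symbolAlgebra n → 𝓓_{K}(Rn n, ℂ) := fun τ =>
    if hτ : SymbolBound B N C τ then ⟨multiplier τ.1 φ, (ht τ hτ).contDiff,
      fun x hx => (ht τ hτ).zero_of_notMem x hx⟩ else 0 with hg
  have hgc : ∀ τ, SymbolBound B N C τ → ⇑(g τ) = multiplier τ.1 φ := by
    intro τ hτ
    simp only [hg, dif_pos hτ]
    rfl
  have hgt : ∀ τ, SymbolBound B N C τ →
      TestFunction.ofSupportedIn (subset_univ _) (g τ) = testMultiplier τ φ := fun τ hτ =>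
    TestFunction.ext fun x => congrFun (hgc τ hτ) x
  have hlim : Filter.Tendsto (fun s => g (σs s)) l (𝓝 (g σ)) := by
    rw [(ContDiffMapSupportedIn.withSeminorms ℂ (Rn n) ℂ ⊤ K).tendsto_nhds]
    intro i ε hε
    obtain ⟨e, he, hes⟩ := h.exists_multiplier_rate (isCompact_closedBall 0 r) hr i
    filter_upwards [hσs, he.eventually_lt_const (half_pos hε)] with s hs hs'
    refine lt_of_le_of_lt ?_ (half_lt_self hε)
    refine (ContDiffMapSupportedIn.seminorm_top_le_iff ℂ (half_pos hε).le i _).2 fun x _ => ?_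
    have h1 : ⇑(g (σs s) - g σ) = multiplier (σs s).1 φ - multiplier σ.1 φ := by
      rw [← hgc _ hs, ← hgc _ hσ]
      rfl
    have h2 : ContDiffAt ℝ i (-multiplier σ.1 φ) x :=
      (ht _ hσ).contDiff.neg.contDiffAt.of_le (by exact_mod_cast le_top)
    rw [h1, sub_eq_add_neg, iteratedFDeriv_add_apply
      ((ht _ hs).contDiff.contDiffAt.of_le (by exact_mod_cast le_top)) h2, iteratedFDeriv_neg_apply, ← sub_eq_add_neg]
    exact (hes s x).trans hs'.le
  have hcont : Continuous (TestFunction.ofSupportedIn (subset_univ _) :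
      𝓓_{K}(Rn n, ℂ) → 𝓓((⊤ : Opens (Rn n)), ℂ)) := TestFunction.continuous_ofSupportedIn _
  have := (hcont.tendsto (g σ)).comp hlim
  rw [hgt σ hσ] at this
  refine this.congr' ?_
  filter_upwards [hσs] with s hs
  exact hgt _ hs

/-! ### Equicontinuous families of distributions -/

theorem exists_ofSupportedIn {n : ℕ} {F : Type*} [NormedAddCommGroup F] [NormedSpace ℝ F]
    (φ : 𝓓((⊤ : Opens (Rn n)), F)) : ∃ (K : Compacts (Rn n)) (f : 𝓓_{K}(Rn n, F)),
      TestFunction.ofSupportedIn (subset_univ _) f = φ :=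
  ⟨⟨tsupport φ, φ.hasCompactSupport⟩, .of_support_subset φ.contDiff subset_closure, rfl⟩

/-- The family is packaged into one linear map to bounded functions on `ι`. Its continuity can be
tested on each space of test functions with fixed compact support, and it is the equicontinuity of
the family. -/
theorem equicontinuous_of_supported_bound {n : ℕ} {ι : Type*}
    (F : ι → 𝓓((⊤ : Opens (Rn n)), ℝ) →L[ℝ] ℂ)
    (h : ∀ K : Compacts (Rn n), ∃ (s : Finset ℕ) (C : ℝ), 0 ≤ C ∧ ∀ (i : ι) (f : 𝓓_{K}(Rn n, ℝ)),
      ‖F i (TestFunction.ofSupportedIn (subset_univ _) f)‖ ≤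
        C * (s.sup fun j => N[ℝ; ℝ]_{K, j}) f) :
    Equicontinuous fun i => ⇑(F i) := by
  have hmem : ∀ φ : 𝓓((⊤ : Opens (Rn n)), ℝ), Memℓp (fun i => F i φ) ⊤ := by
    intro φ
    obtain ⟨K, f, rfl⟩ := exists_ofSupportedIn φ
    obtain ⟨s, C, hC, hb⟩ := h K
    rw [memℓp_infty_iff]
    exact ⟨_, by rintro _ ⟨i, rfl⟩; exact hb i f⟩
  let Φ : 𝓓((⊤ : Opens (Rn n)), ℝ) →L[ℝ] lp (fun _ : ι => ℂ) ⊤ :=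
    TestFunction.mkCLM ℝ (fun φ => ⟨fun i => F i φ, hmem φ⟩)
      (fun φ ψ => Subtype.ext (funext fun i => map_add (F i) φ ψ))
      (fun c φ => Subtype.ext (funext fun i => map_smul (F i) c φ))
      (fun K hK => by
        obtain ⟨s, C, hC, hb⟩ := h K
        exact (ContDiffMapSupportedIn.mkCLMtoNormedSpace ℝ
          (fun f : 𝓓_{K}(Rn n, ℝ) => (⟨fun i => F i (TestFunction.ofSupportedIn hK f),
            hmem _⟩ : lp (fun _ : ι => ℂ) ⊤))
          (fun f g => Subtype.ext (funext fun i => map_add (F i)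
            (TestFunction.ofSupportedIn hK f) (TestFunction.ofSupportedIn hK g)))
          (fun c f => Subtype.ext (funext fun i => map_smul (F i) c
            (TestFunction.ofSupportedIn hK f)))
          ⟨s, C, hC, fun f => lp.norm_le_of_forall_le (mul_nonneg hC (apply_nonneg _ _))
            fun i => hb i f⟩).continuous)
  intro φ
  refine Metric.equicontinuousAt_of_continuity_modulus (fun ψ => ‖Φ (φ - ψ)‖) ?_ _
    (Filter.Eventually.of_forall fun ψ i => ?_)
  · have : Continuous fun ψ => ‖Φ (φ - ψ)‖ := (Φ.continuous.comp (continuous_sub_left φ)).norm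
    have h2 := this.tendsto φ
    simpa using h2
  · rw [dist_eq_norm, ← map_sub]
    exact lp.norm_apply_le_norm (by simp) (Φ (φ - ψ)) i

theorem Distr.tendsto_iff {n : ℕ} {ι : Type*} {l : Filter ι} {Ts : ι → Distr n} {T : Distr n} :
    Filter.Tendsto Ts l (𝓝 T) ↔ ∀ S : Set 𝓓((⊤ : Opens (Rn n)), ℝ), IsCompact S →
      TendstoUniformlyOn (fun s => ⇑(Ts s)) (⇑T) l S :=
  UniformConvergenceCLM.tendsto_iff_tendstoUniformlyOn _ _ _

/-- On an equicontinuous family pointwise convergence is uniform on compact sets, and this is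
convergence in the topology of `Distr n`. -/
theorem Distr.tendsto_of_equicontinuous {n : ℕ} {ι : Type*} {l : Filter ι} {Ts : ι → Distr n}
    {T : Distr n} (h : Equicontinuous fun s => ⇑(Ts s))
    (ht : ∀ φ, Filter.Tendsto (fun s => Ts s φ) l (𝓝 (T φ))) : Filter.Tendsto Ts l (𝓝 T) := by
  rw [Distr.tendsto_iff]
  have := (EquicontinuousOn.tendsto_uniformOnFun_iff_pi
    (𝔖 := {S : Set 𝓓((⊤ : Opens (Rn n)), ℝ) | IsCompact S}) (fun _ h => h) sUnion_isCompact_eq_univ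
    (fun K _ => h.equicontinuousOn K) l (⇑T)).2 (tendsto_pi_nhds.2 ht)
  rw [UniformOnFun.tendsto_iff_tendstoUniformlyOn] at this
  exact this

/-- A convergent sequence of test functions together with its limit is compact, and the
distributions converge uniformly there. The filter must be countably generated for sequences to
suffice. -/
theorem Distr.tendsto_apply {n : ℕ} {ι : Type*} {l : Filter ι} [l.IsCountablyGenerated]
    {Ts : ι → Distr n} {T : Distr n} (h : Filter.Tendsto Ts l (𝓝 T))
    {φs : ι → 𝓓((⊤ : Opens (Rn n)), ℝ)} {φ : 𝓓((⊤ : Opens (Rn n)), ℝ)}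
    (hφ : Filter.Tendsto φs l (𝓝 φ)) : Filter.Tendsto (fun s => Ts s (φs s)) l (𝓝 (T φ)) := by
  refine Filter.tendsto_of_seq_tendsto fun x hx => ?_
  have h1 := hφ.comp hx
  have h2 := Distr.tendsto_iff.1 (h.comp hx) _ h1.isCompact_insert_range
  have h3 : Filter.Tendsto (fun k => T (φs (x k))) Filter.atTop (𝓝 (T φ)) :=
    ((ContinuousLinearMap.continuous (T : 𝓓((⊤ : Opens (Rn n)), ℝ) →L[ℝ] ℂ)).tendsto φ).comp h1
  rw [Metric.tendstoUniformlyOn_iff] at h2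
  rw [Metric.tendsto_atTop'] at h3 ⊢
  intro ε hε
  obtain ⟨N, hN⟩ := h3 (ε / 2) (half_pos hε)
  obtain ⟨N', hN'⟩ := Filter.eventually_atTop.1 (h2 (ε / 2) (half_pos hε))
  refine ⟨max N N', fun k hk => ?_⟩
  have a1 := hN k (lt_of_le_of_lt (le_max_left _ _) hk)
  have a2 := hN' k ((le_max_right _ _).trans hk.le) (φs (x k)) (mem_insert_of_mem _ ⟨k, rfl⟩)
  rw [dist_comm] at a2
  have := dist_triangle (Ts (x k) (φs (x k))) (T (φs (x k))) (T φ)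
  simp only [Function.comp] at a2 ⊢
  linarith

/-! ### Transposed multipliers on distributions -/

namespace Distr

variable {n : ℕ}

/-- The real part of a test function. -/
def rePart : 𝓓((⊤ : Opens (Rn n)), ℂ) →L[ℝ] 𝓓((⊤ : Opens (Rn n)), ℝ) :=
  TestFunction.postcompCLM Complex.reCLM

/-- The imaginary part of a test function. -/
def imPart : 𝓓((⊤ : Opens (Rn n)), ℂ) →L[ℝ] 𝓓((⊤ : Opens (Rn n)), ℝ) :=
  TestFunction.postcompCLM Complex.imCLM

/-- Real valued test functions as complex valued ones. -/
def ofRealTest : 𝓓((⊤ : Opens (Rn n)), ℝ) →L[ℝ] 𝓓((⊤ : Opens (Rn n)), ℂ) :=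
  TestFunction.postcompCLM Complex.ofRealCLM

theorem rePart_ofRealTest (φ : 𝓓((⊤ : Opens (Rn n)), ℝ)) : rePart (ofRealTest φ) = φ :=
  TestFunction.ext fun _ => rfl

theorem imPart_ofRealTest (φ : 𝓓((⊤ : Opens (Rn n)), ℝ)) : imPart (ofRealTest φ) = 0 :=
  TestFunction.ext fun _ => rfl

theorem rePart_add_imPart (ψ : 𝓓((⊤ : Opens (Rn n)), ℂ)) :
    ofRealTest (rePart ψ) + Complex.I • ofRealTest (imPart ψ) = ψ :=
  TestFunction.ext fun x => by
    change ((ψ x).re : ℂ) + Complex.I * ((ψ x).im : ℂ) = ψ x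
    rw [mul_comm]
    exact Complex.re_add_im _

theorem rePart_smul (c : ℂ) (ψ : 𝓓((⊤ : Opens (Rn n)), ℂ)) :
    rePart (c • ψ) = c.re • rePart ψ - c.im • imPart ψ :=
  TestFunction.ext fun x => Complex.mul_re c (ψ x)

theorem imPart_smul (c : ℂ) (ψ : 𝓓((⊤ : Opens (Rn n)), ℂ)) :
    imPart (c • ψ) = c.re • imPart ψ + c.im • rePart ψ :=
  TestFunction.ext fun x => Complex.mul_im c (ψ x)

/-- The complex linear extension of a distribution to complex valued test functions. -/
def complexify (T : Distr n) : 𝓓((⊤ : Opens (Rn n)), ℂ) →L[ℝ] ℂ :=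
  (T : 𝓓((⊤ : Opens (Rn n)), ℝ) →L[ℝ] ℂ).comp rePart +
    Complex.I • (T : 𝓓((⊤ : Opens (Rn n)), ℝ) →L[ℝ] ℂ).comp imPart

theorem complexify_apply (T : Distr n) (ψ : 𝓓((⊤ : Opens (Rn n)), ℂ)) :
    complexify T ψ = T (rePart ψ) + Complex.I * T (imPart ψ) := rfl

theorem complexify_ofRealTest (T : Distr n) (φ : 𝓓((⊤ : Opens (Rn n)), ℝ)) :
    complexify T (ofRealTest φ) = T φ := by
  rw [complexify_apply, rePart_ofRealTest, imPart_ofRealTest, map_zero, mul_zero, add_zero]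

theorem complexify_smul (T : Distr n) (c : ℂ) (ψ : 𝓓((⊤ : Opens (Rn n)), ℂ)) :
    complexify T (c • ψ) = c * complexify T ψ := by
  have e : (c.re : ℂ) + c.im * Complex.I = c := Complex.re_add_im c
  simp only [complexify_apply, rePart_smul, imPart_smul, map_add, map_sub, map_smul,
    Complex.real_smul]
  generalize T (rePart ψ) = a
  generalize T (imPart ψ) = b
  linear_combination (a + Complex.I * b) * e - (c.im : ℂ) * b * Complex.I_mul_I

/-- The transpose of a Fourier multiplier. -/
def symbolMul (σ : symbolAlgebra n) (T : Distr n) : Distr n :=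
  ((complexify T).comp ((testMultiplier (reflect σ)).restrictScalars ℝ)).comp ofRealTest

theorem symbolMul_apply (σ : symbolAlgebra n) (T : Distr n) (φ : 𝓓((⊤ : Opens (Rn n)), ℝ)) :
    symbolMul σ T φ = complexify T (testMultiplier (reflect σ) (ofRealTest φ)) := rfl

theorem complexify_symbolMul (σ : symbolAlgebra n) (T : Distr n) (ψ : 𝓓((⊤ : Opens (Rn n)), ℂ)) :
    complexify (symbolMul σ T) ψ = complexify T (testMultiplier (reflect σ) ψ) := by
  rw [complexify_apply, symbolMul_apply, symbolMul_apply, ← complexify_smul, ← map_add, ← map_smul,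
    ← map_add, rePart_add_imPart]

/-- Symbols act on distributions. -/
def act (n : ℕ) : symbolAlgebra n →ₐ[ℂ] Module.End ℂ (Distr n) :=
  AlgHom.ofLinearMap
    { toFun σ :=
        { toFun := symbolMul σ
          map_add' S T := by
            ext φ
            change (S + T) _ + Complex.I * (S + T) _ = S _ + Complex.I * S _ + (T _ + Complex.I * T _)
            change S _ + T _ + Complex.I * (S _ + T _) = _
            ring
          map_smul' c T := by
            ext φ
            change c * T _ + Complex.I * (c * T _) = c * (T _ + Complex.I * T _)
            ring }
      map_add' σ τ := by
        refine LinearMap.ext fun T => ?_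
        ext φ
        change symbolMul (σ + τ) T φ = symbolMul σ T φ + symbolMul τ T φ
        rw [symbolMul_apply, map_add, testMultiplier_add, map_add]
        rfl
      map_smul' c σ := by
        refine LinearMap.ext fun T => ?_
        ext φ
        change symbolMul (c • σ) T φ = c * symbolMul σ T φ
        rw [symbolMul_apply, map_smul, testMultiplier_smul, complexify_smul]
        rfl }
    (by
      refine LinearMap.ext fun T => ?_
      ext φ
      change symbolMul 1 T φ = T φ
      rw [symbolMul_apply, map_one, testMultiplier_one, complexify_ofRealTest])
    fun σ τ => by
      refine LinearMap.ext fun T => ?_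
      ext φ
      change symbolMul (σ * τ) T φ = symbolMul σ (symbolMul τ T) φ
      rw [symbolMul_apply, symbolMul_apply, complexify_symbolMul, ← testMultiplier_mul, map_mul,
        mul_comm]

theorem act_apply (σ : symbolAlgebra n) (T : Distr n) (φ : 𝓓((⊤ : Opens (Rn n)), ℝ)) :
    act n σ T φ = complexify T (testMultiplier (reflect σ) (ofRealTest φ)) := rfl

theorem fderiv_ofReal_comp (φ : 𝓓((⊤ : Opens (Rn n)), ℝ)) (x v : Rn n) :
    fderiv ℝ (ofRealTest φ) x v = ((fderiv ℝ φ x v : ℝ) : ℂ) := by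
  have hd : DifferentiableAt ℝ φ x := (φ.contDiff.differentiable (by simp)) x
  have := (Complex.ofRealCLM.hasFDerivAt.comp x hd.hasFDerivAt).fderiv
  change fderiv ℝ (Complex.ofRealCLM ∘ φ) x v = _
  rw [this]
  rfl

/-- Reflection turns `ξ_j` into `-ξ_j`; this is the sign in the definition of the derivative of a
distribution. -/
theorem act_coordSymbol (j : Fin n) (T : Distr n) : act n (coordSymbol j) T = Dx j T := by
  ext φ
  have h1 : testMultiplier (reflect (coordSymbol j)) (ofRealTest φ) =
      Complex.I • ofRealTest (LineDeriv.lineDerivOp (unitVec j) φ) := by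
    obtain ⟨r, hr⟩ := exists_isTestOn (ofRealTest φ)
    have h2 : reflect (coordSymbol j) = (-1 : ℂ) • coordSymbol j := by
      refine Subtype.ext (funext fun ξ => ?_)
      change (((-ξ) j : ℝ) : ℂ) = (-1 : ℂ) * ((ξ j : ℝ) : ℂ)
      simp
    rw [h2, testMultiplier_smul]
    refine TestFunction.ext fun x => ?_
    have h3 := congrFun (multiplier_coord (isCompact_closedBall 0 r) hr j) x
    have hd : DifferentiableAt ℝ φ x := (φ.contDiff.differentiable (by simp)) x
    have h4 : (LineDeriv.lineDerivOp (unitVec j) φ) x = fderiv ℝ φ x (unitVec j) := by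
      rw [TestFunction.lineDerivOp_eq_lineDerivCLM ℝ, TestFunction.lineDerivCLM_apply_of_le,
        hd.lineDeriv_eq_fderiv]
      simp
    change (-1 : ℂ) * multiplier _ _ x =
      Complex.I * (((LineDeriv.lineDerivOp (unitVec j) φ) x : ℝ) : ℂ)
    refine (congrArg ((-1 : ℂ) * ·) h3).trans ?_
    rw [fderiv_ofReal_comp, h4]
    ring
  rw [act_apply, h1, complexify_smul, complexify_ofRealTest]
  change _ = (-Complex.I) * (LineDeriv.lineDerivOp (unitVec j) T) φ
  rw [Distribution.lineDerivOp_apply_apply, map_neg]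
  ring

/-- A distribution has finite order on each compact set: a continuous seminorm is dominated by
finitely many of the defining ones. -/
theorem exists_complexify_bound (T : Distr n) (K : Compacts (Rn n)) :
    ∃ (s : Finset ℕ) (C : ℝ), 0 ≤ C ∧ ∀ f : 𝓓_{K}(Rn n, ℂ),
      ‖complexify T (TestFunction.ofSupportedIn (subset_univ _) f)‖ ≤
        C * (s.sup fun j => N[ℝ; ℂ]_{K, j}) f := by
  have hcont : Continuous (TestFunction.ofSupportedIn (subset_univ _) :
      𝓓_{K}(Rn n, ℂ) → 𝓓((⊤ : Opens (Rn n)), ℂ)) := TestFunction.continuous_ofSupportedIn _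
  let L : 𝓓_{K}(Rn n, ℂ) →ₗ[ℝ] ℂ := (complexify T).toLinearMap.comp
    (TestFunction.ofSupportedInCLM ℝ (Ω := ⊤) (subset_univ _)).toLinearMap
  have hL : Continuous ((normSeminorm ℝ ℂ).comp L) :=
    continuous_norm.comp ((complexify T).continuous.comp hcont)
  obtain ⟨s, C, -, h⟩ := Seminorm.bound_of_continuous
    (ContDiffMapSupportedIn.withSeminorms ℝ (Rn n) ℂ ⊤ K) _ hL
  exact ⟨s, C, C.2, fun f => h f⟩

end Distr

namespace Distr

variable {n : ℕ}

/-- The transposed multipliers send test functions on `K` to test functions on one larger ball, with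
seminorm bounds uniform in `s`; on that ball `T` has finite order. -/
theorem equicontinuous_act {ι : Type*} {B : ℝ} {N : ℕ} {C : ℝ} (hB : 0 ≤ B)
    (σs : ι → symbolAlgebra n) (h : ∀ s, SymbolBound B N C (σs s)) (T : Distr n) :
    Equicontinuous fun s => ⇑(act n (σs s) T) := by
  refine equicontinuous_of_supported_bound
    (fun s => (act n (σs s) T : 𝓓((⊤ : Opens (Rn n)), ℝ) →L[ℝ] ℂ)) fun K => ?_
  obtain ⟨r, hr⟩ := compacts_subset_closedBall K
  obtain ⟨S, C₁, hC₁, hT⟩ := exists_complexify_bound T (ballCompacts n (r + reach n B))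
  choose C' hC'0 hC' using fun i : ℕ => exists_multiplier_bound K.isCompact N i
  set J := N + S.sup id + (n + 1) with hJ
  refine ⟨Finset.range (J + 1), C₁ * ((∑ i ∈ S, C' i) * |C|), by
    have := Finset.sum_nonneg fun i (_ : i ∈ S) => hC'0 i
    positivity, fun s f => ?_⟩
  have hσ : SymbolBound B N C (reflect (σs s)) :=
    ⟨fun ξ => by
      have := (h s).growth (-ξ)
      rw [norm_neg] at this
      exact this, (h s).sliceType.comp_neg⟩
  set f' : 𝓓_{K}(Rn n, ℂ) := ContDiffMapSupportedIn.postcompLM Complex.ofRealCLM f with hf'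
  have ht := isTestOn_of_supportedIn f'
  have ht' := isTestOn_multiplier (reflect (σs s)).2.1 hσ.growth hB hσ.sliceType (ht.mono hr)
  set g : 𝓓_{ballCompacts n (r + reach n B)}(Rn n, ℂ) := ⟨multiplier (reflect (σs s)).1 f',
    ht'.contDiff, fun x hx => ht'.zero_of_notMem x hx⟩ with hg
  have e1 : act n (σs s) T (TestFunction.ofSupportedIn (subset_univ _) f) =
      complexify T (TestFunction.ofSupportedIn (subset_univ _) g) := by
    rw [act_apply]
    congr 1
  refine (congrArg norm e1).trans_le ((hT g).trans ?_)
  rw [mul_assoc]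
  gcongr
  have hM0 : 0 ≤ ((Finset.range (J + 1)).sup fun j => N[ℝ; ℝ]_{K, j}) f := apply_nonneg _ _
  have hS0 := Finset.sum_nonneg fun i (_ : i ∈ S) => hC'0 i
  refine Seminorm.finset_sup_apply_le (by positivity) fun i hi => ?_
  refine (ContDiffMapSupportedIn.seminorm_top_le_iff ℝ (by positivity) i g).2 fun x _ => ?_
  have hi' : i ≤ S.sup id := Finset.le_sup (f := id) hi
  refine (hC' i C _ f' (reflect (σs s)).2.1 hσ.growth ht
    (((Finset.range (J + 1)).sup fun j => N[ℝ; ℝ]_{K, j}) f) (fun j hj y => ?_) x).trans ?_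
  · refine (ContDiffMapSupportedIn.norm_iteratedFDeriv_apply_le_seminorm_top ℝ).trans ?_
    refine (ContDiffMapSupportedIn.seminorm_postcompLM_le ℝ Complex.ofRealCLM f).trans ?_
    rw [Complex.ofRealCLM_norm, one_mul]
    exact Seminorm.le_finset_sup_apply (p := fun j => N[ℝ; ℝ]_{K, j})
      (Finset.mem_range.2 (by omega))
  · have h1 := Finset.single_le_sum (f := C') (fun i _ => hC'0 i) hi
    have h2 := le_abs_self C
    have h3 := hσ.growth.nonneg
    gcongr

open Classical in
theorem tendsto_act {ι : Type*} {l : Filter ι} [l.IsCountablyGenerated]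
    {σs : ι → symbolAlgebra n} {σ : symbolAlgebra n} (h : DomTendsto σs l σ) (T : Distr n) :
    Filter.Tendsto (fun s => act n (σs s) T) l (𝓝 (act n σ T)) := by
  obtain ⟨⟨B, N, C, hB, hσ, hσs⟩, hpt⟩ := id h
  -- Replacing the symbols that violate the bound by the limit changes nothing eventually, and it
  -- makes the family equicontinuous over all indices.
  set τs : ι → symbolAlgebra n := fun s => if SymbolBound B N C (σs s) then σs s else σ with hτs
  have heq : ∀ᶠ s in l, τs s = σs s := hσs.mono fun s hs => if_pos hs
  have hb : ∀ s, SymbolBound B N C (τs s) := by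
    intro s
    simp only [hτs]
    split_ifs with hs
    exacts [hs, hσ]
  have hτ : DomTendsto τs l σ := ⟨⟨B, N, C, hB, hσ, Filter.Eventually.of_forall hb⟩,
    fun ξ => (hpt ξ).congr' (heq.mono fun s hs => by simp only [hs])⟩
  have hlim : Filter.Tendsto (fun s => act n (τs s) T) l (𝓝 (act n σ T)) := by
    refine tendsto_of_equicontinuous (equicontinuous_act hB τs hb T) fun φ => ?_
    exact ((complexify T).continuous.tendsto _).comp
      (tendsto_testMultiplier hτ.reflect (ofRealTest φ))
  exact hlim.congr' (heq.mono fun s hs => by simp only [hs])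

theorem tendsto_act_apply {ι : Type*} {l : Filter ι} [l.IsCountablyGenerated]
    {σs : ι → symbolAlgebra n} {σ : symbolAlgebra n} (h : DomTendsto σs l σ) {Ts : ι → Distr n}
    {T : Distr n} (hT : Filter.Tendsto Ts l (𝓝 T)) (φ : 𝓓((⊤ : Opens (Rn n)), ℝ)) :
    Filter.Tendsto (fun s => act n (σs s) (Ts s) φ) l (𝓝 (act n σ T φ)) := by
  have h1 := tendsto_testMultiplier h.reflect (ofRealTest φ)
  simp only [act_apply, complexify_apply]
  exact (tendsto_apply hT ((rePart.continuous.tendsto _).comp h1)).add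
    ((tendsto_apply hT ((imPart.continuous.tendsto _).comp h1)).const_mul Complex.I)

end Distr

/-- The action of symbols on distributions. -/
def distrAction (n : ℕ) : SymbolAction n (Distr n) where
  act := Distr.act n
  Index := 𝓓((⊤ : Opens (Rn n)), ℝ)
  functional φ :=
    { toFun T := T φ
      map_add' _ _ := rfl
      map_smul' _ _ := rfl }
  real_smul r T := by
    ext φ
    exact Complex.real_smul
  act_coord := Distr.act_coordSymbol
  tendsto_act T h := Distr.tendsto_act h T
  eq_zero T h := by
    ext φ
    exact h φ
  tendsto_functional φ h hT := Distr.tendsto_act_apply h hT φ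

/-! ### Linear differential equations depending on a parameter -/

theorem continuous_op_neg {𝔸 P : Type*} [NormedRing 𝔸] [TopologicalSpace P] {L : ℝ → P → 𝔸}
    (hL : Continuous (Function.uncurry L)) :
    Continuous (Function.uncurry fun s p => MulOpposite.op (-L s p)) :=
  MulOpposite.continuous_op.comp hL.neg

theorem exists_bound_op_neg {𝔸 P : Type*} [NormedRing 𝔸] [TopologicalSpace P] {L : ℝ → P → 𝔸}
    (hb : ∀ K : Set P, IsCompact K → ∃ M, ∀ s, ∀ p ∈ K, ‖L s p‖ ≤ M) (K : Set P)
    (hK : IsCompact K) : ∃ M, ∀ s, ∀ p ∈ K, ‖MulOpposite.op (-L s p)‖ ≤ M := by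
  obtain ⟨M, hM⟩ := hb K hK
  exact ⟨M, fun s p hp => by rw [MulOpposite.norm_op, norm_neg]; exact hM s p hp⟩

section Dyson

variable {𝔸 P : Type*} [NormedRing 𝔸] [NormedAlgebra ℂ 𝔸]

/-- The terms of the Dyson series of the equation `S' = L S`, `S(0) = 1`. -/
def dyson (L : ℝ → P → 𝔸) : ℕ → ℝ → P → 𝔸
  | 0, _, _ => 1
  | k + 1, t, p => ∫ s in (0 : ℝ)..t, L s p * dyson L k s p

theorem dyson_succ (L : ℝ → P → 𝔸) (k : ℕ) (t : ℝ) (p : P) :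
    dyson L (k + 1) t p = ∫ s in (0 : ℝ)..t, L s p * dyson L k s p := rfl

/-- Time reversal, which reduces estimates at negative times to positive ones. -/
theorem dyson_neg (L : ℝ → P → 𝔸) (k : ℕ) (t : ℝ) (p : P) :
    dyson L k (-t) p = dyson (fun s p => -L (-s) p) k t p := by
  induction k generalizing t with
  | zero => rfl
  | succ k ih =>
    rw [dyson_succ, dyson_succ]
    simp only [← ih]
    have := intervalIntegral.integral_comp_neg (a := 0) (b := t) fun s => L s p * dyson L k s p
    rw [neg_zero] at this
    rw [intervalIntegral.integral_symm, ← this, ← intervalIntegral.integral_neg]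
    simp only [neg_mul]

theorem continuous_dyson [TopologicalSpace P] {L : ℝ → P → 𝔸} (hL : Continuous (Function.uncurry L)) (k : ℕ) :
    Continuous (Function.uncurry (dyson L k)) := by
  induction k with
  | zero => exact continuous_const
  | succ k ih =>
    have h : Continuous fun q : (ℝ × P) × ℝ => L q.2 q.1.2 * dyson L k q.2 q.1.2 :=
      (hL.comp (by fun_prop : Continuous fun q : (ℝ × P) × ℝ => (q.2, q.1.2))).mul
        (ih.comp (by fun_prop : Continuous fun q : (ℝ × P) × ℝ => (q.2, q.1.2)))
    exact intervalIntegral.continuous_parametric_intervalIntegral_of_continuous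
      (f := fun (q : ℝ × P) s => L s q.2 * dyson L k s q.2) h continuous_fst

/-- The iterated integral over a simplex yields the factorial. The factor `‖(1 : 𝔸)‖` is kept
because the norm of the unit is not normalised. -/
theorem norm_dyson_le_of_nonneg {L : ℝ → P → 𝔸} {p : P}
    {M : ℝ} (hM : ∀ s, ‖L s p‖ ≤ M) (k : ℕ) {t : ℝ} (ht : 0 ≤ t) :
    ‖dyson L k t p‖ ≤ ‖(1 : 𝔸)‖ * ((M * t) ^ k / k.factorial) := by
  have hM0 : 0 ≤ M := (norm_nonneg _).trans (hM 0)
  induction k generalizing t with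
  | zero => simp [dyson]
  | succ k ih =>
    rw [dyson_succ]
    have h1 : ∀ s ∈ Ioc 0 t, ‖L s p * dyson L k s p‖ ≤
        M ^ (k + 1) / k.factorial * ‖(1 : 𝔸)‖ * s ^ k := by
      intro s hs
      calc _ ≤ M * (‖(1 : 𝔸)‖ * ((M * s) ^ k / k.factorial)) :=
            (norm_mul_le _ _).trans (mul_le_mul (hM s) (ih hs.1.le) (norm_nonneg _) hM0)
        _ = _ := by rw [mul_pow, pow_succ]; ring
    refine (intervalIntegral.norm_integral_le_of_norm_le ht
      (Filter.Eventually.of_forall h1) (Continuous.intervalIntegrable (by fun_prop) _ _)).trans_eq ?_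
    rw [intervalIntegral.integral_const_mul, integral_pow, Nat.factorial_succ]
    push_cast
    rw [zero_pow (Nat.succ_ne_zero k), sub_zero, mul_pow]
    field_simp

theorem norm_dyson_le {L : ℝ → P → 𝔸} {p : P}
    {M : ℝ} (hM : ∀ s, ‖L s p‖ ≤ M) (k : ℕ) (t : ℝ) :
    ‖dyson L k t p‖ ≤ ‖(1 : 𝔸)‖ * ((M * |t|) ^ k / k.factorial) := by
  rcases le_total 0 t with ht | ht
  · rw [abs_of_nonneg ht]
    exact norm_dyson_le_of_nonneg hM k ht
  · rw [abs_of_nonpos ht]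
    have := norm_dyson_le_of_nonneg (L := fun s p => -L (-s) p) (p := p) (M := M)
      (fun s => by simpa using hM (-s)) k (t := -t) (by linarith)
    rwa [← dyson_neg, neg_neg] at this

theorem summable_dyson_bound (c x : ℝ) :
    Summable fun k : ℕ => c * (x ^ k / k.factorial) :=
  (Real.summable_pow_div_factorial x).mul_left c

theorem summable_dyson [CompleteSpace 𝔸] {L : ℝ → P → 𝔸} {p : P}
    {M : ℝ} (hM : ∀ s, ‖L s p‖ ≤ M) (t : ℝ) : Summable fun k => dyson L k t p :=
  Summable.of_norm_bounded (summable_dyson_bound _ _) fun k => norm_dyson_le hM k t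

/-- The solution of `S' = L S`, `S(0) = 1`. -/
def propagator (L : ℝ → P → 𝔸) (t : ℝ) (p : P) : 𝔸 := ∑' k, dyson L k t p

theorem propagator_zero (L : ℝ → P → 𝔸) (p : P) : propagator L 0 p = 1 := by
  rw [propagator, tsum_eq_single 0]
  · rfl
  · intro k hk
    obtain ⟨j, rfl⟩ := Nat.exists_eq_succ_of_ne_zero hk
    rw [dyson_succ, intervalIntegral.integral_same]

/-! ### Dependence of the propagator on time and on the parameter -/

section Continuity

variable [TopologicalSpace P]

theorem hasDerivAt_propagator [CompleteSpace 𝔸] {L : ℝ → P → 𝔸}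
    (hL : Continuous (Function.uncurry L)) {p : P}
    {M : ℝ} (hM : ∀ s, ‖L s p‖ ≤ M) (t : ℝ) :
    HasDerivAt (fun s => propagator L s p) (L t p * propagator L t p) t := by
  have hM0 : 0 ≤ M := (norm_nonneg _).trans (hM 0)
  have hLp : Continuous fun s => L s p := hL.comp (by fun_prop : Continuous fun s : ℝ => (s, p))
  have hD : ∀ k, Continuous fun s => dyson L k s p := fun k =>
    (continuous_dyson hL k).comp (by fun_prop : Continuous fun s : ℝ => (s, p))
  -- Differentiating a term of the series gives `L` times the previous term, hence the shifted
  -- exponents `k - 1` in the summable bound; for `k = 0` the truncated difference only bounds the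
  -- derivative zero.
  set g' : ℕ → ℝ → 𝔸 := fun k s => match k with
    | 0 => 0
    | k + 1 => L s p * dyson L k s p with hg'
  set ρ := |t| + 1 with hρ
  have h := hasDerivAt_tsum_of_isPreconnected (𝕜 := ℝ) (t := Metric.ball 0 ρ)
    (g := fun k s => dyson L k s p) (g' := g')
    (u := fun k => M * (‖(1 : 𝔸)‖ * ((M * ρ) ^ (k - 1) / (k - 1).factorial))) (y₀ := 0) (y := t)
    ?_ Metric.isOpen_ball (convex_ball _ _).isPreconnected ?_ ?_ (by simp [hρ]; positivity)
    (summable_dyson hM 0) (by simp [hρ])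
  · have e : ∑' k, g' k t = L t p * propagator L t p := by
      have hs : Summable fun k => g' k t := by
        rw [← summable_nat_add_iff 1]
        exact (summable_dyson hM t).mul_left (L t p)
      rw [hs.tsum_eq_zero_add]
      simp only [hg', zero_add]
      exact (summable_dyson hM t).tsum_mul_left (L t p)
    rw [← e]
    exact h
  · rw [← summable_nat_add_iff 1]
    exact (summable_dyson_bound _ _).mul_left M
  · intro k s _
    cases k with
    | zero => exact hasDerivAt_const s (1 : 𝔸)
    | succ k =>
      exact intervalIntegral.integral_hasDerivAt_right
        ((hLp.mul (hD k)).intervalIntegrable _ _)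
        ((hLp.mul (hD k)).stronglyMeasurableAtFilter _ _) (hLp.mul (hD k)).continuousAt
  · intro k s hs
    have hs' : |s| ≤ ρ := (mem_ball_zero_iff.1 hs).le
    cases k with
    | zero => simp only [hg', norm_zero]; positivity
    | succ k =>
      refine (norm_mul_le _ _).trans (mul_le_mul (hM s) ((norm_dyson_le hM k s).trans ?_)
        (norm_nonneg _) hM0)
      simp only [Nat.add_sub_cancel]
      gcongr

theorem continuous_propagator [CompleteSpace 𝔸] [LocallyCompactSpace P] {L : ℝ → P → 𝔸}
    (hL : Continuous (Function.uncurry L))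
    (hb : ∀ K : Set P, IsCompact K → ∃ M, ∀ s, ∀ p ∈ K, ‖L s p‖ ≤ M) (t : ℝ) :
    Continuous fun p => propagator L t p := by
  rw [continuous_iff_continuousAt]
  intro p₀
  obtain ⟨K, hK, hKp⟩ := exists_compact_mem_nhds p₀
  obtain ⟨M, hM⟩ := hb K hK
  refine ContinuousOn.continuousAt ?_ hKp
  exact continuousOn_tsum (fun k => ((continuous_dyson hL k).comp
    (by fun_prop : Continuous fun p : P => (t, p))).continuousOn)
    (summable_dyson_bound ‖(1 : 𝔸)‖ (M * |t|)) fun k p hp => norm_dyson_le (fun s => hM s p hp) k t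

theorem differentiable_dyson [CompleteSpace 𝔸] {L : ℝ → P → 𝔸}
    (hL : Continuous (Function.uncurry L)) {q : ℂ → P}
    (hq : Continuous q) (hd : ∀ s, Differentiable ℂ fun z => L s (q z)) (k : ℕ) (t : ℝ) :
    Differentiable ℂ fun z => dyson L k t (q z) := by
  induction k generalizing t with
  | zero => exact differentiable_const _
  | succ k ih =>
    have hF : Continuous (Function.uncurry fun (s : ℝ) (z : ℂ) => L s (q z) * dyson L k s (q z)) := by
      have h1 : Continuous fun x : ℝ × ℂ => (x.1, q x.2) := by fun_prop
      exact (hL.comp h1).mul ((continuous_dyson hL k).comp h1)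
    have key : ∀ a b : ℝ, a ≤ b →
        Differentiable ℂ fun z => ∫ s in a..b, L s (q z) * dyson L k s (q z) := by
      intro a b hab
      simp only [intervalIntegral.integral_of_le hab, ← MeasureTheory.integral_Icc_eq_integral_Ioc]
      exact differentiable_setIntegral isCompact_Icc measurableSet_Icc hF fun s => (hd s).mul (ih s)
    simp only [dyson_succ]
    rcases le_total 0 t with ht | ht
    · exact key 0 t ht
    · simp only [intervalIntegral.integral_symm t 0]
      exact (key t 0 ht).neg

/-- The Dyson series converges uniformly on bounded sets of `z`, so holomorphy passes from its terms
to the sum. -/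
theorem differentiable_propagator [CompleteSpace 𝔸] {L : ℝ → P → 𝔸}
    (hL : Continuous (Function.uncurry L))
    (hb : ∀ K : Set P, IsCompact K → ∃ M, ∀ s, ∀ p ∈ K, ‖L s p‖ ≤ M) {q : ℂ → P}
    (hq : Continuous q) (hd : ∀ s, Differentiable ℂ fun z => L s (q z)) (t : ℝ) :
    Differentiable ℂ fun z => propagator L t (q z) := by
  intro z₀
  obtain ⟨M, hM⟩ := hb (q '' Metric.closedBall z₀ 1) ((isCompact_closedBall z₀ 1).image hq)
  refine DifferentiableOn.differentiableAt (s := Metric.ball z₀ 1) ?_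
    (Metric.ball_mem_nhds z₀ one_pos)
  exact Complex.differentiableOn_tsum_of_summable_norm
    (summable_dyson_bound ‖(1 : 𝔸)‖ (M * |t|))
    (fun k => (differentiable_dyson hL hq hd k t).differentiableOn) Metric.isOpen_ball
    fun k z hz => norm_dyson_le
      (fun s => hM s (q z) (mem_image_of_mem q (Metric.ball_subset_closedBall hz))) k t

/-- The solution of `R' = -R L`, `R(0) = 1`. -/
def coPropagator (L : ℝ → P → 𝔸) (t : ℝ) (p : P) : 𝔸 :=
  (propagator (fun s p => MulOpposite.op (-L s p)) t p).unop

theorem coPropagator_zero (L : ℝ → P → 𝔸) (p : P) : coPropagator L 0 p = 1 := by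
  rw [coPropagator, propagator_zero]
  rfl

/-- In the opposite ring right multiplication becomes left multiplication, so the theory of the
propagator applies unchanged. -/
theorem hasDerivAt_coPropagator [CompleteSpace 𝔸] {L : ℝ → P → 𝔸}
    (hL : Continuous (Function.uncurry L)) {p : P}
    {M : ℝ} (hM : ∀ s, ‖L s p‖ ≤ M) (t : ℝ) :
    HasDerivAt (fun s => coPropagator L s p) (-(coPropagator L t p * L t p)) t := by
  have h := hasDerivAt_propagator (continuous_op_neg hL) (p := p) (M := M)
    (fun s => by rw [MulOpposite.norm_op, norm_neg]; exact hM s) t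
  have := (MulOpposite.opContinuousLinearEquiv ℝ (M := 𝔸)).symm.hasFDerivAt.comp_hasDerivAt t h
  refine this.congr_deriv ?_
  change MulOpposite.unop (MulOpposite.op (-L t p) * _) = _
  rw [MulOpposite.unop_mul, MulOpposite.unop_op, mul_neg]
  rfl

/-- The derivative of the product `R S` is `-R L S + R L S = 0`, and the product is one at time
zero. -/
theorem coPropagator_mul_propagator [CompleteSpace 𝔸] {L : ℝ → P → 𝔸}
    (hL : Continuous (Function.uncurry L)) {p : P}
    {M : ℝ} (hM : ∀ s, ‖L s p‖ ≤ M) (t : ℝ) : coPropagator L t p * propagator L t p = 1 := by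
  have h : ∀ s, HasDerivAt (fun s => coPropagator L s p * propagator L s p) 0 s := by
    intro s
    refine ((hasDerivAt_coPropagator hL hM s).fun_mul
      (hasDerivAt_propagator hL hM s)).congr_deriv ?_
    rw [neg_mul, mul_assoc, neg_add_cancel]
  have := is_const_of_deriv_eq_zero (fun s => (h s).differentiableAt) (fun s => (h s).deriv) t 0
  rw [this, propagator_zero, coPropagator_zero, one_mul]

theorem continuous_coPropagator [CompleteSpace 𝔸] [LocallyCompactSpace P] {L : ℝ → P → 𝔸}
    (hL : Continuous (Function.uncurry L))
    (hb : ∀ K : Set P, IsCompact K → ∃ M, ∀ s, ∀ p ∈ K, ‖L s p‖ ≤ M) (t : ℝ) :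
    Continuous fun p => coPropagator L t p :=
  MulOpposite.continuous_unop.comp (continuous_propagator (continuous_op_neg hL)
    (exists_bound_op_neg hb) t)

theorem differentiable_coPropagator [CompleteSpace 𝔸] {L : ℝ → P → 𝔸}
    (hL : Continuous (Function.uncurry L))
    (hb : ∀ K : Set P, IsCompact K → ∃ M, ∀ s, ∀ p ∈ K, ‖L s p‖ ≤ M) {q : ℂ → P}
    (hq : Continuous q) (hd : ∀ s, Differentiable ℂ fun z => L s (q z)) (t : ℝ) :
    Differentiable ℂ fun z => coPropagator L t (q z) :=
  (MulOpposite.opContinuousLinearEquiv ℂ (M := 𝔸)).symm.differentiable.comp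
    (differentiable_propagator (continuous_op_neg hL) (exists_bound_op_neg hb) hq
      (fun s => (MulOpposite.opContinuousLinearEquiv ℂ (M := 𝔸)).differentiable.comp (hd s).neg) t)

end Continuity

end Dyson

/-! ### The fundamental matrix of the first order system -/

/-- The complex line through `ξ` in the direction of the `i`-th coordinate axis. -/
def complexSlice {n : ℕ} (i : Fin n) (ξ : Rn n) (z : ℂ) : Fin n → ℂ :=
  fun j => (ξ j : ℂ) + z * ((unitVec i : Rn n) j : ℝ)

theorem continuous_complexSlice {n : ℕ} (i : Fin n) (ξ : Rn n) : Continuous (complexSlice i ξ) :=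
  continuous_pi fun _ => by unfold complexSlice; fun_prop

theorem norm_complexSlice_le {n : ℕ} (i : Fin n) (ξ : Rn n) (z : ℂ) :
    ‖complexSlice i ξ z‖ ≤ ‖ξ‖ + ‖z‖ := by
  refine (pi_norm_le_iff_of_nonneg (by positivity)).2 fun j => ?_
  have h1 : ‖(unitVec i : Rn n) j‖ ≤ 1 := by
    simpa using PiLp.norm_apply_le (unitVec i : Rn n) j
  refine (norm_add_le _ _).trans ?_
  rw [norm_mul, Complex.norm_real, Complex.norm_real]
  exact add_le_add (PiLp.norm_apply_le ξ j) (mul_le_of_le_one_right (norm_nonneg _) h1)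

/-- The polynomial factor is absorbed by `ρ ≤ exp ρ`, which adds `m` to the type. The dependence on
the base point `ξ` goes into the constant, which may vary with the line. -/
theorem hasSliceType_of_entire {n m : ℕ} {F : (Fin n → ℂ) → ℂ} {K D : ℝ} (hK : 0 ≤ K)
    (hD : 0 ≤ D) (hd : ∀ i ξ, Differentiable ℂ fun z => F (complexSlice i ξ z))
    (hF : ∀ ζ, ‖F ζ‖ ≤ K * (1 + ‖ζ‖) ^ m * Real.exp ((1 + ‖ζ‖) * D)) :
    HasSliceType (m + D) fun ξ : Rn n => F fun i => (ξ i : ℂ) := by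
  intro i ξ
  refine ⟨_, hd i ξ, fun s => congrArg F ?_, K * Real.exp ((1 + ‖ξ‖) * (m + D)), fun z => ?_⟩
  · ext j
    simp only [complexSlice, PiLp.add_apply, PiLp.smul_apply, smul_eq_mul, Complex.ofReal_add,
      Complex.ofReal_mul]
  · have h1 : 1 + ‖complexSlice i ξ z‖ ≤ (1 + ‖ξ‖) + ‖z‖ := by
      linarith [norm_complexSlice_le i ξ z]
    set ρ := 1 + ‖complexSlice i ξ z‖ with hρ
    have hρ0 : 0 ≤ ρ := by positivity
    calc _ ≤ K * ρ ^ m * Real.exp (ρ * D) := hF _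
      _ ≤ K * Real.exp ρ ^ m * Real.exp (ρ * D) := by
          gcongr
          linarith [Real.add_one_le_exp ρ]
      _ = K * Real.exp (ρ * (m + D)) := by
          rw [← Real.exp_nat_mul, mul_assoc, ← Real.exp_add]
          ring_nf
      _ ≤ K * Real.exp (((1 + ‖ξ‖) + ‖z‖) * (m + D)) := by gcongr
      _ = _ := by
          rw [mul_assoc, ← Real.exp_add]
          ring_nf

/-- The operator of the companion matrix with last row `-c`. -/
def companionCLM {m : ℕ} (c : Fin m → ℂ) : (Fin m → ℂ) →L[ℂ] (Fin m → ℂ) :=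
  LinearMap.toContinuousLinearMap (Matrix.toLin' (companion c))

theorem companionCLM_apply {m : ℕ} (c U : Fin m → ℂ) :
    companionCLM c U = (companion c).mulVec U := rfl

/-- The companion operator is affine in its last row, so continuity and holomorphy of the generator
follow from those of the scalar symbols. -/
theorem companionCLM_eq {m : ℕ} (c : Fin m → ℂ) :
    companionCLM c = companionCLM 0 + ∑ q, c q • (companionCLM (Pi.single q 1) - companionCLM 0) := by
  ext U p
  simp only [add_apply, sum_apply,
    smul_apply, sub_apply, companionCLM_apply, Pi.add_apply,
    Finset.sum_apply, Pi.smul_apply, Pi.sub_apply]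
  by_cases hp : (p : ℕ) + 1 < m
  · simp [companion_mulVec_of_lt _ _ hp]
  · simp [companion_mulVec_last _ _ hp, Pi.single_apply]

/-- The generator of the first order system, extended constantly in time outside `[0,T]`. -/
def generator {n m : ℕ} {T : ℝ} (hT : 0 ≤ T) (a : ℕ → (Fin n → ℕ) → ℝ → ℂ) (t : ℝ)
    (ζ : Fin n → ℂ) : (Fin m → ℂ) →L[ℂ] (Fin m → ℂ) :=
  Complex.I • companionCLM fun q => fullSymbolC a (m - q) (projIcc 0 T hT t) ζ

section Generator

variable {n m : ℕ} {T : ℝ} (hT : 0 ≤ T) {a : ℕ → (Fin n → ℕ) → ℝ → ℂ}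

theorem generator_eq (t : ℝ) (ζ : Fin n → ℂ) : (generator hT a t ζ : (Fin m → ℂ) →L[ℂ] _) =
    Complex.I • (companionCLM 0 + ∑ q : Fin m, fullSymbolC a (m - q) (projIcc 0 T hT t) ζ •
      (companionCLM (Pi.single q 1) - companionCLM 0)) := by
  rw [generator, companionCLM_eq]

theorem continuous_generator (hcont : ∀ k ∈ Finset.Icc 1 m, ∀ γ : Fin n → ℕ, ∑ i, γ i ≤ k →
      ContinuousOn (a k γ) (Icc 0 T)) :
    Continuous (Function.uncurry (generator (m := m) hT a)) := by
  have h1 : ∀ q : Fin m, Continuous fun x : ℝ × (Fin n → ℂ) =>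
      fullSymbolC a (m - q) (projIcc 0 T hT x.1) x.2 := by
    intro q
    unfold fullSymbolC
    refine continuous_finsetSum _ fun d hd => continuous_finsetSum _ fun γ hγ => ?_
    have hγd := mem_multiIndices.1 hγ
    have hd' := Finset.mem_range.1 hd
    have h2 : Continuous fun t => a (m - q) γ (projIcc 0 T hT t) :=
      (continuousOn_iff_continuous_domRestrict.1
        (hcont (m - q) (Finset.mem_Icc.2 ⟨by omega, by omega⟩) γ (by omega))).comp
        continuous_projIcc
    exact (h2.comp continuous_fst).mul (by fun_prop)
  have e : Function.uncurry (generator (m := m) hT a) = fun x => Complex.I • (companionCLM 0 +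
      ∑ q : Fin m, fullSymbolC a (m - q) (projIcc 0 T hT x.1) x.2 •
      (companionCLM (Pi.single q 1) - companionCLM 0)) := by
    ext1 x
    exact generator_eq hT x.1 x.2
  rw [e]
  have h3 : Continuous fun x : ℝ × (Fin n → ℂ) =>
      ∑ q : Fin m, fullSymbolC a (m - q) (projIcc 0 T hT x.1) x.2 •
        (companionCLM (Pi.single q 1) - companionCLM 0 : (Fin m → ℂ) →L[ℂ] _) :=
    continuous_finsetSum _ fun q _ => (h1 q).smul continuous_const
  fun_prop

theorem exists_generator_bound (hcont : ∀ k ∈ Finset.Icc 1 m, ∀ γ : Fin n → ℕ, ∑ i, γ i ≤ k →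
      ContinuousOn (a k γ) (Icc 0 T)) (K : Set (Fin n → ℂ)) (hK : IsCompact K) :
    ∃ M, ∀ s, ∀ ζ ∈ K, ‖(generator hT a s ζ : (Fin m → ℂ) →L[ℂ] _)‖ ≤ M := by
  obtain ⟨M, hM⟩ := ((isCompact_Icc (a := (0 : ℝ)) (b := T)).prod hK).exists_bound_of_continuousOn
    (continuous_generator (m := m) hT hcont).continuousOn
  refine ⟨M, fun s ζ hζ => ?_⟩
  have := hM (projIcc 0 T hT s, ζ) ⟨(projIcc 0 T hT s).2, hζ⟩
  simpa [Function.uncurry, generator] using this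

theorem differentiable_generator_slice (s : ℝ) (i : Fin n) (ξ : Rn n) :
    Differentiable ℂ fun z => (generator hT a s (complexSlice i ξ z) : (Fin m → ℂ) →L[ℂ] _) := by
  simp only [generator_eq, fullSymbolC, complexSlice]
  fun_prop

/-- Orbits of the propagator solve the first order system. -/
theorem hasDerivWithinAt_propagator_apply (hcont : ∀ k ∈ Finset.Icc 1 m, ∀ γ : Fin n → ℕ,
      ∑ i, γ i ≤ k → ContinuousOn (a k γ) (Icc 0 T)) (ζ : Fin n → ℂ) (w : Fin m → ℂ) {t : ℝ}
    (ht : t ∈ Icc 0 T) :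
    HasDerivWithinAt (fun s => propagator (generator hT a) s ζ w)
      (Complex.I • (companion fun q : Fin m => fullSymbolC a (m - q) t ζ).mulVec
        (propagator (generator hT a) t ζ w)) (Icc 0 T) t := by
  obtain ⟨M, hM⟩ := exists_generator_bound (m := m) hT hcont {ζ} isCompact_singleton
  have h := hasDerivAt_propagator (continuous_generator hT hcont) (fun s => hM s ζ rfl) t
  have h2 := (((ContinuousLinearMap.apply ℂ (Fin m → ℂ) w).restrictScalars ℝ).hasFDerivAt.comp_hasDerivAt t h)
  refine h2.hasDerivWithinAt.congr_deriv ?_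
  change generator hT a t ζ (propagator (generator hT a) t ζ w) = _
  rw [generator, projIcc_of_mem hT ht]
  rfl

theorem norm_propagator_apply_le {C : ℝ} (hC : 0 ≤ C)
    (hsym : ∀ k ∈ Finset.Icc 1 m, ∀ t ∈ Icc (0 : ℝ) T, ∀ ζ : Fin n → ℂ,
      ‖fullSymbolC a k t ζ‖ ≤ C * (1 + ‖ζ‖) ^ k)
    (hcont : ∀ k ∈ Finset.Icc 1 m, ∀ γ : Fin n → ℕ,
      ∑ i, γ i ≤ k → ContinuousOn (a k γ) (Icc 0 T)) (ζ : Fin n → ℂ) (w : Fin m → ℂ) {s t : ℝ}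
    (hs : s ∈ Icc 0 T) (ht : t ∈ Icc 0 T) :
    ‖propagator (generator hT a) t ζ w‖ ≤ m * (1 + ‖ζ‖) ^ m *
      Real.exp ((1 + ‖ζ‖) * ((1 + C) * m * T)) * ‖propagator (generator hT a) s ζ w‖ := by
  refine (pi_norm_le_iff_of_nonneg (by positivity)).2 fun q => ?_
  have := companion_exp_bound hC (by linarith [norm_nonneg ζ] : 1 ≤ 1 + ‖ζ‖)
    (c := fun t q => fullSymbolC a (m - q) t ζ)
    (fun t ht q => hsym _ (Finset.mem_Icc.2 ⟨by omega, by omega⟩) t ht ζ)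
    (fun t ht => hasDerivWithinAt_propagator_apply hT hcont ζ w ht) hs ht q
  simpa only [mul_assoc] using this

/-- In finite dimension a left inverse is also a right inverse. -/
theorem propagator_mul_coPropagator (hcont : ∀ k ∈ Finset.Icc 1 m, ∀ γ : Fin n → ℕ,
      ∑ i, γ i ≤ k → ContinuousOn (a k γ) (Icc 0 T)) (t : ℝ) (ζ : Fin n → ℂ) (w : Fin m → ℂ) :
    propagator (generator hT a) t ζ (coPropagator (generator hT a) t ζ w) = w := by
  obtain ⟨M, hM⟩ := exists_generator_bound (m := m) hT hcont {ζ} isCompact_singleton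
  have h := coPropagator_mul_propagator (continuous_generator hT hcont) (fun s => hM s ζ rfl) t
  have h' : (coPropagator (generator (m := m) hT a) t ζ).toLinearMap *
      (propagator (generator (m := m) hT a) t ζ).toLinearMap = 1 :=
    LinearMap.ext fun U => congrArg (fun f : (Fin m → ℂ) →L[ℂ] (Fin m → ℂ) => f U) h
  exact LinearMap.congr_fun (mul_eq_one_comm.1 h') w

end Generator

/-- Evaluation of symbols at a frequency. -/
def evalSymbol {n : ℕ} (ξ : Rn n) : symbolAlgebra n →ₐ[ℂ] ℂ :=
  (Pi.evalAlgHom ℂ (fun _ => ℂ) ξ).comp (symbolAlgebra n).val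

theorem evalSymbol_apply {n : ℕ} (ξ : Rn n) (σ : symbolAlgebra n) : evalSymbol ξ σ = σ.1 ξ := rfl

theorem symbol_ext {n : ℕ} {σ τ : symbolAlgebra n} (h : ∀ ξ, evalSymbol ξ σ = evalSymbol ξ τ) :
    σ = τ := Subtype.ext (funext h)

/-- The full symbol as an element of the algebra of symbols. -/
def symbolOf {n : ℕ} (a : ℕ → (Fin n → ℕ) → ℝ → ℂ) (k : ℕ) (t : ℝ) : symbolAlgebra n :=
  ∑ d ∈ Finset.range (k + 1), ∑ γ ∈ multiIndices n d, a k γ t • ∏ i, coordSymbol i ^ γ i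

theorem evalSymbol_symbolOf {n : ℕ} (a : ℕ → (Fin n → ℕ) → ℝ → ℂ) (k : ℕ) (t : ℝ) (ξ : Rn n) :
    evalSymbol ξ (symbolOf a k t) = fullSymbol a k t ξ := by
  simp only [symbolOf, fullSymbol, map_sum, map_smul, map_prod, map_pow, smul_eq_mul]
  rfl

/-- The companion matrix of the full symbols. -/
def symbolCompanion {n : ℕ} (m : ℕ) (a : ℕ → (Fin n → ℕ) → ℝ → ℂ) (t : ℝ) :
    Matrix (Fin m) (Fin m) (symbolAlgebra n) :=
  Matrix.of fun p q =>
    if (p : ℕ) + 1 < m then (if (q : ℕ) = p + 1 then 1 else 0) else -symbolOf a (m - q) t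

theorem evalSymbol_symbolCompanion {n m : ℕ} (a : ℕ → (Fin n → ℕ) → ℝ → ℂ) (t : ℝ) (ξ : Rn n)
    (p q : Fin m) : evalSymbol ξ (symbolCompanion m a t p q) =
      companion (fun q : Fin m => fullSymbol a (m - q) t ξ) p q := by
  simp only [symbolCompanion, companion, Matrix.of_apply]
  split_ifs <;> simp [evalSymbol_symbolOf]

/-- The fundamental matrix `S` of the first order system and its inverse `R`, as matrices of
symbols with bounds that are uniform in time. -/
structure FundamentalPair {n : ℕ} (m : ℕ) (T : ℝ) (a : ℕ → (Fin n → ℕ) → ℝ → ℂ) where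
  S : ℝ → Matrix (Fin m) (Fin m) (symbolAlgebra n)
  R : ℝ → Matrix (Fin m) (Fin m) (symbolAlgebra n)
  type : ℝ
  order : ℕ
  const : ℝ
  bound_S : ∀ t ∈ Icc 0 T, ∀ p q, SymbolBound type order const (S t p q)
  bound_R : ∀ t ∈ Icc 0 T, ∀ p q, SymbolBound type order const (R t p q)
  S_mul_R : ∀ t ∈ Icc 0 T, S t * R t = 1
  S_zero : S 0 = 1
  R_zero : R 0 = 1
  deriv_S : ∀ t ∈ Icc 0 T, ∀ ξ p q, HasDerivWithinAt (fun s => evalSymbol ξ (S s p q))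
    (evalSymbol ξ ((Complex.I • (symbolCompanion m a t * S t)) p q)) (Icc 0 T) t
  deriv_R : ∀ t ∈ Icc 0 T, ∀ ξ p q, HasDerivWithinAt (fun s => evalSymbol ξ (R s p q))
    (evalSymbol ξ ((-(Complex.I • (R t * symbolCompanion m a t))) p q)) (Icc 0 T) t

theorem clm_apply_eq_sum {m : ℕ} (F : (Fin m → ℂ) →L[ℂ] (Fin m → ℂ)) (w : Fin m → ℂ) (p : Fin m) :
    F w p = ∑ k, F (Pi.single k 1) p * w k := by
  conv_lhs => rw [← Finset.univ_sum_single w, map_sum, Finset.sum_apply]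
  refine Finset.sum_congr rfl fun k _ => ?_
  have : (Pi.single k (w k) : Fin m → ℂ) = w k • Pi.single k 1 := by
    rw [← Pi.single_smul, smul_eq_mul, mul_one]
  rw [this, map_smul, Pi.smul_apply, smul_eq_mul, mul_comm]

/-- Two estimates meet here: the crude exponential one at complex frequencies gives the exponential
type, and the mode bound at real frequencies gives polynomial growth. -/
theorem nonempty_fundamentalPair {n m : ℕ} {T : ℝ} (hT : 0 ≤ T)
    {a : ℕ → (Fin n → ℕ) → ℝ → ℂ}
    (hcont : ∀ k ∈ Finset.Icc 1 m, ∀ γ : Fin n → ℕ, ∑ i, γ i ≤ k →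
      ContinuousOn (a k γ) (Icc 0 T)) {κ : ℕ} {A : ℝ}
    (hmode : ∀ ξ : Rn n, ∀ U : ℝ → Fin m → ℂ, IsMode m T a ξ U →
      ∀ s ∈ Icc (0 : ℝ) T, ∀ t ∈ Icc (0 : ℝ) T, ‖U t‖ ≤ A * (1 + ‖ξ‖) ^ κ * ‖U s‖) :
    Nonempty (FundamentalPair m T a) := by
  obtain ⟨C, hC, hsym⟩ := exists_fullSymbolC_bound hcont
  have h0 : (0 : ℝ) ∈ Icc 0 T := ⟨le_rfl, hT⟩
  set L := generator (m := m) hT a with hL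
  have hLc : Continuous (Function.uncurry L) := continuous_generator hT hcont
  have hLb := exists_generator_bound (m := m) hT hcont
  have hLd := fun s i ξ => differentiable_generator_slice (m := m) (a := a) hT s i ξ
  set D := (1 + C) * m * T with hD
  have hD0 : 0 ≤ D := by positivity
  have hsingle : ∀ q : Fin m, ‖(Pi.single q 1 : Fin m → ℂ)‖ = 1 := fun q => by
    rw [Pi.norm_single, norm_one]
  have hP0 : ∀ ζ w, propagator L 0 ζ w = w := fun ζ w => by rw [propagator_zero]; rfl
  have hPR : ∀ t ζ w, propagator L t ζ (coPropagator L t ζ w) = w :=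
    propagator_mul_coPropagator hT hcont
  have hPmode : ∀ (ξ : Rn n) w, IsMode m T a ξ fun s => propagator L s (fun i => (ξ i : ℂ)) w :=
    fun ξ w t ht => hasDerivWithinAt_propagator_apply hT hcont _ w ht
  have hprop : ∀ F : (Fin n → ℂ) → ((Fin m → ℂ) →L[ℂ] (Fin m → ℂ)), Continuous F →
      (∀ i ξ, Differentiable ℂ fun z => F (complexSlice i ξ z)) →
      (∀ ζ q, ‖F ζ (Pi.single q 1)‖ ≤ m * (1 + ‖ζ‖) ^ m * Real.exp ((1 + ‖ζ‖) * D)) →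
      (∀ (ξ : Rn n) q, ‖F (fun i => (ξ i : ℂ)) (Pi.single q 1)‖ ≤ A * (1 + ‖ξ‖) ^ κ) →
      ∀ p q, Continuous (fun ξ : Rn n => F (fun i => (ξ i : ℂ)) (Pi.single q 1) p) ∧
        HasGrowth κ A (fun ξ : Rn n => F (fun i => (ξ i : ℂ)) (Pi.single q 1) p) ∧
        HasSliceType (m + D) (fun ξ : Rn n => F (fun i => (ξ i : ℂ)) (Pi.single q 1) p) := by
    intro F h1 h2 h3 h4 p q
    refine ⟨?_, fun ξ => (norm_le_pi_norm _ p).trans (h4 ξ q), ?_⟩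
    · have h5 : Continuous fun ξ : Rn n => fun i => (ξ i : ℂ) := by fun_prop
      exact (continuous_apply p).comp ((h1.comp h5).clm_apply continuous_const)
    · refine hasSliceType_of_entire (F := fun ζ => F ζ (Pi.single q 1) p) (K := m) (by positivity)
        hD0 (fun i ξ => ?_) fun ζ => (norm_le_pi_norm _ p).trans (h3 ζ q)
      exact differentiable_pi.1 ((h2 i ξ).clm_apply (differentiable_const _)) p
  have hS : ∀ t ∈ Icc 0 T, _ := fun t ht => hprop (fun ζ => propagator L t ζ)
    (continuous_propagator hLc hLb t)
    (fun i ξ => differentiable_propagator hLc hLb (continuous_complexSlice i ξ)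
      (fun s => hLd s i ξ) t)
    (fun ζ q => by
      have := norm_propagator_apply_le hT hC hsym hcont ζ (Pi.single q 1) h0 ht
      rwa [← hL, hP0, hsingle, mul_one] at this)
    (fun ξ q => by
      have := hmode ξ _ (hPmode ξ (Pi.single q 1)) 0 h0 t ht
      rwa [hP0, hsingle, mul_one] at this)
  -- `coPropagator L t ζ w` is the initial value of the orbit that reaches `w` at time `t`, so the
  -- bounds for the inverse are the backward estimates for orbits.
  have hR : ∀ t ∈ Icc 0 T, _ := fun t ht => hprop (fun ζ => coPropagator L t ζ)
    (continuous_coPropagator hLc hLb t)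
    (fun i ξ => differentiable_coPropagator hLc hLb (continuous_complexSlice i ξ)
      (fun s => hLd s i ξ) t)
    (fun ζ q => by
      have := norm_propagator_apply_le hT hC hsym hcont ζ (coPropagator L t ζ (Pi.single q 1)) ht h0
      rwa [← hL, hP0, hPR, hsingle, mul_one] at this)
    (fun ξ q => by
      have := hmode ξ _ (hPmode ξ (coPropagator L t (fun i => (ξ i : ℂ)) (Pi.single q 1))) t ht 0 h0
      rwa [hP0, hPR, hsingle, mul_one] at this)
  -- Times outside `[0, T]` are projected to the interval, so that the entries are elements of the
  -- symbol algebra for every real `t`.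
  let π : ℝ → ℝ := fun t => projIcc 0 T hT t
  have hπ : ∀ t, π t ∈ Icc 0 T := fun t => (projIcc 0 T hT t).2
  have hπ' : ∀ t ∈ Icc 0 T, π t = t := fun t ht => by simp only [π, projIcc_of_mem hT ht]
  let S : ℝ → Matrix (Fin m) (Fin m) (symbolAlgebra n) := fun t => Matrix.of fun p q =>
    ⟨_, (hS (π t) (hπ t) p q).1, ⟨_, _, (hS (π t) (hπ t) p q).2.1⟩, _, (hS (π t) (hπ t) p q).2.2⟩
  let R : ℝ → Matrix (Fin m) (Fin m) (symbolAlgebra n) := fun t => Matrix.of fun p q =>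
    ⟨_, (hR (π t) (hπ t) p q).1, ⟨_, _, (hR (π t) (hπ t) p q).2.1⟩, _, (hR (π t) (hπ t) p q).2.2⟩
  have eS : ∀ t ∈ Icc 0 T, ∀ ξ p q, evalSymbol ξ (S t p q) =
      propagator L t (fun i => (ξ i : ℂ)) (Pi.single q 1) p := fun t ht ξ p q => by
    change propagator L (π t) (fun i => (ξ i : ℂ)) (Pi.single q 1) p = _
    rw [hπ' t ht]
  have eR : ∀ t ∈ Icc 0 T, ∀ ξ p q, evalSymbol ξ (R t p q) =
      coPropagator L t (fun i => (ξ i : ℂ)) (Pi.single q 1) p := fun t ht ξ p q => by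
    change coPropagator L (π t) (fun i => (ξ i : ℂ)) (Pi.single q 1) p = _
    rw [hπ' t ht]
  have e1 : ∀ ξ p q, evalSymbol ξ ((1 : Matrix (Fin m) (Fin m) (symbolAlgebra n)) p q) =
      (Pi.single q 1 : Fin m → ℂ) p := fun ξ p q => by
    rw [Matrix.one_apply, Pi.single_apply]
    split_ifs <;> simp
  exact ⟨{
    S := S
    R := R
    type := m + D
    order := κ
    const := A
    bound_S := fun t _ p q => ⟨(hS (π t) (hπ t) p q).2.1, (hS (π t) (hπ t) p q).2.2⟩
    bound_R := fun t _ p q => ⟨(hR (π t) (hπ t) p q).2.1, (hR (π t) (hπ t) p q).2.2⟩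
    S_mul_R := fun t ht => by
      refine Matrix.ext fun p q => symbol_ext fun ξ => ?_
      simp only [Matrix.mul_apply, map_sum, map_mul, eS t ht, eR t ht, e1]
      rw [← clm_apply_eq_sum, hPR]
    S_zero := by
      refine Matrix.ext fun p q => symbol_ext fun ξ => ?_
      rw [eS 0 h0, hP0, e1]
    R_zero := by
      refine Matrix.ext fun p q => symbol_ext fun ξ => ?_
      rw [eR 0 h0, coPropagator_zero, e1]
      rfl
    deriv_S := fun t ht ξ p q => by
      refine HasDerivWithinAt.congr_of_mem ?_ (fun s hs => eS s hs ξ p q) ht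
      refine (hasDerivWithinAt_pi.1 (hPmode ξ (Pi.single q 1) t ht) p).congr_deriv ?_
      simp only [Matrix.smul_apply, Matrix.mul_apply, map_smul, map_sum, map_mul, eS t ht,
        evalSymbol_symbolCompanion]
      rfl
    deriv_R := fun t ht ξ p q => by
      refine HasDerivWithinAt.congr_of_mem ?_ (fun s hs => eR s hs ξ p q) ht
      obtain ⟨M, hM⟩ := hLb {fun i => (ξ i : ℂ)} isCompact_singleton
      have h := hasDerivAt_coPropagator hLc (fun s => hM s _ rfl) t
      have h2 := ((ContinuousLinearMap.apply ℂ (Fin m → ℂ)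
        (Pi.single q 1)).restrictScalars ℝ).hasFDerivAt.comp_hasDerivAt t h
      refine (hasDerivWithinAt_pi.1 h2.hasDerivWithinAt p).congr_deriv ?_
      change -(coPropagator L t (fun i => (ξ i : ℂ)) (L t (fun i => (ξ i : ℂ)) (Pi.single q 1)) p) = _
      rw [clm_apply_eq_sum]
      simp only [Matrix.neg_apply, Matrix.smul_apply, Matrix.mul_apply, map_neg, map_smul, map_sum,
        map_mul, eR t ht, evalSymbol_symbolCompanion, smul_eq_mul, Finset.mul_sum]
      congr 1
      refine Finset.sum_congr rfl fun k _ => ?_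
      have : L t (fun i => (ξ i : ℂ)) (Pi.single q 1) k =
          Complex.I * companion (fun q : Fin m => fullSymbol a (m - q) t ξ) k q := by
        rw [hL, generator, projIcc_of_mem hT ht]
        change Complex.I * (companion _).mulVec _ k = _
        rw [Matrix.mulVec_single_one]
        rfl
      rw [this]
      ring }⟩

/-! ### Differentiable families of symbols -/

/-- A family of symbols with uniform bounds on a set of parameters. -/
def IsBoundedFamily {n : ℕ} (s : Set ℝ) (σ : ℝ → symbolAlgebra n) : Prop :=
  ∃ B N C, ∀ t ∈ s, SymbolBound B N C (σ t)

namespace IsBoundedFamily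

variable {n : ℕ} {s : Set ℝ} {σ τ : ℝ → symbolAlgebra n}

theorem const (σ : symbolAlgebra n) : IsBoundedFamily s fun _ => σ := by
  obtain ⟨B, N, C, -, h⟩ := exists_symbolBound σ
  exact ⟨B, N, C, fun _ _ => h⟩

theorem add (h : IsBoundedFamily s σ) (h' : IsBoundedFamily s τ) :
    IsBoundedFamily s fun t => σ t + τ t := by
  obtain ⟨B, N, C, h⟩ := h
  obtain ⟨B', N', C', h'⟩ := h'
  exact ⟨max B B', max N N', C + C', fun t ht =>
    ⟨((h t ht).growth.mono (le_max_left _ _) le_rfl).add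
      ((h' t ht).growth.mono (le_max_right _ _) le_rfl),
    ((h t ht).sliceType.mono (le_max_left _ _)).add ((h' t ht).sliceType.mono (le_max_right _ _))⟩⟩

theorem mul (h : IsBoundedFamily s σ) (h' : IsBoundedFamily s τ) :
    IsBoundedFamily s fun t => σ t * τ t := by
  obtain ⟨B, N, C, h⟩ := h
  obtain ⟨B', N', C', h'⟩ := h'
  exact ⟨B + B', N + N', C * C', fun t ht =>
    ⟨(h t ht).growth.mul (h' t ht).growth, (h t ht).sliceType.mul (h' t ht).sliceType⟩⟩

theorem smul (h : IsBoundedFamily s σ) {c : ℝ → ℂ} {K : ℝ} (hc : ∀ t ∈ s, ‖c t‖ ≤ K) :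
    IsBoundedFamily s fun t => c t • σ t := by
  obtain ⟨B, N, C, h⟩ := h
  refine ⟨0 + B, N, K * C, fun t ht => ⟨fun ξ => ?_,
    (hasSliceType_const (c t)).mul (h t ht).sliceType⟩⟩
  change ‖c t * (σ t).1 ξ‖ ≤ _
  rw [norm_mul, mul_assoc]
  exact mul_le_mul (hc t ht) ((h t ht).growth ξ) (norm_nonneg _) ((norm_nonneg _).trans (hc t ht))

theorem const_smul (h : IsBoundedFamily s σ) (c : ℂ) : IsBoundedFamily s fun t => c • σ t :=
  h.smul fun _ _ => le_rfl

theorem neg (h : IsBoundedFamily s σ) : IsBoundedFamily s fun t => -σ t := by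
  simpa only [neg_one_smul] using h.const_smul (-1)

theorem sum {ι : Type*} {u : Finset ι} {σ : ι → ℝ → symbolAlgebra n}
    (h : ∀ i ∈ u, IsBoundedFamily s (σ i)) : IsBoundedFamily s fun t => ∑ i ∈ u, σ i t := by
  classical
  induction u using Finset.induction_on with
  | empty => simpa using const (0 : symbolAlgebra n)
  | insert i u hi ih =>
    simp only [Finset.sum_insert hi]
    exact (h i (Finset.mem_insert_self i u)).add
      (ih fun j hj => h j (Finset.mem_insert_of_mem hj))

theorem domTendsto (h : IsBoundedFamily s σ) {t : ℝ}
    (hσ : ∀ ξ, ContinuousWithinAt (fun r => evalSymbol ξ (σ r)) s t) :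
    DomTendsto σ (𝓝[s] t) (σ t) := by
  obtain ⟨B, N, C, h⟩ := h
  exact domTendsto_of_bound (eventually_mem_nhdsWithin.mono h) hσ

/-- The difference quotients of a family of symbols converge boundedly. -/
theorem domTendsto_slope (hs : Convex ℝ s) (h : IsBoundedFamily s σ) (h' : IsBoundedFamily s τ)
    (hd : ∀ t ∈ s, ∀ ξ, HasDerivWithinAt (fun r => evalSymbol ξ (σ r)) (evalSymbol ξ (τ t)) s t)
    {t : ℝ} (ht : t ∈ s) :
    DomTendsto (fun r => (((r - t)⁻¹ : ℝ) : ℂ) • (σ r - σ t)) (𝓝[s \ {t}] t) (τ t) := by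
  obtain ⟨B, N, C, h⟩ := h
  obtain ⟨B', N', C', h'⟩ := h'
  refine domTendsto_of_bound (B := 0 + max B (0 + B)) (N := N') (C := C') ?_ fun ξ => ?_
  · filter_upwards [self_mem_nhdsWithin] with r hr
    refine ⟨fun ξ => ?_, ?_⟩
    · have hC' := (h' t ht).growth.nonneg
      -- By the mean value inequality the difference quotients inherit the growth bound of the
      -- derivative `τ`.
      have key := hs.norm_image_sub_le_of_norm_hasDerivWithin_le (fun x hx => hd x hx ξ)
        (fun x hx => (h' x hx).growth ξ) ht hr.1
      change ‖(((r - t)⁻¹ : ℝ) : ℂ) * ((σ r).1 ξ - (σ t).1 ξ)‖ ≤ _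
      have hrt : 0 < ‖r - t‖ := norm_pos_iff.2 (sub_ne_zero.2 hr.2)
      rw [norm_mul, Complex.norm_real, norm_inv, inv_mul_le_iff₀ hrt, mul_comm]
      exact key
    -- The factor `(r - t)⁻¹` is unbounded, but a scalar has type zero and affects only the constant
    -- on each line; the type itself stays uniform in `r`.
    · have h1 : HasSliceType (max B (0 + B)) ((σ r).1 + (fun _ => (-1 : ℂ)) * (σ t).1) :=
        ((h r hr.1).sliceType.mono (le_max_left _ _)).add
          (((hasSliceType_const (-1 : ℂ)).mul (h t ht).sliceType).mono (le_max_right _ _))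
      have h2 := (hasSliceType_const (n := n) (((r - t)⁻¹ : ℝ) : ℂ)).mul h1
      convert h2 using 1
      ext ξ
      change _ * ((σ r).1 ξ - (σ t).1 ξ) = _ * ((σ r).1 ξ + -1 * (σ t).1 ξ)
      ring
  · have := hasDerivWithinAt_iff_tendsto_slope.1 (hd t ht ξ)
    refine this.congr fun r => ?_
    rw [slope_def_module, ← evalSymbol_apply, map_smul, map_sub, Complex.real_smul, smul_eq_mul]

end IsBoundedFamily

/-! ### The companion matrix over the symbol algebra -/

section Companion

variable {n m : ℕ} {T : ℝ} {a : ℕ → (Fin n → ℕ) → ℝ → ℂ}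

theorem isBoundedFamily_symbolOf
    (hcont : ∀ k ∈ Finset.Icc 1 m, ∀ γ : Fin n → ℕ, ∑ i, γ i ≤ k →
      ContinuousOn (a k γ) (Icc 0 T)) {k : ℕ} (hk : k ∈ Finset.Icc 1 m) :
    IsBoundedFamily (Icc 0 T) (symbolOf a k) := by
  refine IsBoundedFamily.sum fun d hd => IsBoundedFamily.sum fun γ hγ => ?_
  have hγd := mem_multiIndices.1 hγ
  have hd' := Finset.mem_range.1 hd
  obtain ⟨K, hK⟩ := isCompact_Icc.exists_bound_of_continuousOn (hcont k hk γ (by omega))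
  exact (IsBoundedFamily.const _).smul hK

theorem isBoundedFamily_symbolCompanion
    (hcont : ∀ k ∈ Finset.Icc 1 m, ∀ γ : Fin n → ℕ, ∑ i, γ i ≤ k →
      ContinuousOn (a k γ) (Icc 0 T)) (p q : Fin m) :
    IsBoundedFamily (Icc 0 T) fun t => symbolCompanion m a t p q := by
  simp only [symbolCompanion, Matrix.of_apply]
  split_ifs
  · exact .const _
  · exact .const _
  · exact (isBoundedFamily_symbolOf hcont (Finset.mem_Icc.2 ⟨by omega, by omega⟩)).neg

theorem continuousOn_evalSymbol_symbolCompanion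
    (hcont : ∀ k ∈ Finset.Icc 1 m, ∀ γ : Fin n → ℕ, ∑ i, γ i ≤ k →
      ContinuousOn (a k γ) (Icc 0 T)) (ξ : Rn n) (p q : Fin m) :
    ContinuousOn (fun t => evalSymbol ξ (symbolCompanion m a t p q)) (Icc 0 T) := by
  simp only [symbolCompanion, Matrix.of_apply]
  split_ifs
  · exact continuousOn_const
  · exact continuousOn_const
  · simp only [map_neg, evalSymbol_symbolOf, fullSymbol]
    refine (continuousOn_finsetSum _ fun d hd => continuousOn_finsetSum _ fun γ hγ => ?_).neg
    have hγd := mem_multiIndices.1 hγ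
    have hd' := Finset.mem_range.1 hd
    exact (hcont _ (Finset.mem_Icc.2 ⟨by omega, by omega⟩) γ (by omega)).mul continuousOn_const

theorem symbolCompanion_mul_of_lt {t : ℝ} (S : Matrix (Fin m) (Fin m) (symbolAlgebra n))
    {p : Fin m} (hp : (p : ℕ) + 1 < m) (l : Fin m) :
    (symbolCompanion m a t * S) p l = S ⟨p + 1, hp⟩ l := by
  simp only [Matrix.mul_apply, symbolCompanion, Matrix.of_apply, hp, if_true]
  rw [Finset.sum_eq_single ⟨p + 1, hp⟩]
  · simp
  · intro q _ hq
    rw [if_neg fun h => hq (Fin.ext h), zero_mul]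
  · simp

theorem symbolCompanion_mul_last {t : ℝ} (S : Matrix (Fin m) (Fin m) (symbolAlgebra n))
    {p : Fin m} (hp : ¬ (p : ℕ) + 1 < m) (l : Fin m) :
    (symbolCompanion m a t * S) p l = -∑ q : Fin m, symbolOf a (m - q) t * S q l := by
  simp only [Matrix.mul_apply, symbolCompanion, Matrix.of_apply, hp, if_false]
  rw [← Finset.sum_neg_distrib]
  exact Finset.sum_congr rfl fun q _ => Subtype.ext (neg_mul _ _)

end Companion

/-! ### Differential operators as symbols -/

section DiffOp

variable {n : ℕ} {X : Type*} [AddCommGroup X] [Module ℂ X] [Module ℝ X] [LineDeriv (Rn n) X X]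
  [TopologicalSpace X] (𝒜 : SymbolAction n X)

theorem SymbolAction.act_coord_pow (i : Fin n) (k : ℕ) (f : X) :
    𝒜.act (coordSymbol i ^ k) f = (Dx i)^[k] f := by
  induction k generalizing f with
  | zero => simp
  | succ k ih => rw [pow_succ, map_mul, Module.End.mul_apply, 𝒜.act_coord, ih,
      Function.iterate_succ_apply]

theorem SymbolAction.act_monomial (γ : Fin n → ℕ) (f : X) :
    𝒜.act (∏ i, coordSymbol i ^ γ i) f = DxPow γ f := by
  have h : ∀ L : List (Fin n), 𝒜.act (L.map fun i => coordSymbol i ^ γ i).prod f =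
      L.foldr (fun i h => (Dx i)^[γ i] h) f := by
    intro L
    induction L with
    | nil => simp
    | cons i L ih =>
      rw [List.map_cons, List.prod_cons, map_mul, Module.End.mul_apply, ih, 𝒜.act_coord_pow,
        List.foldr_cons]
  rw [DxPow, ← h, ← List.ofFn_eq_map, List.prod_ofFn]

theorem SymbolAction.act_symbolOf (a : ℕ → (Fin n → ℕ) → ℝ → ℂ) (k : ℕ) (t : ℝ) (f : X) :
    𝒜.act (symbolOf a k t) f = diffOp a k t f := by
  simp only [symbolOf, diffOp, map_sum, map_smul, LinearMap.sum_apply, LinearMap.smul_apply,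
    𝒜.act_monomial]

end DiffOp

/-! ### Well-posedness -/

section WellPosed

variable {n m : ℕ} {T : ℝ} {a : ℕ → (Fin n → ℕ) → ℝ → ℂ}

/-! ### Symbols of the time derivatives of the solution -/

namespace FundamentalPair

variable (Φ : FundamentalPair m T a)

theorem isBoundedFamily_S (p q : Fin m) : IsBoundedFamily (Icc 0 T) fun t => Φ.S t p q :=
  ⟨_, _, _, fun t ht => Φ.bound_S t ht p q⟩

theorem isBoundedFamily_R (p q : Fin m) : IsBoundedFamily (Icc 0 T) fun t => Φ.R t p q :=
  ⟨_, _, _, fun t ht => Φ.bound_R t ht p q⟩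

/-- The symbols of the solution operators for `D_t^j u`, `j ≤ m`. -/
def row (hm : 1 ≤ m) (j : ℕ) (t : ℝ) (l : Fin m) : symbolAlgebra n :=
  if h : j < m then Φ.S t ⟨j, h⟩ l else (symbolCompanion m a t * Φ.S t) ⟨m - 1, by omega⟩ l

theorem row_of_lt (hm : 1 ≤ m) {j : ℕ} (h : j < m) (t : ℝ) (l : Fin m) :
    Φ.row hm j t l = Φ.S t ⟨j, h⟩ l := dif_pos h

theorem row_top (hm : 1 ≤ m) (t : ℝ) (l : Fin m) :
    Φ.row hm m t l = -∑ q : Fin m, symbolOf a (m - q) t * Φ.S t q l := by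
  rw [row, dif_neg (lt_irrefl m), symbolCompanion_mul_last _ (by simp; omega)]

theorem row_succ (hm : 1 ≤ m) {j : ℕ} (h : j < m) (t : ℝ) (l : Fin m) :
    Φ.row hm (j + 1) t l = (symbolCompanion m a t * Φ.S t) ⟨j, h⟩ l := by
  by_cases h' : j + 1 < m
  · rw [row_of_lt _ _ h', symbolCompanion_mul_of_lt _ h']
  · have : j + 1 = m := by omega
    rw [this, row_top, symbolCompanion_mul_last _ h']

theorem isBoundedFamily_row (hm : 1 ≤ m)
    (hcont : ∀ k ∈ Finset.Icc 1 m, ∀ γ : Fin n → ℕ, ∑ i, γ i ≤ k →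
      ContinuousOn (a k γ) (Icc 0 T)) (j : ℕ) (l : Fin m) :
    IsBoundedFamily (Icc 0 T) fun t => Φ.row hm j t l := by
  by_cases h : j < m
  · simp only [row_of_lt _ _ h]
    exact Φ.isBoundedFamily_S _ l
  · simp only [row, h, dif_neg, not_false_eq_true, Matrix.mul_apply]
    exact .sum fun q _ => (isBoundedFamily_symbolCompanion hcont _ q).mul (Φ.isBoundedFamily_S q l)

theorem hasDerivWithinAt_row (hm : 1 ≤ m) {j : ℕ} (h : j < m) {t : ℝ} (ht : t ∈ Icc 0 T)
    (ξ : Rn n) (l : Fin m) : HasDerivWithinAt (fun s => evalSymbol ξ (Φ.row hm j s l))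
      (evalSymbol ξ (Complex.I • Φ.row hm (j + 1) t l)) (Icc 0 T) t := by
  simp only [row_succ _ _ h, row_of_lt _ _ h]
  exact Φ.deriv_S t ht ξ ⟨j, h⟩ l

theorem continuousOn_row (hm : 1 ≤ m)
    (hcont : ∀ k ∈ Finset.Icc 1 m, ∀ γ : Fin n → ℕ, ∑ i, γ i ≤ k →
      ContinuousOn (a k γ) (Icc 0 T)) (j : ℕ) (ξ : Rn n) (l : Fin m) :
    ContinuousOn (fun s => evalSymbol ξ (Φ.row hm j s l)) (Icc 0 T) := by
  by_cases h : j < m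
  · exact fun t ht => (Φ.hasDerivWithinAt_row hm h ht ξ l).continuousWithinAt
  · simp only [row, h, dif_neg, not_false_eq_true, Matrix.mul_apply, map_sum, map_mul]
    exact continuousOn_finsetSum _ fun q _ =>
      (continuousOn_evalSymbol_symbolCompanion hcont ξ _ q).mul
        fun t ht => (Φ.deriv_S t ht ξ q l).continuousWithinAt

end FundamentalPair

/-! ### Existence and uniqueness from an action of the symbol algebra -/

variable {X : Type*} [AddCommGroup X] [Module ℂ X] [Module ℝ X] [LineDeriv (Rn n) X X]
  [TopologicalSpace X] (𝒜 : SymbolAction n X) (Φ : FundamentalPair m T a)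

theorem neg_I_pow_mul_I_pow (j : ℕ) : (-Complex.I) ^ j * Complex.I ^ j = 1 := by
  rw [← mul_pow]
  simp

theorem SymbolAction.act_smul (c : ℂ) (σ : symbolAlgebra n) (f : X) :
    𝒜.act (c • σ) f = c • 𝒜.act σ f := by
  rw [map_smul, LinearMap.smul_apply]

/-- Row `j` of the fundamental matrix produces `D_t^j u`, and the factor `I ^ j` converts it to the
ordinary derivative. Dominated convergence of the difference quotients of the symbols differentiates
the action in time, and the last row of the companion matrix is the equation. -/
theorem SymbolAction.exists_isSolution [ContinuousAdd X] (hm : 1 ≤ m)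
    (hcont : ∀ k ∈ Finset.Icc 1 m, ∀ γ : Fin n → ℕ, ∑ i, γ i ≤ k →
      ContinuousOn (a k γ) (Icc 0 T)) (g : Fin m → X) :
    IsSolution m T a g fun t => ∑ l, 𝒜.act (Φ.S t ⟨0, hm⟩ l) (g l) := by
  refine ⟨fun j t => ∑ l, 𝒜.act (Complex.I ^ j • Φ.row hm j t l) (g l), ?_, ⟨?_, ?_⟩, ?_, ?_⟩
  · ext1 t
    simp only [pow_zero, one_smul, Φ.row_of_lt hm hm]
  · intro j hj t ht
    have h1 : ∀ l, Filter.Tendsto (fun s => 𝒜.act ((((s - t)⁻¹ : ℝ) : ℂ) •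
        (Complex.I ^ j • Φ.row hm j s l - Complex.I ^ j • Φ.row hm j t l)) (g l))
        (𝓝[Icc 0 T \ {t}] t) (𝓝 (𝒜.act (Complex.I ^ (j + 1) • Φ.row hm (j + 1) t l) (g l))) := by
      intro l
      refine 𝒜.tendsto_act (g l) (IsBoundedFamily.domTendsto_slope (convex_Icc 0 T)
        (σ := fun s => Complex.I ^ j • Φ.row hm j s l)
        (τ := fun s => Complex.I ^ (j + 1) • Φ.row hm (j + 1) s l)
        ((Φ.isBoundedFamily_row hm hcont j l).const_smul _)
        ((Φ.isBoundedFamily_row hm hcont (j + 1) l).const_smul _) (fun s hs ξ => ?_) ht)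
      have := (Φ.hasDerivWithinAt_row hm hj hs ξ l).const_mul (Complex.I ^ j)
      simp only [map_smul, smul_eq_mul] at this ⊢
      refine this.congr_deriv ?_
      ring
    refine (tendsto_finsetSum _ fun l _ => h1 l).congr fun s => ?_
    rw [slope_def_module, 𝒜.real_smul, ← Finset.sum_sub_distrib, Finset.smul_sum]
    refine Finset.sum_congr rfl fun l _ => ?_
    rw [map_smul, map_sub, LinearMap.smul_apply, LinearMap.sub_apply]
  · intro j _ t ht
    refine tendsto_finsetSum _ fun l _ => 𝒜.tendsto_act (g l) (IsBoundedFamily.domTendsto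
      (σ := fun s => Complex.I ^ j • Φ.row hm j s l)
      ((Φ.isBoundedFamily_row hm hcont j l).const_smul _) fun ξ => ?_)
    simp only [map_smul, smul_eq_mul]
    exact (Φ.continuousOn_row hm hcont j ξ l t ht).const_mul _
  · intro t ht
    have h1 : ∀ j, (-Complex.I) ^ j • ∑ l, 𝒜.act (Complex.I ^ j • Φ.row hm j t l) (g l) =
        ∑ l, 𝒜.act (Φ.row hm j t l) (g l) := by
      intro j
      rw [Finset.smul_sum]
      refine Finset.sum_congr rfl fun l _ => ?_
      rw [map_smul, LinearMap.smul_apply, smul_smul, neg_I_pow_mul_I_pow, one_smul]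
    simp only [h1, ← 𝒜.act_symbolOf, map_sum]
    rw [Finset.sum_range, Finset.sum_comm, ← Finset.sum_add_distrib]
    refine Finset.sum_eq_zero fun l _ => ?_
    rw [Φ.row_top, map_neg, LinearMap.neg_apply, map_sum, LinearMap.sum_apply, neg_add_eq_zero]
    refine Finset.sum_congr rfl fun q _ => ?_
    rw [map_mul, Module.End.mul_apply, Φ.row_of_lt hm q.2]
  · intro j
    rw [Finset.smul_sum, Finset.sum_eq_single j]
    · rw [map_smul, LinearMap.smul_apply, smul_smul, neg_I_pow_mul_I_pow, one_smul,
        Φ.row_of_lt hm j.2, Φ.S_zero, Matrix.one_apply_eq, map_one, Module.End.one_apply]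
    · intro l _ hl
      rw [map_smul, Φ.row_of_lt hm j.2, Φ.S_zero, Matrix.one_apply_ne hl.symm, map_zero, smul_zero,
        LinearMap.zero_apply, smul_zero]
    · simp

/-- The product rule for a family of symbols acting on a differentiable curve. -/
theorem SymbolAction.hasDerivWithinAt_functional (i : 𝒜.Index) {σ τ : ℝ → symbolAlgebra n}
    (h : IsBoundedFamily (Icc 0 T) σ) (h' : IsBoundedFamily (Icc 0 T) τ)
    (hd : ∀ t ∈ Icc 0 T, ∀ ξ,
      HasDerivWithinAt (fun r => evalSymbol ξ (σ r)) (evalSymbol ξ (τ t)) (Icc 0 T) t)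
    {v w : ℝ → X} {t : ℝ} (ht : t ∈ Icc 0 T)
    (hv : Filter.Tendsto (slope v t) (𝓝[Icc (0 : ℝ) T \ {t}] t) (𝓝 (w t))) :
    HasDerivWithinAt (fun s => 𝒜.functional i (𝒜.act (σ s) (v s)))
      (𝒜.functional i (𝒜.act (σ t) (w t) + 𝒜.act (τ t) (v t))) (Icc 0 T) t := by
  rw [hasDerivWithinAt_iff_tendsto_slope, map_add]
  have hσ : DomTendsto σ (𝓝[Icc (0 : ℝ) T \ {t}] t) (σ t) :=
    (h.domTendsto fun ξ => (hd t ht ξ).continuousWithinAt).comp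
      (Filter.tendsto_id.mono_left (nhdsWithin_mono t sdiff_subset))
  -- The quotient for the product is `σ s` applied to the quotient of `v` plus the quotient of `σ`
  -- applied to `v t`; the two limits are the two terms of the product rule.
  have h1 := 𝒜.tendsto_functional i hσ hv
  have h2 := 𝒜.tendsto_functional i (IsBoundedFamily.domTendsto_slope (convex_Icc 0 T) h h' hd ht)
    (tendsto_const_nhds (x := v t))
  refine (h1.add h2).congr fun s => ?_
  rw [slope_def_module, slope_def_module, 𝒜.real_smul, Complex.real_smul, ← smul_eq_mul (a := ((_ : ℝ) : ℂ)),
    map_smul, map_smul, map_smul, LinearMap.smul_apply, map_smul, ← smul_add, map_sub, map_sub,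
    map_sub, LinearMap.sub_apply, map_sub, sub_add_sub_cancel]

/-- For any solution the vector `R(t, D) V(t)` has zero derivative after pairing with each
functional, hence equals its initial value `g`. Applying `S(t, D)` recovers `u t`. -/
theorem SymbolAction.eq_of_isSolution (hm : 1 ≤ m)
    (hcont : ∀ k ∈ Finset.Icc 1 m, ∀ γ : Fin n → ℕ, ∑ i, γ i ≤ k →
      ContinuousOn (a k γ) (Icc 0 T)) {g : Fin m → X} {u : ℝ → X} (hu : IsSolution m T a g u)
    {t : ℝ} (ht : t ∈ Icc 0 T) : u t = ∑ l, 𝒜.act (Φ.S t ⟨0, hm⟩ l) (g l) := by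
  obtain ⟨v, rfl, ⟨hv, -⟩, heq, hg⟩ := hu
  set V : ℕ → ℝ → X := fun j t => (-Complex.I) ^ j • v j t with hV
  have hvV : ∀ j t, v j t = Complex.I ^ j • V j t := fun j t => by
    rw [hV, smul_smul, mul_comm, neg_I_pow_mul_I_pow, one_smul]
  -- The equation as a first order system: the upper rows hold by definition of `V`, the last one is
  -- the differential equation.
  have hsys : ∀ t ∈ Icc 0 T, ∀ k : Fin m,
      V (k + 1) t = ∑ j, 𝒜.act (symbolCompanion m a t k j) (V j t) := by
    intro t ht k
    by_cases hk : (k : ℕ) + 1 < m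
    · rw [Finset.sum_eq_single ⟨k + 1, hk⟩]
      · simp [symbolCompanion, hk]
      · intro j _ hj
        have : (j : ℕ) ≠ k + 1 := fun h => hj (Fin.ext h)
        simp [symbolCompanion, hk, this]
      · simp
    · have h1 := heq t ht
      have hkm : (k : ℕ) + 1 = m := by omega
      rw [Finset.sum_range, add_eq_zero_iff_eq_neg] at h1
      rw [hkm]
      refine h1.trans ?_
      rw [← Finset.sum_neg_distrib]
      refine Finset.sum_congr rfl fun j _ => ?_
      simp only [symbolCompanion, Matrix.of_apply, hk, if_false]
      rw [map_neg, LinearMap.neg_apply, 𝒜.act_symbolOf]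
  have hconst : ∀ t ∈ Icc 0 T, ∀ l, ∑ j, 𝒜.act (Φ.R t l j) (V j t) = g l := by
    intro t ht l
    rw [← sub_eq_zero]
    refine 𝒜.eq_zero _ fun i => ?_
    have hd : ∀ s ∈ Icc 0 T, HasDerivWithinAt
        (fun r => 𝒜.functional i (∑ j, 𝒜.act (Φ.R r l j) (V j r))) 0 (Icc 0 T) s := by
      intro s hs
      -- The scalar `(-I) ^ j` is moved from `V j` into the symbol, so that the product rule applies
      -- to `v j`, whose time derivative is `v (j + 1)`.
      have h1 : ∀ j : Fin m, _ := fun j => 𝒜.hasDerivWithinAt_functional i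
        (σ := fun r => (-Complex.I) ^ (j : ℕ) • Φ.R r l j)
        (τ := fun r => (-Complex.I) ^ (j : ℕ) •
          (-(Complex.I • (Φ.R r * symbolCompanion m a r))) l j)
        ((Φ.isBoundedFamily_R l j).const_smul _)
        (by
          simp only [Matrix.neg_apply, Matrix.smul_apply, Matrix.mul_apply]
          exact (((IsBoundedFamily.sum fun q _ => (Φ.isBoundedFamily_R l q).mul
            (isBoundedFamily_symbolCompanion hcont q j)).const_smul _).neg).const_smul _)
        (fun r hr ξ => by
          have := (Φ.deriv_R r hr ξ l j).const_mul ((-Complex.I) ^ (j : ℕ))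
          simpa only [map_smul, smul_eq_mul] using this) (w := v (j + 1)) hs (hv j j.2 s hs)
      have h2 := HasDerivWithinAt.fun_sum fun j (_ : j ∈ Finset.univ) => h1 j
      refine (h2.congr_deriv ?_).congr_of_mem (fun r _ => ?_) hs
      -- Differentiating the solution gives `I R A V` and differentiating `R` gives `-I R A V`, with
      -- `A` the companion matrix; they cancel.
      · rw [← map_sum, Finset.sum_add_distrib]
        have e1 : ∑ j : Fin m, 𝒜.act ((-Complex.I) ^ (j : ℕ) • Φ.R s l j) (v (j + 1) s) =
            Complex.I • ∑ k, ∑ j, 𝒜.act (Φ.R s l k) (𝒜.act (symbolCompanion m a s k j) (V j s)) := by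
          rw [Finset.smul_sum]
          refine Finset.sum_congr rfl fun k _ => ?_
          rw [← map_sum, ← hsys s hs, hvV, 𝒜.act_smul, (𝒜.act (Φ.R s l k)).map_smul, smul_smul,
            pow_succ, ← mul_assoc, neg_I_pow_mul_I_pow, one_mul]
        have e2 : ∑ j : Fin m, 𝒜.act ((-Complex.I) ^ (j : ℕ) •
            (-(Complex.I • (Φ.R s * symbolCompanion m a s))) l j) (v j s) =
            -(Complex.I • ∑ k, ∑ j, 𝒜.act (Φ.R s l k)
              (𝒜.act (symbolCompanion m a s k j) (V j s))) := by
          rw [Finset.sum_comm, Finset.smul_sum, ← Finset.sum_neg_distrib]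
          refine Finset.sum_congr rfl fun j _ => ?_
          rw [𝒜.act_smul, ← LinearMap.map_smul, Matrix.neg_apply, Matrix.smul_apply, map_neg,
            LinearMap.neg_apply, 𝒜.act_smul, Matrix.mul_apply, map_sum, LinearMap.sum_apply]
          simp only [map_mul, Module.End.mul_apply]
          rfl
        rw [e1, e2, add_neg_cancel, map_zero]
      · rw [map_sum]
        refine Finset.sum_congr rfl fun j _ => ?_
        rw [map_smul (𝒜.act), LinearMap.smul_apply, ← map_smul]
    have h3 := constant_of_derivWithin_zero (fun s hs => (hd s hs).differentiableWithinAt)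
      (fun s hs => (hd s (Ico_subset_Icc_self hs)).derivWithin
        (uniqueDiffOn_Icc (hs.1.trans_lt hs.2) s (Ico_subset_Icc_self hs))) t ht
    rw [map_sub, h3, Φ.R_zero, sub_eq_zero]
    congr 1
    rw [Finset.sum_eq_single l]
    · rw [Matrix.one_apply_eq, map_one, Module.End.one_apply]
      exact hg l
    · intro j _ hj
      rw [Matrix.one_apply_ne hj.symm, map_zero, LinearMap.zero_apply]
    · simp
  have h0 : v 0 t = V 0 t := by rw [hvV, pow_zero, one_smul]
  rw [h0]
  simp only [← hconst t ht, map_sum]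
  rw [Finset.sum_comm]
  have h4 : ∀ j : Fin m, ∑ l, 𝒜.act (Φ.S t ⟨0, hm⟩ l) (𝒜.act (Φ.R t l j) (V j t)) =
      𝒜.act ((1 : Matrix (Fin m) (Fin m) (symbolAlgebra n)) ⟨0, hm⟩ j) (V j t) := by
    intro j
    rw [← Φ.S_mul_R t ht, Matrix.mul_apply, map_sum, LinearMap.sum_apply]
    simp only [map_mul, Module.End.mul_apply]
  simp only [h4]
  rw [Finset.sum_eq_single ⟨0, hm⟩]
  · rw [Matrix.one_apply_eq, map_one, Module.End.one_apply]
  · intro j _ hj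
    rw [Matrix.one_apply_ne hj.symm, map_zero, LinearMap.zero_apply]
  · simp

theorem SymbolAction.wellPosed [ContinuousAdd X] (𝒜 : SymbolAction n X)
    (Φ : FundamentalPair m T a) (hm : 1 ≤ m)
    (hcont : ∀ k ∈ Finset.Icc 1 m, ∀ γ : Fin n → ℕ, ∑ i, γ i ≤ k →
      ContinuousOn (a k γ) (Icc 0 T)) : WellPosed X m T a := fun g =>
  ⟨_, 𝒜.exists_isSolution Φ hm hcont g, fun _ hw _ ht => 𝒜.eq_of_isSolution Φ hm hcont hw ht⟩

end WellPosed

end WeaklyHyperbolic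

end

theorem mainTheorem2 (n m : ℕ) (hn : 1 ≤ n) (hm : 1 ≤ m) (T : ℝ) (hT : 0 < T)
    (a : ℕ → (Fin n → ℕ) → ℝ → ℂ)
    (hcont : ∀ k ∈ Finset.Icc 1 m, ∀ γ : Fin n → ℕ, ∑ i, γ i ≤ k →
      ContinuousOn (a k γ) (Set.Icc 0 T))
    (hanalytic : ∀ k ∈ Finset.Icc 1 m, ∀ γ : Fin n → ℕ, ∑ i, γ i = k →
      AnalyticOn ℝ (a k γ) (Set.Icc 0 T))
    (lam : Fin m → ℝ → WeaklyHyperbolic.Rn n → ℝ)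
    (hroots : WeaklyHyperbolic.AreCharacteristicRoots m T a lam)
    (hLC : WeaklyHyperbolic.RootCondition m T lam)
    (hLevi : WeaklyHyperbolic.LeviCondition m T a lam) :
    WeaklyHyperbolic.WellPosed (WeaklyHyperbolic.Smooth n) m T a ∧
      WeaklyHyperbolic.WellPosed (WeaklyHyperbolic.Distr n) m T a ∧
      WeaklyHyperbolic.PolynomialFourierBound m T a := by
  obtain ⟨κ, A, hA, hmode⟩ := WeaklyHyperbolic.mode_bound hT hcont hanalytic hroots hLC hLevi
  obtain ⟨Φ⟩ := WeaklyHyperbolic.nonempty_fundamentalPair hT.le hcont hmode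
  exact ⟨(WeaklyHyperbolic.smoothAction n).wellPosed Φ hm hcont,
    (WeaklyHyperbolic.distrAction n).wellPosed Φ hm hcont,
    WeaklyHyperbolic.polynomialFourierBound_of_mode_bound hT hA hmode⟩
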